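/- **Conventions.** $L$ denotes a nonempty dense linearly ordered set without endpoints and $\bar L$ its Dedekind completion without endpoints, with the order topology. $\mathrm{Ed}(x_1,x_2;y_1,y_2)$ means that $(x_1<x_2$ and $y_1<y_2)$ or $(x_1>x_2$ and $y_1>y_2)$, and $\mathrm{ED}(L)=\langle L,\mathrm{Ed}\rangle$. $\mathrm{Aut}(\mathrm{ED}(L))$ consists of the order-preserving and order-reversing (\emph{monotonic}) permutations of $L$; each extends uniquely to an element of $\mathrm{Aut}(\mathrm{ED}(\bar L))$, with which it is identified. Let $G\le \mathrm{Aut}(\mathrm{ED}(L))$. The support of $g\in G$ is $\{x\in\bar L: g(x)\ne x\}$. $\mathrm{Opp}(G)$, $\mathrm{Lft}(G)$, $\mathrm{Rt}(G)$ are the subgroups of order-preserving elements, of elements with support bounded above, and of elements with support bounded below; $\mathrm{Bdd}(G)=\mathrm{Lft}(G)\cap\mathrm{Rt}(G)$, and $\mathrm{Bdd}'(G)$ is its derived group. $G$ is \emph{3-interval-transitive} if for all nonempty open intervals (rays and $L$ itself allowed) $I_1<I_2<I_3$ and $J_1<J_2<J_3$ of $L$ some $g\in G$ satisfies $g(I_i)\cap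 J_i\neq\emptyset$ for $i=1,2,3$. Let $K$ be the class of all $\langle \mathrm{ED}(L),G\rangle$ such that $G$ is 3-interval-transitive and $\mathrm{Bdd}(G)\neq 1$. Orbits are orbits of $G$ on $\bar L$ (unless said otherwise). The pointwise order on $G$ is $f\le g$ iff $f(x)\le g(x)$ for all $x\in L$; it is \emph{nontrivial} if $f\le g$ for some $f\ne g$ in $G$, and then it makes $G$ a \emph{half-ordered group}. $o\text{-}\mathrm{Aut}(G)$ is the group of automorphisms $\alpha$ of $G$ with $\alpha(f)\le\alpha(g)\iff f\le g$. $\mathrm{Ep}(G)\subseteq\bar L$ is the set of endpoints in $\bar L$ of the convex hulls of the sets $\mathrm{int}(\mathrm{cl}(\mathrm{supp}(g)))$, $g\in G$. For an invariant $X\subseteq\bar L$, $\mathrm{ACT}(X,G)$ is the structure with universe $X\sqcup G$, predicates for $X$ and $G$, the relation $\mathrm{Ed}$ on $X$, composition on $G$, and the application map $G\times X\to X$; its language is the language of monotonic permutation groups. The language of groups has one binary operation symbol. $\equiv$ is elementary equivalence. A bijection $\tau:\bar L_1\to\bar L_2$ \emph{induces} $\alpha:G_1\cong G_2$ if $\alpha(g)=\tau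 g\tau^{-1}$ for all $g\in G_1$. A \emph{strong interpretation} of structures $M^*$ in structures $M$ with $|M|\subseteq|M^*|$ consists of formulas in the language of $M$ for which there is, for each pair $(M,M^*)$ considered, a map $\mu$ from the set of tuples over $M$ that satisfy one of the formulas onto $|M^*|$ such that the formulas define $\mu(\vec a)=\mu(\vec b)$, the $\mu$-preimages of the relations of $M^*$ (functions being treated as their graphs), and $\{(\vec a,\mu(\vec a)):\mu(\vec a)\in|M|\}$. It is first order if the formulas are; in a second order one the formulas are second order and the tuples may also contain relations on $M$. **Theorem (Monotonic Reconstruction Package).** *(A) Two groups.* Let $\langle\mathrm{ED}(L_i),G_i\rangle\in K$ for $i=1,2$. 1. Suppose $G_1\equiv G_2$. Then $\mathrm{ACT}(\mathrm{Ep}(G_1),G_1)\equiv\mathrm{ACT}(\mathrm{Ep}(G_2),G_2)$, $\mathrm{ACT}(\mathrm{Ep}(G_1),\mathrm{Bdd}(G_1))\equiv\mathrm{ACT}(\mathrm{Ep}(G_2),\mathrm{Bdd}(G_2))$, and $\mathrm{ACT}(\mathrm{Ep}(G_1),\mathrm{Opp}(G_1))\equiv\mathrm{ACT}(\mathrm{Ep}(G_2),\mathrm{Opp}(G_2))$.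 Writing $M_i^{\mathrm{Lft}}=\mathrm{ACT}(\mathrm{Ep}(G_i),\mathrm{Lft}(G_i))$ and $M_i^{\mathrm{Rt}}=\mathrm{ACT}(\mathrm{Ep}(G_i),\mathrm{Rt}(G_i))$, either $M_1^{\mathrm{Lft}}\equiv M_2^{\mathrm{Lft}}$ and $M_1^{\mathrm{Rt}}\equiv M_2^{\mathrm{Rt}}$, or $M_1^{\mathrm{Lft}}\equiv M_2^{\mathrm{Rt}}$ and $M_1^{\mathrm{Rt}}\equiv M_2^{\mathrm{Lft}}$. 2. Let $\alpha:G_1\cong G_2$ be a group isomorphism. There is a monotonic bijection $\tau:\bar L_1\to\bar L_2$ that induces $\alpha$. It is an isomorphism $\mathrm{ED}(\bar L_1)\cong\mathrm{ED}(\bar L_2)$ and a homeomorphism, and it is the only bijection inducing $\alpha$ that is monotonic, or an isomorphism of equal direction structures, or a homeomorphism. Moreover $\tau\cup\alpha:\mathrm{ACT}(\bar L_1,G_1)\cong\mathrm{ACT}(\bar L_2,G_2)$ and $\tau{\restriction}\mathrm{Ep}(G_1)\cup\alpha:\mathrm{ACT}(\mathrm{Ep}(G_1),G_1)\cong\mathrm{ACT}(\mathrm{Ep}(G_2),G_2)$;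 the map $M\mapsto\tau(M)$ is a bijection between the sets of orbits, and $\tau{\restriction}M\cup\alpha:\mathrm{ACT}(M,G_1)\cong\mathrm{ACT}(\tau(M),G_2)$ for every orbit $M$; and either $\tau$ preserves order, on $\bar L_1$ and on every orbit, and $\alpha$ preserves the pointwise order, or $\tau$ reverses order, on $\bar L_1$ and on every orbit, and $\alpha$ reverses the pointwise order. If the pointwise order on $G_1$ is nontrivial and $\alpha$ is an isomorphism for the pointwise orders, then $\tau$ preserves order. *(B) One group.* Let $\langle\mathrm{ED}(L),G\rangle\in K$. 1. Let $H$ be $G$, $\mathrm{Opp}(G)$, $\mathrm{Bdd}(G)$ or $\mathrm{Bdd}'(G)$. Every automorphism of $H$ is conjugation by a unique element of $\mathrm{Aut}(\mathrm{ED}(\bar L))$, and by this identification $\mathrm{Aut}(H)=\mathrm{Norm}_{\mathrm{Aut}(\mathrm{ED}(\bar L))}(H)=\mathrm{Norm}_{\mathrm{Homeo}(\bar L)}(H)$. In this sense $\mathrm{Aut}(G)\le\mathrm{Aut}(\mathrm{Opp}(G))\le\mathrm{Aut}(\mathrm{Bdd}(G))\le\mathrm{Aut}(\mathrm{Bdd}'(G))\le\mathrm{Aut}(\mathrm{ED}(\bar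 L))$. The statements in (A2) on $\mathrm{Ep}$, orbits and order hold in particular for automorphisms of $G$. 2. $o\text{-}\mathrm{Aut}(G)$ has index at most $2$ in $\mathrm{Aut}(G)$; if the pointwise order on $G$ is nontrivial, its elements are induced by order-preserving $\tau$, so $o\text{-}\mathrm{Aut}(G)\le\mathrm{Aut}(\bar L)$. 3. $\mathrm{Opp}(G)$, $\mathrm{Bdd}(G)$ and $\mathrm{Bdd}'(G)$ are characteristic in $G$. Every automorphism of $G$ either preserves both of $\mathrm{Lft}(G)$ and $\mathrm{Rt}(G)$ or interchanges them, and is determined by its restriction to $\mathrm{Bdd}'(G)$. 4. Let $H$ be $\mathrm{Lft}(G)$ or $\mathrm{Rt}(G)$. If the pointwise order on $G$ is nontrivial, then $o\text{-}\mathrm{Aut}(G)\le\mathrm{Aut}(H)$, that is, the elements of $o\text{-}\mathrm{Aut}(G)$ map $H$ onto $H$ and are determined by their restrictions to $H$. If $H\ne\mathrm{Bdd}(G)$, then $\mathrm{Aut}(H)\le\mathrm{Aut}(\bar L)$, that is, each automorphism of $H$ is induced by an order-preserving permutation of $\bar L$, and by no other element of $\mathrm{Aut}(\mathrm{ED}(\bar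 L))$. 5. If $G$ is transitive on $L$, then $\mathrm{Aut}(G)=\mathrm{Norm}_{\mathrm{Aut}(\mathrm{ED}(L))}(G)$ if and only if there is no orbit $M\ne L$ with $\mathrm{ACT}(L,G)\cong\mathrm{ACT}(M,G)$. 6. If $H$ is $\mathrm{Bdd}(G)$, $\mathrm{Lft}(G)$, $\mathrm{Rt}(G)$ or $\mathrm{Opp}(G)$ and $G\equiv H$, then $G=H$. *(C) Interpretations and expressibility*, uniformly for all $\langle\mathrm{ED}(L),G\rangle\in K$. 1. $\mathrm{ACT}(\mathrm{Ep}(G),G)$ has a first order strong interpretation in the group $G$, and $\mathrm{ACT}(\bar L,G)$ has a second order strong interpretation in $G$. 2. For every first order formula $\varphi(x_1,\dots,x_n)$ in the language of monotonic permutation groups there is a first order formula $\psi$ in the language of groups such that for all $\vec g\in G^n$: $\mathrm{ACT}(\mathrm{Ep}(G),G)\models\varphi[\vec g]$ iff $G\models\psi[\vec g]$. There is also a second order formula $\psi$ that has the same property with $\mathrm{ACT}(\bar L,G)$ for $\mathrm{ACT}(\mathrm{Ep}(G),G)$. 3. In particular each of the following is expressed by a first order formula in the language of groups: $g$ is signed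 (that is, $g\ne\mathrm{Id}$, and $g(x)\ge x$ for all $x\in L$ or $g(x)\le x$ for all $x\in L$); $g_1$ and $g_2$ are signed and have the same sign; $g\in\mathrm{Bdd}(G)$; $g\in\mathrm{Lft}(G)\cup\mathrm{Rt}(G)$; $g_1,g_2$ are both in $\mathrm{Lft}(G)$ or both in $\mathrm{Rt}(G)$; $G$ is transitive on $\mathrm{Ep}(G)$; $G$ has exactly $n$ orbits in $\mathrm{Ep}(G)$ (for each natural number $n$); $g$ preserves order. There is a second order sentence in the language of groups that holds, for $G$ transitive on $L$, iff $L$ is Dedekind complete. -/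

import Mathlib

universe u v w

namespace MonRec

open Set FirstOrder

/-! ### Equal direction structures and their automorphisms -/

/-- The equal direction relation of a chain. -/
def Ed {X : Type*} [LT X] (a b c d : X) : Prop :=
  (a < b ∧ c < d) ∨ (b < a ∧ d < c)

/-- Isomorphisms of equal direction structures `ED(X) ≅ ED(Y)`. -/
def IsEDIso {X Y : Type*} [LT X] [LT Y] (e : X ≃ Y) : Prop :=
  ∀ a b c d : X, Ed (e a) (e b) (e c) (e d) ↔ Ed a b c d

/-- Monotonic maps between chains: strictly order-preserving or strictly order-reversing. -/
def Monotonic {X Y : Type*} [Preorder X] [Preorder Y] (f : X → Y) : Prop :=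
  StrictMono f ∨ StrictAnti f

/-- The group `Aut(ED(X))`. -/
def AutED (X : Type*) [LT X] : Subgroup (Equiv.Perm X) where
  carrier := {e | IsEDIso e}
  mul_mem' := by
    intro e f he hf a b c d
    exact (he (f a) (f b) (f c) (f d)).trans (hf a b c d)
  one_mem' := by
    intro a b c d
    exact Iff.rfl
  inv_mem' := by
    intro e he a b c d
    have h := he (e⁻¹ a) (e⁻¹ b) (e⁻¹ c) (e⁻¹ d)
    simp only [← Equiv.Perm.mul_apply, mul_inv_cancel, Equiv.Perm.one_apply] at h
    exact h.symm

theorem Monotonic.isEDIso {X Y : Type*} [LinearOrder X] [LinearOrder Y] {e : X ≃ Y}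
    (h : Monotonic e) : IsEDIso e := by
  intro a b c d
  rcases h with h | h
  · simp only [Ed, h.lt_iff_lt]
  · simp only [Ed, h.lt_iff_gt]
    tauto

theorem IsEDIso.monotonic {X Y : Type*} [LinearOrder X] [LinearOrder Y] {e : X ≃ Y}
    (h : IsEDIso e) : Monotonic e := by
  by_cases hm : StrictMono e
  · exact Or.inl hm
  · right
    simp only [StrictMono, not_forall] at hm
    obtain ⟨a, b, hab, hn⟩ := hm
    have hba : e b < e a :=
      lt_of_le_of_ne (not_lt.1 hn) (fun hh => hab.ne' (e.injective hh))
    intro c d hcd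
    have := (h a b c d).2 (Or.inl ⟨hab, hcd⟩)
    rcases this with ⟨h1, _⟩ | ⟨_, h2⟩
    · exact absurd h1 hn
    · exact h2

theorem isEDIso_iff {X Y : Type*} [LinearOrder X] [LinearOrder Y] {e : X ≃ Y} :
    IsEDIso e ↔ Monotonic e := ⟨IsEDIso.monotonic, Monotonic.isEDIso⟩

/-! ### The Dedekind completion without endpoints -/

/-- The Dedekind completion without endpoints of a chain: all Dedekind cuts apart from the
least and the greatest one. -/
def Cpl (L : Type*) [LinearOrder L] : Type _ :=
  {A : DedekindCut L // A ≠ ⊥ ∧ A ≠ ⊤}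

noncomputable instance (L : Type*) [LinearOrder L] : LinearOrder (Cpl L) :=
  inferInstanceAs (LinearOrder {A : DedekindCut L // A ≠ ⊥ ∧ A ≠ ⊤})

/-- The completion carries its order topology. -/
noncomputable instance (L : Type*) [LinearOrder L] : TopologicalSpace (Cpl L) := Preorder.topology (Cpl L)

section Chain

variable {L : Type u} [LinearOrder L]

theorem cutMono_aux (e : L ≃ L) (he : StrictMono e) (s : Set L) :
    upperBounds (e '' s) = e '' upperBounds s ∧ lowerBounds (e '' s) = e '' lowerBounds s := by
  constructor
  · ext x
    constructor
    · intro hx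
      refine ⟨e.symm x, fun y hy => ?_, by simp⟩
      have := hx (mem_image_of_mem e hy)
      rw [← he.le_iff_le]
      simpa using this
    · rintro ⟨y, hy, rfl⟩ _ ⟨z, hz, rfl⟩
      exact he.monotone (hy hz)
  · ext x
    constructor
    · intro hx
      refine ⟨e.symm x, fun y hy => ?_, by simp⟩
      have := hx (mem_image_of_mem e hy)
      rw [← he.le_iff_le]
      simpa using this
    · rintro ⟨y, hy, rfl⟩ _ ⟨z, hz, rfl⟩
      exact he.monotone (hy hz)

theorem cutAnti_aux (e : L ≃ L) (he : StrictAnti e) (s : Set L) :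
    upperBounds (e '' s) = e '' lowerBounds s ∧ lowerBounds (e '' s) = e '' upperBounds s := by
  constructor
  · ext x
    constructor
    · intro hx
      refine ⟨e.symm x, fun y hy => ?_, by simp⟩
      have := hx (mem_image_of_mem e hy)
      rw [← he.le_iff_ge]
      simpa using this
    · rintro ⟨y, hy, rfl⟩ _ ⟨z, hz, rfl⟩
      exact he.antitone (hy hz)
  · ext x
    constructor
    · intro hx
      refine ⟨e.symm x, fun y hy => ?_, by simp⟩
      have := hx (mem_image_of_mem e hy)
      rw [← he.le_iff_ge]
      simpa using this
    · rintro ⟨y, hy, rfl⟩ _ ⟨z, hz, rfl⟩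
      exact he.antitone (hy hz)

/-- The image of a cut under an order-preserving permutation. -/
def cutMono (e : L ≃ L) (he : StrictMono e) (A : DedekindCut L) : DedekindCut L where
  extent := e '' A.left
  intent := e '' A.right
  upperPolar_extent :=
    (cutMono_aux e he A.left).1.trans (congrArg _ A.upperBounds_left)
  lowerPolar_intent :=
    (cutMono_aux e he A.right).2.trans (congrArg _ A.lowerBounds_right)

/-- The image of a cut under an order-reversing permutation. -/
def cutAnti (e : L ≃ L) (he : StrictAnti e) (A : DedekindCut L) : DedekindCut L where
  extent := e '' A.right
  intent := e '' A.left
  upperPolar_extent :=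
    (cutAnti_aux e he A.right).1.trans (congrArg _ A.lowerBounds_right)
  lowerPolar_intent :=
    (cutAnti_aux e he A.left).2.trans (congrArg _ A.upperBounds_left)

theorem symm_strictMono {e : L ≃ L} (he : StrictMono e) : StrictMono e.symm := by
  intro a b hab
  rw [← he.lt_iff_lt]
  simpa using hab

theorem symm_strictAnti {e : L ≃ L} (he : StrictAnti e) : StrictAnti e.symm := by
  intro a b hab
  rw [← he.lt_iff_gt]
  simpa using hab

/-- The order isomorphism of the lattice of cuts given by an order-preserving permutation. -/
def cutMonoIso (e : L ≃ L) (he : StrictMono e) : DedekindCut L ≃o DedekindCut L where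
  toFun := cutMono e he
  invFun := cutMono e.symm (symm_strictMono he)
  left_inv A := DedekindCut.ext (by simp [cutMono, DedekindCut.left, image_image])
  right_inv A := DedekindCut.ext (by simp [cutMono, DedekindCut.left, image_image])
  map_rel_iff' {A B} := by
    rw [← Concept.extent_subset_extent_iff, ← Concept.extent_subset_extent_iff]
    exact image_subset_image_iff e.injective

/-- The order-reversing bijection of the lattice of cuts given by an order-reversing
permutation. -/
def cutAntiIso (e : L ≃ L) (he : StrictAnti e) : DedekindCut L ≃o (DedekindCut L)ᵒᵈ where
  toFun A := OrderDual.toDual (cutAnti e he A)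
  invFun A := cutAnti e.symm (symm_strictAnti he) (OrderDual.ofDual A)
  left_inv A := DedekindCut.ext
    (by simp [cutAnti, DedekindCut.left, DedekindCut.right, image_image])
  right_inv A := by
    apply OrderDual.ofDual.injective
    exact DedekindCut.ext (by simp [cutAnti, DedekindCut.left, DedekindCut.right, image_image])
  map_rel_iff' {A B} := by
    change cutAnti e he B ≤ cutAnti e he A ↔ A ≤ B
    rw [← Concept.extent_subset_extent_iff, ← Concept.intent_subset_intent_iff]
    exact image_subset_image_iff e.injective

theorem cutMono_principal (e : L ≃ L) (he : StrictMono e) (a : L) :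
    cutMono e he (DedekindCut.principal a) = DedekindCut.principal (e a) := by
  apply DedekindCut.ext
  ext x
  constructor
  · rintro ⟨y, hy, rfl⟩
    exact he.monotone hy
  · intro hx
    refine ⟨e.symm x, ?_, by simp⟩
    change e.symm x ≤ a
    rw [← he.le_iff_le]
    simpa using hx

theorem cutAnti_principal (e : L ≃ L) (he : StrictAnti e) (a : L) :
    cutAnti e he (DedekindCut.principal a) = DedekindCut.principal (e a) := by
  apply DedekindCut.ext
  ext x
  constructor
  · rintro ⟨y, hy, rfl⟩
    exact he.antitone hy
  · intro hx
    refine ⟨e.symm x, ?_, by simp⟩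
    change a ≤ e.symm x
    rw [← he.le_iff_ge]
    simpa using hx

variable [NoMinOrder L] [NoMaxOrder L]

/-- The inclusion of `L` in its Dedekind completion. -/
def Cpl.of (a : L) : Cpl L :=
  ⟨DedekindCut.principal a, by
    obtain ⟨b, hb⟩ := exists_lt a
    obtain ⟨c, hc⟩ := exists_gt a
    exact ⟨ne_bot_of_gt (DedekindCut.principal_lt_principal.2 hb),
      ne_top_of_lt (DedekindCut.principal_lt_principal.2 hc)⟩⟩

theorem Cpl.of_lt_of {a b : L} : Cpl.of a < Cpl.of b ↔ a < b :=
  DedekindCut.principal_lt_principal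

theorem exists_extension (g : AutED L) :
    ∃ h : AutED (Cpl L), ∀ a : L, (h : Equiv.Perm (Cpl L)) (Cpl.of a) = Cpl.of (g.1 a) := by
  rcases IsEDIso.monotonic g.2 with hg | hg
  · let h : Equiv.Perm (Cpl L) := (cutMonoIso g.1 hg).toEquiv.subtypeEquiv (by
      intro A
      simp [map_eq_bot_iff, map_eq_top_iff])
    refine ⟨⟨h, Monotonic.isEDIso (Or.inl ?_)⟩, ?_⟩
    · intro A B hAB
      exact (cutMonoIso g.1 hg).strictMono hAB
    · intro a
      exact Subtype.ext (cutMono_principal g.1 hg a)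
  · let h : Equiv.Perm (Cpl L) :=
      ((cutAntiIso g.1 hg).toEquiv.trans OrderDual.ofDual).subtypeEquiv (by
      intro A
      have h1 : A = ⊥ ↔ cutAnti g.1 hg A = ⊤ := by
        rw [← map_eq_bot_iff (cutAntiIso g.1 hg)]
        rfl
      have h2 : A = ⊤ ↔ cutAnti g.1 hg A = ⊥ := by
        rw [← map_eq_top_iff (cutAntiIso g.1 hg)]
        rfl
      change _ ↔ cutAnti g.1 hg A ≠ ⊥ ∧ cutAnti g.1 hg A ≠ ⊤
      simp only [ne_eq, h1, h2]
      tauto)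
    refine ⟨⟨h, Monotonic.isEDIso (Or.inr ?_)⟩, ?_⟩
    · intro A B hAB
      exact (cutAntiIso g.1 hg).strictMono hAB
    · intro a
      exact Subtype.ext (cutAnti_principal g.1 hg a)

variable [Nonempty L]

theorem extension_unique (g : AutED L) (h h' : AutED (Cpl L))
    (H : ∀ a : L, (h : Equiv.Perm (Cpl L)) (Cpl.of a) = Cpl.of (g.1 a))
    (H' : ∀ a : L, (h' : Equiv.Perm (Cpl L)) (Cpl.of a) = Cpl.of (g.1 a)) : h = h' := by
  have key : ∀ h h' : AutED (Cpl L),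
      (∀ a : L, (h : Equiv.Perm (Cpl L)) (Cpl.of a) = Cpl.of (g.1 a)) →
      (∀ a : L, (h' : Equiv.Perm (Cpl L)) (Cpl.of a) = Cpl.of (g.1 a)) →
      ∀ x, ¬ h.1 x < h'.1 x := by
    intro h h' H H' x hx
    obtain ⟨c, hc1, hc2⟩ := DedekindCut.lt_iff_exists.1 (show (h.1 x).1 < (h'.1 x).1 from hx)
    obtain ⟨b, rfl⟩ : ∃ b, g.1 b = c := ⟨g.1.symm c, by simp⟩
    have h1 : h.1 x < h.1 (Cpl.of b) := by rw [H]; exact hc1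
    have h2 : h'.1 (Cpl.of b) ≤ h'.1 x := by rw [H']; exact hc2
    obtain ⟨a⟩ := ‹Nonempty L›
    obtain ⟨d, had⟩ := exists_gt a
    have had' : Cpl.of a < Cpl.of d := Cpl.of_lt_of.2 had
    rcases IsEDIso.monotonic h.2 with m | m <;> rcases IsEDIso.monotonic h'.2 with m' | m'
    · exact absurd (m.lt_iff_lt.1 h1) (not_lt.2 (m'.le_iff_le.1 h2))
    · have e1 := m had'
      have e2 := m' had'
      rw [H, H] at e1
      rw [H', H'] at e2
      exact lt_asymm e1 e2
    · have e1 := m had'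
      have e2 := m' had'
      rw [H, H] at e1
      rw [H', H'] at e2
      exact lt_asymm e1 e2
    · exact absurd (m.lt_iff_gt.1 h1) (not_lt.2 (m'.le_iff_ge.1 h2))
  apply Subtype.ext
  ext x
  rcases lt_trichotomy (h.1 x) (h'.1 x) with hlt | heq | hgt
  · exact absurd hlt (key h h' H H' x)
  · exact heq
  · exact absurd hgt (key h' h H' H x)

/-- The embedding of `Aut(ED(L))` in `Aut(ED(L̄))` that sends `g` to its unique extension. -/
noncomputable def bar : AutED L →* AutED (Cpl L) :=
  MonoidHom.mk' (fun g => (exists_extension g).choose) (by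
    intro f g
    refine extension_unique (f * g) _ _ (exists_extension (f * g)).choose_spec ?_
    intro a
    have hg := (exists_extension g).choose_spec a
    have hf := (exists_extension f).choose_spec (g.1 a)
    change (exists_extension f).choose.1 ((exists_extension g).choose.1 (Cpl.of a)) = _
    rw [hg, hf]
    rfl)

theorem bar_of (g : AutED L) (a : L) :
    (bar g : Equiv.Perm (Cpl L)) (Cpl.of a) = Cpl.of (g.1 a) :=
  (exists_extension g).choose_spec a

/-! ### Supports, bounded elements, distinguished subgroups -/

/-- The support of `g`, a subset of `L̄`. -/
def supp (g : AutED L) : Set (Cpl L) := {x | (bar g).1 x ≠ x}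

theorem supp_one : supp (1 : AutED L) = ∅ := by
  ext x
  simp [supp]

theorem supp_mul (f g : AutED L) : supp (f * g) ⊆ supp f ∪ supp g := by
  intro x hx
  by_contra hn
  simp only [supp, mem_union, mem_ofPred_eq, not_or, not_not] at hn
  apply hx
  rw [map_mul]
  change (bar f).1 ((bar g).1 x) = x
  rw [hn.2, hn.1]

theorem supp_inv (g : AutED L) : supp g⁻¹ ⊆ supp g := by
  intro x hx hn
  apply hx
  rw [map_inv]
  change (bar g).1⁻¹ x = x
  rw [Equiv.Perm.inv_eq_iff_eq]
  exact hn.symm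

/-- `Opp(G)`: the order-preserving elements of `G`. -/
def Opp (G : Subgroup (AutED L)) : Subgroup (AutED L) where
  carrier := {g | g ∈ G ∧ StrictMono g.1}
  mul_mem' hf hg := ⟨G.mul_mem hf.1 hg.1, hf.2.comp hg.2⟩
  one_mem' := ⟨G.one_mem, strictMono_id⟩
  inv_mem' hg := ⟨G.inv_mem hg.1, symm_strictMono hg.2⟩

/-- `Lft(G)`: the elements of `G` with support bounded above. -/
def Lft (G : Subgroup (AutED L)) : Subgroup (AutED L) where
  carrier := {g | g ∈ G ∧ BddAbove (supp g)}
  mul_mem' hf hg := ⟨G.mul_mem hf.1 hg.1,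
    haveI : Nonempty (Cpl L) := ⟨Cpl.of (Classical.arbitrary L)⟩
    (hf.2.union hg.2).mono (supp_mul _ _)⟩
  one_mem' := ⟨G.one_mem, by
    rw [supp_one]
    exact ⟨Cpl.of (Classical.arbitrary L), by simp [upperBounds]⟩⟩
  inv_mem' hg := ⟨G.inv_mem hg.1, hg.2.mono (supp_inv _)⟩

/-- `Rt(G)`: the elements of `G` with support bounded below. -/
def Rt (G : Subgroup (AutED L)) : Subgroup (AutED L) where
  carrier := {g | g ∈ G ∧ BddBelow (supp g)}
  mul_mem' hf hg := ⟨G.mul_mem hf.1 hg.1,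
    haveI : Nonempty (Cpl L) := ⟨Cpl.of (Classical.arbitrary L)⟩
    (hf.2.union hg.2).mono (supp_mul _ _)⟩
  one_mem' := ⟨G.one_mem, by
    rw [supp_one]
    exact ⟨Cpl.of (Classical.arbitrary L), by simp [lowerBounds]⟩⟩
  inv_mem' hg := ⟨G.inv_mem hg.1, hg.2.mono (supp_inv _)⟩

/-- `Bdd(G)`: the elements of `G` with bounded support. -/
def Bdd (G : Subgroup (AutED L)) : Subgroup (AutED L) := Lft G ⊓ Rt G

/-- `BddDer G`: the derived group of `Bdd(G)`. -/
def BddDer (G : Subgroup (AutED L)) : Subgroup (AutED L) := ⁅Bdd G, Bdd G⁆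

/-! ### Interval-transitivity and the class of groups considered -/

/-- The `L`-intervals: nonempty bounded open intervals, open rays, and `L` itself. -/
def IsInterval (I : Set L) : Prop :=
  (∃ x y : L, x < y ∧ I = Ioo x y) ∨ (∃ x : L, I = Iio x) ∨ (∃ x : L, I = Ioi x) ∨ I = univ

/-- `I₁ < ⋯ < Iₙ` for `L`-intervals. -/
def IntervalChain {n : ℕ} (I : Fin n → Set L) : Prop :=
  (∀ i, IsInterval (I i)) ∧ ∀ i j, i < j → ∀ x ∈ I i, ∀ y ∈ I j, x < y

/-- `n`-interval-transitivity of `⟨ED(L), G⟩`. -/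
def IntervalTransitive (n : ℕ) (G : Subgroup (AutED L)) : Prop :=
  ∀ I J : Fin n → Set L, IntervalChain I → IntervalChain J →
    ∃ g ∈ G, ∀ i, ((g.1 '' I i) ∩ J i).Nonempty

/-- `⟨ED(L), G⟩` is 3-interval-transitive and has a nonidentity bounded element. -/
def IsMN3 (G : Subgroup (AutED L)) : Prop :=
  IntervalTransitive 3 G ∧ ∃ g ∈ Bdd G, g ≠ 1

/-! ### Orbits in the completion and the pointwise order -/

/-- The orbit of a point of `L̄` under `G`. -/
def orbit (G : Subgroup (AutED L)) (x : Cpl L) : Set (Cpl L) := {y | ∃ g ∈ G, (bar g).1 x = y}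

/-- The set of orbits of `⟨L̄, G⟩`. -/
def orbits (G : Subgroup (AutED L)) : Set (Set (Cpl L)) := range (orbit G)

/-- The pointwise order. -/
def PwLE (f g : AutED L) : Prop := ∀ x : L, f.1 x ≤ g.1 x

/-- The pointwise order on `G` is nontrivial, as is required of the order of a half-ordered
group. -/
def HasNontrivialOrder (G : Subgroup (AutED L)) : Prop :=
  ∃ f ∈ G, ∃ g ∈ G, PwLE f g ∧ f ≠ g

/-- `o-Aut(G)`: the automorphisms of `G` that preserve the pointwise order. -/
def oAut (G : Subgroup (AutED L)) : Subgroup (MulAut G) where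
  carrier := {α | ∀ f g : G, PwLE (α f : AutED L) (α g : AutED L) ↔ PwLE (f : AutED L) g}
  mul_mem' {α β} hα hβ f g := (hα (β f) (β g)).trans (hβ f g)
  one_mem' _ _ := Iff.rfl
  inv_mem' {α} hα f g := by
    have h := hα (α⁻¹ f) (α⁻¹ g)
    simp only [MulAut.apply_inv_self] at h
    exact h.symm

/-- `g` is signed: it is not the identity and moves all points of its support in the same
direction. -/
def Signed (g : AutED L) : Prop :=
  g ≠ 1 ∧ ((∀ x : L, x ≤ g.1 x) ∨ ∀ x : L, g.1 x ≤ x)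

/-- The signed elements `g₁` and `g₂` have the same sign. -/
def SameSign (g₁ g₂ : AutED L) : Prop :=
  Signed g₁ ∧ Signed g₂ ∧
    ∀ x₁ x₂ : L, g₁.1 x₁ ≠ x₁ → g₂.1 x₂ ≠ x₂ → Ed (g₁.1 x₁) x₁ (g₂.1 x₂) x₂

/-! ### The set `Ep(ED(L), G)` of endpoints -/

/-- The regular open set `var(g) = int(cl(supp(g)))`. -/
def var (g : AutED L) : Set (Cpl L) := interior (closure (supp g))

/-- The endpoints in `L̄` of the convex hull of `U`. As `L̄` has neither a least nor a greatest
point, there are none if `U` is empty. -/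
def endpoints (U : Set (Cpl L)) : Set (Cpl L) := {x | IsGLB U x ∨ IsLUB U x}

/-- `Ep(ED(L), G)`. -/
def Ep (G : Subgroup (AutED L)) : Set (Cpl L) := {x | ∃ g ∈ G, x ∈ endpoints (var g)}

end Chain

/-! ### Languages and structures -/

/-- The only symbol of the language of groups: the binary operation. -/
inductive GRFun : ℕ → Type
  | mul : GRFun 2

/-- The first order language of groups. -/
def LGR : FirstOrder.Language.{0, 0} := ⟨GRFun, fun _ => Empty⟩

instance grStructure (G : Type*) [Mul G] : LGR.Structure G where
  funMap := fun {n} f => match n, f with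
    | _, GRFun.mul => fun x => x 0 * x 1
  RelMap := fun r => Empty.elim r

/-- The symbols of the language of monotonic permutation groups, with functions and partial
functions written as relations: being a point, being a group element, equal direction, the graph
of the group operation, and the graph of the application function. -/
inductive MNPGRel : ℕ → Type
  | pt : MNPGRel 1
  | gr : MNPGRel 1
  | ed : MNPGRel 4
  | comp : MNPGRel 3
  | ap : MNPGRel 3

/-- The first order language of monotonic permutation groups. -/
def LMNPG : FirstOrder.Language.{0, 0} := ⟨fun _ => Empty, MNPGRel⟩

section Act

variable {L : Type u} [LinearOrder L] [NoMinOrder L] [NoMaxOrder L] [Nonempty L]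

/-- The universe of `ACT(X, G)`, where `X` is a `G`-invariant subset of `L̄` with its equal
direction relation: the disjoint union of `X` and `G`. -/
def ACT (X : Set (Cpl L)) (G : Subgroup (AutED L)) : Type u := X ⊕ G

/-- A point as an element of `ACT(X, G)`. -/
def ACT.pt {X : Set (Cpl L)} {G : Subgroup (AutED L)} (x : X) : ACT X G := Sum.inl x

/-- A group element as an element of `ACT(X, G)`. -/
def ACT.gr {X : Set (Cpl L)} {G : Subgroup (AutED L)} (g : G) : ACT X G := Sum.inr g

instance actStructure (X : Set (Cpl L)) (G : Subgroup (AutED L)) :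
    LMNPG.Structure (ACT X G) where
  funMap := fun f => Empty.elim f
  RelMap := fun {n} R => match n, R with
    | _, MNPGRel.pt => fun v => ∃ x : X, v 0 = ACT.pt x
    | _, MNPGRel.gr => fun v => ∃ g : G, v 0 = ACT.gr g
    | _, MNPGRel.ed => fun v => ∃ a b c d : X, v 0 = ACT.pt a ∧ v 1 = ACT.pt b ∧
        v 2 = ACT.pt c ∧ v 3 = ACT.pt d ∧ Ed (a : Cpl L) b c d
    | _, MNPGRel.comp => fun v => ∃ f g h : G, v 0 = ACT.gr f ∧ v 1 = ACT.gr g ∧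
        v 2 = ACT.gr h ∧ f * g = h
    | _, MNPGRel.ap => fun v => ∃ (g : G) (x y : X), v 0 = ACT.gr g ∧ v 1 = ACT.pt x ∧
        v 2 = ACT.pt y ∧ (bar (g : AutED L)).1 x = y

end Act

/-! ### First order strong interpretations -/

/-- The formulas of a first order strong interpretation, by `n`-tuples, of structures in the
relational language `L'` in structures in the language `L`. -/
structure FOInterp (L L' : FirstOrder.Language.{0, 0}) where
  /-- the length of the tuples -/
  n : ℕ
  /-- the tuples that represent elements -/
  fU : L.Formula (Fin n)
  /-- two tuples represent the same element -/
  fEq : L.Formula (Fin 2 × Fin n)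
  /-- the relations of the interpreted structure -/
  fRel : ∀ {m : ℕ}, L'.Relations m → L.Formula (Fin m × Fin n)
  /-- a tuple represents a given element of the smaller structure -/
  fImap : L.Formula (Fin n ⊕ Unit)

/-- `μ` is a strong interpreting mapping of `M'` in `M`, where `i` is the inclusion of the
universe of `M` in that of `M'`. -/
def FOInterp.IsStrongInterpretingMap {L L' : FirstOrder.Language.{0, 0}} (I : FOInterp L L')
    {M : Type u} {M' : Type w} [L.Structure M] [L'.Structure M'] (i : M → M')
    (μ : {a : Fin I.n → M // I.fU.Realize a} → M') : Prop :=
  Function.Surjective μ ∧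
  (∀ a b, μ a = μ b ↔ I.fEq.Realize (fun p => (![a.1, b.1] : Fin 2 → Fin I.n → M) p.1 p.2)) ∧
  (∀ (m : ℕ) (R : L'.Relations m) (a : Fin m → {a : Fin I.n → M // I.fU.Realize a}),
    FirstOrder.Language.Structure.RelMap R (fun j => μ (a j)) ↔
      (I.fRel R).Realize (fun p => (a p.1).1 p.2)) ∧
  (∀ (a : Fin I.n → M) (x : M),
    I.fImap.Realize (Sum.elim a (fun _ => x)) ↔ ∃ h : I.fU.Realize a, μ ⟨a, h⟩ = i x)

/-! ### Second order logic -/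

/-- Second order formulas over `L` with free first order variables in `α` and free relation
variables in `β`, the relation variable `X` being `ar X`-ary. (Function variables are dispensable
in favour of their graphs.) -/
inductive SOFormula (L : FirstOrder.Language.{0, 0}) : (α β : Type) → (β → ℕ) → Type 1
  | falsum {α β : Type} {ar : β → ℕ} : SOFormula L α β ar
  | equal {α β : Type} {ar : β → ℕ} (t s : L.Term α) : SOFormula L α β ar
  | rel {α β : Type} {ar : β → ℕ} {n : ℕ} (R : L.Relations n) (ts : Fin n → L.Term α) :
      SOFormula L α β ar
  | var {α β : Type} {ar : β → ℕ} (X : β) (ts : Fin (ar X) → L.Term α) : SOFormula L α β ar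
  | imp {α β : Type} {ar : β → ℕ} (φ ψ : SOFormula L α β ar) : SOFormula L α β ar
  | all {α β : Type} {ar : β → ℕ} (φ : SOFormula L (Option α) β ar) : SOFormula L α β ar
  | allRel {α β : Type} {ar : β → ℕ} (k : ℕ)
      (φ : SOFormula L α (Option β) (fun o => o.elim k ar)) : SOFormula L α β ar

/-- Satisfaction of second order formulas in the standard (full) semantics. -/
def SOFormula.Realize {L : FirstOrder.Language.{0, 0}} {M : Type u} [L.Structure M] :
    {α β : Type} → {ar : β → ℕ} → SOFormula L α β ar →
      (α → M) → ((X : β) → (Fin (ar X) → M) → Prop) → Prop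
  | _, _, _, .falsum, _, _ => False
  | _, _, _, .equal t s, a, _ => t.realize a = s.realize a
  | _, _, _, .rel R ts, a, _ => FirstOrder.Language.Structure.RelMap R (fun j => (ts j).realize a)
  | _, _, _, .var X ts, a, V => V X (fun j => (ts j).realize a)
  | _, _, _, .imp φ ψ, a, V => φ.Realize a V → ψ.Realize a V
  | _, _, _, .all φ, a, V => ∀ x : M, φ.Realize (fun o => o.elim x a) V
  | _, _, _, .allRel k φ, a, V => ∀ S : (Fin k → M) → Prop,
      φ.Realize a (fun o => match o with
        | none => S
        | some X => V X)

/-- The formulas of a second order strong interpretation of structures in the relational language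
`L'` in structures in the language `L`; elements are represented by tuples of `n` elements and
`p` relations. -/
structure SOInterp (L L' : FirstOrder.Language.{0, 0}) where
  /-- the number of first order entries -/
  n : ℕ
  /-- the number of second order entries -/
  p : ℕ
  /-- the arities of the second order entries -/
  ar : Fin p → ℕ
  /-- the tuples that represent elements -/
  fU : SOFormula L (Fin n) (Fin p) ar
  /-- two tuples represent the same element -/
  fEq : SOFormula L (Fin 2 × Fin n) (Fin 2 × Fin p) (fun q => ar q.2)
  /-- the relations of the interpreted structure -/
  fRel : ∀ {m : ℕ}, L'.Relations m → SOFormula L (Fin m × Fin n) (Fin m × Fin p) (fun q => ar q.2)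
  /-- a tuple represents a given element of the smaller structure -/
  fImap : SOFormula L (Fin n ⊕ Unit) (Fin p) ar

/-- The tuples of elements of `M` and relations on `M` that satisfy the first formula. -/
structure SOInterp.Arg {L L' : FirstOrder.Language.{0, 0}} (I : SOInterp L L') (M : Type u)
    [L.Structure M] where
  /-- the first order entries -/
  fo : Fin I.n → M
  /-- the second order entries -/
  so : (j : Fin I.p) → (Fin (I.ar j) → M) → Prop
  sat : I.fU.Realize fo so

/-- `μ` is a strong interpreting mapping of `M'` in `M`, where `i` is the inclusion of the
universe of `M` in that of `M'`. -/
def SOInterp.IsStrongInterpretingMap {L L' : FirstOrder.Language.{0, 0}} (I : SOInterp L L')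
    {M : Type u} {M' : Type w} [L.Structure M] [L'.Structure M'] (i : M → M')
    (μ : I.Arg M → M') : Prop :=
  Function.Surjective μ ∧
  (∀ a b, μ a = μ b ↔
    I.fEq.Realize (fun q => ((![a, b] : Fin 2 → I.Arg M) q.1).fo q.2)
      (fun q => ((![a, b] : Fin 2 → I.Arg M) q.1).so q.2)) ∧
  (∀ (m : ℕ) (R : L'.Relations m) (a : Fin m → I.Arg M),
    FirstOrder.Language.Structure.RelMap R (fun j => μ (a j)) ↔
      (I.fRel R).Realize (fun q => (a q.1).fo q.2) (fun q => (a q.1).so q.2)) ∧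
  (∀ (a : Fin I.n → M) (A : (j : Fin I.p) → (Fin (I.ar j) → M) → Prop) (x : M),
    I.fImap.Realize (Sum.elim a (fun _ => x)) A ↔ ∃ h : I.fU.Realize a A, μ ⟨a, A, h⟩ = i x)

/-! ### Expressibility in the language of groups -/

/-- The `n`-ary relation `P` on the groups `G` for which `⟨ED(L), G⟩` is 3-interval-transitive with
a nonidentity bounded element is expressed by one first order formula in the language of groups. -/
def FOExpressible (n : ℕ) (P : ∀ (L : Type u) [LinearOrder L] [DenselyOrdered L] [NoMinOrder L]
    [NoMaxOrder L] [Nonempty L] (G : Subgroup (AutED L)), (Fin n → G) → Prop) : Prop :=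
  ∃ ψ : LGR.Formula (Fin n), ∀ (L : Type u) [LinearOrder L] [DenselyOrdered L] [NoMinOrder L]
    [NoMaxOrder L] [Nonempty L] (G : Subgroup (AutED L)), IsMN3 G →
      ∀ g : Fin n → G, ψ.Realize g ↔ P L G g

/-- The same for second order formulas all of whose free variables are first order. -/
def SOExpressible (n : ℕ) (P : ∀ (L : Type u) [LinearOrder L] [DenselyOrdered L] [NoMinOrder L]
    [NoMaxOrder L] [Nonempty L] (G : Subgroup (AutED L)), (Fin n → G) → Prop) : Prop :=
  ∃ ψ : SOFormula LGR (Fin n) Empty Empty.elim, ∀ (L : Type u) [LinearOrder L]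
    [DenselyOrdered L] [NoMinOrder L] [NoMaxOrder L] [Nonempty L] (G : Subgroup (AutED L)),
    IsMN3 G → ∀ g : Fin n → G, ψ.Realize g (fun X => X.elim) ↔ P L G g

/-! ### Maps that induce group isomorphisms -/

section Two

variable {L₁ : Type u} [LinearOrder L₁] [NoMinOrder L₁] [NoMaxOrder L₁] [Nonempty L₁]
  {L₂ : Type v} [LinearOrder L₂] [NoMinOrder L₂] [NoMaxOrder L₂] [Nonempty L₂]
  {G₁ : Subgroup (AutED L₁)} {G₂ : Subgroup (AutED L₂)}

/-- A bijection that is a homeomorphism. -/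
def IsHomeo {X Y : Type*} [TopologicalSpace X] [TopologicalSpace Y] (τ : X ≃ Y) : Prop :=
  Continuous τ ∧ Continuous τ.symm

/-- `τ` induces `α`: `α(g) = τ ∘ g ∘ τ⁻¹` on the completion, for all `g`. -/
def Induces (τ : Cpl L₁ ≃ Cpl L₂) (α : G₁ ≃* G₂) : Prop :=
  ∀ (g : G₁) (y : Cpl L₂), (bar (α g : AutED L₂)).1 y = τ ((bar (g : AutED L₁)).1 (τ.symm y))

/-- `τ ↾ X ∪ α` is an isomorphism of `ACT(X, G₁)` onto `ACT(Y, G₂)`. -/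
def IsActIso (X : Set (Cpl L₁)) (Y : Set (Cpl L₂)) (τ : Cpl L₁ ≃ Cpl L₂) (α : G₁ ≃* G₂) : Prop :=
  ∃ Φ : ACT X G₁ ≃[LMNPG] ACT Y G₂,
    (∀ x : X, ∃ y : Y, (y : Cpl L₂) = τ x ∧ Φ (ACT.pt x) = ACT.pt y) ∧
    ∀ g : G₁, Φ (ACT.gr g) = ACT.gr (α g)

/-- How the bijection `τ` induced by `α` acts on orbits, and how `α` acts on the pointwise
order. -/
structure RespectsOrbitsAndOrder (τ : Cpl L₁ ≃ Cpl L₂) (α : G₁ ≃* G₂) : Prop where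
  /-- `M ↦ τ(M)` is a bijection between the sets of orbits -/
  bijOn_orbits : BijOn (fun M => τ '' M) (orbits G₁) (orbits G₂)
  /-- the restriction of `τ` to an orbit is compatible with the actions of the groups -/
  actIso_orbit : ∀ M ∈ orbits G₁, IsActIso M (τ '' M) τ α
  /-- `τ` preserves order on all orbits and `α` preserves the pointwise order, or `τ` reverses
  order on all orbits and `α` reverses the pointwise order -/
  preserves_or_reverses :
    (StrictMono τ ∧ (∀ M ∈ orbits G₁, StrictMonoOn τ M) ∧
      ∀ f g : G₁, PwLE (α f : AutED L₂) (α g) ↔ PwLE (f : AutED L₁) g) ∨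
    (StrictAnti τ ∧ (∀ M ∈ orbits G₁, StrictAntiOn τ M) ∧
      ∀ f g : G₁, PwLE (α f : AutED L₂) (α g) ↔ PwLE (g : AutED L₁) f)
  /-- if `α` is an isomorphism of half-ordered groups, then `τ` preserves order -/
  strictMono_of_order : HasNontrivialOrder G₁ →
    (∀ f g : G₁, PwLE (α f : AutED L₂) (α g) ↔ PwLE (f : AutED L₁) g) → StrictMono τ

end Two

/-! ### Normalizers -/

/-- The group of homeomorphisms of `X`, as a group of permutations. -/
def homeoGroup (X : Type*) [TopologicalSpace X] : Subgroup (Equiv.Perm X) where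
  carrier := {τ | IsHomeo τ}
  mul_mem' hσ hτ := ⟨hσ.1.comp hτ.1, hτ.2.comp hσ.2⟩
  one_mem' := ⟨continuous_id, continuous_id⟩
  inv_mem' hτ := ⟨hτ.2, hτ.1⟩

section One

variable {L : Type u} [LinearOrder L] [NoMinOrder L] [NoMaxOrder L] [Nonempty L]

/-- `G` as a group of permutations of `L̄`. -/
noncomputable def permCpl (G : Subgroup (AutED L)) : Subgroup (Equiv.Perm (Cpl L)) :=
  (G.map bar).map (AutED (Cpl L)).subtype

/-- The normalizer of `G` in `Aut(ED(L̄))`. -/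
noncomputable def normAut (G : Subgroup (AutED L)) : Subgroup (Equiv.Perm (Cpl L)) :=
  AutED (Cpl L) ⊓ Subgroup.normalizer (permCpl G : Set (Equiv.Perm (Cpl L)))

/-- The normalizer of `G` in `Homeo(L̄)`. -/
noncomputable def normHomeo (G : Subgroup (AutED L)) : Subgroup (Equiv.Perm (Cpl L)) :=
  homeoGroup (Cpl L) ⊓ Subgroup.normalizer (permCpl G : Set (Equiv.Perm (Cpl L)))

/-- Every automorphism of `G` is conjugation by a unique automorphism of `ED(L̄)`, and
`Aut(G) = Norm_{Aut(ED(L̄))}(G) = Norm_{Homeo(L̄)}(G)`. -/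
def AutIsNormalizer (G : Subgroup (AutED L)) : Prop :=
  (∀ α : MulAut G, ∃! τ : Equiv.Perm (Cpl L), τ ∈ AutED (Cpl L) ∧ Induces τ α) ∧
  normAut G = normHomeo G ∧
  ∃ Φ : normHomeo G ≃* MulAut G, ∀ τ : normHomeo G, Induces (τ : Equiv.Perm (Cpl L)) (Φ τ)

end One

end MonRec

open MonRec
open scoped FirstOrder

set_option linter.unusedSectionVars false

namespace MonRec

open Set

/-! ### Groups of monotonic permutations of a complete chain -/

/-! The abstract group knows the chain because disjointness of supports is a first order property of
group elements. Suppose that f and g have disjoint supports and that h moves a point of the support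
of f. A small interval inside that support is moved off itself by h, and noncommuting f₁, f₂
supported in the interval satisfy [f₁,[f₂,h]] = [f₁,f₂], a nonidentity element that centralizes g.
Suppose on the other hand that g preserves order and moves a point that f moves too. If h is
supported in a short enough interval around the point, then for all f₁, f₂ centralizing g the
support of [f₁,[f₂,h]] is covered by four translates of the interval under the centralizer of g.
Each translate contains at most one of the points gⁱy of a forward orbit, whereas the support of a
commutator that centralizes g is closed under g. This is `ad_iff_disjoint`. Squares always preserve
order, so from then on an element is represented by the support of its square. The language has no
symbols for inverses, hence commutators and conjugates appear as solutions of equations.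

Pairs of elements code rays: the first entry bounds the ray, the second selects a component of the
complement of the closure of the support of the first. The component is unbounded if no group
element squeezes it into a certain fixed support (`ray_iff`). Inclusion of rays defines sameness of
direction, and relative to a reference ray the order of endpoints becomes definable
(`IsLRay.rayLE_iff`). These endpoints are dense and form exactly Ep(G) (`mem_ep_iff`). The action on
them is conjugation of pairs (`IsRayAt.conj`).

A group isomorphism carries rays to rays. It therefore gives an order isomorphism or
anti-isomorphism between dense sets of endpoints, which extends to the completions
(`exists_monotonic_equivariant`). It is unique because only the identity commutes with the group
(`eq_self_of_commute`). The statements about automorphisms follow from this τ, since it carries the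
support of g to that of α(g). They apply to the distinguished subgroups because already Bdd'(G)
belongs to the class (`IsMN3.bddDer`), and hence so does every group between it and G.

For the model theoretic part, endpoints are represented by rays, and points of the completion by
cuts in the set of rays, which are binary relations on the group. One translation theorem,
`TransOps.Models.realize_trans`, serves both logics. No direction of the chain is definable without
parameters, so Lft(G) and Rt(G) can be treated only as an unordered pair; `theories_match` recovers
a matching of their theories from this. -/

/-- A group acting faithfully by monotonic permutations on a Dedekind complete chain,
3-interval-transitively and with a nonidentity bounded element. -/
class LocMove (A X : Type*) [Group A] [LinearOrder X] [MulAction A X] : Prop where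
  lub : ∀ s : Set X, s.Nonempty → BddAbove s → ∃ x, IsLUB s x
  monotonic : ∀ g : A, Monotonic (fun x : X => g • x)
  faithful : ∀ g : A, (∀ x : X, g • x = x) → g = 1
  trans : ∀ a₁ b₁ a₂ b₂ a₃ b₃ c₁ d₁ c₂ d₂ c₃ d₃ : X, a₁ < b₁ → b₁ ≤ a₂ → a₂ < b₂ → b₂ ≤ a₃ →
    a₃ < b₃ → c₁ < d₁ → d₁ ≤ c₂ → c₂ < d₂ → d₂ ≤ c₃ → c₃ < d₃ →
    ∃ g : A, ∃ x₁ ∈ Ioo a₁ b₁, ∃ x₂ ∈ Ioo a₂ b₂, ∃ x₃ ∈ Ioo a₃ b₃,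
      g • x₁ ∈ Ioo c₁ d₁ ∧ g • x₂ ∈ Ioo c₂ d₂ ∧ g • x₃ ∈ Ioo c₃ d₃
  bdd : ∃ g : A, g ≠ 1 ∧ ∃ u v : X, ∀ x : X, g • x ≠ x → x ∈ Ioo u v

theorem exists_isGLB_of_lub {X : Type*} [LinearOrder X]
    (h : ∀ s : Set X, s.Nonempty → BddAbove s → ∃ x, IsLUB s x) (s : Set X) (hs : s.Nonempty)
    (hb : BddBelow s) : ∃ x, IsGLB s x := by
  obtain ⟨x, hx⟩ := h (lowerBounds s) hb (hs.mono fun y hy z hz => hz hy)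
  exact ⟨x, isLUB_lowerBounds.1 hx⟩

/-- Everything proved for left rays, upward moves and upper bounds holds on the other side by
passing to the reversed chain. Most of the dual lemmas below are definitional unfoldings through
this instance. -/
instance LocMove.dual (A X : Type*) [Group A] [LinearOrder X] [MulAction A X] [h : LocMove A X] :
    LocMove A Xᵒᵈ where
  lub s hs hb := exists_isGLB_of_lub h.lub (OrderDual.toDual ⁻¹' s) hs hb
  monotonic g := (h.monotonic g).imp (fun m _ _ hxy => m hxy) (fun m _ _ hxy => m hxy)
  faithful g hg := h.faithful g hg
  trans a₁ b₁ a₂ b₂ a₃ b₃ c₁ d₁ c₂ d₂ c₃ d₃ h1 h2 h3 h4 h5 k1 k2 k3 k4 k5 := by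
    obtain ⟨g, x₁, i₁, x₂, i₂, x₃, i₃, j₁, j₂, j₃⟩ := h.trans (OrderDual.ofDual b₃)
      (OrderDual.ofDual a₃) (OrderDual.ofDual b₂) (OrderDual.ofDual a₂) (OrderDual.ofDual b₁)
      (OrderDual.ofDual a₁) (OrderDual.ofDual d₃) (OrderDual.ofDual c₃) (OrderDual.ofDual d₂)
      (OrderDual.ofDual c₂) (OrderDual.ofDual d₁) (OrderDual.ofDual c₁) h5 h4 h3 h2 h1 k5 k4 k3
      k2 k1
    exact ⟨g, x₃, i₃.symm, x₂, i₂.symm, x₁, i₁.symm, j₃.symm, j₂.symm, j₁.symm⟩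
  bdd := by
    obtain ⟨g, hg, u, v, hs⟩ := h.bdd
    exact ⟨g, hg, v, u, fun x hx => (hs x hx).symm⟩

section Basic

variable {A : Type*} (X : Type*) [Group A] [LinearOrder X] [MulAction A X]

/-- The element `g` preserves order. -/
def Inc (g : A) : Prop := StrictMono (fun x : X => g • x)

/-- The set of points moved by `g`. -/
def sp (g : A) : Set X := {x | g • x ≠ x}

variable {X}

@[simp] theorem mem_sp {g : A} {x : X} : x ∈ sp X g ↔ g • x ≠ x := Iff.rfl

theorem notMem_sp {g : A} {x : X} : x ∉ sp X g ↔ g • x = x := not_not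

theorem Inc.lt_iff {g : A} (h : Inc X g) {x y : X} : g • x < g • y ↔ x < y := h.lt_iff_lt

theorem Inc.le_iff {g : A} (h : Inc X g) {x y : X} : g • x ≤ g • y ↔ x ≤ y := h.le_iff_le

theorem Inc.smul_lt {g : A} (h : Inc X g) {x y : X} (hxy : x < y) : g • x < g • y := h hxy

theorem Inc.mul {g h : A} (hg : Inc X g) (hh : Inc X h) : Inc X (g * h) := by
  intro x y hxy
  simp only [mul_smul]
  exact hg (hh hxy)

theorem Inc.inv {g : A} (hg : Inc X g) : Inc X g⁻¹ := by
  intro x y hxy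
  have : g • g⁻¹ • x < g • g⁻¹ • y := by simpa using hxy
  exact hg.lt_iff.1 this

theorem Inc.one : Inc X (1 : A) := by
  intro x y hxy
  simpa using hxy

theorem Inc.lt_inv_smul {g : A} (hg : Inc X g) {x y : X} : x < g⁻¹ • y ↔ g • x < y := by
  rw [← hg.lt_iff, smul_inv_smul]

theorem Inc.inv_smul_lt {g : A} (hg : Inc X g) {x y : X} : g⁻¹ • x < y ↔ x < g • y := by
  rw [← hg.lt_iff, smul_inv_smul]

theorem sp_inv (g : A) : sp X g⁻¹ = sp X g := by
  ext x
  simp only [mem_sp, ne_eq, inv_smul_eq_iff, eq_comm (a := x)]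

theorem mem_sp_conj {g h : A} {x : X} : x ∈ sp X (h * g * h⁻¹) ↔ h⁻¹ • x ∈ sp X g := by
  simp only [mem_sp, mul_smul, ne_eq, ← eq_inv_smul_iff (g := h)]

theorem sp_mul_subset (g h : A) : sp X (g * h) ⊆ sp X g ∪ sp X h := by
  intro x hx
  by_contra hn
  simp only [mem_union, mem_sp, not_or, not_not] at hn
  exact hx (by rw [mul_smul, hn.2, hn.1])

theorem smul_mem_sp {g : A} {x : X} : g • x ∈ sp X g ↔ x ∈ sp X g := by
  simp [mem_sp]

theorem inv_smul_mem_sp {g : A} {x : X} : g⁻¹ • x ∈ sp X g ↔ x ∈ sp X g := by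
  rw [← smul_mem_sp, smul_inv_smul]

theorem smul_mem_sp_of_commute {g h : A} (hc : Commute g h) {x : X} :
    h • x ∈ sp X g ↔ x ∈ sp X g := by
  simp only [mem_sp, ← mul_smul, hc.eq, ne_eq]
  rw [mul_smul, smul_left_cancel_iff]

/-- Elements with disjoint supports commute. -/
theorem mul_comm_of_disjoint {g h : A} (hf : ∀ g : A, (∀ x : X, g • x = x) → g = 1)
    (hd : Disjoint (sp X g) (sp X h)) : g * h = h * g := by
  have key : ∀ x : X, (g * h) • x = (h * g) • x := by
    intro x
    simp only [mul_smul]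
    by_cases hx : x ∈ sp X g
    · have h1 := notMem_sp.1 (disjoint_left.1 hd hx)
      have h2 := notMem_sp.1 (disjoint_left.1 hd (smul_mem_sp.2 hx))
      rw [h1, h2]
    · rw [notMem_sp.1 hx]
      by_cases hx' : x ∈ sp X h
      · exact notMem_sp.1 (disjoint_right.1 hd (smul_mem_sp.2 hx'))
      · rw [notMem_sp.1 hx', notMem_sp.1 hx]
  have := hf ((h * g)⁻¹ * (g * h)) (fun x => by rw [mul_smul, key, inv_smul_smul])
  exact (inv_mul_eq_one.1 this).symm

end Basic

section Core

variable {A X : Type*} [Group A] [LinearOrder X] [MulAction A X] [LocMove A X]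

theorem inc_of_lt {g : A} {x y : X} (h : x < y) (h' : g • x < g • y) : Inc X g := by
  rcases LocMove.monotonic (X := X) g with m | m
  · exact m
  · exact absurd (m h) (not_lt.2 h'.le)

theorem inc_of_fixed {g : A} {x y : X} (h : x < y) (hx : g • x = x) (hy : g • y = y) :
    Inc X g := inc_of_lt h (by rwa [hx, hy])

theorem inc_sq (g : A) : Inc X (g * g) := by
  intro x y hxy
  simp only [mul_smul]
  rcases LocMove.monotonic (X := X) g with m | m
  · exact m (m hxy)
  · exact m (m hxy)

/-- An order-preserving permutation of a chain has no cycles of length two, so squaring creates no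
new fixed points. -/
theorem sp_sq {g : A} (hg : Inc X g) : sp X (g * g) = sp X g := by
  ext x
  simp only [mem_sp, mul_smul, ne_eq, not_iff_not]
  constructor
  · intro h
    rcases lt_trichotomy (g • x) x with h1 | h1 | h1
    · exact absurd h ((hg h1).trans h1).ne
    · exact h1
    · exact absurd h (h1.trans (hg h1)).ne'
  · intro h
    rw [h, h]

theorem sp_nonempty {g : A} (h : g ≠ 1) : (sp X g).Nonempty := by
  by_contra hn
  exact h (LocMove.faithful (X := X) g fun x => by_contra fun hx => hn ⟨x, hx⟩)

theorem exists_isGLB (A : Type*) {X : Type*} [Group A] [LinearOrder X] [MulAction A X]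
    [LocMove A X] (s : Set X) (hs : s.Nonempty) (hb : BddBelow s) : ∃ x, IsGLB s x :=
  exists_isGLB_of_lub (LocMove.lub A) s hs hb

/-- A group of order-preserving elements that moves all points in question and has elements with
a fixed point and an arbitrarily far image in an interval has orbits that meet the interval. -/
theorem exists_smul_mem_Ioo (M : Subgroup A) (hM : ∀ n ∈ M, Inc X n) {x c d : X}
    (moved : ∀ s, x ≤ s → s ≤ d → ∃ n ∈ M, n • s ≠ s)
    (far : ∀ n ∈ M, d ≤ n • x → ∃ k ∈ M, ∃ r ∈ Ioo c d, ∃ q ∈ Ioo c d, k • r = r ∧ n • x < k • q) :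
    ∃ n ∈ M, n • x ∈ Ioo c d := by
  -- Otherwise the orbit of `x` has a supremum `s` in the range where `M` moves every point. An
  -- element with `s < n • s` sends some orbit point near `s` beyond `s`, which is absurd.
  have h1 : ∃ n ∈ M, d ≤ n • x := by
    by_contra! hn
    let O : Set X := {y | ∃ n ∈ M, n • x = y}
    have hO : BddAbove O := ⟨d, by rintro _ ⟨n, hnM, rfl⟩; exact (hn n hnM).le⟩
    have hxO : x ∈ O := ⟨1, M.one_mem, one_smul _ _⟩
    obtain ⟨s, hs⟩ := LocMove.lub A O ⟨x, hxO⟩ hO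
    obtain ⟨n, hnM, hns⟩ := moved s (hs.1 hxO)
      (hs.2 (by rintro _ ⟨n, hnM, rfl⟩; exact (hn n hnM).le))
    have key : ∀ n ∈ M, ¬ s < n • s := by
      intro n hnM hlt
      have : n⁻¹ • s < s := (hM n hnM).inv_smul_lt.2 hlt
      obtain ⟨y, ⟨m, hm, rfl⟩, hy, -⟩ := hs.exists_between this
      have h2 : s < n • m • x := (hM n hnM).inv_smul_lt.1 hy
      exact absurd (hs.1 ⟨n * m, M.mul_mem hnM hm, mul_smul _ _ _⟩) (not_le.2 h2)
    rcases lt_or_gt_of_ne hns with h | h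
    · exact key n⁻¹ (M.inv_mem hnM) ((hM n hnM).lt_inv_smul.2 h)
    · exact key n hnM h
  obtain ⟨n, hn, hd⟩ := h1
  obtain ⟨k, hk, r, hr, q, hq, hkr, hkq⟩ := far n hn hd
  -- Since `k` fixes `r`, which is below `n • x`, and sends `q` above `n • x`, the point `k⁻¹ • n •
  -- x` lies between `r` and `q`.
  refine ⟨k⁻¹ * n, M.mul_mem (M.inv_mem hk) hn, ?_⟩
  rw [mul_smul]
  constructor
  · refine hr.1.trans ?_
    rw [(hM k hk).lt_inv_smul, hkr]
    exact hr.2.trans_le hd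
  · exact ((hM k hk).inv_smul_lt.2 hkq).trans hq.2

/-- The subgroup of elements of `N` with support in `V`, provided that they preserve order. -/
def supportedIn (N : Subgroup A) (V : Set X) : Subgroup A where
  carrier := {n | n ∈ N ∧ Inc X n ∧ sp X n ⊆ V}
  mul_mem' ha hb := ⟨N.mul_mem ha.1 hb.1, ha.2.1.mul hb.2.1,
    (sp_mul_subset _ _).trans (union_subset ha.2.2 hb.2.2)⟩
  one_mem' := ⟨N.one_mem, Inc.one, fun x hx => absurd (one_smul A x) hx⟩
  inv_mem' ha := ⟨N.inv_mem ha.1, ha.2.1.inv, by rw [sp_inv]; exact ha.2.2⟩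

/-- A subgroup that is normalized by all order-preserving elements and has a nonidentity bounded
element. -/
structure BddNormal (X : Type*) [LinearOrder X] [MulAction A X] (N : Subgroup A) : Prop where
  conj_mem : ∀ g : A, Inc X g → ∀ n ∈ N, g * n * g⁻¹ ∈ N
  bdd : ∃ n ∈ N, n ≠ 1 ∧ ∃ u v : X, sp X n ⊆ Ioo u v

theorem bddNormal_top : BddNormal X (⊤ : Subgroup A) where
  conj_mem _ _ _ _ := Subgroup.mem_top _
  bdd := by
    obtain ⟨g, hg, u, v, h⟩ := LocMove.bdd (A := A) (X := X)
    exact ⟨g, Subgroup.mem_top _, hg, u, v, h⟩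

variable [NoMinOrder X] [NoMaxOrder X]

theorem inc_of_sp_subset_Ioi {n : A} {a : X} (h : sp X n ⊆ Ioi a) : Inc X n := by
  obtain ⟨b, hb⟩ := exists_lt a
  exact inc_of_fixed hb (notMem_sp.1 fun hx => lt_asymm hb (h hx))
    (notMem_sp.1 fun hx => lt_irrefl a (h hx))

theorem inc_of_sp_subset_Ioo {n : A} {a b : X} (h : sp X n ⊆ Ioo a b) : Inc X n :=
  inc_of_sp_subset_Ioi (h.trans Ioo_subset_Ioi_self)

variable [DenselyOrdered X]

/-! ### Local moves supplied by a normalized subgroup with bounded elements. -/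

namespace BddNormal

variable {N : Subgroup A} (hN : BddNormal X N)

include hN

theorem exists_bump : ∃ n ∈ N, ∃ u v p : X, Inc X n ∧ sp X n ⊆ Ioo u v ∧ p < n • p := by
  obtain ⟨n, hn, h1, u, v, hs⟩ := hN.bdd
  obtain ⟨p, hp⟩ := sp_nonempty (X := X) h1
  have hi := inc_of_sp_subset_Ioo hs
  rcases lt_or_gt_of_ne hp with h | h
  · exact ⟨n⁻¹, N.inv_mem hn, u, v, p, hi.inv, by rwa [sp_inv], hi.lt_inv_smul.2 h⟩
  · exact ⟨n, hn, u, v, p, hi, hs, h⟩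

theorem inv_conj_mem {g n : A} (hg : Inc X g) (hn : n ∈ N) : g⁻¹ * n * g ∈ N := by
  simpa using hN.conj_mem g⁻¹ hg.inv n hn

/-- A conjugator `g` brings some point above `a` below the support of a bump and puts `g • s`
between `p` and `n • p`, where everything is moved. This spends all three intervals of the
transitivity hypothesis, so the support is not yet controlled from above. -/
theorem exists_smul_ne_Ioi {a s : X} (h : a < s) :
    ∃ n ∈ supportedIn N (Ioi a), n • s ≠ s := by
  obtain ⟨n, hn, u, v, p, hi, hs, hp⟩ := hN.exists_bump
  obtain ⟨u', hu'⟩ := exists_lt u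
  obtain ⟨m, hm1, hm2⟩ := exists_between hp
  obtain ⟨b, hb1, hb2⟩ := exists_between h
  obtain ⟨s', hs'⟩ := exists_gt s
  have hup : u < p := (hs hp.ne').1
  obtain ⟨g, x₁, i₁, x₂, i₂, x₃, i₃, j₁, j₂, j₃⟩ := LocMove.trans (A := A) a b b s s s'
    u' u p m m (n • p) hb1 le_rfl hb2 le_rfl hs' hu' hup.le hm1 le_rfl hm2
  have hg : Inc X g := inc_of_lt (i₂.2.trans i₃.1) (j₂.2.trans j₃.1)
  have hs1 : p < g • s := j₂.1.trans (hg i₂.2)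
  have hs2 : g • s < n • p := (hg i₃.1).trans j₃.2
  refine ⟨g⁻¹ * n * g, ⟨hN.inv_conj_mem hg hn, (hg.inv.mul hi).mul hg, ?_⟩, ?_⟩
  · intro x hx
    have : g • x ∈ sp X n := by
      have h2 := mem_sp_conj (g := n) (h := g⁻¹) (x := x)
      rw [inv_inv] at h2
      exact h2.1 hx
    refine hg.lt_iff.1 (lt_trans ?_ (hs this).1)
    exact (hg i₁.1).trans j₁.2
  · have h2 := mem_sp_conj (g := n) (h := g⁻¹) (x := s)
    rw [inv_inv] at h2
    refine h2.2 ?_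
    exact (hs2.trans (hi hs1)).ne'

/-- The element that pulls a far point back into `(c, d)` is a conjugated bump: it fixes one point
of `(c, d)` and throws another one beyond the far point. -/
theorem exists_smul_mem_Ioi {a x c d : X} (hx : a < x) (hc : a ≤ c) (hd : c < d) :
    ∃ n ∈ supportedIn N (Ioi a), n • x ∈ Ioo c d := by
  refine exists_smul_mem_Ioo _ (fun n (hn : n ∈ supportedIn N _) => hn.2.1)
    (fun s hs _ => hN.exists_smul_ne_Ioi (hx.trans_le hs)) ?_
  intro n₀ _ hd0
  obtain ⟨n, hn, u, v, p, hi, hs, hp⟩ := hN.exists_bump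
  obtain ⟨u', hu'⟩ := exists_lt u
  obtain ⟨e₁, he1, he1'⟩ := exists_between hp
  obtain ⟨e₂, he2, he2'⟩ := exists_between he1'
  obtain ⟨m, hm1, hm2⟩ := exists_between hd
  obtain ⟨d', hd'⟩ := exists_gt (n₀ • x)
  have he : e₂ ∈ sp X n := (he2'.trans (hi (he1.trans he2))).ne'
  have hu : u < n⁻¹ • e₂ := (hs (inv_smul_mem_sp.2 he)).1
  -- The point `x₁` is below the support of `n`, and `n` sends `x₂` above `e₂`, hence above `x₃`.
  -- The images under `g` of the first two lie in `(c, d)`, that of `x₃` lies above `n₀ • x`.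
  obtain ⟨g, x₁, i₁, x₂, i₂, x₃, i₃, j₁, j₂, j₃⟩ := LocMove.trans (A := A) u' u (n⁻¹ • e₂) p e₁ e₂
    c m m d (n₀ • x) d' hu' hu.le (hi.inv_smul_lt.2 he2') he1.le he2 hm1 le_rfl hm2 hd0 hd'
  have hg : Inc X g := inc_of_lt (i₁.2.trans (hu.trans i₂.1)) (j₁.2.trans j₂.1)
  have hx1 : ∀ y ∈ sp X n, x₁ < y := fun y hy => i₁.2.trans (hs hy).1
  refine ⟨g * n * g⁻¹, ⟨hN.conj_mem g hg n hn, (hg.mul hi).mul hg.inv, ?_⟩, g • x₁,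
    ⟨j₁.1, j₁.2.trans hm2⟩, g • x₂, ⟨hm1.trans j₂.1, j₂.2⟩, ?_, ?_⟩
  · intro y hy
    have := hx1 _ (mem_sp_conj.1 hy)
    exact (hc.trans_lt j₁.1).trans (hg.lt_inv_smul.1 this)
  · have : x₁ ∉ sp X n := fun h => lt_irrefl _ (hx1 _ h)
    rw [mul_smul, inv_smul_smul, mul_smul, notMem_sp.1 this]
  · rw [mul_smul, inv_smul_smul, mul_smul]
    refine j₃.1.trans (hg ?_)
    exact i₃.2.trans (hi.inv_smul_lt.1 i₂.1)

/-- Four points can be moved into four given intervals. -/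
theorem exists_smul_mem₄ {x₁ x₂ x₃ x₄ c₁ d₁ c₂ d₂ c₃ d₃ c₄ d₄ : X} (h12 : x₁ < x₂) (h23 : x₂ < x₃)
    (h34 : x₃ < x₄) (k1 : c₁ < d₁) (k12 : d₁ ≤ c₂) (k2 : c₂ < d₂) (k23 : d₂ ≤ c₃) (k3 : c₃ < d₃)
    (k34 : d₃ ≤ c₄) (k4 : c₄ < d₄) : ∃ n ∈ N, Inc X n ∧ n • x₁ ∈ Ioo c₁ d₁ ∧ n • x₂ ∈ Ioo c₂ d₂ ∧
      n • x₃ ∈ Ioo c₃ d₃ ∧ n • x₄ ∈ Ioo c₄ d₄ := by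
  obtain ⟨a, ha⟩ := exists_lt (min x₁ c₁)
  have fix : ∀ {b : X} {n : A}, n ∈ supportedIn N (Ioi b) → ∀ y ≤ b, n • y = y := fun hn y hy =>
    notMem_sp.1 fun h => absurd (hn.2.2 h) (not_lt.2 hy)
  -- The points are placed one after the other. Each new factor is supported to the right of the
  -- point placed last and so leaves the earlier placements intact.
  obtain ⟨n₁, hn₁, t₁⟩ := hN.exists_smul_mem_Ioi (x := x₁) (ha.trans_le (min_le_left _ _))
    (ha.le.trans (min_le_right _ _)) k1
  obtain ⟨n₂, hn₂, t₂⟩ := hN.exists_smul_mem_Ioi (x := n₁ • x₂) (hn₁.2.1.smul_lt h12) (t₁.2.le.trans k12) k2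
  obtain ⟨n₃, hn₃, t₃⟩ := hN.exists_smul_mem_Ioi (x := n₂ • n₁ • x₃) (hn₂.2.1.smul_lt (hn₁.2.1.smul_lt h23))
    (t₂.2.le.trans k23) k3
  obtain ⟨n₄, hn₄, t₄⟩ := hN.exists_smul_mem_Ioi (x := n₃ • n₂ • n₁ • x₄)
    (hn₃.2.1.smul_lt (hn₂.2.1.smul_lt (hn₁.2.1.smul_lt h34))) (t₃.2.le.trans k34) k4
  have f2 := fix hn₂ _ le_rfl
  have f3 := fix hn₃ _ le_rfl
  have f4 := fix hn₄ _ le_rfl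
  have g3 : n₃ • n₁ • x₁ = n₁ • x₁ := fix hn₃ _ (by rw [← f2]; exact (hn₂.2.1.smul_lt (hn₁.2.1.smul_lt h12)).le)
  have g4 : n₄ • n₂ • n₁ • x₂ = n₂ • n₁ • x₂ := fix hn₄ _ (by
    rw [← f3]; exact (hn₃.2.1.smul_lt (hn₂.2.1.smul_lt (hn₁.2.1.smul_lt h23))).le)
  have g4' : n₄ • n₁ • x₁ = n₁ • x₁ := fix hn₄ _ (by
    rw [← g3, ← f2]; exact (hn₃.2.1.smul_lt (hn₂.2.1.smul_lt (hn₁.2.1.smul_lt (h12.trans h23)))).le)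
  refine ⟨n₄ * n₃ * n₂ * n₁, N.mul_mem (N.mul_mem (N.mul_mem hn₄.1 hn₃.1) hn₂.1) hn₁.1,
    ((hn₄.2.1.mul hn₃.2.1).mul hn₂.2.1).mul hn₁.2.1, ?_⟩
  simp only [mul_smul]
  refine ⟨?_, ?_, ?_, t₄⟩
  · rwa [f2, g3, g4']
  · rwa [f3, g4]
  · rwa [f4]

/-- Now prescribed points can be moved, not merely some points of prescribed intervals. Sending `a`
below the support of a bump and `b` above it traps the conjugated support on both sides. -/
theorem exists_smul_ne_Ioo {a b s : X} (h : a < s) (h' : s < b) :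
    ∃ n ∈ supportedIn N (Ioo a b), n • s ≠ s := by
  obtain ⟨n, hn, u, v, p, hi, hs, hp⟩ := hN.exists_bump
  obtain ⟨u', hu'⟩ := exists_lt u
  obtain ⟨b', hb'⟩ := exists_gt b
  obtain ⟨v', hv'⟩ := exists_gt v
  obtain ⟨v'', hv''⟩ := exists_gt v'
  have hup : u < p := (hs hp.ne').1
  have hpv : n • p < v := (hs (smul_mem_sp.2 hp.ne')).2
  obtain ⟨g, -, hg, t₁, t₂, t₃, -⟩ := hN.exists_smul_mem₄ h h' hb' hu' hup.le hp hpv.le hv' le_rfl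
    hv''
  have h2 : ∀ x : X, x ∈ sp X (g⁻¹ * n * g) ↔ g • x ∈ sp X n := fun x => by
    simpa using mem_sp_conj (g := n) (h := g⁻¹) (x := x)
  refine ⟨g⁻¹ * n * g, ⟨hN.inv_conj_mem hg hn, (hg.inv.mul hi).mul hg, ?_⟩, ?_⟩
  · intro x hx
    have := hs ((h2 x).1 hx)
    exact ⟨hg.lt_iff.1 (t₁.2.trans this.1), hg.lt_iff.1 (this.2.trans t₃.1)⟩
  · refine (h2 s).2 ?_
    exact (t₂.2.trans (hi t₂.1)).ne'

/-- The elements of `N` with support in an interval have dense orbits in it. -/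
theorem exists_smul_mem_Ioo {a b x c d : X} (hx : x ∈ Ioo a b) (hc : a ≤ c) (hcd : c < d)
    (hd : d ≤ b) : ∃ n ∈ supportedIn N (Ioo a b), n • x ∈ Ioo c d := by
  -- With `d = b` allowed, the smaller bound `d₁` keeps the supremum argument inside the open
  -- interval, where every point is moved.
  obtain ⟨d₁, hd1, hd2⟩ := exists_between hcd
  obtain ⟨n, hn, h⟩ : ∃ n ∈ supportedIn N (Ioo a b), n • x ∈ Ioo c d₁ := by
    refine MonRec.exists_smul_mem_Ioo _ (fun n (hn : n ∈ supportedIn N _) => hn.2.1)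
      (fun s hs hs' => hN.exists_smul_ne_Ioo (hx.1.trans_le hs)
        (hs'.trans_lt (hd2.trans_le hd))) ?_
    intro n₀ hn₀ hd0
    have hb0 : n₀ • x < b := by
      by_contra hcon
      have h1 : n₀ • x ∉ sp X n₀ := fun h => hcon (hn₀.2.2 h).2
      rw [smul_mem_sp, notMem_sp] at h1
      rw [h1] at hcon
      exact hcon hx.2
    obtain ⟨n, hn, u, v, p, hi, hs, hp⟩ := hN.exists_bump
    obtain ⟨m, hm1, hm2⟩ := exists_between hd1
    obtain ⟨d', hd', hd''⟩ := exists_between hb0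
    have hup : u < p := (hs hp.ne').1
    have hpv : n • p < v := (hs (smul_mem_sp.2 hp.ne')).2
    -- The endpoints `u`, `v` of the bump go into `(a, b)`, which confines the conjugate. The fixed
    -- point `u` and the moved point `p` land in `(c, d₁)`, and `n • p` lands beyond `n₀ • x`.
    obtain ⟨g, -, hg, t₁, t₂, t₃, t₄⟩ := hN.exists_smul_mem₄ hup hp hpv hm1 le_rfl hm2 hd0 hd' le_rfl
      hd''
    refine ⟨g * n * g⁻¹, ⟨hN.conj_mem g hg n hn, (hg.mul hi).mul hg.inv, ?_⟩, g • u,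
      ⟨t₁.1, t₁.2.trans hm2⟩, g • p, ⟨hm1.trans t₂.1, t₂.2⟩, ?_, ?_⟩
    · intro y hy
      have := hs (mem_sp_conj.1 hy)
      exact ⟨(hc.trans_lt t₁.1).trans (hg.lt_inv_smul.1 this.1),
        (hg.inv_smul_lt.1 this.2).trans t₄.2⟩
    · have : u ∉ sp X n := fun h => lt_irrefl _ (hs h).1
      rw [mul_smul, inv_smul_smul, mul_smul, notMem_sp.1 this]
    · rw [mul_smul, inv_smul_smul, mul_smul]
      exact t₃.1
  exact ⟨n, hn, h.1, h.2.trans hd2⟩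

theorem exists_ne_one {a b : X} (h : a < b) : ∃ n ∈ supportedIn N (Ioo a b), n ≠ 1 := by
  obtain ⟨s, h1, h2⟩ := exists_between h
  obtain ⟨n, hn, hs⟩ := hN.exists_smul_ne_Ioo h1 h2
  exact ⟨n, hn, fun h => hs (by rw [h, one_smul])⟩

/-- It is enough that `f₂` carries a point moved by `f₁` to a place that `f₁` fixes. -/
theorem exists_not_commute {a b : X} (h : a < b) :
    ∃ f₁ ∈ supportedIn N (Ioo a b), ∃ f₂ ∈ supportedIn N (Ioo a b), f₁ * f₂ ≠ f₂ * f₁ := by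
  obtain ⟨u, hu1, hu2⟩ := exists_between h
  obtain ⟨f₁, hf₁, h1⟩ := hN.exists_ne_one hu2
  obtain ⟨x, hx⟩ := sp_nonempty (X := X) h1
  have hxu := hf₁.2.2 hx
  obtain ⟨f₂, hf₂, h2⟩ := hN.exists_smul_mem_Ioo (x := x) ⟨hu1.trans hxu.1, hxu.2⟩ le_rfl hu1 hu2.le
  refine ⟨f₁, ⟨hf₁.1, hf₁.2.1, hf₁.2.2.trans (Ioo_subset_Ioo_left hu1.le)⟩, f₂, hf₂, fun he => ?_⟩
  have h3 : f₁ • f₂ • x = f₂ • f₁ • x := by rw [← mul_smul, he, mul_smul]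
  rw [notMem_sp.1 fun h => absurd (hf₁.2.2 h).1 (not_lt.2 h2.2.le), smul_left_cancel_iff] at h3
  exact hx h3.symm

end BddNormal

/-! ### Algebraic disjointness -/

variable [TopologicalSpace X] [OrderTopology X]

theorem Monotonic.continuous {Y Z : Type*} [LinearOrder Y] [LinearOrder Z] [TopologicalSpace Y]
    [TopologicalSpace Z] [OrderTopology Y] [OrderTopology Z] [DenselyOrdered Z] {f : Y → Z}
    (h : Monotonic f) (hf : Function.Surjective f) : Continuous f := by
  rcases h with h | h
  · exact h.monotone.continuous_of_surjective hf
  · have h1 : Monotone (fun x => OrderDual.toDual (f x)) := h.antitone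
    exact (h1.continuous_of_surjective (fun y => hf y) :)

theorem continuous_smul_of_locMove (g : A) : Continuous (fun x : X => g • x) :=
  (LocMove.monotonic g).continuous (MulAction.surjective g)

theorem isOpen_sp (g : A) : IsOpen (sp X g) :=
  (isClosed_eq (continuous_smul_of_locMove g) continuous_id).isOpen_compl

theorem exists_Ioo_of_mem_open {U : Set X} (hU : IsOpen U) {x : X} (hx : x ∈ U) :
    ∃ a b, x ∈ Ioo a b ∧ Ioo a b ⊆ U :=
  mem_nhds_iff_exists_Ioo_subset.1 (hU.mem_nhds hx)

/-- A moved point lies in an interval that is moved off itself. -/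
theorem exists_Ioo_disjoint {f : X → X} (hf : Continuous f) {x : X} (h : f x ≠ x) {U : Set X}
    (hU : IsOpen U) (hxU : x ∈ U) :
    ∃ a b, x ∈ Ioo a b ∧ Ioo a b ⊆ U ∧ ∀ y ∈ Ioo a b, f y ∉ Ioo a b := by
  obtain ⟨V, W, hV, hW, hxV, hxW, hd⟩ := t2_separation h
  obtain ⟨a, b, hab, hs⟩ := exists_Ioo_of_mem_open ((hU.inter hW).inter (hV.preimage hf))
    ⟨⟨hxU, hxW⟩, hxV⟩
  exact ⟨a, b, hab, fun y hy => (hs hy).1.1,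
    fun y hy hy' => disjoint_left.1 hd (hs hy).2 (hs hy').1.2⟩

end Core

/-- Algebraic disjointness: for all `h` that do not commute with `f` there are `f₁` and `f₂` in the
centralizer of `g` such that `[f₁, [f₂, h]]` is a nonidentity element of that centralizer. -/
def AD {A : Type*} [Mul A] (f g : A) : Prop :=
  ∀ h : A, f * h ≠ h * f → ∃ f₁ f₂ c c' : A, f₁ * g = g * f₁ ∧ f₂ * g = g * f₂ ∧
    f₂ * h = c * (h * f₂) ∧ f₁ * c = c' * (c * f₁) ∧ c' * c ≠ c ∧ c' * g = g * c'

section AD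

variable {A X : Type*} [Group A] [LinearOrder X] [MulAction A X] [LocMove A X] [NoMinOrder X]
  [NoMaxOrder X] [DenselyOrdered X] [TopologicalSpace X] [OrderTopology X]

theorem mul_comm_of_disjoint_sp {g h : A} (hd : Disjoint (sp X g) (sp X h)) : g * h = h * g :=
  mul_comm_of_disjoint (LocMove.faithful (X := X)) hd

/-- As `h` moves the interval off itself, `h * f₂⁻¹ * h⁻¹` is supported outside it and commutes with
`f₁`. The double commutator thus collapses to that of `f₁` and `f₂`, whose support lies in the
support of `f` and so misses that of `g`. -/
theorem ad_of_disjoint {f g : A} (hd : Disjoint (sp X f) (sp X g)) : AD f g := by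
  intro h hfh
  obtain ⟨x, hx, hhx⟩ : ∃ x ∈ sp X f, h • x ≠ x := by
    by_contra! hn
    exact hfh (mul_comm_of_disjoint_sp (X := X) (disjoint_left.2 fun x hx hx' => hx' (hn x hx)))
  obtain ⟨a, b, hab, hs, hoff⟩ := exists_Ioo_disjoint (continuous_smul_of_locMove h) hhx
    (isOpen_sp f) hx
  obtain ⟨f₁, hf₁, f₂, hf₂, hne⟩ :=
    (bddNormal_top (A := A) (X := X)).exists_not_commute (hab.1.trans hab.2)
  have hg : ∀ n ∈ supportedIn (⊤ : Subgroup A) (Ioo a b), Commute n g := fun n hn =>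
    mul_comm_of_disjoint_sp (X := X) (hd.mono_left (hn.2.2.trans hs))
  have hk : ∀ n ∈ supportedIn (⊤ : Subgroup A) (Ioo a b), Commute n (h * f₂⁻¹ * h⁻¹) := by
    intro n hn
    refine mul_comm_of_disjoint_sp (X := X) (disjoint_left.2 fun x hx hx' => ?_)
    rw [mem_sp_conj, sp_inv] at hx'
    refine hoff _ (hf₂.2.2 hx') ?_
    rw [smul_inv_smul]
    exact hn.2.2 hx
  have h1 : f₁ * (f₂ * (h * f₂⁻¹ * h⁻¹)) =
      (f₁ * f₂ * f₁⁻¹ * f₂⁻¹) * (f₂ * (h * f₂⁻¹ * h⁻¹) * f₁) := by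
    have := (hk f₁ hf₁).eq
    generalize h * f₂⁻¹ * h⁻¹ = k at this ⊢
    calc f₁ * (f₂ * k) = f₁ * f₂ * f₁⁻¹ * (f₁ * k) := by group
      _ = f₁ * f₂ * f₁⁻¹ * (k * f₁) := by rw [this]
      _ = _ := by group
  refine ⟨f₁, f₂, f₂ * (h * f₂⁻¹ * h⁻¹), f₁ * f₂ * f₁⁻¹ * f₂⁻¹, (hg f₁ hf₁).eq, (hg f₂ hf₂).eq,
    by group, h1, fun hc => hne ?_, ?_⟩
  · have h2 := mul_eq_right.1 hc
    calc f₁ * f₂ = (f₁ * f₂ * f₁⁻¹ * f₂⁻¹) * (f₂ * f₁) := by group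
      _ = f₂ * f₁ := by rw [h2, one_mul]
  · exact ((((hg f₁ hf₁).mul_left (hg f₂ hf₂)).mul_left (hg f₁ hf₁).inv_left).mul_left
      (hg f₂ hf₂).inv_left).eq

theorem Inc.pow_smul_lt {g : A} (hg : Inc X g) {x : X} (h : x < g • x) :
    StrictMono (fun n : ℕ => g ^ n • x) := by
  refine strictMono_nat_of_lt_succ fun n => ?_
  induction n with
  | zero => simpa using h
  | succ n ih =>
    have := hg ih
    simpa only [smul_smul, ← pow_succ'] using this

/-- The test element `h` is supported in an interval `U` that `f` moves off itself and that lies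
below some `e` while `g` maps it above `e`. The support of a double commutator as in `AD` is too
small to be closed under `g`. -/
theorem not_ad_of_lt_smul {f g : A} (hg : Inc X g) {x : X} (hf : f • x ≠ x) (hx : x < g • x) :
    ¬ AD f g := by
  intro had
  obtain ⟨a, b, hab, -, hoff⟩ := exists_Ioo_disjoint (continuous_smul_of_locMove f) hf isOpen_univ
    trivial
  obtain ⟨e, he, he'⟩ := exists_between hx
  set U : Set X := Ioo (max a (g⁻¹ • e)) (min b e) with hU
  have hxU : x ∈ U := ⟨max_lt hab.1 (hg.inv_smul_lt.2 he'), lt_min hab.2 he⟩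
  have hUab : U ⊆ Ioo a b := Ioo_subset_Ioo (le_max_left _ _) (min_le_left _ _)
  have hgU : ∀ z ∈ U, z < e ∧ e < g • z := fun z hz =>
    ⟨hz.2.trans_le (min_le_right _ _), hg.inv_smul_lt.1 ((le_max_right _ _).trans_lt hz.1)⟩
  obtain ⟨h, hh, hhx⟩ := (bddNormal_top (A := A) (X := X)).exists_smul_ne_Ioo hxU.1 hxU.2
  -- If `h` commuted with `f`, then `f • x` would be in the support of `h`, hence in the interval
  -- that `f` moves off itself.
  obtain ⟨f₁, f₂, c, c', h1, h2, h3, h4, h5, h6⟩ := had h fun he =>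
    hoff x hab (hUab (hh.2.2 ((smul_mem_sp_of_commute (X := X) (g := h) (h := f) he.symm).2 hhx)))
  obtain ⟨y, hy⟩ := sp_nonempty (X := X) (g := c') fun h => h5 (by rw [h, one_mul])
  have ec : c = f₂ * h * f₂⁻¹ * h⁻¹ := by
    rw [eq_mul_inv_iff_mul_eq, eq_mul_inv_iff_mul_eq, mul_assoc, h3]
  have ec' : c' = f₁ * c * f₁⁻¹ * c⁻¹ := by
    rw [eq_mul_inv_iff_mul_eq, eq_mul_inv_iff_mul_eq, mul_assoc, h4]
  have hsc : ∀ z ∈ sp X c, ∃ i : Bool, (cond i 1 f₂⁻¹) • z ∈ U := by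
    intro z hz
    rw [ec] at hz
    rcases sp_mul_subset _ _ hz with hz | hz
    · exact ⟨false, hh.2.2 (mem_sp_conj.1 hz)⟩
    · rw [sp_inv] at hz
      exact ⟨true, by rw [cond_true, one_smul]; exact hh.2.2 hz⟩
  -- A point of the support of `c'` or its translate by `f₁⁻¹` is in the support of `c`, and such a
  -- point or its translate by `f₂⁻¹` is in `U`. This leaves four translating elements, all of them
  -- centralizing `g`.
  let W : Bool × Bool → A := fun i => (cond i.1 1 f₂⁻¹) * (cond i.2 1 f₁⁻¹)
  have hW : ∀ i, Commute (W i) g := by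
    rintro ⟨_ | _, _ | _⟩ <;> simp only [W, cond_true, cond_false, one_mul, mul_one]
    · exact (Commute.inv_left h2).mul_left (Commute.inv_left h1)
    · exact Commute.inv_left h2
    · exact Commute.inv_left h1
    · exact Commute.one_left g
  have cover : ∀ z ∈ sp X c', ∃ i, W i • z ∈ U := by
    intro z hz
    rw [ec'] at hz
    rcases sp_mul_subset _ _ hz with hz | hz
    · obtain ⟨i, hi⟩ := hsc _ (mem_sp_conj.1 hz)
      exact ⟨(i, false), by simpa [W, mul_smul] using hi⟩
    · rw [sp_inv] at hz
      obtain ⟨i, hi⟩ := hsc _ hz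
      exact ⟨(i, true), by simpa [W] using hi⟩
  choose t ht using fun i : ℕ => cover (g ^ i • y)
    ((smul_mem_sp_of_commute (Commute.pow_right (show Commute c' g from h6) i)).2 hy)
  -- If the same translate served `i < j`, then `U` would contain a point `z` together with `g ^ (j
  -- - i) • z`, which lies above `e`. Infinitely many exponents and four indices give the
  -- contradiction.
  have key : ∀ i j, i < j → t i ≠ t j := by
    intro i j hij he
    have h7 := ht j
    obtain ⟨k, rfl⟩ := Nat.exists_eq_add_of_lt hij
    have h10 : W (t i) • g ^ (i + k + 1) • y = g ^ (k + 1) • W (t i) • g ^ i • y := by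
      rw [smul_smul (g ^ (k + 1)), ← ((hW (t i)).pow_right (k + 1)).eq, mul_smul (W (t i)) (g ^ _),
        smul_smul (g ^ (k + 1)) (g ^ i), ← pow_add, show i + k + 1 = k + 1 + i by ring]
    rw [← he, h10] at h7
    have h8 := hgU _ (ht i)
    have h9 := (hg.pow_smul_lt (h8.1.trans h8.2)).monotone (Nat.succ_le_succ (Nat.zero_le k))
    simp only [Nat.succ_eq_add_one, zero_add, pow_one] at h9
    exact absurd ((h8.2.trans_le h9).trans (hgU _ h7).1) (lt_irrefl _)
  obtain ⟨i, j, hij, he⟩ := Finite.exists_ne_map_eq_of_infinite t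
  rcases lt_or_gt_of_ne hij with h | h
  · exact key i j h he
  · exact key j i h he.symm

/-- Only `g` is required to preserve order. If it moves the common point downwards, the reversed
chain is used. -/
theorem ad_iff_disjoint {f g : A} (hg : Inc X g) : AD f g ↔ Disjoint (sp X f) (sp X g) := by
  refine ⟨fun had => disjoint_left.2 fun x hf hx => ?_, ad_of_disjoint⟩
  rcases lt_or_gt_of_ne hx with h | h
  · have hg' : Inc Xᵒᵈ g := fun a b hab => hg hab
    exact not_ad_of_lt_smul (X := Xᵒᵈ) hg' (x := OrderDual.toDual x) hf h had
  · exact not_ad_of_lt_smul hg hf h had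

end AD

end MonRec

namespace MonRec

open Set

/-! ### Rays in group-theoretic terms -/

section Defs

variable {A : Type*} [Mul A]

/-- The supports of `f ^ 2` and `g ^ 2` are disjoint. -/
def SqDisj (f g : A) : Prop := AD (f * f) (g * g)

/-- The square of `f` is not the identity. -/
def SqNe (f : A) : Prop := f * f * f ≠ f

/-- The support of `g ^ 2` meets the union of those components of the complement of the closure
of the support of `p.1 ^ 2` that meet the support of `p.2 ^ 2`. -/
def Meets (g : A) (p : A × A) : Prop :=
  ∃ k h : A, AD k (p.1 * p.1) ∧ h * k = k * p.2 ∧ ¬ SqDisj g h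

/-- The support of `p.2 ^ 2` lies in an unbounded component of the complement of the closure of
the support of `p.1 ^ 2`. -/
def Ray (p : A × A) : Prop :=
  SqNe p.1 ∧ SqNe p.2 ∧ SqDisj p.2 p.1 ∧
  (∀ h : A, SqNe h → SqDisj h p.1 → Meets h p → ∀ g : A, Meets g p → Meets g (p.1, h)) ∧
  ∃ e : A, SqNe e ∧ ∀ m : A, ∃ g g' : A, g' * m = m * g ∧ Meets g p ∧ SqDisj g' e

/-- Two rays have the same direction. -/
def SameDir (p q : A × A) : Prop :=
  (∀ g : A, Meets g p → Meets g q) ∨ ∀ g : A, Meets g q → Meets g p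

/-- The support of `g ^ 2` misses the part of the chain on the side, in the direction of the ray
`d`, of the endpoint of the ray `p`. -/
def Avoids (d : A × A) (g : A) (p : A × A) : Prop :=
  (SameDir d p ∧ ¬ Meets g p) ∨ (¬ SameDir d p ∧ ∀ e : A, ¬ Meets e p → SqDisj e g)

/-- The endpoint of `p` is less than or equal to that of `q` if `d` is a left ray. -/
def RayLE (d p q : A × A) : Prop := ∀ g : A, Avoids d g q → Avoids d g p

end Defs

section Sem

variable {A : Type*} (X : Type*) [Group A] [LinearOrder X] [MulAction A X]

/-- The set of points moved by `f ^ 2`. -/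
def sqSp (f : A) : Set X := sp X (f * f)

/-- The union of those components of the complement of the closure of the support of `p.1 ^ 2`
that meet the support of `p.2 ^ 2`. -/
def comps (p : A × A) : Set X :=
  {z | ∃ y ∈ sqSp X p.2, ∃ a b, y ∈ Ioo a b ∧ z ∈ Ioo a b ∧ Disjoint (Ioo a b) (sqSp X p.1)}

/-- The pair `p` determines the left ray with endpoint `x`. -/
def IsLRay (p : A × A) (x : X) : Prop :=
  IsGLB (sqSp X p.1) x ∧ (sqSp X p.2).Nonempty ∧ sqSp X p.2 ⊆ Iio x

/-- The pair `p` determines a ray with endpoint `x`. -/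
def IsRayAt (p : A × A) (x : X) : Prop :=
  IsLRay X p x ∨ IsLRay Xᵒᵈ p (OrderDual.toDual x)

theorem isRayAt_dual {p : A × A} {x : X} : IsRayAt Xᵒᵈ p (OrderDual.toDual x) ↔ IsRayAt X p x :=
  or_comm

end Sem

/-! ### The geometric meaning of rays, their directions and their endpoints. -/

section

variable {A X : Type*} [Group A] [LinearOrder X] [MulAction A X] [LocMove A X]

theorem inc_sqSp_eq {f : A} (hf : Inc X f) : sqSp X f = sp X f := sp_sq hf

theorem mem_sqSp_conj {g h : A} {x : X} : h • x ∈ sqSp X (h * g * h⁻¹) ↔ x ∈ sqSp X g := by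
  have : h * g * h⁻¹ * (h * g * h⁻¹) = h * (g * g) * h⁻¹ := by group
  rw [sqSp, this, mem_sp_conj, inv_smul_smul]
  rfl

variable [NoMinOrder X] [NoMaxOrder X] [DenselyOrdered X] [TopologicalSpace X] [OrderTopology X]

theorem isOpen_sqSp (f : A) : IsOpen (sqSp X f) := isOpen_sp _

/-- The order hypothesis of `ad_iff_disjoint` is automatic for squares, so no assumption on `f` and
`g` is left. -/
theorem sqDisj_iff {f g : A} : SqDisj f g ↔ Disjoint (sqSp X f) (sqSp X g) :=
  ad_iff_disjoint (inc_sq g)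

theorem sqNe_iff {f : A} : SqNe f ↔ (sqSp X f).Nonempty := by
  rw [SqNe, ne_eq, mul_eq_right]
  constructor
  · exact fun h => sp_nonempty h
  · rintro ⟨x, hx⟩ h
    exact hx (by rw [h, one_smul])

theorem exists_small {V : Set X} (hV : IsOpen V) (hne : V.Nonempty) :
    ∃ g : A, (sqSp X g).Nonempty ∧ sqSp X g ⊆ V := by
  obtain ⟨x, hx⟩ := hne
  obtain ⟨a, b, hab, hs⟩ := exists_Ioo_of_mem_open hV hx
  obtain ⟨g, hg, h1⟩ := (bddNormal_top (A := A) (X := X)).exists_ne_one (hab.1.trans hab.2)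
  refine ⟨g, ?_, ?_⟩
  · rw [inc_sqSp_eq hg.2.1]; exact sp_nonempty h1
  · rw [inc_sqSp_eq hg.2.1]; exact hg.2.2.trans hs

theorem sqSp_subset_comps {p : A × A} (h : Disjoint (sqSp X p.2) (sqSp X p.1)) :
    sqSp X p.2 ⊆ comps X p := by
  intro y hy
  obtain ⟨a, b, hab, hs⟩ := exists_Ioo_of_mem_open (isOpen_sqSp _) hy
  exact ⟨y, hy, a, b, hab, hab, h.mono_left hs⟩

/-- The admitted conjugators fix the support of `p.1 * p.1` pointwise, so they cannot carry anything
across it. Conversely, inside an interval that avoids this support the orbits of elements supported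
there are dense, so every part of the component is reached. -/
theorem meets_iff {p : A × A} (h1 : (sqSp X p.1).Nonempty) (h2 : Disjoint (sqSp X p.2) (sqSp X p.1))
    {g : A} : Meets g p ↔ (sqSp X g ∩ comps X p).Nonempty := by
  constructor
  · rintro ⟨k, h, hk, hc, hd⟩
    rw [ad_iff_disjoint (X := X) (inc_sq _)] at hk
    have hh : h = k * p.2 * k⁻¹ := eq_mul_inv_of_mul_eq hc
    rw [sqDisj_iff (X := X), not_disjoint_iff] at hd
    obtain ⟨z, hzg, hz⟩ := hd
    refine ⟨z, hzg, ?_⟩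
    obtain ⟨y, rfl⟩ := MulAction.surjective k z
    rw [hh, mem_sqSp_conj] at hz
    -- Fixing two different points of an open set pointwise fixed by `k` excludes reversal of order.
    have hki : Inc X k := by
      obtain ⟨w, hw⟩ := h1
      obtain ⟨a, b, hab, hs⟩ := exists_Ioo_of_mem_open (isOpen_sqSp _) hw
      have fx : ∀ x ∈ Ioo a b, k • x = x := fun x hx => notMem_sp.1 (disjoint_right.1 hk (hs hx))
      obtain ⟨c, hc1, hc2⟩ := exists_between hab.1
      exact inc_of_fixed hc2 (fx c ⟨hc1, hc2.trans hab.2⟩) (fx w hab)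
    have fix : ∀ w ∈ sqSp X p.1, k • w = w := fun w hw => notMem_sp.1 (disjoint_right.1 hk hw)
    obtain ⟨a, b, hab, hs⟩ := exists_Ioo_of_mem_open (isOpen_sqSp _) hz
    have hdab := h2.mono_left hs
    -- The hull of a small interval around `y` and of its image still avoids the support of `p.1 *
    -- p.1`: a point fixed by `k` is on the same side of `a` as of `k • a`, and likewise for `b`.
    refine ⟨y, hz, min a (k • a), max b (k • b), ⟨min_lt_of_left_lt hab.1, lt_max_of_lt_left hab.2⟩,
      ⟨min_lt_of_right_lt (hki.smul_lt hab.1), lt_max_of_lt_right (hki.smul_lt hab.2)⟩, ?_⟩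
    rw [disjoint_left]
    intro w hw hwf
    have hn : ¬ (a < w ∧ w < b) := fun h => disjoint_left.1 hdab h hwf
    have hn' : ¬ (k • a < w ∧ w < k • b) := by
      rw [← fix w hwf, hki.lt_iff, hki.lt_iff]
      exact hn
    have e1 : a < w ↔ k • a < w := by
      conv_rhs => rw [← fix w hwf, hki.lt_iff]
    have e2 : w < b ↔ w < k • b := by
      conv_rhs => rw [← fix w hwf, hki.lt_iff]
    rcases min_lt_iff.1 hw.1 with h3 | h3 <;> rcases lt_max_iff.1 hw.2 with h4 | h4
    · exact hn ⟨h3, h4⟩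
    · exact hn' ⟨e1.1 h3, h4⟩
    · exact hn' ⟨h3, e2.1 h4⟩
    · exact hn' ⟨h3, h4⟩
  · rintro ⟨z, hzg, y, hy, a, b, hya, hza, hd⟩
    obtain ⟨c, d, hcd, hs⟩ := exists_Ioo_of_mem_open ((isOpen_sqSp g).inter isOpen_Ioo)
      ⟨hzg, hza⟩
    have h5 : c < min d b := lt_min (hcd.1.trans hcd.2) (hcd.1.trans hza.2)
    obtain ⟨k, hk, hky⟩ := (bddNormal_top (A := A) (X := X)).exists_smul_mem_Ioo hya
      (le_max_left a c) (d := min d b) (max_lt (lt_min (hza.1.trans hcd.2) (hza.1.trans hza.2)) h5)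
      (min_le_right _ _)
    refine ⟨k, k * p.2 * k⁻¹, ?_, by group, ?_⟩
    · rw [ad_iff_disjoint (X := X) (inc_sq _)]
      exact hd.mono_left hk.2.2
    · rw [sqDisj_iff (X := X), not_disjoint_iff]
      refine ⟨k • y, (hs ⟨(le_max_right _ _).trans_lt hky.1, hky.2.trans_le (min_le_left _ _)⟩).1, ?_⟩
      rwa [mem_sqSp_conj]

/-- This separates bounded components from unbounded ones: a bounded one fits into any given
interval after a group element is applied. -/
theorem exists_squeeze {w₁ w₂ a b : X} (hw : w₁ < w₂) (h : a < b) :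
    ∃ m : A, Inc X m ∧ m • w₁ ∈ Ioo a b ∧ m • w₂ ∈ Ioo a b := by
  obtain ⟨c, h1, h2⟩ := exists_between h
  obtain ⟨w₃, h3⟩ := exists_gt w₂
  obtain ⟨w₄, h4⟩ := exists_gt w₃
  obtain ⟨b₁, k1⟩ := exists_gt b
  obtain ⟨b₂, k2⟩ := exists_gt b₁
  obtain ⟨m, -, hm, t1, t2, -⟩ := (bddNormal_top (A := A) (X := X)).exists_smul_mem₄ hw h3 h4 h1
    le_rfl h2 le_rfl k1 le_rfl k2
  exact ⟨m, hm, ⟨t1.1, t1.2.trans h2⟩, ⟨h1.trans t2.1, t2.2⟩⟩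

theorem comps_subset_of_between {f h : A} {w₁ w₂ : X} (h1 : w₁ ∈ sqSp X f) (h2 : w₂ ∈ sqSp X f)
    (hs : sqSp X h ⊆ Ioo w₁ w₂) : comps X (f, h) ⊆ Ioo w₁ w₂ := by
  rintro z ⟨y, hy, a, b, hya, hza, hd⟩
  have := hs hy
  constructor
  · by_contra! hz
    exact disjoint_left.1 hd ⟨hza.1.trans_le hz, this.1.trans hya.2⟩ h1
  · by_contra! hz
    exact disjoint_left.1 hd ⟨hya.1.trans this.2, hz.trans_lt hza.2⟩ h2

theorem comps_subset_Iio {f h : A} {w : X} (h2 : w ∈ sqSp X f) (hs : sqSp X h ⊆ Iio w) :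
    comps X (f, h) ⊆ Iio w := by
  rintro z ⟨y, hy, a, b, hya, hza, hd⟩
  by_contra! hz
  exact disjoint_left.1 hd ⟨hya.1.trans (hs hy), (not_lt.1 hz).trans_lt hza.2⟩ h2

/-- If the support of `p.1 * p.1` had points on both sides of `y`, a bounded component could be
squeezed into the support of `e * e`, against the last clause of `Ray`. So this support lies above
`y` and its infimum is the endpoint. The clause on a single component then keeps the whole support
of `p.2 * p.2` below the endpoint. -/
theorem Ray.exists_isLRay {p : A × A} (hp : Ray p) {y w : X} (hy : y ∈ sqSp X p.2)
    (hw : w ∈ sqSp X p.1) (hyw : y < w) : ∃ x : X, IsLRay X p x := by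
  obtain ⟨h1, h2, h3, h4, e, he, h5⟩ := hp
  rw [sqNe_iff (X := X)] at h1 h2 he
  rw [sqDisj_iff (X := X)] at h3
  have single : ∀ h : A, (sqSp X h).Nonempty → sqSp X h ⊆ sqSp X p.2 → ∀ g : A, Meets g p →
      (sqSp X g ∩ comps X (p.1, h)).Nonempty := by
    intro h hne hs g hg
    have hd : Disjoint (sqSp X h) (sqSp X p.1) := h3.mono_left hs
    rw [← meets_iff (X := X) (p := (p.1, h)) h1 hd]
    refine h4 h ((sqNe_iff (X := X)).2 hne) ((sqDisj_iff (X := X)).2 hd) ?_ g hg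
    rw [meets_iff (X := X) h1 h3]
    obtain ⟨x, hx⟩ := hne
    exact ⟨x, hx, sqSp_subset_comps h3 (hs hx)⟩
  have c1 : ∀ w' ∈ sqSp X p.1, y < w' := by
    intro w' hw'
    by_contra! hwy
    have hwy' : w' < y := lt_of_le_of_ne hwy fun h => disjoint_left.1 h3 hy (h ▸ hw')
    obtain ⟨h, hne, hs⟩ := exists_small (A := A) ((isOpen_sqSp p.2).inter isOpen_Ioo)
      ⟨y, hy, hwy', hyw⟩
    obtain ⟨c, hc⟩ := he
    obtain ⟨a, b, hab, hse⟩ := exists_Ioo_of_mem_open (isOpen_sqSp _) hc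
    obtain ⟨m, hm, m1, m2⟩ := exists_squeeze (A := A) (hwy'.trans hyw) (hab.1.trans hab.2)
    obtain ⟨g, g', hgm, hg, hd⟩ := h5 m
    obtain ⟨z, hz, hz'⟩ := single h hne (hs.trans inter_subset_left) g hg
    have hzw := comps_subset_of_between hw' hw (hs.trans inter_subset_right) hz'
    rw [sqDisj_iff (X := X), eq_mul_inv_of_mul_eq hgm] at hd
    refine disjoint_left.1 hd (mem_sqSp_conj.2 hz) (hse ?_)
    exact ⟨m1.1.trans (hm.smul_lt hzw.1), (hm.smul_lt hzw.2).trans m2.2⟩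
  obtain ⟨x, hx⟩ := exists_isGLB A (sqSp X p.1) h1 ⟨y, fun w hw => (c1 w hw).le⟩
  -- An open set disjoint from another set cannot contain the infimum of that set.
  have open_ne : ∀ y' ∈ sqSp X p.2, y' ≠ x := by
    rintro y' hy' rfl
    obtain ⟨a, b, hab, hs⟩ := exists_Ioo_of_mem_open (isOpen_sqSp _) hy'
    obtain ⟨w'', hw'', hle, hlt⟩ := hx.exists_between hab.2
    exact disjoint_left.1 h3 (hs ⟨hab.1.trans_le hle, hlt⟩) hw''
  have hyx : y < x := lt_of_le_of_ne (hx.2 fun w hw => (c1 w hw).le) (open_ne y hy)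
  refine ⟨x, hx, h2, ?_⟩
  intro y' hy'
  by_contra! hxy
  have hxy' : x < y' := lt_of_le_of_ne (not_lt.1 hxy) (open_ne y' hy').symm
  obtain ⟨w'', hw'', hle, hlt⟩ := hx.exists_between hxy'
  -- Small elements inside the support of `p.2 * p.2`, one on each side of `w''`, would have to
  -- belong to the same component, although `w''` separates them.
  obtain ⟨h, hne, hs⟩ := exists_small (A := A) ((isOpen_sqSp p.2).inter isOpen_Iio) ⟨y, hy, hyx⟩
  obtain ⟨g, hgne, hgs⟩ := exists_small (A := A) ((isOpen_sqSp p.2).inter isOpen_Ioi)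
    ⟨y', hy', hlt⟩
  obtain ⟨z, hz, hz'⟩ := single h hne (hs.trans inter_subset_left) g (by
    rw [meets_iff (X := X) h1 h3]
    obtain ⟨z, hz⟩ := hgne
    exact ⟨z, hz, sqSp_subset_comps h3 (hgs hz).1⟩)
  have := comps_subset_Iio hw'' (fun u hu => (hs hu).2.trans_le hle) hz'
  exact lt_asymm this (hgs hz).2

namespace IsLRay

variable {p : A × A} {x : X} (hp : IsLRay X p x)

include hp

theorem nonempty : (sqSp X p.1).Nonempty := by
  by_contra h
  rw [not_nonempty_iff_eq_empty] at h
  have := hp.1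
  rw [h, isGLB_empty_iff] at this
  exact not_isTop x this

theorem disjoint : Disjoint (sqSp X p.2) (sqSp X p.1) :=
  disjoint_left.2 fun _ h h' => absurd (hp.1.1 h') (not_le.2 (hp.2.2 h))

theorem comps_eq_of {h : A} (hh : (sqSp X h ∩ Iio x).Nonempty) :
    Iio x ⊆ comps X (p.1, h) := by
  obtain ⟨y, hy, hyx⟩ := hh
  intro z hz
  obtain ⟨a, ha⟩ := exists_lt (min y z)
  exact ⟨y, hy, a, x, ⟨ha.trans_le (min_le_left _ _), hyx⟩, ⟨ha.trans_le (min_le_right _ _), hz⟩,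
    disjoint_left.2 fun w hw hw' => absurd (hp.1.1 hw') (not_le.2 hw.2)⟩

theorem comps_eq : comps X p = Iio x := by
  refine subset_antisymm ?_ (hp.comps_eq_of (h := p.2) ?_)
  · rintro z ⟨y, hy, a, b, hya, hza, hd⟩
    by_contra! hz
    obtain ⟨w, hw, hle, hlt⟩ := hp.1.exists_between ((not_lt.1 hz).trans_lt hza.2)
    exact disjoint_left.1 hd ⟨hya.1.trans ((hp.2.2 hy).trans_le hle), hlt⟩ hw
  · obtain ⟨y, hy⟩ := hp.2.1
    exact ⟨y, hy, hp.2.2 hy⟩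

theorem meets_iff {g : A} : Meets g p ↔ (sqSp X g ∩ Iio x).Nonempty := by
  rw [MonRec.meets_iff (X := X) hp.nonempty hp.disjoint, hp.comps_eq]

theorem ray : Ray p := by
  refine ⟨(sqNe_iff (X := X)).2 hp.nonempty, (sqNe_iff (X := X)).2 hp.2.1,
    (sqDisj_iff (X := X)).2 hp.disjoint, ?_, ?_⟩
  · intro h _ hd hm g hg
    rw [hp.meets_iff] at hm hg
    rw [sqDisj_iff (X := X)] at hd
    rw [MonRec.meets_iff (X := X) (p := (p.1, h)) hp.nonempty hd]
    exact hg.mono (inter_subset_inter_right _ (hp.comps_eq_of hm))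
  · obtain ⟨n, hn, u, v, q, hi, hs, hq⟩ := (bddNormal_top (A := A) (X := X)).exists_bump
    refine ⟨n, (sqNe_iff (X := X)).2 ⟨q, ?_⟩, fun m => ?_⟩
    · rw [inc_sqSp_eq hi]
      exact hq.ne'
    · obtain ⟨y, hyx, hy⟩ : ∃ y, y < x ∧ m • y ∉ Icc u v := by
        rcases LocMove.monotonic (X := X) m with hm | hm
        · obtain ⟨y, hy⟩ := exists_lt (min x (m⁻¹ • u))
          refine ⟨y, hy.trans_le (min_le_left _ _), fun h => absurd h.1 (not_le.2 ?_)⟩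
          exact Inc.lt_inv_smul hm |>.1 (hy.trans_le (min_le_right _ _))
        · obtain ⟨y, hy⟩ := exists_lt (min x (m⁻¹ • v))
          refine ⟨y, hy.trans_le (min_le_left _ _), fun h => absurd h.2 (not_le.2 ?_)⟩
          have := hm (hy.trans_le (min_le_right _ _))
          simpa using this
      obtain ⟨g, hne, hg⟩ := exists_small (A := A) (isOpen_Iio.inter
        (isClosed_Icc.isOpen_compl.preimage (continuous_smul_of_locMove m))) ⟨y, hyx, hy⟩
      refine ⟨g, m * g * m⁻¹, by group, ?_, ?_⟩
      · rw [hp.meets_iff]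
        obtain ⟨z, hz⟩ := hne
        exact ⟨z, hz, (hg hz).1⟩
      · rw [sqDisj_iff (X := X), disjoint_left]
        intro z hz hz'
        obtain ⟨z, rfl⟩ := MulAction.surjective m z
        rw [mem_sqSp_conj] at hz
        rw [inc_sqSp_eq hi] at hz'
        exact (hg hz).2 (Ioo_subset_Icc_self (hs hz'))

end IsLRay

/-- The relative position of one point of each of the two supports decides between a left ray and a
right ray. -/
theorem ray_iff {p : A × A} : Ray p ↔ ∃ x : X, IsRayAt X p x := by
  constructor
  · intro hp
    obtain ⟨y, hy⟩ := (sqNe_iff (X := X)).1 hp.2.1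
    obtain ⟨w, hw⟩ := (sqNe_iff (X := X)).1 hp.1
    rcases lt_trichotomy y w with h | h | h
    · obtain ⟨x, hx⟩ := hp.exists_isLRay hy hw h
      exact ⟨x, Or.inl hx⟩
    · subst h
      exact absurd hw (disjoint_left.1 ((sqDisj_iff (X := X)).1 hp.2.2.1) hy)
    · have hy' : OrderDual.toDual y ∈ sqSp Xᵒᵈ p.2 := hy
      have hw' : OrderDual.toDual w ∈ sqSp Xᵒᵈ p.1 := hw
      obtain ⟨x, hx⟩ := hp.exists_isLRay hy' hw' h
      exact ⟨x, Or.inr hx⟩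
  · rintro ⟨x, h | h⟩
    · exact h.ray
    · exact h.ray

theorem IsLRay.meets_iff_dual {p : A × A} {x : X} (h : IsLRay Xᵒᵈ p (OrderDual.toDual x)) {g : A} :
    Meets g p ↔ (sqSp X g ∩ Ioi x).Nonempty := h.meets_iff

/-- `Meets` detects sets only up to closure, by elements of arbitrarily small support, so an
implication between two instances of it yields a density form of inclusion. -/
theorem IsLRay.subset_of_meets {p q : A × A} {U V : Set X}
    (hp : ∀ g, Meets g p ↔ (sqSp X g ∩ U).Nonempty) (hq : ∀ g, Meets g q ↔ (sqSp X g ∩ V).Nonempty)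
    (h : ∀ g : A, Meets g p → Meets g q) : ∀ a b, Ioo a b ⊆ U → a < b → (Ioo a b ∩ V).Nonempty := by
  intro a b hs hab
  obtain ⟨g, ⟨z, hz⟩, hg⟩ := exists_small (A := A) isOpen_Ioo (nonempty_Ioo.2 hab)
  obtain ⟨w, hw, hwV⟩ := (hq g).1 (h g ((hp g).2 ⟨z, hz, hs (hg hz)⟩))
  exact ⟨w, hg hw, hwV⟩

theorem IsLRay.sameDir {p q : A × A} {x y : X} (hp : IsLRay X p x) (hq : IsLRay X q y) :
    SameDir p q := by
  simp only [SameDir, hp.meets_iff, hq.meets_iff]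
  rcases le_total x y with h | h
  · exact Or.inl fun g hg => hg.mono (inter_subset_inter_right _ (Iio_subset_Iio h))
  · exact Or.inr fun g hg => hg.mono (inter_subset_inter_right _ (Iio_subset_Iio h))

/-- Far out on one of two opposite rays there are elements whose support misses the other ray, so
neither implication in `SameDir` can hold. -/
theorem IsLRay.not_sameDir {p q : A × A} {x y : X} (hp : IsLRay X p x)
    (hq : IsLRay Xᵒᵈ q (OrderDual.toDual y)) : ¬ SameDir p q := by
  rintro (h | h)
  · obtain ⟨a, ha⟩ := exists_lt (min x y)
    obtain ⟨z, hz, hz'⟩ := IsLRay.subset_of_meets (X := X) (U := Iio x) (V := Ioi y)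
      (fun g => hp.meets_iff) (fun g => hq.meets_iff_dual) h a (min x y)
      (fun z hz => hz.2.trans_le (min_le_left _ _)) ha
    exact absurd (hz.2.trans_le (min_le_right _ _)) (not_lt.2 (le_of_lt hz'))
  · obtain ⟨a, ha⟩ := exists_gt (max x y)
    obtain ⟨z, hz, hz'⟩ := IsLRay.subset_of_meets (X := X) (U := Ioi y) (V := Iio x)
      (fun g => hq.meets_iff_dual) (fun g => hp.meets_iff) h (max x y) a
      (fun z hz => (le_max_right _ _).trans_lt hz.1) ha
    exact absurd ((le_max_left _ _).trans_lt hz.1) (not_lt.2 (le_of_lt hz'))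

/-- If `p` is opposite to `d`, its ray is on the wrong side of the endpoint. The required side is
then exhausted by the supports of those `e` that do not meet the ray of `p`. -/
theorem IsLRay.avoids_iff {d p : A × A} {x y : X} (hd : IsLRay X d y) (hp : IsRayAt X p x) {g : A} :
    Avoids d g p ↔ Disjoint (sqSp X g) (Iio x) := by
  rcases hp with hp | hp
  · have h1 := hd.sameDir hp
    simp only [Avoids, h1, true_and, not_true, false_and, or_false, hp.meets_iff,
      not_nonempty_iff_eq_empty, disjoint_iff_inter_eq_empty]
  · have h1 := hd.not_sameDir hp
    simp only [Avoids, h1, false_and, not_false_eq_true, true_and, false_or, hp.meets_iff_dual,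
      not_nonempty_iff_eq_empty, ← disjoint_iff_inter_eq_empty, sqDisj_iff (X := X)]
    constructor
    · intro h
      rw [disjoint_left]
      intro z hz hzx
      obtain ⟨e, ⟨w, hw⟩, he⟩ := exists_small (A := A) ((isOpen_sqSp g).inter isOpen_Iio)
        ⟨z, hz, hzx⟩
      refine disjoint_left.1 (h e ?_) hw (he hw).1
      exact disjoint_left.2 fun z hz hz' => lt_asymm (he hz).2 hz'
    · intro h e he
      rw [disjoint_left]
      intro z hze hzg
      obtain ⟨a, b, hab, hs⟩ := exists_Ioo_of_mem_open ((isOpen_sqSp e).inter (isOpen_sqSp g))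
        ⟨hze, hzg⟩
      rcases lt_or_ge z x with h2 | h2
      · exact disjoint_left.1 h hzg h2
      -- The endpoint itself belongs to neither side. A common point at or above it has further
      -- common points strictly above it, as both supports are open.
      · obtain ⟨c, hc, hc'⟩ := exists_between hab.2
        exact disjoint_left.1 he (hs ⟨hab.1.trans hc, hc'⟩).1 (h2.trans_lt hc)

/-- Small supports tell the half-lines below different endpoints apart. The rays `p` and `q` may
have different directions; only `d` fixes the sense of the order. -/
theorem IsLRay.rayLE_iff {d p q : A × A} {x y z : X} (hd : IsLRay X d z) (hp : IsRayAt X p x)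
    (hq : IsRayAt X q y) : RayLE d p q ↔ x ≤ y := by
  simp only [RayLE, hd.avoids_iff hp, hd.avoids_iff hq]
  constructor
  · intro h
    by_contra! hyx
    obtain ⟨g, ⟨w, hw⟩, hg⟩ := exists_small (A := A) isOpen_Ioo (nonempty_Ioo.2 hyx)
    exact disjoint_left.1 (h g (disjoint_left.2 fun z hz hz' => lt_asymm (hg hz).1 hz')) hw (hg hw).2
  · exact fun h g hg => hg.mono_right (Iio_subset_Iio h)

theorem IsLRay.rayLE_iff_dual {d p q : A × A} {x y z : X} (hd : IsLRay Xᵒᵈ d (OrderDual.toDual z))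
    (hp : IsRayAt X p x) (hq : IsRayAt X q y) : RayLE d p q ↔ y ≤ x :=
  hd.rayLE_iff ((isRayAt_dual X).2 hp) ((isRayAt_dual X).2 hq)

/-- The ray itself can serve as the reference for direction. -/
theorem IsRayAt.unique {p : A × A} {x y : X} (hp : IsRayAt X p x) (hq : IsRayAt X p y) : x = y := by
  rcases hp with h | h
  · exact le_antisymm ((h.rayLE_iff (Or.inl h) hq).1 fun _ => id)
      ((h.rayLE_iff hq (Or.inl h)).1 fun _ => id)
  · exact le_antisymm ((h.rayLE_iff_dual hq (Or.inr h)).1 fun _ => id)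
      ((h.rayLE_iff_dual (Or.inr h) hq).1 fun _ => id)

theorem IsLRay.conj {p : A × A} {x : X} (hp : IsLRay X p x) {g : A} (hg : Inc X g) :
    IsLRay X (g * p.1 * g⁻¹, g * p.2 * g⁻¹) (g • x) := by
  have key : ∀ f : A, ∀ z : X, z ∈ sqSp X (g * f * g⁻¹) ↔ g⁻¹ • z ∈ sqSp X f := fun f z => by
    rw [← mem_sqSp_conj (g := f) (h := g), smul_inv_smul]
  refine ⟨⟨?_, ?_⟩, ?_, ?_⟩
  · intro z hz
    rw [← hg.inv.le_iff, inv_smul_smul]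
    exact hp.1.1 ((key _ _).1 hz)
  · intro z hz
    rw [← hg.inv.le_iff, inv_smul_smul]
    refine hp.1.2 fun w hw => ?_
    rw [← hg.le_iff, smul_inv_smul]
    exact hz (mem_sqSp_conj.2 hw)
  · obtain ⟨y, hy⟩ := hp.2.1
    exact ⟨g • y, mem_sqSp_conj.2 hy⟩
  · intro z hz
    have := hp.2.2 ((key _ _).1 hz)
    exact hg.inv_smul_lt.1 this

theorem IsLRay.conj_anti {p : A × A} {x : X} (hp : IsLRay X p x) {g : A}
    (hg : StrictAnti (fun x : X => g • x)) :
    IsLRay Xᵒᵈ (g * p.1 * g⁻¹, g * p.2 * g⁻¹) (OrderDual.toDual (g • x)) := by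
  have key : ∀ f : A, ∀ z : X, z ∈ sqSp X (g * f * g⁻¹) ↔ g⁻¹ • z ∈ sqSp X f := fun f z => by
    rw [← mem_sqSp_conj (g := f) (h := g), smul_inv_smul]
  have le : ∀ {a b : X}, g • a ≤ g • b ↔ b ≤ a := hg.le_iff_ge
  have lt : ∀ {a b : X}, g • a < g • b ↔ b < a := hg.lt_iff_gt
  refine ⟨(?_ : IsLUB (sqSp X (g * p.1 * g⁻¹)) (g • x)), ?_,
    (?_ : sqSp X (g * p.2 * g⁻¹) ⊆ Ioi (g • x))⟩
  · constructor
    · intro z hz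
      have := hp.1.1 ((key _ _).1 hz)
      rwa [← le, smul_inv_smul] at this
    · intro z hz
      rw [← smul_inv_smul g z, le]
      refine hp.1.2 fun w hw => ?_
      rw [← le, smul_inv_smul]
      exact hz (mem_sqSp_conj.2 hw)
  · obtain ⟨y, hy⟩ := hp.2.1
    exact ⟨g • y, mem_sqSp_conj.2 hy⟩
  · intro z hz
    have := hp.2.2 ((key _ _).1 hz)
    rw [mem_Iio, ← lt, smul_inv_smul] at this
    exact this

/-- This makes the action on endpoints visible in the group. An order-reversing element exchanges
left and right rays but respects endpoints all the same. -/
theorem IsRayAt.conj {p : A × A} {x : X} (hp : IsRayAt X p x) (g : A) :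
    IsRayAt X (g * p.1 * g⁻¹, g * p.2 * g⁻¹) (g • x) := by
  rcases LocMove.monotonic (X := X) g with hg | hg <;> rcases hp with hp | hp
  · exact Or.inl (hp.conj hg)
  · exact Or.inr (hp.conj (X := Xᵒᵈ) (fun _ _ h => hg h))
  · exact Or.inr (hp.conj_anti hg)
  · exact Or.inl (hp.conj_anti (X := Xᵒᵈ) (fun _ _ h => hg h))

theorem exists_isRayAt_of_mem {f : A} {x : X} (h : IsGLB (sqSp X f) x ∨ IsLUB (sqSp X f) x) :
    ∃ p : A × A, IsRayAt X p x := by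
  rcases h with h | h
  · obtain ⟨g, hne, hs⟩ := exists_small (A := A) isOpen_Iio (nonempty_Iio (a := x))
    exact ⟨(f, g), Or.inl ⟨h, hne, hs⟩⟩
  · obtain ⟨g, hne, hs⟩ := exists_small (A := A) isOpen_Ioi (nonempty_Ioi (a := x))
    exact ⟨(f, g), Or.inr ⟨h, hne, hs⟩⟩

theorem exists_isLRay_mem_Ioo (A : Type*) {X : Type*} [Group A] [LinearOrder X] [MulAction A X]
    [LocMove A X] [NoMinOrder X] [NoMaxOrder X] [DenselyOrdered X] [TopologicalSpace X]
    [OrderTopology X] {a b : X} (h : a < b) : ∃ p : A × A, ∃ x ∈ Ioo a b, IsLRay X p x := by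
  -- A support inside `(c, b)` has its infimum at or above `c`, hence strictly inside `(a, b)`.
  obtain ⟨c, h1, h2⟩ := exists_between h
  obtain ⟨f, hne, hs⟩ := exists_small (A := A) isOpen_Ioo (nonempty_Ioo.2 h2)
  obtain ⟨x, hx⟩ := exists_isGLB A (sqSp X f) hne ⟨c, fun y hy => (hs hy).1.le⟩
  obtain ⟨g, hne', hs'⟩ := exists_small (A := A) isOpen_Iio (nonempty_Iio (a := x))
  obtain ⟨y, hy⟩ := hne
  exact ⟨(f, g), x, ⟨h1.trans_le (hx.2 fun y hy => (hs hy).1.le),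
    (hx.1 hy).trans_lt (hs hy).2⟩, hx, hne', hs'⟩

end

end MonRec

namespace MonRec

open Set

/-! ### Order isomorphisms and homeomorphisms of complete chains -/

open Classical in
/-- A chain with least upper bounds is conditionally complete. -/
noncomputable abbrev conditionallyCompleteOfLub (X : Type*) [inst : LinearOrder X] [Nonempty X]
    (h : ∀ s : Set X, s.Nonempty → BddAbove s → ∃ x, IsLUB s x) :
    ConditionallyCompleteLinearOrder X :=
  { inst, (inferInstance : Lattice X) with
    sSup := fun s => if hs : s.Nonempty ∧ BddAbove s then (h s hs.1 hs.2).choose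
      else Classical.arbitrary X
    sInf := fun s => if hs : s.Nonempty ∧ BddBelow s then
      (exists_isGLB_of_lub h s hs.1 hs.2).choose else Classical.arbitrary X
    isLUB_csSup := fun s hs hb => by
      have : s.Nonempty ∧ BddAbove s := ⟨hs, hb⟩
      simp only [this, and_self, dite_true]
      exact (h s hs hb).choose_spec
    isGLB_csInf := fun s hs hb => by
      have : s.Nonempty ∧ BddBelow s := ⟨hs, hb⟩
      simp only [this, and_self, dite_true]
      exact (exists_isGLB_of_lub h s hs hb).choose_spec
    csSup_of_not_bddAbove := fun s hs => by simp [hs]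
    csInf_of_not_bddBelow := fun s hs => by simp [hs] }

/-- This is the intermediate value theorem: a dense chain with least upper bounds is connected.
Because of it homeomorphisms give nothing beyond monotonic bijections. -/
theorem monotonic_of_continuous {X Y : Type*} [LinearOrder X] [DenselyOrdered X] [Nonempty X]
    [TopologicalSpace X] [OrderTopology X] [LinearOrder Y] [TopologicalSpace Y] [OrderTopology Y]
    (h : ∀ s : Set X, s.Nonempty → BddAbove s → ∃ x, IsLUB s x) {f : X → Y} (hc : Continuous f)
    (hf : Function.Injective f) : Monotonic f := by
  let _ := conditionallyCompleteOfLub X h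
  exact hc.strictMono_of_inj hf

section Dense

variable {I X Y : Type*} [LinearOrder X] [LinearOrder Y]

/-- The point `y` is the supremum of the `v i` with `u i < x`. By density of `u` this set has no
largest member, so the inequalities on both sides are strict. -/
theorem lub_comparison (hY : ∀ s : Set Y, s.Nonempty → BddAbove s → ∃ x, IsLUB s x)
    {u : I → X} {v : I → Y} (hu : ∀ a b, a < b → ∃ i, u i ∈ Ioo a b) [NoMinOrder X] [NoMaxOrder X]
    (h : ∀ i j, u i ≤ u j ↔ v i ≤ v j) (x : X) : ∃ y : Y, ∀ i, v i < y ↔ u i < x := by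
  have hlt : ∀ i j, u i < u j ↔ v i < v j := fun i j => by
    rw [← not_le, h, not_le]
  obtain ⟨a, ha⟩ := exists_lt x
  obtain ⟨b, hb⟩ := exists_gt x
  obtain ⟨i, hi⟩ := hu a x ha
  obtain ⟨j, hj⟩ := hu x b hb
  obtain ⟨y, hy⟩ := hY (v '' {i | u i < x}) ⟨_, i, hi.2, rfl⟩ ⟨v j, by
    rintro _ ⟨k, hk, rfl⟩
    exact ((hlt k j).1 (lt_trans hk hj.1)).le⟩
  refine ⟨y, fun k => ⟨fun hk => ?_, fun hk => ?_⟩⟩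
  · obtain ⟨_, ⟨l, hl, rfl⟩, hkl, -⟩ := hy.exists_between hk
    exact ((hlt k l).2 hkl).trans hl
  · obtain ⟨l, hl⟩ := hu _ _ hk
    exact ((hlt k l).1 hl.1).trans_le (hy.1 ⟨l, hl.2, rfl⟩)

theorem eq_of_forall_lt_iff {u : I → X} (hu : ∀ a b, a < b → ∃ i, u i ∈ Ioo a b) {x y : X}
    (h : ∀ i, u i < x ↔ u i < y) : x = y := by
  rcases lt_trichotomy x y with hxy | hxy | hxy
  · obtain ⟨i, hi⟩ := hu _ _ hxy
    exact absurd ((h i).2 hi.2) (not_lt.2 hi.1.le)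
  · exact hxy
  · obtain ⟨i, hi⟩ := hu _ _ hxy
    exact absurd ((h i).1 hi.2) (not_lt.2 hi.1.le)

/-- An order isomorphism of dense subsets of complete chains extends to an order isomorphism. -/
theorem exists_orderIso_of_dense [NoMinOrder X] [NoMaxOrder X] [NoMinOrder Y] [NoMaxOrder Y]
    [DenselyOrdered X]
    (hX : ∀ s : Set X, s.Nonempty → BddAbove s → ∃ x, IsLUB s x)
    (hY : ∀ s : Set Y, s.Nonempty → BddAbove s → ∃ x, IsLUB s x)
    (u : I → X) (v : I → Y) (hu : ∀ a b, a < b → ∃ i, u i ∈ Ioo a b)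
    (hv : ∀ a b, a < b → ∃ i, v i ∈ Ioo a b) (h : ∀ i j, u i ≤ u j ↔ v i ≤ v j) :
    ∃ τ : X ≃o Y, ∀ i, τ (u i) = v i := by
  choose F hF using lub_comparison hY hu h
  choose F' hF' using lub_comparison hX hv (fun i j => (h i j).symm)
  refine ⟨⟨⟨F, F', fun x => eq_of_forall_lt_iff hu fun i => ?_,
    fun y => eq_of_forall_lt_iff hv fun i => ?_⟩, fun {x y} => ?_⟩, fun j => ?_⟩
  · rw [hF', hF]
  · rw [hF, hF']
  · constructor
    · intro hle
      by_contra! hlt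
      obtain ⟨i, hi⟩ := hu _ _ hlt
      exact absurd ((hF y i).1 (((hF x i).2 hi.2).trans_le hle)) (not_lt.2 hi.1.le)
    · intro hle
      by_contra! hlt
      obtain ⟨i, hi⟩ := hv _ _ hlt
      have := ((hF x i).1 hi.2).trans_le hle
      exact absurd ((hF y i).2 this) (not_lt.2 hi.1.le)
  · refine eq_of_forall_lt_iff hv fun i => ?_
    change v i < F (u j) ↔ _
    rw [hF, ← not_le, h, not_le]

end Dense

/-! ### Reconstruction -/

section Iso

variable {A B : Type*} [Group A] [Group B] (α : A ≃* B)

/-- The image of a pair of group elements. -/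
def mapPair (p : A × A) : B × B := (α p.1, α p.2)

/-- All the predicates on rays are built from multiplication and quantification over the group, so
an isomorphism transports them; this and the following lemmas record it. -/
theorem ad_map {f g : A} : AD (α f) (α g) ↔ AD f g := by
  simp only [AD, α.surjective.forall, α.surjective.exists, ← map_mul, α.injective.eq_iff, ne_eq]

theorem sqDisj_map {f g : A} : SqDisj (α f) (α g) ↔ SqDisj f g := by
  simp only [SqDisj, ← map_mul, ad_map]

theorem sqNe_map {f : A} : SqNe (α f) ↔ SqNe f := by
  simp only [SqNe, ← map_mul, ne_eq, α.injective.eq_iff]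

theorem meets_map {f : A} {p : A × A} : Meets (α f) (mapPair α p) ↔ Meets f p := by
  simp only [Meets, mapPair, α.surjective.exists, ← map_mul, ad_map, sqDisj_map,
    α.injective.eq_iff]

theorem ray_map {p : A × A} : Ray (mapPair α p) ↔ Ray p := by
  have h : ∀ (h g : A), Meets (α g) ((mapPair α p).1, α h) ↔ Meets g (p.1, h) := fun h g =>
    meets_map α (p := (p.1, h))
  simp only [Ray, α.surjective.forall, α.surjective.exists, meets_map, h, ← map_mul]
  simp only [mapPair, sqNe_map, sqDisj_map, α.injective.eq_iff]

theorem sameDir_map {p q : A × A} : SameDir (mapPair α p) (mapPair α q) ↔ SameDir p q := by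
  simp only [SameDir, α.surjective.forall, meets_map]

theorem rayLE_map {d p q : A × A} :
    RayLE (mapPair α d) (mapPair α p) (mapPair α q) ↔ RayLE d p q := by
  simp only [RayLE, Avoids, α.surjective.forall, meets_map, sameDir_map, sqDisj_map]

end Iso

section Reconstruct

variable {A X : Type*} [Group A] [LinearOrder X] [MulAction A X] [LocMove A X] [NoMinOrder X]
  [NoMaxOrder X] [DenselyOrdered X] [TopologicalSpace X] [OrderTopology X]
  {B Y : Type*} [Group B] [LinearOrder Y] [MulAction B Y] [LocMove B Y] [NoMinOrder Y]
  [NoMaxOrder Y] [DenselyOrdered Y] [TopologicalSpace Y] [OrderTopology Y]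

/-- One ray that is a left ray in both chains makes `RayLE` mean the given order on both of them.
The correspondence of endpoints is then an isomorphism of dense sets. -/
theorem exists_orderIso_of_isLRay (α : A ≃* B) {d : A × A} {x₀ : X} {y₀ : Y} (hd : IsLRay X d x₀)
    (hd' : IsLRay Y (mapPair α d) y₀) :
    ∃ τ : X ≃o Y, ∀ p x y, IsRayAt X p x → IsRayAt Y (mapPair α p) y → τ x = y := by
  have h1 : ∀ p : {p : A × A // Ray p}, ∃ x : X, IsRayAt X p.1 x := fun p => ray_iff.1 p.2
  have h2 : ∀ p : {p : A × A // Ray p}, ∃ y : Y, IsRayAt Y (mapPair α p.1) y := fun p =>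
    ray_iff.1 ((ray_map α).2 p.2)
  choose u hu using h1
  choose v hv using h2
  have hu' : ∀ a b : X, a < b → ∃ i, u i ∈ Ioo a b := by
    intro a b hab
    obtain ⟨p, x, hx, hp⟩ := exists_isLRay_mem_Ioo A hab
    refine ⟨⟨p, hp.ray⟩, ?_⟩
    rwa [(hu ⟨p, _⟩).unique (Or.inl hp)]
  have hv' : ∀ a b : Y, a < b → ∃ i, v i ∈ Ioo a b := by
    intro a b hab
    obtain ⟨q, x, hx, hp⟩ := exists_isLRay_mem_Ioo B hab
    obtain ⟨p, rfl⟩ : ∃ p, mapPair α p = q :=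
      ⟨(α.symm q.1, α.symm q.2), by simp [mapPair]⟩
    refine ⟨⟨p, (ray_map α).1 hp.ray⟩, ?_⟩
    rwa [(hv ⟨p, _⟩).unique (Or.inl hp)]
  obtain ⟨τ, hτ⟩ := exists_orderIso_of_dense (LocMove.lub A) (LocMove.lub B) u v hu' hv'
    fun i j => by rw [← hd.rayLE_iff (hu i) (hu j), ← hd'.rayLE_iff (hv i) (hv j), rayLE_map]
  refine ⟨τ, fun p x y hx hy => ?_⟩
  have := hτ ⟨p, ray_iff.2 ⟨x, hx⟩⟩
  rwa [(hu ⟨p, _⟩).unique hx, (hv ⟨p, _⟩).unique hy] at this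

theorem dense_rayPoints (A X : Type*) [Group A] [LinearOrder X] [MulAction A X] [LocMove A X]
    [NoMinOrder X] [NoMaxOrder X] [DenselyOrdered X] [TopologicalSpace X] [OrderTopology X] :
    Dense {x : X | ∃ p : A × A, IsRayAt X p x} := by
  rw [dense_iff_inter_open]
  rintro U hU ⟨x, hx⟩
  obtain ⟨a, b, hab, hs⟩ := exists_Ioo_of_mem_open hU hx
  obtain ⟨p, y, hy, hp⟩ := exists_isLRay_mem_Ioo A (hab.1.trans hab.2)
  exact ⟨y, hs hy, p, Or.inl hp⟩

/-- Both sides are continuous in the point, and at endpoints of rays the action is conjugation of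
pairs, which `α` respects. -/
theorem equivariant_of_rays (α : A ≃* B) {τ : X ≃ Y} (hm : Monotonic τ)
    (h : ∀ p x y, IsRayAt X p x → IsRayAt Y (mapPair α p) y → τ x = y) (g : A) (x : X) :
    τ (g • x) = α g • τ x := by
  have hc : Continuous τ := hm.continuous τ.surjective
  refine congrFun (Continuous.ext_on (dense_rayPoints A X)
    (hc.comp (continuous_smul_of_locMove g)) ((continuous_smul_of_locMove (α g)).comp hc) ?_) x
  rintro x ⟨p, hp⟩
  obtain ⟨y, hy⟩ := (ray_iff (X := Y)).1 ((ray_map α).2 (ray_iff.2 ⟨x, hp⟩))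
  have h1 := hp.conj g
  have h2 := hy.conj (α g)
  change τ (g • x) = α g • τ x
  rw [h p x y hp hy]
  refine h _ _ _ h1 ?_
  simpa [mapPair] using h2

/-- A group isomorphism is induced by a monotonic bijection. -/
theorem exists_monotonic_equivariant [Nonempty X] (α : A ≃* B) :
    ∃ τ : X ≃ Y, Monotonic τ ∧ ∀ (g : A) (x : X), τ (g • x) = α g • τ x := by
  obtain ⟨a, b, hab⟩ := exists_pair_lt X
  obtain ⟨d, x₀, -, hd⟩ := exists_isLRay_mem_Ioo A hab
  obtain ⟨y₀, hy⟩ := (ray_iff (X := Y)).1 ((ray_map α).2 hd.ray)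
  rcases hy with hy | hy
  · obtain ⟨τ, hτ⟩ := exists_orderIso_of_isLRay α hd hy
    exact ⟨τ.toEquiv, Or.inl τ.strictMono,
      equivariant_of_rays α (Or.inl τ.strictMono) hτ⟩
  -- The image of the reference ray is a right ray here, so the isomorphism is onto the reversal of
  -- `Y` and yields an order-reversing bijection.
  · obtain ⟨τ, hτ⟩ := exists_orderIso_of_isLRay α hd hy
    have hm : Monotonic (τ.toEquiv.trans OrderDual.ofDual) := Or.inr fun _ _ h => τ.strictMono h
    exact ⟨τ.toEquiv.trans OrderDual.ofDual, hm, equivariant_of_rays α hm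
      fun p x y hx hy => hτ p x (OrderDual.toDual y) hx ((isRayAt_dual Y).2 hy)⟩

/-- Only the identity commutes with the group. -/
theorem eq_self_of_commute {f : X → X} (hc : Continuous f) (hf : Function.Injective f)
    (h : ∀ (g : A) (x : X), f (g • x) = g • f x) (x : X) : f x = x := by
  by_contra hx
  obtain ⟨a, b, hab, -, hoff⟩ := exists_Ioo_disjoint hc hx isOpen_univ trivial
  obtain ⟨g, hg, hne⟩ := (bddNormal_top (A := A) (X := X)).exists_smul_ne_Ioo hab.1 hab.2
  -- The element `g` is supported in an interval that `f` moves off itself, hence fixes `f x`; so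
  -- `f` takes the same value at `g • x` and `x`.
  refine hne (hf ?_)
  rw [h]
  exact notMem_sp.1 fun h' => hoff x hab (hg.2.2 h')

/-- The composite of `τ'` with the inverse of `τ` commutes with the group. An arbitrary family `φ`
in place of an action on `Y` allows the use for a subgroup whose image is another subgroup. -/
theorem eq_of_equivariant {τ τ' : X ≃ Y} (hc : Continuous τ.symm) (hc' : Continuous τ') {φ : A → Y → Y}
    (h : ∀ (g : A) (x : X), τ (g • x) = φ g (τ x)) (h' : ∀ (g : A) (x : X), τ' (g • x) = φ g (τ' x)) :
    τ' = τ := by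
  ext x
  have := eq_self_of_commute (A := A) (f := fun x => τ.symm (τ' x)) (hc.comp hc')
    (τ.symm.injective.comp τ'.injective) (fun g x => by
      rw [h', Equiv.symm_apply_eq, h, Equiv.apply_symm_apply]) x
  exact (Equiv.symm_apply_eq _).1 this

end Reconstruct

end MonRec

namespace MonRec

open Set

/-! ### The action on the completion -/

section Completion

variable {L : Type u} [LinearOrder L]

instance : OrderTopology (Cpl L) := ⟨rfl⟩

theorem Cpl.exists_isLUB (s : Set (Cpl L)) (hs : s.Nonempty) (hb : BddAbove s) :
    ∃ x, IsLUB s x := by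
  obtain ⟨x, hx⟩ := hs
  obtain ⟨b, hb⟩ := hb
  have hl := isLUB_sSup (Subtype.val '' s)
  have h1 : x.1 ≤ sSup (Subtype.val '' s) := hl.1 ⟨x, hx, rfl⟩
  have h2 : sSup (Subtype.val '' s) ≤ b.1 := hl.2 (by
    rintro _ ⟨y, hy, rfl⟩
    exact hb hy)
  refine ⟨⟨sSup (Subtype.val '' s), ?_, ?_⟩, ?_, ?_⟩
  · exact ne_bot_of_gt ((bot_lt_iff_ne_bot.2 x.2.1).trans_le h1)
  · exact ne_top_of_lt (h2.trans_lt (lt_top_iff_ne_top.2 b.2.2))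
  · intro y hy
    exact hl.1 (mem_image_of_mem _ hy)
  · intro y hy
    refine hl.2 ?_
    rintro _ ⟨z, hz, rfl⟩
    exact hy hz

variable [NoMinOrder L] [NoMaxOrder L]

theorem Cpl.of_injective : Function.Injective (Cpl.of : L → Cpl L) := fun a b h => by
  rcases lt_trichotomy a b with h' | h' | h'
  · exact absurd h (Cpl.of_lt_of.2 h').ne
  · exact h'
  · exact absurd h (Cpl.of_lt_of.2 h').ne'

theorem Cpl.exists_of_lt (x : Cpl L) : ∃ a : L, Cpl.of a < x := by
  obtain ⟨a, -, ha⟩ := DedekindCut.lt_iff_exists'.1 (bot_lt_iff_ne_bot.2 x.2.1)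
  exact ⟨a, ha⟩

theorem Cpl.exists_lt_of (x : Cpl L) : ∃ a : L, x < Cpl.of a := by
  obtain ⟨a, ha, -⟩ := DedekindCut.lt_iff_exists.1 (lt_top_iff_ne_top.2 x.2.2)
  exact ⟨a, ha⟩

instance : NoMinOrder (Cpl L) := ⟨fun x => (Cpl.exists_of_lt x).imp' _ fun _ h => h⟩

instance : NoMaxOrder (Cpl L) := ⟨fun x => (Cpl.exists_lt_of x).imp' _ fun _ h => h⟩

instance [Nonempty L] : Nonempty (Cpl L) := ⟨Cpl.of (Classical.arbitrary L)⟩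

variable [DenselyOrdered L]

/-- Comparison of cuts yields principal cuts with one of the two inequalities possibly weak; density
of `L` leaves room for a strict choice. -/
theorem Cpl.exists_of_mem_Ioo {x y : Cpl L} (h : x < y) : ∃ a : L, Cpl.of a ∈ Ioo x y := by
  obtain ⟨c, hxc, hcy⟩ := DedekindCut.lt_iff_exists.1 (show x.1 < y.1 from h)
  obtain ⟨d, hxd, hdc⟩ := DedekindCut.lt_iff_exists'.1 hxc
  obtain ⟨u, hdu, huc⟩ := exists_between (DedekindCut.principal_lt_principal.1 hdc)
  exact ⟨u, lt_of_le_of_lt (b := Cpl.of d) hxd (Cpl.of_lt_of.2 hdu),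
    lt_of_lt_of_le (b := Cpl.of c) (Cpl.of_lt_of.2 huc) hcy⟩

instance : DenselyOrdered (Cpl L) :=
  ⟨fun _ _ h => (Cpl.exists_of_mem_Ioo h).imp' _ fun _ h => h⟩

theorem Cpl.dense_range_of : Dense (range (Cpl.of : L → Cpl L)) := by
  rw [dense_iff_inter_open]
  rintro U hU ⟨x, hx⟩
  obtain ⟨a, b, hab, hs⟩ := exists_Ioo_of_mem_open hU hx
  obtain ⟨y, hy⟩ := Cpl.exists_of_mem_Ioo (hab.1.trans hab.2)
  exact ⟨Cpl.of y, hs hy, y, rfl⟩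

end Completion

section Action

variable {L : Type u} [LinearOrder L] [NoMinOrder L] [NoMaxOrder L] [Nonempty L]

/-- A group of monotonic permutations of `L` acts on the completion. -/
noncomputable instance actCpl (G : Subgroup (AutED L)) : MulAction G (Cpl L) where
  smul g x := (bar (g : AutED L)).1 x
  one_smul x := by
    change (bar (1 : AutED L)).1 x = x
    rw [map_one]
    rfl
  mul_smul g h x := by
    change (bar (g * h : AutED L)).1 x = _
    rw [map_mul]
    rfl

variable {G : Subgroup (AutED L)}

theorem smul_of (g : G) (a : L) : g • Cpl.of a = Cpl.of ((g : AutED L).1 a) := bar_of _ _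

theorem sp_cpl (g : G) : sp (Cpl L) g = supp (g : AutED L) := rfl

theorem monotonic_smul_cpl (g : G) : Monotonic (fun x : Cpl L => g • x) :=
  IsEDIso.monotonic (bar (g : AutED L)).2

theorem inc_cpl_iff {g : G} : Inc (Cpl L) g ↔ StrictMono (g : AutED L).1 := by
  obtain ⟨a⟩ := ‹Nonempty L›
  obtain ⟨b, hab⟩ := exists_gt a
  constructor
  · intro h x y hxy
    have := h (Cpl.of_lt_of.2 hxy)
    simp only [smul_of] at this
    exact Cpl.of_lt_of.1 this
  · intro h
    rcases monotonic_smul_cpl g with m | m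
    · exact m
    · have h1 := m (Cpl.of_lt_of.2 hab)
      simp only [smul_of] at h1
      exact absurd (h hab) (not_lt.2 (Cpl.of_lt_of.1 h1).le)

theorem eq_one_of_smul_cpl {g : G} (h : ∀ x : Cpl L, g • x = x) : g = 1 := by
  ext a
  have := h (Cpl.of a)
  rw [smul_of] at this
  exact Cpl.of_injective this

variable [DenselyOrdered L]

theorem isInterval_Ioo {a b : L} (h : a < b) : IsInterval (Ioo a b) := Or.inl ⟨a, b, h, rfl⟩

theorem exists_of_Ioo_subset {x y : Cpl L} (h : x < y) :
    ∃ a b : L, a < b ∧ ∀ c ∈ Ioo a b, Cpl.of c ∈ Ioo x y := by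
  obtain ⟨a, ha⟩ := Cpl.exists_of_mem_Ioo h
  obtain ⟨b, hb⟩ := Cpl.exists_of_mem_Ioo ha.2
  exact ⟨a, b, Cpl.of_lt_of.1 hb.1, fun c hc =>
    ⟨ha.1.trans (Cpl.of_lt_of.2 hc.1), (Cpl.of_lt_of.2 hc.2).trans hb.2⟩⟩

theorem intervalChain_of_Ioo {x y : Fin 3 → Cpl L} (h : ∀ i, x i < y i) (h01 : y 0 ≤ x 1)
    (h12 : y 1 ≤ x 2) : ∃ I : Fin 3 → Set L, IntervalChain I ∧
      ∀ i, ∀ c ∈ I i, Cpl.of c ∈ Ioo (x i) (y i) := by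
  choose a b hab hc using fun i => exists_of_Ioo_subset (h i)
  refine ⟨fun i => Ioo (a i) (b i), ⟨fun i => isInterval_Ioo (hab i), ?_⟩, hc⟩
  intro i j hij c hci d hdj
  have h1 := (hc i c hci).2
  have h2 := (hc j d hdj).1
  refine Cpl.of_lt_of.1 ((h1.trans_le ?_).trans h2)
  have h02 : y 0 ≤ x 2 := h01.trans ((h 1).le.trans h12)
  fin_cases i <;> fin_cases j <;> first | exact h01 | exact h12 | exact h02 | simp at hij

/-- Every interval of the completion contains the image of an interval of `L`, so transitivity on
intervals passes to the completion and the abstract reconstruction applies. -/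
theorem IsMN3.locMove (hG : IsMN3 G) : LocMove G (Cpl L) where
  lub := Cpl.exists_isLUB
  monotonic := monotonic_smul_cpl
  faithful _ := eq_one_of_smul_cpl
  trans a₁ b₁ a₂ b₂ a₃ b₃ c₁ d₁ c₂ d₂ c₃ d₃ h1 h12 h2 h23 h3 k1 k12 k2 k23 k3 := by
    obtain ⟨I, hI, hI'⟩ := intervalChain_of_Ioo (x := ![a₁, a₂, a₃]) (y := ![b₁, b₂, b₃])
      (by intro i; fin_cases i <;> assumption) h12 h23
    obtain ⟨J, hJ, hJ'⟩ := intervalChain_of_Ioo (x := ![c₁, c₂, c₃]) (y := ![d₁, d₂, d₃])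
      (by intro i; fin_cases i <;> assumption) k12 k23
    obtain ⟨g, hg, hgIJ⟩ := hG.1 I J hI hJ
    choose z hz using hgIJ
    choose y hy using fun i => (hz i).1
    have key : ∀ i, (⟨g, hg⟩ : G) • Cpl.of (y i) = Cpl.of (z i) := fun i => by
      rw [smul_of, ← (hy i).2]
    refine ⟨⟨g, hg⟩, Cpl.of (y 0), hI' 0 _ (hy 0).1, Cpl.of (y 1), hI' 1 _ (hy 1).1, Cpl.of (y 2),
      hI' 2 _ (hy 2).1, ?_, ?_, ?_⟩
    · rw [key]; exact hJ' 0 _ (hz 0).2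
    · rw [key]; exact hJ' 1 _ (hz 1).2
    · rw [key]; exact hJ' 2 _ (hz 2).2
  bdd := by
    obtain ⟨g, hg, h1⟩ := hG.2
    obtain ⟨⟨hgG, v, hv⟩, -, u, hu⟩ := hg
    obtain ⟨v', hv'⟩ := exists_gt v
    obtain ⟨u', hu'⟩ := exists_lt u
    exact ⟨⟨g, hgG⟩, fun h => h1 (congrArg Subtype.val h), u', v', fun x hx =>
      ⟨hu'.trans_le (hu hx), (hv hx).trans_lt hv'⟩⟩

/-- A subgroup containing enough elements of `G` is again 3-interval-transitive. -/
theorem isMN3_of_bddNormal (hG : IsMN3 G) {N : Subgroup (AutED L)}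
    (hN : BddNormal (Cpl L) (N.subgroupOf G)) : IsMN3 N := by
  have := hG.locMove
  constructor
  · intro I J hI hJ
    have hne : ∀ {I : Set L}, IsInterval I → I.Nonempty := by
      rintro I (⟨x, y, h, rfl⟩ | ⟨x, rfl⟩ | ⟨x, rfl⟩ | rfl)
      · exact nonempty_Ioo.2 h
      · exact nonempty_Iio
      · exact nonempty_Ioi
      · exact univ_nonempty
    -- Intervals whose endpoints belong to the given target intervals are separated from each other,
    -- as `exists_smul_mem₄` requires.
    have hsub : ∀ {I : Set L}, IsInterval I → ∃ c d : L, c < d ∧ Ioo c d ⊆ I ∧ c ∈ I ∧ d ∈ I := by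
      rintro I (⟨x, y, h, rfl⟩ | ⟨x, rfl⟩ | ⟨x, rfl⟩ | rfl)
      · obtain ⟨c, h1, h2⟩ := exists_between h
        obtain ⟨d, h3, h4⟩ := exists_between h2
        exact ⟨c, d, h3, Ioo_subset_Ioo h1.le h4.le, ⟨h1, h2⟩, h1.trans h3, h4⟩
      · obtain ⟨d, hd⟩ := exists_lt x
        obtain ⟨c, hc⟩ := exists_lt d
        exact ⟨c, d, hc, fun z hz => hz.2.trans hd, hc.trans hd, hd⟩
      · obtain ⟨c, hc⟩ := exists_gt x
        obtain ⟨d, hd⟩ := exists_gt c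
        exact ⟨c, d, hd, fun z hz => hc.trans hz.1, hc, hc.trans hd⟩
      · obtain ⟨x⟩ := ‹Nonempty L›
        obtain ⟨y, h⟩ := exists_gt x
        exact ⟨x, y, h, subset_univ _, trivial, trivial⟩
    choose a ha using fun i => hne (hI.1 i)
    choose c d hcd hs hcJ hdJ using fun i => hsub (hJ.1 i)
    -- Three intervals are in question; the fourth point and its target are dummies.
    obtain ⟨e, he⟩ := exists_gt (a 2)
    obtain ⟨f, hf⟩ := exists_gt (d 2)
    obtain ⟨n, hn, hi, t1, t2, t3, -⟩ := hN.exists_smul_mem₄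
      (Cpl.of_lt_of.2 (hI.2 0 1 (by decide) _ (ha 0) _ (ha 1)))
      (Cpl.of_lt_of.2 (hI.2 1 2 (by decide) _ (ha 1) _ (ha 2))) (Cpl.of_lt_of.2 he)
      (Cpl.of_lt_of.2 (hcd 0)) (Cpl.of_lt_of.2 (hJ.2 0 1 (by decide) _ (hdJ 0) _ (hcJ 1))).le
      (Cpl.of_lt_of.2 (hcd 1)) (Cpl.of_lt_of.2 (hJ.2 1 2 (by decide) _ (hdJ 1) _ (hcJ 2))).le
      (Cpl.of_lt_of.2 (hcd 2)) le_rfl (Cpl.of_lt_of.2 hf)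
    have key : ∀ i, n • Cpl.of (a i) ∈ Ioo (Cpl.of (c i)) (Cpl.of (d i)) := by
      intro i
      fin_cases i
      exacts [t1, t2, t3]
    refine ⟨n, hn, fun i => ⟨_, ⟨a i, ha i, rfl⟩, hs i ?_⟩⟩
    have := key i
    rw [smul_of] at this
    exact ⟨Cpl.of_lt_of.1 this.1, Cpl.of_lt_of.1 this.2⟩
  · obtain ⟨n, hn, h1, u, v, hs⟩ := hN.bdd
    exact ⟨n, ⟨⟨hn, v, fun x hx => (hs hx).2.le⟩, hn, u, fun x hx => (hs hx).1.le⟩,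
      fun h => h1 (Subtype.ext h)⟩

/-- Together with `IsMN3.bddDer` this puts all groups between the derived group of `Bdd G` and `G`
into the class, which covers every distinguished subgroup. -/
theorem IsMN3.mono {N : Subgroup (AutED L)} (hN : IsMN3 N) (h : N ≤ G) : IsMN3 G := by
  refine ⟨fun I J hI hJ => ?_, ?_⟩
  · obtain ⟨g, hg, hIJ⟩ := hN.1 I J hI hJ
    exact ⟨g, h hg, hIJ⟩
  · obtain ⟨g, ⟨⟨hg, h1⟩, -, h2⟩, hne⟩ := hN.2
    exact ⟨g, ⟨⟨h hg, h1⟩, h hg, h2⟩, hne⟩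

theorem lft_le : Lft G ≤ G := fun _ h => h.1

theorem rt_le : Rt G ≤ G := fun _ h => h.1

theorem opp_le : Opp G ≤ G := fun _ h => h.1

theorem bdd_le_lft : Bdd G ≤ Lft G := inf_le_left

theorem bdd_le_rt : Bdd G ≤ Rt G := inf_le_right

theorem bdd_le : Bdd G ≤ G := bdd_le_lft.trans lft_le

theorem bddDer_le_bdd : BddDer G ≤ Bdd G := Subgroup.commutator_le_self _

theorem mem_bdd_iff {g : AutED L} : g ∈ Bdd G ↔ g ∈ G ∧ BddAbove (supp g) ∧ BddBelow (supp g) :=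
  ⟨fun h => ⟨h.1.1, h.1.2, h.2.2⟩, fun h => ⟨⟨h.1, h.2.1⟩, h.1, h.2.2⟩⟩

theorem strictMono_of_bddBelow_supp {g : AutED L} (h : BddBelow (supp g)) : StrictMono g.1 := by
  obtain ⟨u, hu⟩ := h
  obtain ⟨b, hb⟩ := exists_lt u
  obtain ⟨a, ha⟩ := exists_lt b
  have fix : ∀ x < u, (bar g).1 x = x := fun x hx => by
    by_contra hn
    exact absurd (hu hn) (not_le.2 hx)
  rcases IsEDIso.monotonic (bar g).2 with m | m
  · exact (inc_cpl_iff (G := ⊤) (g := ⟨g, trivial⟩)).1 m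
  · have := m ha
    rw [fix a (ha.trans hb), fix b hb] at this
    exact absurd this (not_lt.2 ha.le)

theorem bdd_le_opp : Bdd G ≤ Opp G := fun _ hg =>
  ⟨hg.1.1, strictMono_of_bddBelow_supp hg.2.2⟩

theorem supp_conj (g h : AutED L) : supp (h * g * h⁻¹) = (bar h).1 '' supp g := by
  ext x
  have h1 := mem_sp_conj (X := Cpl L) (g := (⟨g, trivial⟩ : (⊤ : Subgroup (AutED L))))
    (h := ⟨h, trivial⟩) (x := x)
  constructor
  · intro hx
    exact ⟨_, h1.1 hx, smul_inv_smul (⟨h, trivial⟩ : (⊤ : Subgroup (AutED L))) x⟩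
  · rintro ⟨y, hy, rfl⟩
    refine h1.2 ?_
    rwa [← inv_smul_smul (⟨h, trivial⟩ : (⊤ : Subgroup (AutED L))) y] at hy

theorem bdd_image_of_monotonic {X Y : Type*} [LinearOrder X] [LinearOrder Y] {f : X → Y}
    (hf : Monotonic f) {s : Set X} (h : BddAbove s ∧ BddBelow s) :
    BddAbove (f '' s) ∧ BddBelow (f '' s) := by
  rcases hf with hf | hf
  · exact ⟨hf.monotone.map_bddAbove h.1, hf.monotone.map_bddBelow h.2⟩
  · exact ⟨hf.antitone.map_bddBelow h.2, hf.antitone.map_bddAbove h.1⟩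

theorem conj_mem_bdd {g n : AutED L} (hg : g ∈ G) (hn : n ∈ Bdd G) : g * n * g⁻¹ ∈ Bdd G := by
  rw [mem_bdd_iff] at hn ⊢
  refine ⟨G.mul_mem (G.mul_mem hg hn.1) (G.inv_mem hg), ?_⟩
  rw [supp_conj]
  exact bdd_image_of_monotonic (IsEDIso.monotonic (bar g).2) hn.2

/-- The derived group of `Bdd G` is normalized by `G`, and the commutator of two noncommuting
elements with supports in one bounded interval is a nonidentity bounded member. -/
theorem IsMN3.bddDer (hG : IsMN3 G) : IsMN3 (BddDer G) := by
  have := hG.locMove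
  have hsup : ∀ {a b : Cpl L} {f : G}, f ∈ supportedIn (⊤ : Subgroup G) (Ioo a b) →
      (f : AutED L) ∈ Bdd G := fun {a b f} hf => mem_bdd_iff.2 ⟨f.2,
    ⟨b, fun x hx => (hf.2.2 hx).2.le⟩, ⟨a, fun x hx => (hf.2.2 hx).1.le⟩⟩
  refine isMN3_of_bddNormal hG ⟨?_, ?_⟩
  · intro g _ n hn
    have hmap : (BddDer G).map (MulAut.conj (g : AutED L)).toMonoidHom ≤ BddDer G := by
      rw [BddDer, Subgroup.map_commutator]
      refine Subgroup.commutator_mono ?_ ?_ <;>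
      · rintro _ ⟨n, hn, rfl⟩
        exact conj_mem_bdd g.2 hn
    exact hmap ⟨n, hn, rfl⟩
  · obtain ⟨a, b, hab⟩ := exists_pair_lt (Cpl L)
    obtain ⟨f₁, hf₁, f₂, hf₂, hne⟩ := (bddNormal_top (A := G) (X := Cpl L)).exists_not_commute hab
    refine ⟨f₁ * f₂ * f₁⁻¹ * f₂⁻¹, ?_, fun h => hne (by
      rwa [mul_inv_eq_one, mul_inv_eq_iff_eq_mul] at h), a, b, ?_⟩
    · exact Subgroup.commutator_mem_commutator (hsup hf₁) (hsup hf₂)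
    · have h1 := (supportedIn (⊤ : Subgroup G) (Ioo a b)).mul_mem
        ((supportedIn _ _).mul_mem ((supportedIn _ _).mul_mem hf₁ hf₂)
        ((supportedIn _ _).inv_mem hf₁)) ((supportedIn _ _).inv_mem hf₂)
      exact h1.2.2

theorem IsMN3.bdd (hG : IsMN3 G) : IsMN3 (Bdd G) := hG.bddDer.mono bddDer_le_bdd

theorem IsMN3.lft (hG : IsMN3 G) : IsMN3 (Lft G) := hG.bdd.mono bdd_le_lft

theorem IsMN3.rt (hG : IsMN3 G) : IsMN3 (Rt G) := hG.bdd.mono bdd_le_rt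

theorem IsMN3.opp (hG : IsMN3 G) : IsMN3 (Opp G) := hG.bdd.mono bdd_le_opp

/-! ### The endpoints -/

/-- An order-reversing permutation does not fix two different points, so there are moved points
arbitrarily far out on both sides. -/
theorem not_bdd_supp_of_anti {g : AutED L} (h : StrictAnti (bar g).1) :
    ¬ BddAbove (supp g) ∧ ¬ BddBelow (supp g) := by
  have h1 : ∀ x y, x < y → x ∈ supp g ∨ y ∈ supp g := by
    intro x y hxy
    by_contra! hn
    simp only [supp, mem_ofPred_eq, not_not] at hn
    have := h hxy
    rw [hn.1, hn.2] at this
    exact lt_asymm hxy this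
  constructor
  · rintro ⟨u, hu⟩
    obtain ⟨b, hb⟩ := exists_gt u
    obtain ⟨c, hc⟩ := exists_gt b
    rcases h1 b c hc with h | h
    · exact absurd (hu h) (not_le.2 hb)
    · exact absurd (hu h) (not_le.2 (hb.trans hc))
  · rintro ⟨u, hu⟩
    obtain ⟨b, hb⟩ := exists_lt u
    obtain ⟨c, hc⟩ := exists_lt b
    rcases h1 c b hc with h | h
    · exact absurd (hu h) (not_le.2 (hc.trans hb))
    · exact absurd (hu h) (not_le.2 hb)

/-- The support is open, so `var` lies between it and its closure, and a set has the same bounds as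
its closure. Regularization therefore does not affect endpoints. -/
theorem isGLB_var_iff (hG : IsMN3 G) {g : G} {x : Cpl L} :
    (IsGLB (var (g : AutED L)) x ↔ IsGLB (supp (g : AutED L)) x) ∧
      (IsLUB (var (g : AutED L)) x ↔ IsLUB (supp (g : AutED L)) x) := by
  have := hG.locMove
  have ho : IsOpen (supp (g : AutED L)) := isOpen_sp g
  have h1 : supp (g : AutED L) ⊆ var (g : AutED L) := interior_maximal subset_closure ho
  have h2 : var (g : AutED L) ⊆ closure (supp (g : AutED L)) := interior_subset
  have h3 : upperBounds (var (g : AutED L)) = upperBounds (supp (g : AutED L)) :=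
    subset_antisymm (upperBounds_mono_set h1) (by
      rw [← upperBounds_closure]; exact upperBounds_mono_set h2)
  have h4 : lowerBounds (var (g : AutED L)) = lowerBounds (supp (g : AutED L)) :=
    subset_antisymm (lowerBounds_mono_set h1) (by
      rw [← lowerBounds_closure]; exact lowerBounds_mono_set h2)
  simp only [IsGLB, IsLUB, h3, h4, and_self]

/-- An element whose support is bounded on one side preserves order, so its square has the same
support and can serve as the first entry of a ray. -/
theorem mem_ep_iff (hG : IsMN3 G) {x : Cpl L} : x ∈ Ep G ↔ ∃ p : G × G, IsRayAt (Cpl L) p x := by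
  have := hG.locMove
  constructor
  · rintro ⟨g, hg, hx⟩
    have hx' : IsGLB (supp g) x ∨ IsLUB (supp g) x :=
      hx.imp (isGLB_var_iff hG (g := ⟨g, hg⟩)).1.1 (isGLB_var_iff hG (g := ⟨g, hg⟩)).2.1
    have hi : Inc (Cpl L) (⟨g, hg⟩ : G) := by
      rcases monotonic_smul_cpl (⟨g, hg⟩ : G) with m | m
      · exact m
      · have := not_bdd_supp_of_anti (g := g) m
        rcases hx' with h | h
        · exact absurd ⟨x, h.1⟩ this.2
        · exact absurd ⟨x, h.1⟩ this.1
    refine exists_isRayAt_of_mem (f := (⟨g, hg⟩ : G)) ?_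
    rwa [inc_sqSp_eq hi]
  · rintro ⟨p, h | h⟩
    · refine ⟨_, (p.1 * p.1).2, Or.inl ?_⟩
      rw [(isGLB_var_iff hG).1]
      exact h.1
    · refine ⟨_, (p.1 * p.1).2, Or.inr ?_⟩
      rw [(isGLB_var_iff hG).2]
      exact h.1

end Action

end MonRec

namespace MonRec

open Set FirstOrder

theorem strictMono_equiv_symm {X Y : Type*} [LinearOrder X] [LinearOrder Y] {τ : X ≃ Y}
    (h : StrictMono τ) : StrictMono τ.symm := fun a b hab => by
  rw [← h.lt_iff_lt]
  simpa using hab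

theorem strictAnti_equiv_symm {X Y : Type*} [LinearOrder X] [LinearOrder Y] {τ : X ≃ Y}
    (h : StrictAnti τ) : StrictAnti τ.symm := fun a b hab => by
  rw [← h.lt_iff_gt]
  simpa using hab

theorem Monotonic.symm {X Y : Type*} [LinearOrder X] [LinearOrder Y] {τ : X ≃ Y}
    (h : Monotonic τ) : Monotonic τ.symm := h.imp strictMono_equiv_symm strictAnti_equiv_symm

theorem Monotonic.isHomeo {X Y : Type*} [LinearOrder X] [LinearOrder Y] [DenselyOrdered X]
    [DenselyOrdered Y] [TopologicalSpace X] [TopologicalSpace Y] [OrderTopology X]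
    [OrderTopology Y] {τ : X ≃ Y} (h : Monotonic τ) : IsHomeo τ :=
  ⟨h.continuous τ.surjective, h.symm.continuous τ.symm.surjective⟩

theorem mem_ep_iff_supp {L : Type u} [LinearOrder L] [NoMinOrder L] [NoMaxOrder L] [Nonempty L]
    [DenselyOrdered L] {G : Subgroup (AutED L)} (hG : IsMN3 G) {x : Cpl L} :
    x ∈ Ep G ↔ ∃ g : G, IsGLB (supp (g : AutED L)) x ∨ IsLUB (supp (g : AutED L)) x := by
  constructor
  · rintro ⟨g, hg, hx⟩
    exact ⟨⟨g, hg⟩, hx.imp (isGLB_var_iff hG (g := ⟨g, hg⟩)).1.1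
      (isGLB_var_iff hG (g := ⟨g, hg⟩)).2.1⟩
  · rintro ⟨g, hx⟩
    exact ⟨g, g.2, hx.imp (isGLB_var_iff hG).1.2 (isGLB_var_iff hG).2.2⟩

/-! ### Monotonic bijections that induce isomorphisms of two groups. -/

section Two

variable {L₁ : Type u} [LinearOrder L₁] [NoMinOrder L₁] [NoMaxOrder L₁] [Nonempty L₁]
  {L₂ : Type v} [LinearOrder L₂] [NoMinOrder L₂] [NoMaxOrder L₂] [Nonempty L₂]
  {G₁ : Subgroup (AutED L₁)} {G₂ : Subgroup (AutED L₂)} {α : G₁ ≃* G₂} {τ : Cpl L₁ ≃ Cpl L₂}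

theorem induces_iff : Induces τ α ↔ ∀ (g : G₁) (x : Cpl L₁), τ (g • x) = α g • τ x := by
  constructor
  · intro h g x
    have := h g (τ x)
    rw [Equiv.symm_apply_apply] at this
    exact this.symm
  · intro h g y
    have := h g (τ.symm y)
    rw [Equiv.apply_symm_apply] at this
    exact this.symm

theorem ed_iff_of_monotonic (hm : Monotonic τ) (a b c d : Cpl L₁) :
    Ed (τ a) (τ b) (τ c) (τ d) ↔ Ed a b c d := hm.isEDIso a b c d

/-- A monotonic bijection that induces a group isomorphism gives isomorphisms of the actions. -/
theorem isActIso_of_induces (hm : Monotonic τ) (hτ : Induces τ α) {X : Set (Cpl L₁)}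
    {Y : Set (Cpl L₂)} (hXY : ∀ x, x ∈ X ↔ τ x ∈ Y) : IsActIso X Y τ α := by
  rw [induces_iff] at hτ
  let e : X ≃ Y := τ.subtypeEquiv hXY
  let Φ : ACT X G₁ ≃ ACT Y G₂ := Equiv.sumCongr e α.toEquiv
  have hpt : ∀ x : X, Φ (ACT.pt x) = ACT.pt (e x) := fun x => rfl
  have hgr : ∀ g : G₁, Φ (ACT.gr g) = ACT.gr (α g) := fun g => rfl
  have he : ∀ x : X, (e x : Cpl L₂) = τ x := fun x => rfl
  refine ⟨{ toEquiv := Φ, map_fun' := fun f => Empty.elim f, map_rel' := ?_ },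
    fun x => ⟨e x, he x, hpt x⟩, hgr⟩
  intro n R x
  cases R
  · change (∃ y : Y, Φ (x 0) = ACT.pt y) ↔ ∃ y : X, x 0 = ACT.pt y
    simp only [e.surjective.exists, ← hpt, Φ.injective.eq_iff]
  · change (∃ y : G₂, Φ (x 0) = ACT.gr y) ↔ ∃ y : G₁, x 0 = ACT.gr y
    simp only [α.surjective.exists, ← hgr, Φ.injective.eq_iff]
  · change (∃ a b c d : Y, Φ (x 0) = ACT.pt a ∧ Φ (x 1) = ACT.pt b ∧ Φ (x 2) = ACT.pt c ∧
      Φ (x 3) = ACT.pt d ∧ Ed (a : Cpl L₂) b c d) ↔ ∃ a b c d : X, x 0 = ACT.pt a ∧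
      x 1 = ACT.pt b ∧ x 2 = ACT.pt c ∧ x 3 = ACT.pt d ∧ Ed (a : Cpl L₁) b c d
    simp only [e.surjective.exists, ← hpt, Φ.injective.eq_iff, he, ed_iff_of_monotonic hm]
  · change (∃ f g h : G₂, Φ (x 0) = ACT.gr f ∧ Φ (x 1) = ACT.gr g ∧ Φ (x 2) = ACT.gr h ∧
      f * g = h) ↔ ∃ f g h : G₁, x 0 = ACT.gr f ∧ x 1 = ACT.gr g ∧ x 2 = ACT.gr h ∧ f * g = h
    simp only [α.surjective.exists, ← hgr, Φ.injective.eq_iff, ← map_mul, α.injective.eq_iff]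
  · change (∃ (g : G₂) (a b : Y), Φ (x 0) = ACT.gr g ∧ Φ (x 1) = ACT.pt a ∧
      Φ (x 2) = ACT.pt b ∧ g • (a : Cpl L₂) = b) ↔ ∃ (g : G₁) (a b : X), x 0 = ACT.gr g ∧
      x 1 = ACT.pt a ∧ x 2 = ACT.pt b ∧ g • (a : Cpl L₁) = b
    simp only [α.surjective.exists, e.surjective.exists, ← hgr, ← hpt, Φ.injective.eq_iff, he,
      ← hτ, τ.injective.eq_iff]

theorem orbit_eq (G : Subgroup (AutED L₁)) (x : Cpl L₁) : orbit G x = range (fun g : G => g • x) := by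
  ext y
  constructor
  · rintro ⟨g, hg, rfl⟩
    exact ⟨⟨g, hg⟩, rfl⟩
  · rintro ⟨g, rfl⟩
    exact ⟨g, g.2, rfl⟩

theorem image_orbit (hτ : Induces τ α) (x : Cpl L₁) : τ '' orbit G₁ x = orbit G₂ (τ x) := by
  rw [induces_iff] at hτ
  rw [orbit_eq, orbit_eq, ← range_comp]
  ext y
  constructor
  · rintro ⟨g, rfl⟩
    exact ⟨α g, (hτ g x).symm⟩
  · rintro ⟨g, rfl⟩
    refine ⟨α.symm g, ?_⟩
    simp [hτ]

variable [DenselyOrdered L₁] [DenselyOrdered L₂]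

/-- The inequality defines a closed set of points, and `L` is dense in the completion. -/
theorem pwLE_iff {G : Subgroup (AutED L₁)} {f g : G} :
    PwLE (f : AutED L₁) g ↔ ∀ x : Cpl L₁, f • x ≤ g • x := by
  constructor
  · intro h
    have hc : ∀ g : G, Continuous (fun x : Cpl L₁ => g • x) := fun g =>
      (monotonic_smul_cpl g).continuous (MulAction.surjective g)
    have hcl : IsClosed {x : Cpl L₁ | f • x ≤ g • x} := isClosed_le (hc f) (hc g)
    have hsub : range (Cpl.of : L₁ → Cpl L₁) ⊆ {x : Cpl L₁ | f • x ≤ g • x} := by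
      rintro _ ⟨a, rfl⟩
      change f • Cpl.of a ≤ g • Cpl.of a
      rw [smul_of, smul_of]
      exact not_lt.1 fun hlt => absurd (h a) (not_le.2 (Cpl.of_lt_of.1 hlt))
    have := hcl.closure_subset_iff.2 hsub
    rw [Cpl.dense_range_of.closure_eq] at this
    exact fun x => this trivial
  · intro h a
    have := h (Cpl.of a)
    rw [smul_of, smul_of] at this
    exact not_lt.1 fun hlt => absurd this (not_le.2 (Cpl.of_lt_of.2 hlt))

theorem pwLE_map_of_strictMono (hm : StrictMono τ) (hτ : Induces τ α) (f g : G₁) :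
    PwLE (α f : AutED L₂) (α g) ↔ PwLE (f : AutED L₁) g := by
  rw [induces_iff] at hτ
  simp only [pwLE_iff, τ.surjective.forall, ← hτ, hm.le_iff_le]

theorem pwLE_map_of_strictAnti (hm : StrictAnti τ) (hτ : Induces τ α) (f g : G₁) :
    PwLE (α f : AutED L₂) (α g) ↔ PwLE (g : AutED L₁) f := by
  rw [induces_iff] at hτ
  simp only [pwLE_iff, τ.surjective.forall, ← hτ, hm.le_iff_ge]

theorem PwLE.antisymm {f g : AutED L₁} (h : PwLE f g) (h' : PwLE g f) : f = g :=
  Subtype.ext (Equiv.ext fun x => le_antisymm (h x) (h' x))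

/-- If `τ` reversed order, `α` would both preserve and reverse the pointwise order, and comparable
elements would be equal. -/
theorem strictMono_of_preserves (hm : Monotonic τ) (hτ : Induces τ α) (ho : HasNontrivialOrder G₁)
    (h : ∀ f g : G₁, PwLE (α f : AutED L₂) (α g) ↔ PwLE (f : AutED L₁) g) : StrictMono τ := by
  rcases hm with hm | hm
  · exact hm
  · obtain ⟨f, hf, g, hg, hfg, hne⟩ := ho
    have h1 := (h ⟨f, hf⟩ ⟨g, hg⟩).2 hfg
    rw [pwLE_map_of_strictAnti hm hτ] at h1
    exact absurd (hfg.antisymm h1) hne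

theorem respectsOrbitsAndOrder (hm : Monotonic τ) (hτ : Induces τ α) :
    RespectsOrbitsAndOrder τ α where
  bijOn_orbits := by
    refine ⟨?_, (image_injective.2 τ.injective).injOn, ?_⟩
    · rintro _ ⟨x, rfl⟩
      exact ⟨τ x, (image_orbit hτ x).symm⟩
    · rintro _ ⟨y, rfl⟩
      refine ⟨orbit G₁ (τ.symm y), ⟨_, rfl⟩, ?_⟩
      change τ '' _ = _
      rw [image_orbit hτ, τ.apply_symm_apply]
  actIso_orbit M _ := isActIso_of_induces hm hτ fun x => (τ.injective.mem_set_image).symm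
  preserves_or_reverses := by
    rcases hm with hm | hm
    · exact Or.inl ⟨hm, fun M _ => hm.strictMonoOn M, pwLE_map_of_strictMono hm hτ⟩
    · exact Or.inr ⟨hm, fun M _ => hm.strictAntiOn M, pwLE_map_of_strictAnti hm hτ⟩
  strictMono_of_order := strictMono_of_preserves hm hτ

theorem supp_map (hτ : Induces τ α) (g : G₁) : supp (α g : AutED L₂) = τ '' supp (g : AutED L₁) := by
  rw [induces_iff] at hτ
  rw [← sp_cpl, ← sp_cpl]
  ext y
  obtain ⟨x, rfl⟩ := τ.surjective y
  rw [τ.injective.mem_set_image, mem_sp, mem_sp, ← hτ, ne_eq, τ.injective.eq_iff]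

theorem strictMono_map_iff (hm : Monotonic τ) (hτ : Induces τ α) (g : G₁) :
    StrictMono (α g : AutED L₂).1 ↔ StrictMono (g : AutED L₁).1 := by
  rw [induces_iff] at hτ
  rw [← inc_cpl_iff, ← inc_cpl_iff]
  constructor
  · intro h x y hxy
    rcases hm with hm | hm
    · have := h (hm hxy)
      simp only [← hτ] at this
      exact hm.lt_iff_lt.1 this
    · have := h (hm hxy)
      simp only [← hτ] at this
      exact hm.lt_iff_gt.1 this
  · intro h x y hxy
    obtain ⟨x, rfl⟩ := τ.surjective x
    obtain ⟨y, rfl⟩ := τ.surjective y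
    simp only [← hτ]
    rcases hm with hm | hm
    · exact hm (h (hm.lt_iff_lt.1 hxy))
    · exact hm (h (hm.lt_iff_gt.1 hxy))

theorem mem_ep_map_iff (h₁ : IsMN3 G₁) (h₂ : IsMN3 G₂) (hm : Monotonic τ) (hτ : Induces τ α)
    (x : Cpl L₁) : x ∈ Ep G₁ ↔ τ x ∈ Ep G₂ := by
  have key : ∀ g : G₁, ∀ x, (IsGLB (supp (g : AutED L₁)) x ∨ IsLUB (supp (g : AutED L₁)) x) ↔
      (IsGLB (supp (α g : AutED L₂)) (τ x) ∨ IsLUB (supp (α g : AutED L₂)) (τ x)) := by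
    intro g x
    rw [supp_map hτ]
    rcases hm with hm | hm
    · let e : Cpl L₁ ≃o Cpl L₂ := ⟨τ, hm.le_iff_le⟩
      exact or_congr (e.isGLB_image' (x := x)).symm (e.isLUB_image' (x := x)).symm
    · let e : Cpl L₁ ≃o (Cpl L₂)ᵒᵈ := ⟨τ.trans OrderDual.toDual, hm.le_iff_ge⟩
      -- A reversing `τ` exchanges greatest lower and least upper bounds.
      rw [or_comm]
      exact or_congr (e.isLUB_image' (x := x)).symm (e.isGLB_image' (x := x)).symm
  rw [mem_ep_iff_supp h₁, mem_ep_iff_supp h₂, α.surjective.exists]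
  exact exists_congr fun g => key g x

theorem monotonic_of_cases (h : Monotonic τ ∨ IsEDIso τ ∨ IsHomeo τ) : Monotonic τ := by
  rcases h with h | h | h
  · exact h
  · exact h.monotonic
  · exact monotonic_of_continuous Cpl.exists_isLUB h.1 τ.injective

theorem Induces.unique (h₁ : IsMN3 G₁) {τ' : Cpl L₁ ≃ Cpl L₂} (hm : Monotonic τ)
    (hm' : Monotonic τ') (hτ : Induces τ α) (hτ' : Induces τ' α) : τ' = τ := by
  have := h₁.locMove
  rw [induces_iff] at hτ hτ'
  exact eq_of_equivariant (A := G₁) hm.isHomeo.2 hm'.isHomeo.1 (φ := fun g y => α g • y) hτ hτ'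

theorem exists_monotonic_induces (h₁ : IsMN3 G₁) (h₂ : IsMN3 G₂) (α : G₁ ≃* G₂) :
    ∃ τ : Cpl L₁ ≃ Cpl L₂, Monotonic τ ∧ Induces τ α := by
  have := h₁.locMove
  have := h₂.locMove
  obtain ⟨τ, hm, h⟩ := exists_monotonic_equivariant (X := Cpl L₁) (Y := Cpl L₂) α
  exact ⟨τ, hm, induces_iff.2 h⟩

/-- Group isomorphisms are induced by unique monotonic bijections. -/
theorem group_iso_induced (h₁ : IsMN3 G₁) (h₂ : IsMN3 G₂) (α : G₁ ≃* G₂) :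
    ∃ τ : Cpl L₁ ≃ Cpl L₂, Monotonic τ ∧ IsEDIso τ ∧ IsHomeo τ ∧ Induces τ α ∧
      (∀ τ' : Cpl L₁ ≃ Cpl L₂, Monotonic τ' ∨ IsEDIso τ' ∨ IsHomeo τ' → Induces τ' α → τ' = τ) ∧
      IsActIso Set.univ Set.univ τ α ∧ IsActIso (Ep G₁) (Ep G₂) τ α ∧
      RespectsOrbitsAndOrder τ α := by
  obtain ⟨τ, hm, hτ⟩ := exists_monotonic_induces h₁ h₂ α
  exact ⟨τ, hm, hm.isEDIso, hm.isHomeo, hτ,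
    fun τ' h' hτ' => Induces.unique h₁ hm (monotonic_of_cases h') hτ hτ',
    isActIso_of_induces hm hτ (fun _ => Iff.rfl), isActIso_of_induces hm hτ
    (mem_ep_map_iff h₁ h₂ hm hτ), respectsOrbitsAndOrder hm hτ⟩

end Two

/-! ### Automorphisms of one group as elements of its normalizer. -/

section One

variable {L : Type u} [LinearOrder L] [NoMinOrder L] [NoMaxOrder L] [Nonempty L] [DenselyOrdered L]
  {G : Subgroup (AutED L)}

theorem mem_permCpl {σ : Equiv.Perm (Cpl L)} : σ ∈ permCpl G ↔ ∃ g : G, (bar (g : AutED L)).1 = σ := by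
  constructor
  · rintro ⟨_, ⟨g, hg, rfl⟩, rfl⟩
    exact ⟨⟨g, hg⟩, rfl⟩
  · rintro ⟨g, rfl⟩
    exact ⟨_, ⟨g, g.2, rfl⟩, rfl⟩

theorem bar_injective : Function.Injective (bar : AutED L → AutED (Cpl L)) := by
  intro f g h
  ext a
  have h1 := bar_of f a
  rw [h, bar_of] at h1
  exact (Cpl.of_injective h1).symm

theorem bar_val_injective {f g : AutED L} (h : (bar f).1 = (bar g).1) : f = g :=
  bar_injective (Subtype.ext h)

theorem induces_iff_conj {α : MulAut G} {τ : Equiv.Perm (Cpl L)} :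
    Induces τ α ↔ ∀ g : G, (bar (α g : AutED L)).1 = τ * (bar (g : AutED L)).1 * τ⁻¹ :=
  forall_congr' fun g =>
    (Equiv.ext_iff (f := (bar (α g : AutED L)).1) (g := τ * (bar (g : AutED L)).1 * τ⁻¹)).symm

theorem Induces.mul {α β : MulAut G} {σ τ : Equiv.Perm (Cpl L)} (hσ : Induces σ α)
    (hτ : Induces τ β) : Induces (σ * τ) (α * β) := by
  rw [induces_iff_conj] at *
  intro g
  rw [MulAut.mul_apply, hσ, hτ]
  group

theorem Induces.injective {α β : MulAut G} {τ : Equiv.Perm (Cpl L)} (hα : Induces τ α)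
    (hβ : Induces τ β) : α = β := by
  rw [induces_iff_conj] at *
  ext1 g
  exact Subtype.ext (bar_val_injective ((hα g).trans (hβ g).symm))

/-- By `monotonic_of_continuous` homeomorphisms are monotonic, and monotonic permutations are
homeomorphisms. This is why the two normalizers coincide. -/
theorem homeoGroup_eq : homeoGroup (Cpl L) = AutED (Cpl L) := by
  ext τ
  constructor
  · intro h
    exact (monotonic_of_continuous Cpl.exists_isLUB h.1 τ.injective).isEDIso
  · intro h
    exact (IsEDIso.monotonic h).isHomeo

theorem normAut_eq_normHomeo : normAut G = normHomeo G := by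
  rw [normAut, normHomeo, homeoGroup_eq]

theorem exists_mulAut_of_conj {H P : Type*} [Group H] [Group P] (ρ : H →* P)
    (hρ : Function.Injective ρ) (σ : P) (h : ∀ n, n ∈ ρ.range ↔ σ * n * σ⁻¹ ∈ ρ.range) :
    ∃ α : MulAut H, ∀ g, ρ (α g) = σ * ρ g * σ⁻¹ := by
  have h1 : ∀ g : H, ∃ g' : H, ρ g' = σ * ρ g * σ⁻¹ := fun g => (h _).1 ⟨g, rfl⟩
  have h2 : ∀ g : H, ∃ g' : H, ρ g' = σ⁻¹ * ρ g * σ := fun g => (h _).2 ⟨g, by group⟩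
  choose f hf using h1
  choose f' hf' using h2
  have left_inv : ∀ g, f' (f g) = g := fun g => hρ (by rw [hf', hf]; group)
  have right_inv : ∀ g, f (f' g) = g := fun g => hρ (by rw [hf, hf']; group)
  have map_mul : ∀ g g', f (g * g') = f g * f g' := fun g g' =>
    hρ (by rw [hf, map_mul, map_mul, hf, hf]; group)
  exact ⟨MulEquiv.mk' ⟨f, f', left_inv, right_inv⟩ map_mul, hf⟩

/-- A multiplicative relation that is total and unique in both directions is the graph of an
isomorphism. It is applied to the relation that a permutation induces an automorphism. -/
theorem exists_mulEquiv_of_rel {N A : Type*} [Group N] [Group A] (R : N → A → Prop)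
    (mul : ∀ n m a b, R n a → R m b → R (n * m) (a * b)) (ex : ∀ a, ∃ n, R n a)
    (ex' : ∀ n, ∃ a, R n a) (un : ∀ n m a, R n a → R m a → n = m)
    (un' : ∀ n a b, R n a → R n b → a = b) : ∃ Φ : N ≃* A, ∀ n, R n (Φ n) := by
  choose f hf using ex'
  choose f' hf' using ex
  exact ⟨MulEquiv.mk' ⟨f, f', fun n => un _ _ _ (hf' _) (hf n), fun a => un' _ _ _ (hf _) (hf' a)⟩
    fun n m => un' _ _ _ (hf _) (mul _ _ _ _ (hf n) (hf m)), hf⟩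

theorem mem_normHomeo_iff {τ : Equiv.Perm (Cpl L)} : τ ∈ normHomeo G ↔ Monotonic τ ∧
    ∀ σ, σ ∈ permCpl G ↔ τ * σ * τ⁻¹ ∈ permCpl G := by
  rw [normHomeo, homeoGroup_eq, Subgroup.mem_inf, ← isEDIso_iff, Subgroup.mem_normalizer_iff]
  rfl

theorem mem_normHomeo_iff_induces {τ : Equiv.Perm (Cpl L)} : τ ∈ normHomeo G ↔ Monotonic τ ∧
    ∃ α : MulAut G, Induces τ α := by
  rw [mem_normHomeo_iff]
  refine and_congr_right fun _ => ?_
  simp only [induces_iff_conj]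
  constructor
  · intro h
    refine exists_mulAut_of_conj (((AutED (Cpl L)).subtype.comp bar).comp G.subtype)
      (fun f g hfg => Subtype.ext (bar_val_injective hfg)) τ fun n => ?_
    have h1 : ∀ n, n ∈ (((AutED (Cpl L)).subtype.comp bar).comp G.subtype).range ↔
        n ∈ permCpl G := fun n => mem_permCpl.symm
    rw [h1, h1, h]
  · rintro ⟨α, hα⟩ σ
    constructor
    · intro hσ
      obtain ⟨g, rfl⟩ := mem_permCpl.1 hσ
      exact mem_permCpl.2 ⟨α g, hα g⟩
    · intro hσ
      obtain ⟨g', hg'⟩ := mem_permCpl.1 hσ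
      refine mem_permCpl.2 ⟨α.symm g', ?_⟩
      have := hα (α.symm g')
      rw [MulEquiv.apply_symm_apply, hg'] at this
      simpa using this.symm

theorem IsMN3.autIsNormalizer (hG : IsMN3 G) : AutIsNormalizer G := by
  refine ⟨fun α => ?_, normAut_eq_normHomeo, ?_⟩
  · obtain ⟨τ, hm, hτ⟩ := exists_monotonic_induces hG hG α
    exact ⟨τ, ⟨hm.isEDIso, hτ⟩, fun τ' h =>
      Induces.unique hG hm (IsEDIso.monotonic h.1) hτ h.2⟩
  · refine exists_mulEquiv_of_rel (fun (τ : normHomeo G) α => Induces (τ : Equiv.Perm (Cpl L)) α)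
      (fun _ _ _ _ h h' => Induces.mul h h') (fun α => ?_)
      (fun τ => (mem_normHomeo_iff_induces.1 τ.2).2) (fun τ τ' α h h' => ?_)
      fun _ _ _ h h' => Induces.injective h h'
    · obtain ⟨τ, hm, hτ⟩ := exists_monotonic_induces hG hG α
      exact ⟨⟨τ, mem_normHomeo_iff_induces.2 ⟨hm, α, hτ⟩⟩, hτ⟩
    · exact Subtype.ext (Induces.unique hG (mem_normHomeo_iff_induces.1 τ'.2).1
        (mem_normHomeo_iff_induces.1 τ.2).1 h' h)

theorem normHomeo_le {N : Subgroup (AutED L)} (hN : N ≤ G) (h : ∀ (α : MulAut G)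
    (τ : Equiv.Perm (Cpl L)), Monotonic τ → Induces τ α → ∀ g : G, (α g : AutED L) ∈ N ↔
      (g : AutED L) ∈ N) : normHomeo G ≤ normHomeo N := by
  intro τ hτ
  obtain ⟨hm, α, hα⟩ := mem_normHomeo_iff_induces.1 hτ
  have hconj := induces_iff_conj.1 hα
  rw [mem_normHomeo_iff]
  refine ⟨hm, fun σ => ⟨fun hσ => ?_, fun hσ => ?_⟩⟩
  · obtain ⟨g, rfl⟩ := mem_permCpl.1 hσ
    have := hconj ⟨g, hN g.2⟩
    exact mem_permCpl.2 ⟨⟨_, (h α τ hm hα ⟨g, hN g.2⟩).2 g.2⟩, this⟩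
  · obtain ⟨g', hg'⟩ := mem_permCpl.1 hσ
    have h1 := hconj (α.symm ⟨g', hN g'.2⟩)
    rw [MulEquiv.apply_symm_apply] at h1
    refine mem_permCpl.2 ⟨⟨_, (h α τ hm hα (α.symm ⟨g', hN g'.2⟩)).1 ?_⟩, ?_⟩
    · rw [MulEquiv.apply_symm_apply]
      exact g'.2
    · simpa [hg'] using h1.symm

/-! ### Behaviour of the distinguished subgroups under automorphisms. -/

section Char

variable {α : MulAut G} {τ : Equiv.Perm (Cpl L)}

theorem mem_opp_map_iff (hm : Monotonic τ) (hτ : Induces τ α) (g : G) :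
    (α g : AutED L) ∈ Opp G ↔ (g : AutED L) ∈ Opp G :=
  ⟨fun h => ⟨g.2, (strictMono_map_iff hm hτ g).1 h.2⟩,
    fun h => ⟨(α g).2, (strictMono_map_iff hm hτ g).2 h.2⟩⟩

theorem bddAbove_supp_map_iff (hm : StrictMono τ) (hτ : Induces τ α) (g : G) :
    (BddAbove (supp (α g : AutED L)) ↔ BddAbove (supp (g : AutED L))) ∧
    (BddBelow (supp (α g : AutED L)) ↔ BddBelow (supp (g : AutED L))) := by
  rw [supp_map hτ]
  let e : Cpl L ≃o Cpl L := ⟨τ, hm.le_iff_le⟩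
  exact ⟨e.bddAbove_image, e.bddBelow_image⟩

theorem bddAbove_supp_map_iff_of_anti (hm : StrictAnti τ) (hτ : Induces τ α) (g : G) :
    (BddAbove (supp (α g : AutED L)) ↔ BddBelow (supp (g : AutED L))) ∧
    (BddBelow (supp (α g : AutED L)) ↔ BddAbove (supp (g : AutED L))) := by
  rw [supp_map hτ]
  let e : Cpl L ≃o (Cpl L)ᵒᵈ := ⟨τ.trans OrderDual.toDual, hm.le_iff_ge⟩
  exact ⟨e.bddBelow_image, e.bddAbove_image⟩

/-- An intermediate group `N` is allowed because the lemma is needed for automorphisms of `Opp G` as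
well as of `G`. -/
theorem mem_bdd_map_iff {N : Subgroup (AutED L)} (hN : N ≤ G) {α : MulAut N}
    (hm : Monotonic τ) (hτ : Induces τ α) (g : N) :
    (α g : AutED L) ∈ Bdd G ↔ (g : AutED L) ∈ Bdd G := by
  rw [mem_bdd_iff, mem_bdd_iff]
  simp only [hN g.2, hN (α g).2, true_and]
  rcases hm with hm | hm
  · rw [(bddAbove_supp_map_iff hm hτ g).1, (bddAbove_supp_map_iff hm hτ g).2]
  · rw [(bddAbove_supp_map_iff_of_anti hm hτ g).1, (bddAbove_supp_map_iff_of_anti hm hτ g).2,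
      and_comm]

theorem commutator_subgroupOf {P : Type*} [Group P] {N H : Subgroup P} (h : N ≤ H) :
    ⁅N, N⁆.subgroupOf H = ⁅N.subgroupOf H, N.subgroupOf H⁆ := by
  apply Subgroup.map_injective H.subtype_injective
  rw [Subgroup.map_commutator, Subgroup.subgroupOf_map_subtype, Subgroup.subgroupOf_map_subtype,
    inf_eq_left.2 h, inf_eq_left.2 ((Subgroup.commutator_le_self N).trans h)]

theorem characteristic_of_mem_iff {P : Type*} [Group P] {N H : Subgroup P}
    (h : ∀ (α : MulAut H) (g : H), (α g : P) ∈ N ↔ (g : P) ∈ N) :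
    (N.subgroupOf H).Characteristic := by
  rw [Subgroup.characteristic_iff_comap_eq]
  intro φ
  ext g
  exact h φ g

theorem IsMN3.characteristic (hG : IsMN3 G) : ((Opp G).subgroupOf G).Characteristic ∧
    ((Bdd G).subgroupOf G).Characteristic ∧ ((BddDer G).subgroupOf G).Characteristic := by
  have h1 : ((Bdd G).subgroupOf G).Characteristic := characteristic_of_mem_iff fun α g => by
    obtain ⟨τ, hm, hτ⟩ := exists_monotonic_induces hG hG α
    exact mem_bdd_map_iff le_rfl hm hτ g
  refine ⟨characteristic_of_mem_iff fun α g => ?_, h1, ?_⟩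
  · obtain ⟨τ, hm, hτ⟩ := exists_monotonic_induces hG hG α
    exact mem_opp_map_iff hm hτ g
  -- The derived group of a characteristic subgroup is characteristic.
  · rw [BddDer, commutator_subgroupOf bdd_le]
    infer_instance

theorem normHomeo_chain : normHomeo G ≤ normHomeo (Opp G) ∧
    normHomeo (Opp G) ≤ normHomeo (Bdd G) ∧ normHomeo (Bdd G) ≤ normHomeo (BddDer G) := by
  refine ⟨normHomeo_le opp_le fun α τ hm hτ => mem_opp_map_iff hm hτ,
    normHomeo_le bdd_le_opp fun α τ hm hτ => mem_bdd_map_iff opp_le hm hτ,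
    normHomeo_le bddDer_le_bdd fun α τ _ _ g => ?_⟩
  have h : ((BddDer G).subgroupOf (Bdd G)).Characteristic := by
    have h1 : (Bdd G).subgroupOf (Bdd G) = ⊤ := Subgroup.subgroupOf_self _
    rw [BddDer, commutator_subgroupOf le_rfl, h1]
    infer_instance
  have := Subgroup.characteristic_iff_comap_eq.1 h α
  exact SetLike.ext_iff.1 this g

/-- A bijection that induces an automorphism of `G` is already determined by its compatibility with
`N`, as `N` is rich enough for `eq_of_equivariant`. -/
theorem eq_of_agree {N : Subgroup (AutED L)} (hG : IsMN3 G) (hN : IsMN3 N) (hle : N ≤ G)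
    {α β : MulAut G} (h : ∀ g : G, (g : AutED L) ∈ N → α g = β g) : α = β := by
  have := hN.locMove
  obtain ⟨τ, hm, hτ⟩ := exists_monotonic_induces hG hG α
  obtain ⟨σ, hm', hσ⟩ := exists_monotonic_induces hG hG β
  have h1 : σ = τ := eq_of_equivariant (A := N) hm.isHomeo.2 hm'.isHomeo.1
    (φ := fun g y => α ⟨g, hle g.2⟩ • y) (fun g x => induces_iff.1 hτ ⟨g, hle g.2⟩ x)
    (fun g x => by
      rw [h ⟨g, hle g.2⟩ g.2]
      exact induces_iff.1 hσ ⟨g, hle g.2⟩ x)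
  subst h1
  exact hτ.injective hσ

theorem map_subgroupOf_eq {P : Type*} [Group P] {N M H : Subgroup P} {α : MulAut H}
    (h : ∀ g : H, (α g : P) ∈ M ↔ (g : P) ∈ N) :
    (N.subgroupOf H).map α.toMonoidHom = M.subgroupOf H := by
  ext g
  constructor
  · rintro ⟨g, hg, rfl⟩
    exact (h g).2 hg
  · intro hg
    exact ⟨α.symm g, (h _).1 (by rwa [MulEquiv.apply_symm_apply]), MulEquiv.apply_symm_apply α g⟩

theorem map_lft_rt_of_strictMono (hm : StrictMono τ) (hτ : Induces τ α) :
    ((Lft G).subgroupOf G).map α.toMonoidHom = (Lft G).subgroupOf G ∧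
      ((Rt G).subgroupOf G).map α.toMonoidHom = (Rt G).subgroupOf G :=
  ⟨map_subgroupOf_eq fun g => ⟨fun h => ⟨g.2, (bddAbove_supp_map_iff hm hτ g).1.1 h.2⟩,
      fun h => ⟨(α g).2, (bddAbove_supp_map_iff hm hτ g).1.2 h.2⟩⟩,
    map_subgroupOf_eq fun g => ⟨fun h => ⟨g.2, (bddAbove_supp_map_iff hm hτ g).2.1 h.2⟩,
      fun h => ⟨(α g).2, (bddAbove_supp_map_iff hm hτ g).2.2 h.2⟩⟩⟩

theorem map_lft_rt_of_strictAnti (hm : StrictAnti τ) (hτ : Induces τ α) :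
    ((Lft G).subgroupOf G).map α.toMonoidHom = (Rt G).subgroupOf G ∧
      ((Rt G).subgroupOf G).map α.toMonoidHom = (Lft G).subgroupOf G :=
  ⟨map_subgroupOf_eq fun g => ⟨fun h => ⟨g.2, (bddAbove_supp_map_iff_of_anti hm hτ g).2.1 h.2⟩,
      fun h => ⟨(α g).2, (bddAbove_supp_map_iff_of_anti hm hτ g).2.2 h.2⟩⟩,
    map_subgroupOf_eq fun g => ⟨fun h => ⟨g.2, (bddAbove_supp_map_iff_of_anti hm hτ g).1.1 h.2⟩,
      fun h => ⟨(α g).2, (bddAbove_supp_map_iff_of_anti hm hτ g).1.2 h.2⟩⟩⟩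

end Char

/-- Automorphisms that do not preserve the pointwise order are induced by order-reversing maps, and
the product of two of these is induced by an order-preserving one. -/
theorem IsMN3.index_oAut (hG : IsMN3 G) : (oAut G).index ≠ 0 ∧ (oAut G).index ≤ 2 := by
  have anti : ∀ α : MulAut G, α ∉ oAut G → ∃ τ : Equiv.Perm (Cpl L), StrictAnti τ ∧
      Induces τ α := by
    intro α hα
    obtain ⟨τ, hm | hm, hτ⟩ := exists_monotonic_induces hG hG α
    · exact absurd (pwLE_map_of_strictMono hm hτ) hα
    · exact ⟨τ, hm, hτ⟩
  have h2 : (oAut G).index ∣ 2 := by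
    by_cases h : ∀ α : MulAut G, α ∈ oAut G
    · rw [(Subgroup.eq_top_iff' _).2 h, Subgroup.index_top]
      exact one_dvd 2
    · push Not at h
      obtain ⟨a, ha⟩ := h
      rw [← Subgroup.relIndex_top_right, Subgroup.relIndex_dvd_two_iff]
      refine ⟨a, trivial, fun b _ => ?_⟩
      by_contra! hn
      obtain ⟨τ, hm, hτ⟩ := anti a ha
      obtain ⟨σ, hm', hσ⟩ := anti b hn.2
      have h3 : StrictMono (σ * τ : Equiv.Perm (Cpl L)) := fun x y hxy => hm' (hm hxy)
      exact hn.1 (pwLE_map_of_strictMono h3 (hσ.mul hτ))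
  exact ⟨fun h => by simp [h] at h2, Nat.le_of_dvd two_pos h2⟩

theorem strictMono_of_mem_oAut (ho : HasNontrivialOrder G) {α : MulAut G} (hα : α ∈ oAut G)
    {τ : Equiv.Perm (Cpl L)} (hm : Monotonic τ) (hτ : Induces τ α) : StrictMono τ :=
  strictMono_of_preserves hm hτ ho hα

theorem lft_lft : Lft (Lft G) = Lft G :=
  le_antisymm lft_le fun _ h => ⟨h, h.2⟩

theorem rt_rt : Rt (Rt G) = Rt G :=
  le_antisymm rt_le fun _ h => ⟨h, h.2⟩

/-- The statements on automorphisms and the subgroups of elements with support bounded on one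
side. -/
theorem IsMN3.one_sided (hG : IsMN3 G) {H : Subgroup (AutED L)} (hH : H = Lft G ∨ H = Rt G) :
    (HasNontrivialOrder G →
      (∀ α ∈ oAut G, (H.subgroupOf G).map α.toMonoidHom = H.subgroupOf G) ∧
      ∀ α ∈ oAut G, ∀ β ∈ oAut G, (∀ g ∈ H.subgroupOf G, α g = β g) → α = β) ∧
    (H ≠ Bdd G → ∀ α : MulAut H, ∃ τ : Equiv.Perm (Cpl L), StrictMono τ ∧ Induces τ α ∧
      ∀ τ' ∈ AutED (Cpl L), Induces τ' α → τ' = τ) := by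
  have hHG : H ≤ G := by
    rcases hH with rfl | rfl
    exacts [lft_le, rt_le]
  have hBH : Bdd G ≤ H := by
    rcases hH with rfl | rfl
    exacts [bdd_le_lft, bdd_le_rt]
  have hH3 : IsMN3 H := hG.bdd.mono hBH
  refine ⟨fun ho => ⟨fun α hα => ?_, fun α _ β _ h => ?_⟩, fun hne α => ?_⟩
  · obtain ⟨τ, hm, hτ⟩ := exists_monotonic_induces hG hG α
    have := map_lft_rt_of_strictMono (strictMono_of_mem_oAut ho hα hm hτ) hτ
    rcases hH with rfl | rfl
    exacts [this.1, this.2]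
  · exact eq_of_agree hG hH3 hHG h
  · obtain ⟨τ, hm, hτ⟩ := exists_monotonic_induces hH3 hH3 α
    refine ⟨τ, ?_, hτ, fun τ' hτ' h => Induces.unique hH3 hm (IsEDIso.monotonic hτ') hτ h⟩
    rcases hm with hm | hm
    · exact hm
    -- A reversing `τ` turns the bound of the support of `α g` on one side into a bound of the
    -- support of `g` on the other side, so all elements of `H` would be bounded.
    · refine absurd (le_antisymm (fun g hg => mem_bdd_iff.2 ⟨hHG hg, ?_⟩) hBH) hne
      have h1 := bddAbove_supp_map_iff_of_anti hm hτ ⟨g, hg⟩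
      have h2 := (α ⟨g, hg⟩).2
      rcases hH with rfl | rfl
      · exact ⟨hg.2, h1.1.1 h2.2⟩
      · exact ⟨h1.2.1 h2.2, hg.2⟩

end One

end MonRec

namespace MonRec

open Set FirstOrder

/-! ### Isomorphisms of actions on dense sets of points -/

section Dense

variable {L₁ : Type u} [LinearOrder L₁] [NoMinOrder L₁] [NoMaxOrder L₁] [Nonempty L₁]
  {L₂ : Type v} [LinearOrder L₂] [NoMinOrder L₂] [NoMaxOrder L₂] [Nonempty L₂]
  [DenselyOrdered L₁] [DenselyOrdered L₂]
  {G₁ : Subgroup (AutED L₁)} {G₂ : Subgroup (AutED L₂)}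

/-- An isomorphism of the actions on dense sets of points extends to the completions. -/
theorem exists_monotonic_of_act_equiv {X : Set (Cpl L₁)} {Y : Set (Cpl L₂)}
    (hX : ∀ a b, a < b → ∃ x ∈ X, x ∈ Ioo a b) (hi : ∀ (g : G₁), ∀ x ∈ X, g • x ∈ X) (hY : ∀ a b, a < b → ∃ y ∈ Y, y ∈ Ioo a b)
    (Φ : ACT X G₁ ≃[LMNPG] ACT Y G₂) :
    ∃ (τ : Cpl L₁ ≃ Cpl L₂) (α : G₁ ≃* G₂), Monotonic τ ∧ Induces τ α ∧ τ '' X = Y := by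
  have hpt : ∀ v : ACT X G₁, (∃ y : Y, Φ v = ACT.pt y) ↔ ∃ x : X, v = ACT.pt x := fun v =>
    Φ.map_rel' MNPGRel.pt ![v]
  have hgr : ∀ v : ACT X G₁, (∃ y : G₂, Φ v = ACT.gr y) ↔ ∃ x : G₁, v = ACT.gr x := fun v =>
    Φ.map_rel' MNPGRel.gr ![v]
  have e1 : ∀ x : X, ∃ y : Y, Φ (ACT.pt x) = ACT.pt y := fun x => (hpt _).2 ⟨x, rfl⟩
  have a1 : ∀ x : G₁, ∃ y : G₂, Φ (ACT.gr x) = ACT.gr y := fun x => (hgr _).2 ⟨x, rfl⟩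
  choose e he using e1
  choose α hα using a1
  have pinj : ∀ {x x' : X}, (ACT.pt x : ACT X G₁) = ACT.pt x' → x = x' := fun h => Sum.inl_injective h
  have pinj' : ∀ {x x' : Y}, (ACT.pt x : ACT Y G₂) = ACT.pt x' → x = x' := fun h =>
    Sum.inl_injective h
  have ginj : ∀ {x x' : G₁}, (ACT.gr x : ACT X G₁) = ACT.gr x' → x = x' := fun h =>
    Sum.inr_injective h
  have ginj' : ∀ {x x' : G₂}, (ACT.gr x : ACT Y G₂) = ACT.gr x' → x = x' := fun h =>
    Sum.inr_injective h
  have esurj : ∀ y : Y, ∃ x, e x = y := by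
    intro y
    obtain ⟨v, hv⟩ := Φ.surjective (ACT.pt y)
    obtain ⟨x, rfl⟩ := (hpt v).1 ⟨y, hv⟩
    exact ⟨x, pinj' ((he x).symm.trans hv)⟩
  have asurj : Function.Surjective α := by
    intro y
    obtain ⟨v, hv⟩ := Φ.surjective (ACT.gr y)
    obtain ⟨x, rfl⟩ := (hgr v).1 ⟨y, hv⟩
    exact ⟨x, ginj' ((hα x).symm.trans hv)⟩
  have ainj : Function.Injective α := fun f g h => by
    refine ginj (Φ.injective ?_)
    rw [hα, hα, h]
  have hmul : ∀ f g, α (f * g) = α f * α g := by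
    intro f g
    obtain ⟨f', g', h', h1, h2, h3, h4⟩ :=
      (Φ.map_rel' MNPGRel.comp ![ACT.gr f, ACT.gr g, ACT.gr (f * g)]).2 ⟨f, g, f * g, rfl, rfl, rfl, rfl⟩
    rw [← ginj' ((hα f).symm.trans h1), ← ginj' ((hα g).symm.trans h2),
      ← ginj' ((hα _).symm.trans h3)] at h4
    exact h4.symm
  have hed : ∀ a b c d : X, Ed (a : Cpl L₁) b c d → Ed (e a : Cpl L₂) (e b) (e c) (e d) := by
    intro a b c d h
    obtain ⟨a', b', c', d', h1, h2, h3, h4, h5⟩ :=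
      (Φ.map_rel' MNPGRel.ed ![ACT.pt a, ACT.pt b, ACT.pt c, ACT.pt d]).2
        ⟨a, b, c, d, rfl, rfl, rfl, rfl, h⟩
    rw [← pinj' ((he a).symm.trans h1), ← pinj' ((he b).symm.trans h2),
      ← pinj' ((he c).symm.trans h3), ← pinj' ((he d).symm.trans h4)] at h5
    exact h5
  have hap : ∀ (g : G₁) (x y : X), g • (x : Cpl L₁) = y → α g • (e x : Cpl L₂) = e y := by
    intro g x y h
    obtain ⟨g', x', y', h1, h2, h3, h4⟩ :=
      (Φ.map_rel' MNPGRel.ap ![ACT.gr g, ACT.pt x, ACT.pt y]).2 ⟨g, x, y, rfl, rfl, rfl, h⟩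
    rw [← ginj' ((hα g).symm.trans h1), ← pinj' ((he x).symm.trans h2),
      ← pinj' ((he y).symm.trans h3)] at h4
    exact h4
  have hv : ∀ a b : Cpl L₂, a < b → ∃ i : X, (e i : Cpl L₂) ∈ Ioo a b := by
    intro a b hab
    obtain ⟨y, hy, h⟩ := hY a b hab
    obtain ⟨x, hx⟩ := esurj ⟨y, hy⟩
    exact ⟨x, by rwa [hx]⟩
  have hu : ∀ a b : Cpl L₁, a < b → ∃ i : X, (i : Cpl L₁) ∈ Ioo a b := fun a b hab => by
    obtain ⟨x, hx, h⟩ := hX a b hab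
    exact ⟨⟨x, hx⟩, h⟩
  suffices H : ∃ τ : Cpl L₁ ≃ Cpl L₂, Monotonic τ ∧ ∀ x : X, τ x = e x by
    obtain ⟨τ, hm, hτ⟩ := H
    refine ⟨τ, MulEquiv.mk' (Equiv.ofBijective α ⟨ainj, asurj⟩) hmul, hm, induces_iff.2 ?_, ?_⟩
    · intro g
      have hd : Dense X := by
        rw [dense_iff_inter_open]
        rintro U hU ⟨x, hx⟩
        obtain ⟨a, b, hab, hs⟩ := exists_Ioo_of_mem_open hU hx
        obtain ⟨y, hy, h⟩ := hX a b (hab.1.trans hab.2)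
        exact ⟨y, hs h, hy⟩
      refine congrFun (Continuous.ext_on hd
        (hm.isHomeo.1.comp ((monotonic_smul_cpl g).continuous (MulAction.surjective g)))
        (((monotonic_smul_cpl (α g)).continuous (MulAction.surjective (α g))).comp hm.isHomeo.1) ?_)
      intro x hx
      change τ (g • x) = α g • τ x
      rw [hτ ⟨x, hx⟩, hτ ⟨g • x, hi g x hx⟩]
      exact (hap g ⟨x, hx⟩ ⟨g • x, hi g x hx⟩ rfl).symm
    · ext y
      constructor
      · rintro ⟨x, hx, rfl⟩
        rw [hτ ⟨x, hx⟩]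
        exact (e _).2
      · intro hy
        obtain ⟨x, hx⟩ := esurj ⟨y, hy⟩
        exact ⟨x, x.2, by rw [hτ, hx]⟩
  obtain ⟨a, b, hab⟩ : ∃ a b : X, (a : Cpl L₁) < b := by
    obtain ⟨u, v, huv⟩ := exists_pair_lt (Cpl L₁)
    obtain ⟨x, hx⟩ := hu u v huv
    obtain ⟨y, hy⟩ := hu x v hx.2
    exact ⟨x, y, hy.1⟩
  have hle : ∀ {Z : Type v} [LinearOrder Z] (f : X → Z),
      (∀ c d : X, (c : Cpl L₁) < d → f c < f d) → ∀ c d : X, (c : Cpl L₁) ≤ d ↔ f c ≤ f d := by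
    intro Z _ f h c d
    constructor
    · intro hcd
      rcases hcd.lt_or_eq with h' | h'
      · exact (h c d h').le
      · rw [Subtype.ext h']
    · intro hcd
      by_contra! h'
      exact absurd (h d c h') (not_lt.2 hcd)
  -- The images of the fixed pair `a < b` decide the direction once and for all: equal direction
  -- with this pair is preserved, so `e` is increasing or decreasing throughout.
  rcases hed a b a b (Or.inl ⟨hab, hab⟩) with ⟨h1, -⟩ | ⟨h1, -⟩
  · obtain ⟨τ, hτ⟩ := exists_orderIso_of_dense Cpl.exists_isLUB Cpl.exists_isLUB
      (fun x : X => (x : Cpl L₁)) (fun x : X => (e x : Cpl L₂)) hu hv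
      (hle (fun x : X => (e x : Cpl L₂)) fun c d hcd => by
        rcases hed a b c d (Or.inl ⟨hab, hcd⟩) with ⟨-, h⟩ | ⟨h, -⟩
        · exact h
        · exact absurd h h1.not_gt)
    exact ⟨τ.toEquiv, Or.inl τ.strictMono, hτ⟩
  · obtain ⟨τ, hτ⟩ := exists_orderIso_of_dense (Y := (Cpl L₂)ᵒᵈ) Cpl.exists_isLUB
      (exists_isGLB_of_lub Cpl.exists_isLUB)
      (fun x : X => (x : Cpl L₁)) (fun x : X => OrderDual.toDual (e x : Cpl L₂)) hu
      (fun a b hab => (hv b a hab).imp fun x hx => ⟨hx.2, hx.1⟩)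
      (hle (fun x : X => OrderDual.toDual (e x : Cpl L₂)) fun c d hcd => by
        rcases hed a b c d (Or.inl ⟨hab, hcd⟩) with ⟨h, -⟩ | ⟨-, h⟩
        · exact absurd h h1.not_gt
        · exact h)
    exact ⟨τ.toEquiv.trans OrderDual.ofDual, Or.inr fun _ _ h => τ.strictMono h,
      fun x => congrArg OrderDual.ofDual (hτ x)⟩

end Dense

/-! ### Automorphisms that are conjugations by monotonic permutations of the chain itself. -/

section One

variable {L : Type u} [LinearOrder L] [NoMinOrder L] [NoMaxOrder L] [Nonempty L] [DenselyOrdered L]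
  {G : Subgroup (AutED L)}

theorem IsMN3.exists_orbit_mem_Ioo (hG : IsMN3 G) (z : Cpl L) {a b : Cpl L} (h : a < b) :
    ∃ x ∈ orbit G z, x ∈ Ioo a b := by
  have := hG.locMove
  obtain ⟨c, hc⟩ := exists_lt (min a z)
  obtain ⟨n, -, hn⟩ := (bddNormal_top (A := G) (X := Cpl L)).exists_smul_mem_Ioi
    (hc.trans_le (min_le_right _ _)) (hc.le.trans (min_le_left _ _)) h
  exact ⟨n • z, ⟨n, n.2, rfl⟩, hn⟩

theorem Induces.of_conj {σ : AutED L} {α : MulAut G}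
    (h : ∀ g : G, (α g : AutED L) = σ * g * σ⁻¹) : Induces (bar σ).1 α :=
  induces_iff_conj.2 fun g => by rw [h, map_mul, map_mul, map_inv]; rfl

theorem monotonic_bar (σ : AutED L) : Monotonic (bar σ).1 := IsEDIso.monotonic (bar σ).2

theorem image_range_of (σ : AutED L) : (bar σ).1 '' range Cpl.of = range (Cpl.of : L → Cpl L) := by
  ext y
  constructor
  · rintro ⟨_, ⟨a, rfl⟩, rfl⟩
    exact ⟨σ.1 a, (bar_of σ a).symm⟩
  · rintro ⟨a, rfl⟩
    exact ⟨Cpl.of (σ.1.symm a), ⟨_, rfl⟩, by rw [bar_of, Equiv.apply_symm_apply]⟩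

theorem orbit_of_transitive (ht : ∀ x y : L, ∃ g ∈ G, g.1 x = y) (a : L) :
    orbit G (Cpl.of a) = range Cpl.of := by
  ext y
  constructor
  · rintro ⟨g, -, rfl⟩
    exact ⟨_, (bar_of g a).symm⟩
  · rintro ⟨b, rfl⟩
    obtain ⟨g, hg, rfl⟩ := ht a b
    exact ⟨g, hg, bar_of g a⟩

/-- A permutation of the completion that maps `L` onto `L` restricts to `L`. -/
theorem exists_bar_eq {τ : Equiv.Perm (Cpl L)} (hm : Monotonic τ)
    (h : τ '' range Cpl.of = range (Cpl.of : L → Cpl L)) : ∃ σ : AutED L, (bar σ).1 = τ := by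
  have h1 : ∀ a : L, ∃ b : L, Cpl.of b = τ (Cpl.of a) := fun a => by
    have : τ (Cpl.of a) ∈ range (Cpl.of : L → Cpl L) := h ▸ mem_image_of_mem τ ⟨a, rfl⟩
    exact this
  have h2 : ∀ b : L, ∃ a : L, Cpl.of b = τ (Cpl.of a) := fun b => by
    have : Cpl.of b ∈ τ '' range (Cpl.of : L → Cpl L) := by
      rw [h]
      exact mem_range_self b
    obtain ⟨_, ⟨a, rfl⟩, ha⟩ := this
    exact ⟨a, ha.symm⟩
  choose s hs using h1
  have hb : Function.Bijective s := by
    constructor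
    · intro a b hab
      refine Cpl.of_injective (τ.injective ?_)
      rw [← hs, ← hs, hab]
    · intro b
      obtain ⟨a, ha⟩ := h2 b
      exact ⟨a, Cpl.of_injective ((hs a).trans ha.symm)⟩
  have hm' : Monotonic (Equiv.ofBijective s hb) := by
    rcases hm with hm | hm
    · refine Or.inl fun a b hab => ?_
      have := hm (Cpl.of_lt_of.2 hab)
      rw [← hs, ← hs] at this
      exact Cpl.of_lt_of.1 this
    · refine Or.inr fun a b hab => ?_
      have := hm (Cpl.of_lt_of.2 hab)
      rw [← hs, ← hs] at this
      exact Cpl.of_lt_of.1 this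
  refine ⟨⟨Equiv.ofBijective s hb, hm'.isEDIso⟩, ?_⟩
  refine Equiv.ext (congrFun (Continuous.ext_on Cpl.dense_range_of
    (monotonic_bar _).isHomeo.1 hm.isHomeo.1 ?_))
  rintro _ ⟨a, rfl⟩
  rw [bar_of]
  exact hs a

/-- When all automorphisms of `G` are conjugations by monotonic permutations of `L`. -/
theorem IsMN3.normalizer_iff (hG : IsMN3 G) (ht : ∀ x y : L, ∃ g ∈ G, g.1 x = y) :
    (∃ Φ : Subgroup.normalizer (G : Set (AutED L)) ≃* MulAut G,
      ∀ (σ : Subgroup.normalizer (G : Set (AutED L))) (g : G),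
        (Φ σ g : AutED L) = σ * g * (σ : AutED L)⁻¹) ↔
    ¬ ∃ M ∈ orbits G, M ≠ Set.range Cpl.of ∧
      Nonempty (ACT (Set.range Cpl.of) G ≃[LMNPG] ACT M G) := by
  obtain ⟨a⟩ := ‹Nonempty L›
  have ha := orbit_of_transitive ht a
  constructor
  · rintro ⟨Φ, hΦ⟩ ⟨_, ⟨z, rfl⟩, hne, ⟨e⟩⟩
    -- The isomorphism extends to a map of the completion that takes `L` to the other orbit. By
    -- assumption the induced automorphism is also conjugation by a permutation of `L`, and
    -- uniqueness identifies the two maps.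
    obtain ⟨τ, α, hm, hτ, him⟩ := exists_monotonic_of_act_equiv (X := range Cpl.of)
      (fun a b hab => by
        obtain ⟨c, hc⟩ := Cpl.exists_of_mem_Ioo hab
        exact ⟨_, ⟨c, rfl⟩, hc⟩)
      (by
        rintro g _ ⟨b, rfl⟩
        exact ⟨_, (smul_of g b).symm⟩)
      (fun a b hab => hG.exists_orbit_mem_Ioo z hab) e
    obtain ⟨σ, rfl⟩ := Φ.surjective α
    have h1 := Induces.of_conj (hΦ σ)
    have h2 := Induces.unique hG (monotonic_bar _) hm h1 hτ
    rw [h2, image_range_of] at him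
    exact hne him.symm
  · intro hn
    have hn' : ∀ α : MulAut G, ∃ σ : AutED L, ∀ g : G, (α g : AutED L) = σ * g * σ⁻¹ := by
      intro α
      obtain ⟨τ, hm, hτ⟩ := exists_monotonic_induces hG hG α
      -- As `L` is an orbit, its image under `τ` is an orbit with an isomorphic action, so by
      -- assumption it cannot differ from `L`.
      have him : τ '' range Cpl.of = range (Cpl.of : L → Cpl L) := by
        by_contra hne
        refine hn ⟨_, ⟨τ (Cpl.of a), rfl⟩, ?_, ?_⟩
        · rw [← image_orbit hτ, ha]
          exact hne
        · rw [← image_orbit hτ, ha]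
          obtain ⟨e, -⟩ := isActIso_of_induces hm hτ (X := range Cpl.of) (Y := τ '' range Cpl.of)
            fun x => τ.injective.mem_set_image.symm
          exact ⟨e⟩
      obtain ⟨σ, rfl⟩ := exists_bar_eq hm him
      refine ⟨σ, fun g => bar_val_injective ?_⟩
      rw [induces_iff_conj.1 hτ g, map_mul, map_mul, map_inv]
      rfl
    refine exists_mulEquiv_of_rel (fun (σ : Subgroup.normalizer (G : Set (AutED L))) (α : MulAut G) =>
      ∀ g : G, (α g : AutED L) = σ * g * (σ : AutED L)⁻¹) ?_ ?_ ?_ ?_ ?_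
    · intro n m a b hn hm g
      rw [MulAut.mul_apply, hn, hm, Subgroup.coe_mul]
      group
    · intro α
      obtain ⟨σ, hσ⟩ := hn' α
      refine ⟨⟨σ, Subgroup.mem_normalizer_iff.2 fun h => ⟨fun hh => ?_, fun hh => ?_⟩⟩, hσ⟩
      · rw [← hσ ⟨h, hh⟩]
        exact (α _).2
      · obtain ⟨k, hk⟩ := α.surjective ⟨_, hh⟩
        have := hσ k
        rw [hk] at this
        have h3 : h = k := by simpa using this
        rw [h3]
        exact k.2
    · intro n
      refine exists_mulAut_of_conj G.subtype G.subtype_injective (n : AutED L) fun h => ?_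
      rw [Subgroup.range_subtype]
      exact Subgroup.mem_normalizer_iff.1 n.2 h
    · intro n m a hn hm
      exact Subtype.ext (bar_val_injective (Induces.unique hG (monotonic_bar _) (monotonic_bar _)
        (Induces.of_conj hm) (Induces.of_conj hn)))
    · intro n a b ha hb
      ext1 g
      exact Subtype.ext ((ha g).trans (hb g).symm)

end One

end MonRec

namespace MonRec

open Set FirstOrder FirstOrder.Language

/-! ### First order formulas with named variables -/

section Variables

variable {L : FirstOrder.Language.{0, 0}} {α β : Type} {M : Type u} [L.Structure M]

/-- The valuation `v` extended by the value `x` of the new variable. -/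
def push (v : α → M) (x : M) : Option α → M := fun o => o.elim x v

@[simp] theorem push_none (v : α → M) (x : M) : push v x none = x := rfl

@[simp] theorem push_some (v : α → M) (x : M) (a : α) : push v x (some a) = v a := rfl

/-- A term regarded as a term in one more variable. -/
def up (t : L.Term α) : L.Term (Option α) := t.relabel some

/-- The new variable. -/
def nv : L.Term (Option α) := Term.var none

@[simp] theorem realize_up (t : L.Term α) (v : α → M) (x : M) :
    (up t).realize (push v x) = t.realize v := by
  rw [up, Term.realize_relabel]
  rfl

@[simp] theorem realize_nv (v : α → M) (x : M) : (nv : L.Term (Option α)).realize (push v x) = x :=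
  rfl

/-- Universal quantification over the new variable. -/
noncomputable def allO (φ : L.Formula (Option α)) : L.Formula α :=
  (φ.relabel (fun o : Option α => o.elim (Sum.inr ()) Sum.inl : Option α → α ⊕ Unit)).iAlls Unit

/-- Existential quantification over the new variable. -/
noncomputable def exO (φ : L.Formula (Option α)) : L.Formula α := ∼(allO ∼φ)

@[simp] theorem realize_allO (φ : L.Formula (Option α)) (v : α → M) :
    (allO φ).Realize v ↔ ∀ x : M, φ.Realize (push v x) := by
  have h : ∀ x : M, (Sum.elim v (fun _ : Unit => x)) ∘
      (fun o : Option α => o.elim (Sum.inr ()) Sum.inl : Option α → α ⊕ Unit) = push v x := by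
    intro x
    funext o
    cases o <;> rfl
  rw [allO, Formula.realize_iAlls]
  simp only [Formula.realize_relabel]
  constructor
  · intro H x
    rw [← h]
    exact H fun _ => x
  · intro H i
    have := H (i ())
    rwa [← h] at this

@[simp] theorem realize_exO (φ : L.Formula (Option α)) (v : α → M) :
    (exO φ).Realize v ↔ ∃ x : M, φ.Realize (push v x) := by
  simp [exO, Formula.realize_not]

end Variables

/-! ### Rays in the first order language of groups -/

section Group

variable {α : Type} {A : Type u} [Mul A]

instance : Mul (LGR.Term α) := ⟨fun t s => Term.func GRFun.mul ![t, s]⟩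

@[simp] theorem realize_mul (t s : LGR.Term α) (v : α → A) :
    (t * s).realize v = t.realize v * s.realize v := rfl

/-- The formula for equality. -/
def eqF (t s : LGR.Term α) : LGR.Formula α := t.equal s

@[simp] theorem realize_eqF (t s : LGR.Term α) (v : α → A) :
    (eqF t s).Realize v ↔ t.realize v = s.realize v :=
  Formula.realize_equal

attribute [local simp] Formula.realize_imp Formula.realize_inf Formula.realize_sup
  Formula.realize_not

/-- The formula for `AD`. -/
noncomputable def fAD (f g : LGR.Term α) : LGR.Formula α :=
  allO ((∼(eqF (up f * nv) (nv * up f))).imp (exO (exO (exO (exO (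
    eqF (up (up (up nv)) * up (up (up (up (up g))))) (up (up (up (up (up g)))) * up (up (up nv))) ⊓
    (eqF (up (up nv) * up (up (up (up (up g))))) (up (up (up (up (up g)))) * up (up nv)) ⊓
    (eqF (up (up nv) * up (up (up (up nv)))) (up nv * (up (up (up (up nv))) * up (up nv))) ⊓
    (eqF (up (up (up nv)) * up nv) (nv * (up nv * up (up (up nv)))) ⊓
    (∼(eqF (nv * up nv) (up nv)) ⊓
    eqF (nv * up (up (up (up (up g))))) (up (up (up (up (up g)))) * nv)))))))))))

@[simp] theorem realize_fAD (f g : LGR.Term α) (v : α → A) :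
    (fAD f g).Realize v ↔ AD (f.realize v) (g.realize v) := by
  simp only [fAD, AD, realize_allO, realize_exO, Formula.realize_imp, Formula.realize_inf,
    Formula.realize_not, realize_eqF, realize_mul, realize_up, realize_nv, ne_eq]

/-- The formula for `SqDisj`. -/
noncomputable def fSqDisj (f g : LGR.Term α) : LGR.Formula α := fAD (f * f) (g * g)

@[simp] theorem realize_fSqDisj (f g : LGR.Term α) (v : α → A) :
    (fSqDisj f g).Realize v ↔ SqDisj (f.realize v) (g.realize v) := by
  simp [fSqDisj, SqDisj]

/-- The formula for `SqNe`. -/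
noncomputable def fSqNe (f : LGR.Term α) : LGR.Formula α := ∼(eqF (f * f * f) f)

@[simp] theorem realize_fSqNe (f : LGR.Term α) (v : α → A) :
    (fSqNe f).Realize v ↔ SqNe (f.realize v) := by
  simp [fSqNe, SqNe]

/-- Both entries of a pair of terms in one more variable. -/
def upp (p : LGR.Term α × LGR.Term α) : LGR.Term (Option α) × LGR.Term (Option α) :=
  (up p.1, up p.2)

/-- The value of a pair of terms. -/
def val2 (p : LGR.Term α × LGR.Term α) (v : α → A) : A × A := (p.1.realize v, p.2.realize v)

@[simp] theorem val2_mk (s t : LGR.Term α) (v : α → A) :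
    val2 (s, t) v = (s.realize v, t.realize v) := rfl

@[simp] theorem val2_upp (p : LGR.Term α × LGR.Term α) (v : α → A) (x : A) :
    val2 (upp p) (push v x) = val2 p v := by
  simp [val2, upp]

@[simp] theorem val2_fst (p : LGR.Term α × LGR.Term α) (v : α → A) :
    (val2 p v).1 = p.1.realize v := rfl

@[simp] theorem val2_snd (p : LGR.Term α × LGR.Term α) (v : α → A) :
    (val2 p v).2 = p.2.realize v := rfl

/-- The formula for `Meets`. -/
noncomputable def fMeets (g : LGR.Term α) (p : LGR.Term α × LGR.Term α) : LGR.Formula α :=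
  exO (exO (fAD (up nv) (up (up p.1) * up (up p.1)) ⊓
    eqF (nv * up nv) (up nv * up (up p.2)) ⊓ ∼(fSqDisj (up (up g)) nv)))

@[simp] theorem realize_fMeets (g : LGR.Term α) (p : LGR.Term α × LGR.Term α) (v : α → A) :
    (fMeets g p).Realize v ↔ Meets (g.realize v) (val2 p v) := by
  simp [fMeets, Meets, and_assoc]

/-- The formula for `Ray`. -/
noncomputable def fRay (p : LGR.Term α × LGR.Term α) : LGR.Formula α :=
  fSqNe p.1 ⊓ fSqNe p.2 ⊓ fSqDisj p.2 p.1 ⊓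
  allO ((fSqNe nv).imp ((fSqDisj nv (up p.1)).imp ((fMeets nv (upp p)).imp
    (allO ((fMeets nv (upp (upp p))).imp (fMeets nv (up (up p.1), up nv))))))) ⊓
  exO (fSqNe nv ⊓ allO (exO (exO (eqF (nv * up (up nv)) (up (up nv) * up nv) ⊓
    fMeets (up nv) (upp (upp (upp (upp p)))) ⊓ fSqDisj nv (up (up (up nv)))))))

@[simp] theorem realize_fRay (p : LGR.Term α × LGR.Term α) (v : α → A) :
    (fRay p).Realize v ↔ Ray (val2 p v) := by
  simp [fRay, Ray, and_assoc]

/-- The formula for `SameDir`. -/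
noncomputable def fSameDir (p q : LGR.Term α × LGR.Term α) : LGR.Formula α :=
  allO ((fMeets nv (upp p)).imp (fMeets nv (upp q))) ⊔
    allO ((fMeets nv (upp q)).imp (fMeets nv (upp p)))

@[simp] theorem realize_fSameDir (p q : LGR.Term α × LGR.Term α) (v : α → A) :
    (fSameDir p q).Realize v ↔ SameDir (val2 p v) (val2 q v) := by
  simp [fSameDir, SameDir]

/-- The formula for `Avoids`. -/
noncomputable def fAvoids (d : LGR.Term α × LGR.Term α) (g : LGR.Term α)
    (p : LGR.Term α × LGR.Term α) : LGR.Formula α :=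
  (fSameDir d p ⊓ ∼(fMeets g p)) ⊔
    (∼(fSameDir d p) ⊓ allO ((∼(fMeets nv (upp p))).imp (fSqDisj nv (up g))))

@[simp] theorem realize_fAvoids (d : LGR.Term α × LGR.Term α) (g : LGR.Term α)
    (p : LGR.Term α × LGR.Term α) (v : α → A) :
    (fAvoids d g p).Realize v ↔ Avoids (val2 d v) (g.realize v) (val2 p v) := by
  simp [fAvoids, Avoids]

/-- The formula for `RayLE`. -/
noncomputable def fRayLE (d p q : LGR.Term α × LGR.Term α) : LGR.Formula α :=
  allO ((fAvoids (upp d) nv (upp q)).imp (fAvoids (upp d) nv (upp p)))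

@[simp] theorem realize_fRayLE (d p q : LGR.Term α × LGR.Term α) (v : α → A) :
    (fRayLE d p q).Realize v ↔ RayLE (val2 d v) (val2 p v) (val2 q v) := by
  simp [fRayLE, RayLE]

end Group

end MonRec

namespace MonRec

open Set FirstOrder FirstOrder.Language

/-! ### Properties of group elements in terms of rays -/

section Defs

variable {A : Type*} [Mul A]

/-- The rays `p` and `q` have the same endpoint. -/
def RayEq (p q : A × A) : Prop := RayLE p p q ∧ RayLE p q p

/-- The element `g` maps the endpoint of the ray `p` to that of the ray `q`. -/
def RayMap (g : A) (p q : A × A) : Prop :=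
  ∀ r : A × A, r.1 * g = g * p.1 → r.2 * g = g * p.2 → RayEq r q

/-- The support of `g` is bounded above if `d` is a left ray. -/
def BddDir (d : A × A) (g : A) : Prop :=
  ∃ b : A × A, Ray b ∧ ∀ q : A × A, Ray q → RayLE d b q → RayMap g q q

/-- The support of `g` is bounded. -/
def BddBoth (g : A) : Prop :=
  ∃ d : A × A, Ray d ∧ BddDir d g ∧ ∃ d' : A × A, Ray d' ∧ ¬ SameDir d d' ∧ BddDir d' g

/-- The element `g` preserves directions. -/
def KeepsDir (g : A) : Prop :=
  ∀ p : A × A, Ray p → ∀ r : A × A, r.1 * g = g * p.1 → r.2 * g = g * p.2 → SameDir p r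

/-- The element `g` moves no point downwards if `d` is a left ray. -/
def MovesUp (d : A × A) (g : A) : Prop :=
  ∀ p : A × A, Ray p → ∀ q : A × A, Ray q → RayMap g p q → RayLE d p q

end Defs

section Formulas

variable {α : Type} {A : Type u} [Mul A]

/-- The pair of the two newest variables. -/
def np : LGR.Term (Option (Option α)) × LGR.Term (Option (Option α)) := (up nv, nv)

@[simp] theorem val2_np (v : α → A) (x y : A) : val2 np (push (push v x) y) = (x, y) := rfl

@[simp] theorem np_fst : (np : LGR.Term (Option (Option α)) × LGR.Term _).1 = up nv := rfl

@[simp] theorem np_snd : (np : LGR.Term (Option (Option α)) × LGR.Term _).2 = nv := rfl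

/-- Universal quantification over pairs. -/
noncomputable def all2 (φ : LGR.Formula (Option (Option α))) : LGR.Formula α := allO (allO φ)

/-- Existential quantification over pairs. -/
noncomputable def ex2 (φ : LGR.Formula (Option (Option α))) : LGR.Formula α := exO (exO φ)

@[simp] theorem realize_all2 (φ : LGR.Formula (Option (Option α))) (v : α → A) :
    (all2 φ).Realize v ↔ ∀ p : A × A, φ.Realize (push (push v p.1) p.2) := by
  simp [all2, Prod.forall]

@[simp] theorem realize_ex2 (φ : LGR.Formula (Option (Option α))) (v : α → A) :
    (ex2 φ).Realize v ↔ ∃ p : A × A, φ.Realize (push (push v p.1) p.2) := by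
  simp [ex2, Prod.exists]

attribute [local simp] Formula.realize_imp Formula.realize_inf Formula.realize_sup
  Formula.realize_not

/-- The formula for `RayEq`. -/
noncomputable def fRayEq (p q : LGR.Term α × LGR.Term α) : LGR.Formula α :=
  fRayLE p p q ⊓ fRayLE p q p

@[simp] theorem realize_fRayEq (p q : LGR.Term α × LGR.Term α) (v : α → A) :
    (fRayEq p q).Realize v ↔ RayEq (val2 p v) (val2 q v) := by
  simp [fRayEq, RayEq]

/-- The formula for `RayMap`. -/
noncomputable def fRayMap (g : LGR.Term α) (p q : LGR.Term α × LGR.Term α) : LGR.Formula α :=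
  all2 ((eqF (np.1 * up (up g)) (up (up g) * up (up p.1))).imp
    ((eqF (np.2 * up (up g)) (up (up g) * up (up p.2))).imp (fRayEq np (upp (upp q)))))

@[simp] theorem realize_fRayMap (g : LGR.Term α) (p q : LGR.Term α × LGR.Term α) (v : α → A) :
    (fRayMap g p q).Realize v ↔ RayMap (g.realize v) (val2 p v) (val2 q v) := by
  simp [fRayMap, RayMap]

/-- The formula for `BddDir`. -/
noncomputable def fBddDir (d : LGR.Term α × LGR.Term α) (g : LGR.Term α) : LGR.Formula α :=
  ex2 (fRay np ⊓ all2 ((fRay np).imp ((fRayLE (upp (upp (upp (upp d)))) (upp (upp np)) np).imp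
    (fRayMap (up (up (up (up g)))) np np))))

@[simp] theorem realize_fBddDir (d : LGR.Term α × LGR.Term α) (g : LGR.Term α) (v : α → A) :
    (fBddDir d g).Realize v ↔ BddDir (val2 d v) (g.realize v) := by
  simp [fBddDir, BddDir]

/-- The formula for `BddBoth`. -/
noncomputable def fBddBoth (g : LGR.Term α) : LGR.Formula α :=
  ex2 (fRay np ⊓ (fBddDir np (up (up g)) ⊓ ex2 (fRay np ⊓ (∼(fSameDir (upp (upp np)) np) ⊓
    fBddDir np (up (up (up (up g))))))))

@[simp] theorem realize_fBddBoth (g : LGR.Term α) (v : α → A) :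
    (fBddBoth g).Realize v ↔ BddBoth (g.realize v) := by
  simp [fBddBoth, BddBoth]

/-- The formula for `KeepsDir`. -/
noncomputable def fKeepsDir (g : LGR.Term α) : LGR.Formula α :=
  all2 ((fRay np).imp (all2 ((eqF (np.1 * up (up (up (up g)))) (up (up (up (up g))) * up (up np.1))).imp
    ((eqF (np.2 * up (up (up (up g)))) (up (up (up (up g))) * up (up np.2))).imp
      (fSameDir (upp (upp np)) np)))))

@[simp] theorem realize_fKeepsDir (g : LGR.Term α) (v : α → A) :
    (fKeepsDir g).Realize v ↔ KeepsDir (g.realize v) := by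
  simp [fKeepsDir, KeepsDir]

/-- The formula for `MovesUp`. -/
noncomputable def fMovesUp (d : LGR.Term α × LGR.Term α) (g : LGR.Term α) : LGR.Formula α :=
  all2 ((fRay np).imp (all2 ((fRay np).imp ((fRayMap (up (up (up (up g)))) (upp (upp np)) np).imp
    (fRayLE (upp (upp (upp (upp d)))) (upp (upp np)) np)))))

@[simp] theorem realize_fMovesUp (d : LGR.Term α × LGR.Term α) (g : LGR.Term α) (v : α → A) :
    (fMovesUp d g).Realize v ↔ MovesUp (val2 d v) (g.realize v) := by
  simp [fMovesUp, MovesUp]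

end Formulas

/-! ### The meaning of the derived predicates on rays in the chain. -/

section Sem

variable {A X : Type*} [Group A] [LinearOrder X] [MulAction A X] [LocMove A X] [NoMinOrder X]
  [NoMaxOrder X] [DenselyOrdered X] [TopologicalSpace X] [OrderTopology X]

theorem IsRayAt.rayEq_iff {p q : A × A} {x y : X} (hp : IsRayAt X p x) (hq : IsRayAt X q y) :
    RayEq p q ↔ x = y := by
  rcases id hp with h | h
  · rw [RayEq, h.rayLE_iff hp hq, h.rayLE_iff hq hp, le_antisymm_iff]
  · rw [RayEq, h.rayLE_iff_dual hp hq, h.rayLE_iff_dual hq hp, le_antisymm_iff, and_comm]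

/-- The equations in `RayMap` have the conjugated pair as their only solution, so the universal
quantifier over `r` merely names it without inverses. -/
theorem IsRayAt.rayMap_iff {p q : A × A} {x y : X} (hp : IsRayAt X p x) (hq : IsRayAt X q y) {g : A} :
    RayMap g p q ↔ g • x = y := by
  rw [← (hp.conj g).rayEq_iff hq]
  constructor
  · exact fun h => h _ (by group) (by group)
  · rintro h ⟨r, s⟩ hr hs
    rw [← eq_mul_inv_iff_mul_eq] at hr hs
    dsimp only at hr hs
    rwa [hr, hs]

/-- If all endpoints beyond that of `b` are fixed, so are all points beyond it, because supports are
open and endpoints are dense. -/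
theorem IsLRay.bddDir_iff {d : A × A} {z : X} (hd : IsLRay X d z) {g : A} :
    BddDir d g ↔ BddAbove (sp X g) := by
  constructor
  · rintro ⟨b, hb, h⟩
    obtain ⟨y, hy⟩ := (ray_iff (X := X)).1 hb
    refine ⟨y, fun x hx => ?_⟩
    by_contra! hyx
    obtain ⟨z, hz, q, hq⟩ := (dense_rayPoints A X).inter_open_nonempty _
      ((isOpen_sp g).inter (isOpen_Ioi (a := y))) ⟨x, hx, hyx⟩
    exact hz.1 ((hq.rayMap_iff hq).1 (h q (ray_iff.2 ⟨z, hq⟩)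
      ((hd.rayLE_iff hy hq).2 (le_of_lt hz.2))))
  · rintro ⟨v, hv⟩
    obtain ⟨v', hv'⟩ := exists_gt v
    obtain ⟨b, y, hy, hb⟩ := exists_isLRay_mem_Ioo A hv'
    refine ⟨b, hb.ray, fun q hq hbq => ?_⟩
    obtain ⟨x, hx⟩ := (ray_iff (X := X)).1 hq
    rw [hd.rayLE_iff (Or.inl hb) hx] at hbq
    refine (hx.rayMap_iff hx).2 (notMem_sp.1 fun h => ?_)
    exact absurd (hv h) (not_le.2 (hy.1.trans_le hbq))

theorem IsLRay.bddDir_iff_dual {d : A × A} {z : X} (hd : IsLRay Xᵒᵈ d (OrderDual.toDual z)) {g : A} :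
    BddDir d g ↔ BddBelow (sp X g) := hd.bddDir_iff

/-- Only endpoints are tested, but the points not moved downwards form a closed set. -/
theorem IsLRay.movesUp_iff {d : A × A} {z : X} (hd : IsLRay X d z) {g : A} :
    MovesUp d g ↔ ∀ x : X, x ≤ g • x := by
  constructor
  · intro h
    have hcl : IsClosed {x : X | x ≤ g • x} := isClosed_le continuous_id (continuous_smul_of_locMove g)
    have hsub : {x : X | ∃ p : A × A, IsRayAt X p x} ⊆ {x : X | x ≤ g • x} := by
      rintro x ⟨p, hp⟩
      have hq := hp.conj g
      have h1 := h p (ray_iff.2 ⟨x, hp⟩) _ (ray_iff.2 ⟨_, hq⟩) ((hp.rayMap_iff hq).2 rfl)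
      exact (hd.rayLE_iff hp hq).1 h1
    have := hcl.closure_subset_iff.2 hsub
    rw [(dense_rayPoints A X).closure_eq] at this
    exact fun x => this trivial
  · intro h p hp q hq hpq
    obtain ⟨x, hx⟩ := (ray_iff (X := X)).1 hp
    obtain ⟨y, hy⟩ := (ray_iff (X := X)).1 hq
    rw [hd.rayLE_iff hx hy, ← (hx.rayMap_iff hy).1 hpq]
    exact h x

theorem IsLRay.movesUp_iff_dual {d : A × A} {z : X} (hd : IsLRay Xᵒᵈ d (OrderDual.toDual z)) {g : A} :
    MovesUp d g ↔ ∀ x : X, g • x ≤ x := hd.movesUp_iff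

variable (X) in
theorem exists_isLRay [Nonempty X] : ∃ (d : A × A) (z : X), IsLRay X d z := by
  obtain ⟨a, b, hab⟩ := exists_pair_lt X
  obtain ⟨d, z, -, hd⟩ := exists_isLRay_mem_Ioo A hab
  exact ⟨d, z, hd⟩

variable (X) in
theorem exists_isLRay_dual [Nonempty X] : ∃ (d : A × A) (z : X), IsLRay Xᵒᵈ d (OrderDual.toDual z) :=
  exists_isLRay Xᵒᵈ

/-- A quantified ray can point either way, so what becomes definable is the disjunction of a
property with its mirror image. Both directions occur. -/
theorem exists_ray_iff [Nonempty X] {P : A × A → Prop}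
    {p q : Prop} (h : ∀ (d : A × A) (z : X), IsLRay X d z → (P d ↔ p))
    (h' : ∀ (d : A × A) (z : X), IsLRay Xᵒᵈ d (OrderDual.toDual z) → (P d ↔ q)) :
    (∃ d : A × A, Ray d ∧ P d) ↔ p ∨ q := by
  constructor
  · rintro ⟨d, hd, hP⟩
    obtain ⟨z, hz | hz⟩ := (ray_iff (X := X)).1 hd
    · exact Or.inl ((h d z hz).1 hP)
    · exact Or.inr ((h' d z hz).1 hP)
  · rintro (hp | hq)
    · obtain ⟨d, z, hz⟩ := exists_isLRay (A := A) X
      exact ⟨d, hz.ray, (h d z hz).2 hp⟩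
    · obtain ⟨d, z, hz⟩ := exists_isLRay_dual (A := A) X
      exact ⟨d, ray_iff.2 ⟨z, Or.inr hz⟩, (h' d z hz).2 hq⟩

theorem bddBoth_iff [Nonempty X] {g : A} : BddBoth g ↔ BddAbove (sp X g) ∧ BddBelow (sp X g) := by
  constructor
  · rintro ⟨d, hd, hg, d', hd', hne, hg'⟩
    obtain ⟨z, hz | hz⟩ := (ray_iff (X := X)).1 hd <;>
    obtain ⟨z', hz' | hz'⟩ := (ray_iff (X := X)).1 hd'
    · exact absurd (hz.sameDir hz') hne
    · exact ⟨hz.bddDir_iff.1 hg, hz'.bddDir_iff_dual.1 hg'⟩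
    · exact ⟨hz'.bddDir_iff.1 hg', hz.bddDir_iff_dual.1 hg⟩
    · exact absurd (IsLRay.sameDir hz hz') hne
  · rintro ⟨h1, h2⟩
    obtain ⟨d, z, hz⟩ := exists_isLRay (A := A) X
    obtain ⟨d', z', hz'⟩ := exists_isLRay_dual (A := A) X
    exact ⟨d, hz.ray, hz.bddDir_iff.2 h1, d', ray_iff.2 ⟨z', Or.inr hz'⟩, hz.not_sameDir hz',
      hz'.bddDir_iff_dual.2 h2⟩

theorem keepsDir_iff [Nonempty X] {g : A} : KeepsDir g ↔ Inc X g := by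
  constructor
  · intro h
    rcases LocMove.monotonic (X := X) g with hg | hg
    · exact hg
    · obtain ⟨d, z, hz⟩ := exists_isLRay (A := A) X
      exact absurd (h d hz.ray (g * d.1 * g⁻¹, g * d.2 * g⁻¹) (by group) (by group))
        (hz.not_sameDir (hz.conj_anti hg))
  · rintro hg p hp ⟨r, s⟩ hr hs
    rw [← eq_mul_inv_iff_mul_eq] at hr hs
    dsimp only at hr hs
    rw [hr, hs]
    obtain ⟨z, hz | hz⟩ := (ray_iff (X := X)).1 hp
    · exact hz.sameDir (hz.conj hg)
    · exact IsLRay.sameDir hz (hz.conj (X := Xᵒᵈ) (fun _ _ h => hg h))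

end Sem

end MonRec

namespace MonRec

open Set FirstOrder FirstOrder.Language

/-! ### Translation of formulas through interpretations -/

/-- The variable that is a given term of a relational language. -/
def Term.idx {L' : FirstOrder.Language.{0, 0}} [L'.IsRelational] {α : Type} : L'.Term α → α
  | .var a => a
  | .func f _ => isEmptyElim f

theorem Term.realize_idx {L' : FirstOrder.Language.{0, 0}} [L'.IsRelational] {α : Type} {M : Type*}
    [L'.Structure M] (t : L'.Term α) (v : α → M) : t.realize v = v (Term.idx t) := by
  cases t with
  | var a => rfl
  | func f _ => exact isEmptyElim f

/-- Formulas of some logic about representatives of the elements of a structure in the language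
`L'`, the formulas in `F β` having variables in `β`. -/
structure TransOps (L' : FirstOrder.Language.{0, 0}) where
  /-- the formulas -/
  F : Type → Type v
  /-- falsity -/
  bot : ∀ {β : Type}, F β
  /-- implication -/
  imp : ∀ {β : Type}, F β → F β → F β
  /-- universal quantification over tuples -/
  all : ∀ {β : Type}, F (Option β) → F β
  /-- change of variables -/
  map : ∀ {β β' : Type}, (β → β') → F β → F β'
  /-- being a representative -/
  dom : F Unit
  /-- representing the same element -/
  eq : F (Fin 2)
  /-- representing related elements -/
  rel : ∀ {m : ℕ}, L'.Relations m → F (Fin m)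

/-- The semantic conditions on a translation, `Rp t m` meaning that `t` represents `m`. -/
structure TransOps.Models {L' : FirstOrder.Language.{0, 0}} (O : TransOps.{v} L') {T : Type u}
    {M' : Type w} [L'.Structure M'] (real : ∀ {β : Type}, O.F β → (β → T) → Prop)
    (Rp : T → M' → Prop) : Prop where
  bot : ∀ {β : Type} (v : β → T), ¬ real O.bot v
  imp : ∀ {β : Type} (φ ψ : O.F β) (v : β → T), real (O.imp φ ψ) v ↔ (real φ v → real ψ v)
  all : ∀ {β : Type} (φ : O.F (Option β)) (v : β → T),
    real (O.all φ) v ↔ ∀ t, real φ (push v t)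
  map : ∀ {β β' : Type} (f : β → β') (φ : O.F β) (v : β' → T), real (O.map f φ) v ↔ real φ (v ∘ f)
  dom : ∀ v : Unit → T, real O.dom v ↔ ∃ m, Rp (v ()) m
  surj : ∀ m, ∃ t, Rp t m
  eq : ∀ (v : Fin 2 → T) (m : Fin 2 → M'), (∀ x, Rp (v x) (m x)) → (real O.eq v ↔ m 0 = m 1)
  rel : ∀ {k : ℕ} (R : L'.Relations k) (v : Fin k → T) (m : Fin k → M'), (∀ x, Rp (v x) (m x)) →
    (real (O.rel R) v ↔ Structure.RelMap R m)

/-- Makes the last numbered variable the new variable. -/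
def lastToNew {α : Type} {k : ℕ} : α ⊕ Fin (k + 1) → Option (α ⊕ Fin k) :=
  Sum.elim (fun a => some (Sum.inl a)) (fun j => Fin.lastCases none (fun i => some (Sum.inr i)) j)

/-- The translation of a formula. -/
def TransOps.trans {L' : FirstOrder.Language.{0, 0}} [L'.IsRelational] (O : TransOps.{v} L')
    {α : Type} : ∀ {k : ℕ}, L'.BoundedFormula α k → O.F (α ⊕ Fin k)
  | _, .falsum => O.bot
  | _, .equal t s => O.map ![Term.idx t, Term.idx s] O.eq
  | _, .rel R ts => O.map (fun j => Term.idx (ts j)) (O.rel R)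
  | _, .imp φ ψ => O.imp (O.trans φ) (O.trans ψ)
  | _, .all φ => O.all (O.imp (O.map (fun _ => none) O.dom) (O.map lastToNew (O.trans φ)))

/-- Induction on formulas. Only the abstract operations of the target logic are used, which lets the
same argument serve the first order representation of endpoints and the second order representation
of all points. -/
theorem TransOps.Models.realize_trans {L' : FirstOrder.Language.{0, 0}} [L'.IsRelational]
    {O : TransOps.{v} L'} {T : Type u} {M' : Type w} [L'.Structure M']
    {real : ∀ {β : Type}, O.F β → (β → T) → Prop} {Rp : T → M' → Prop}
    (H : O.Models real Rp) {α : Type} : ∀ {k : ℕ} (φ : L'.BoundedFormula α k) (v : α ⊕ Fin k → T)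
    (m : α ⊕ Fin k → M'), (∀ x, Rp (v x) (m x)) →
      (real (O.trans φ) v ↔ φ.Realize (m ∘ Sum.inl) (m ∘ Sum.inr))
  | _, .falsum, v, m, h => iff_of_false (H.bot v) id
  | _, .equal t s, v, m, h => by
    have hm : Sum.elim (m ∘ Sum.inl) (m ∘ Sum.inr) = m := Sum.elim_comp_inl_inr m
    simp only [BoundedFormula.Realize, Term.realize_idx, hm]
    rw [trans, H.map]
    exact H.eq (v ∘ ![Term.idx t, Term.idx s]) (m ∘ ![Term.idx t, Term.idx s]) fun x => h _
  | _, .rel R ts, v, m, h => by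
    have hm : Sum.elim (m ∘ Sum.inl) (m ∘ Sum.inr) = m := Sum.elim_comp_inl_inr m
    simp only [BoundedFormula.Realize, Term.realize_idx, hm]
    rw [trans, H.map]
    exact H.rel R (v ∘ fun j => Term.idx (ts j)) (m ∘ fun j => Term.idx (ts j)) fun x => h _
  | _, .imp φ ψ, v, m, h => by
    rw [trans, H.imp, H.realize_trans φ v m h, H.realize_trans ψ v m h]
    rfl
  | k, .all φ, v, m, h => by
    have key : ∀ (t : T) (x : M'), Rp t x → (real (O.map lastToNew (O.trans φ)) (push v t) ↔
        φ.Realize (m ∘ Sum.inl) (Fin.snoc (m ∘ Sum.inr) x)) := by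
      intro t x hx
      rw [H.map, H.realize_trans φ (push v t ∘ lastToNew)
        (Sum.elim (m ∘ Sum.inl) (Fin.snoc (m ∘ Sum.inr) x)) ?_]
      · rfl
      · rintro (a | j)
        · exact h _
        · refine Fin.lastCases ?_ (fun j => ?_) j
          · simpa [lastToNew] using hx
          · simpa [lastToNew] using h _
    -- The translated quantifier is guarded by `O.dom`, so tuples that represent nothing are
    -- ignored, while `H.surj` provides a tuple for every element.
    rw [trans, H.all]
    simp only [H.imp, H.map, H.dom]
    change (∀ t, (∃ m, Rp t m) → _) ↔ ∀ x : M', _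
    constructor
    · intro hh x
      obtain ⟨t, ht⟩ := H.surj x
      exact (key t x ht).1 ((H.map _ _ _).2 (hh t ⟨x, ht⟩))
    · rintro hh t ⟨x, hx⟩
      exact (H.map _ _ _).1 ((key t x hx).2 (hh x))

instance : LMNPG.IsRelational := fun _ => inferInstanceAs (IsEmpty Empty)

/-! ### Triples of group elements as representatives of group elements and points -/

section Triples

/-- Equal direction of the endpoints of rays. -/
def RayEd {A : Type*} [Mul A] (a b c d : A × A) : Prop :=
  (¬ RayLE a b a ∧ ¬ RayLE a d c) ∨ (¬ RayLE a a b ∧ ¬ RayLE a c d)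

/-- Two triples represent the same element. -/
def TrEq {A : Type*} [Mul A] (a b : Fin 3 → A) : Prop :=
  (a 0 = a 1 ∧ b 0 = b 1 ∧ a 2 = b 2) ∨
    (a 0 ≠ a 1 ∧ b 0 ≠ b 1 ∧ RayEq (a 0, a 1) (b 0, b 1))

/-- The relations between the elements represented by triples. -/
def TrRel {A : Type*} [Mul A] : ∀ {m : ℕ}, MNPGRel m → (Fin m → Fin 3 → A) → Prop
  | _, .pt, a => a 0 0 ≠ a 0 1
  | _, .gr, a => a 0 0 = a 0 1
  | _, .ed, a => (a 0 0 ≠ a 0 1 ∧ a 1 0 ≠ a 1 1 ∧ a 2 0 ≠ a 2 1 ∧ a 3 0 ≠ a 3 1) ∧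
      RayEd (a 0 0, a 0 1) (a 1 0, a 1 1) (a 2 0, a 2 1) (a 3 0, a 3 1)
  | _, .comp, a => (a 0 0 = a 0 1 ∧ a 1 0 = a 1 1 ∧ a 2 0 = a 2 1) ∧ a 0 2 * a 1 2 = a 2 2
  | _, .ap, a => (a 0 0 = a 0 1 ∧ a 1 0 ≠ a 1 1 ∧ a 2 0 ≠ a 2 1) ∧
      RayMap (a 0 2) (a 1 0, a 1 1) (a 2 0, a 2 1)

variable {α : Type} {A : Type u} [Mul A]

/-- The formula for `RayEd`. -/
noncomputable def fRayEd (a b c d : LGR.Term α × LGR.Term α) : LGR.Formula α :=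
  (∼(fRayLE a b a) ⊓ ∼(fRayLE a d c)) ⊔ (∼(fRayLE a a b) ⊓ ∼(fRayLE a c d))

/-- The formula for `TrEq`. -/
noncomputable def fTrEq (a b : Fin 3 → LGR.Term α) : LGR.Formula α :=
  (eqF (a 0) (a 1) ⊓ (eqF (b 0) (b 1) ⊓ eqF (a 2) (b 2))) ⊔
    (∼(eqF (a 0) (a 1)) ⊓ (∼(eqF (b 0) (b 1)) ⊓ fRayEq (a 0, a 1) (b 0, b 1)))

/-- The formulas for `TrRel`. -/
noncomputable def fTrRel : ∀ {m : ℕ}, MNPGRel m → (Fin m → Fin 3 → LGR.Term α) → LGR.Formula α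
  | _, .pt, a => ∼(eqF (a 0 0) (a 0 1))
  | _, .gr, a => eqF (a 0 0) (a 0 1)
  | _, .ed, a => (∼(eqF (a 0 0) (a 0 1)) ⊓ (∼(eqF (a 1 0) (a 1 1)) ⊓ (∼(eqF (a 2 0) (a 2 1)) ⊓
      ∼(eqF (a 3 0) (a 3 1))))) ⊓
      fRayEd (a 0 0, a 0 1) (a 1 0, a 1 1) (a 2 0, a 2 1) (a 3 0, a 3 1)
  | _, .comp, a => (eqF (a 0 0) (a 0 1) ⊓ (eqF (a 1 0) (a 1 1) ⊓ eqF (a 2 0) (a 2 1))) ⊓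
      eqF (a 0 2 * a 1 2) (a 2 2)
  | _, .ap, a => (eqF (a 0 0) (a 0 1) ⊓ (∼(eqF (a 1 0) (a 1 1)) ⊓ ∼(eqF (a 2 0) (a 2 1)))) ⊓
      fRayMap (a 0 2) (a 1 0, a 1 1) (a 2 0, a 2 1)

attribute [local simp] Formula.realize_imp Formula.realize_inf Formula.realize_sup
  Formula.realize_not

@[simp] theorem realize_fRayEd (a b c d : LGR.Term α × LGR.Term α) (v : α → A) :
    (fRayEd a b c d).Realize v ↔ RayEd (val2 a v) (val2 b v) (val2 c v) (val2 d v) := by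
  simp [fRayEd, RayEd]

@[simp] theorem realize_fTrEq (a b : Fin 3 → LGR.Term α) (v : α → A) :
    (fTrEq a b).Realize v ↔ TrEq (fun k => (a k).realize v) (fun k => (b k).realize v) := by
  simp [fTrEq, TrEq]

@[simp] theorem realize_fTrRel {m : ℕ} (R : MNPGRel m) (a : Fin m → Fin 3 → LGR.Term α)
    (v : α → A) : (fTrRel R a).Realize v ↔ TrRel R (fun j k => (a j k).realize v) := by
  cases R <;> simp [fTrRel, TrRel]

end Triples

/-! ### Triples over the group as names for endpoints and group elements. -/

section Rep

variable {L : Type u} [LinearOrder L] [NoMinOrder L] [NoMaxOrder L] [Nonempty L] [DenselyOrdered L]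
  {G H : Subgroup (AutED L)}

/-- The triple `t` represents the element `m` of `ACT(Ep(G), H)`. -/
def RepEp (G H : Subgroup (AutED L)) (t : Fin 3 → G) (m : ACT (Ep G) H) : Prop :=
  Sum.elim (fun x : Ep G => t 0 ≠ t 1 ∧ IsRayAt (Cpl L) (t 0, t 1) (x : Cpl L))
    (fun h : H => t 0 = t 1 ∧ (t 2 : AutED L) = h) m

theorem ACT.cases {X : Set (Cpl L)} (m : ACT X H) : (∃ x, m = ACT.pt x) ∨ ∃ h, m = ACT.gr h := by
  rcases m with x | h
  · exact Or.inl ⟨x, rfl⟩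
  · exact Or.inr ⟨h, rfl⟩

/-- One support cannot be nonempty, lie below a point and have that point as its infimum. Equality
of the first two entries of a triple is thus free to mark a group element. -/
theorem Ray.fst_ne_snd (hG : IsMN3 G) {p : G × G} (hp : Ray p) : p.1 ≠ p.2 := by
  have := hG.locMove
  obtain ⟨x, hx⟩ := (ray_iff (X := Cpl L)).1 hp
  intro h
  rcases hx with ⟨h1, ⟨y, hy⟩, hs⟩ | ⟨h1, ⟨y, hy⟩, hs⟩
  · exact absurd (hs hy) (not_lt.2 (h1.1 (h ▸ hy)))
  · exact absurd (hs hy) (not_lt.2 (h1.1 (h ▸ hy)))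

/-- Equal direction is invariant under reversal of the chain, so any ray can be the reference, here
the first argument. -/
theorem IsRayAt.rayEd_iff (hG : IsMN3 G) {a b c d : G × G} {x y z w : Cpl L}
    (ha : IsRayAt (Cpl L) a x) (hb : IsRayAt (Cpl L) b y) (hc : IsRayAt (Cpl L) c z)
    (hd : IsRayAt (Cpl L) d w) : RayEd a b c d ↔ Ed x y z w := by
  have := hG.locMove
  rcases id ha with h | h
  · rw [RayEd, h.rayLE_iff hb ha, h.rayLE_iff ha hb, h.rayLE_iff hd hc, h.rayLE_iff hc hd]
    simp only [not_le, Ed]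
  · rw [RayEd, h.rayLE_iff_dual hb ha, h.rayLE_iff_dual ha hb, h.rayLE_iff_dual hd hc,
      h.rayLE_iff_dual hc hd]
    simp only [not_le, Ed]
    exact or_comm

theorem RepEp.exists_pt {t : Fin 3 → G} {m : ACT (Ep G) H} (h : RepEp G H t m) (ht : t 0 ≠ t 1) :
    ∃ x, m = ACT.pt x ∧ IsRayAt (Cpl L) (t 0, t 1) (x : Cpl L) := by
  rcases m.cases with ⟨x, rfl⟩ | ⟨g, rfl⟩
  · exact ⟨x, rfl, h.2⟩
  · exact absurd h.1 ht

theorem RepEp.exists_gr {t : Fin 3 → G} {m : ACT (Ep G) H} (h : RepEp G H t m) (ht : t 0 = t 1) :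
    ∃ g, m = ACT.gr g ∧ (t 2 : AutED L) = g := by
  rcases m.cases with ⟨x, rfl⟩ | ⟨g, rfl⟩
  · exact absurd ht h.1
  · exact ⟨g, rfl, h.2⟩

theorem RepEp.ne {t : Fin 3 → G} {m : ACT (Ep G) H} (h : RepEp G H t m) {x : Ep G}
    (hm : m = ACT.pt x) : t 0 ≠ t 1 ∧ IsRayAt (Cpl L) (t 0, t 1) (x : Cpl L) := by
  subst hm
  exact h

theorem RepEp.eq {t : Fin 3 → G} {m : ACT (Ep G) H} (h : RepEp G H t m) {g : H}
    (hm : m = ACT.gr g) : t 0 = t 1 ∧ (t 2 : AutED L) = g := by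
  subst hm
  exact h

theorem repEp_eq_iff (hG : IsMN3 G) {t t' : Fin 3 → G} {m m' : ACT (Ep G) H} (h : RepEp G H t m)
    (h' : RepEp G H t' m') : TrEq t t' ↔ m = m' := by
  have := hG.locMove
  constructor
  · rintro (⟨h1, h2, h3⟩ | ⟨h1, h2, h3⟩)
    · obtain ⟨g, rfl, hg⟩ := h.exists_gr h1
      obtain ⟨g', rfl, hg'⟩ := h'.exists_gr h2
      rw [Subtype.ext (hg.symm.trans ((congrArg _ h3).trans hg'))]
    · obtain ⟨x, rfl, hx⟩ := h.exists_pt h1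
      obtain ⟨x', rfl, hx'⟩ := h'.exists_pt h2
      rw [Subtype.ext ((hx.rayEq_iff hx').1 h3)]
  · rintro rfl
    rcases m.cases with ⟨x, rfl⟩ | ⟨g, rfl⟩
    · exact Or.inr ⟨h.1, h'.1, (h.2.rayEq_iff h'.2).2 rfl⟩
    · exact Or.inl ⟨h.1, h'.1, Subtype.ext (h.2.trans h'.2.symm)⟩

theorem repEp_rel_iff (hG : IsMN3 G) {k : ℕ} (R : MNPGRel k) {t : Fin k → Fin 3 → G}
    {m : Fin k → ACT (Ep G) H} (h : ∀ j, RepEp G H (t j) (m j)) :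
    TrRel R t ↔ Structure.RelMap (L := LMNPG) R m := by
  have := hG.locMove
  cases R
  · change _ ↔ ∃ x : Ep G, m 0 = ACT.pt x
    exact ⟨fun h0 => ((h 0).exists_pt h0).imp fun _ hx => hx.1, fun ⟨x, hx⟩ => ((h 0).ne hx).1⟩
  · change _ ↔ ∃ x : H, m 0 = ACT.gr x
    exact ⟨fun h0 => ((h 0).exists_gr h0).imp fun _ hx => hx.1, fun ⟨x, hx⟩ => ((h 0).eq hx).1⟩
  · change _ ↔ ∃ a b c d : Ep G, m 0 = ACT.pt a ∧ m 1 = ACT.pt b ∧ m 2 = ACT.pt c ∧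
      m 3 = ACT.pt d ∧ Ed (a : Cpl L) b c d
    constructor
    · rintro ⟨⟨h0, h1, h2, h3⟩, he⟩
      obtain ⟨a, ha, ha'⟩ := (h 0).exists_pt h0
      obtain ⟨b, hb, hb'⟩ := (h 1).exists_pt h1
      obtain ⟨c, hc, hc'⟩ := (h 2).exists_pt h2
      obtain ⟨d, hd, hd'⟩ := (h 3).exists_pt h3
      exact ⟨a, b, c, d, ha, hb, hc, hd, (ha'.rayEd_iff hG hb' hc' hd').1 he⟩
    · rintro ⟨a, b, c, d, ha, hb, hc, hd, he⟩
      have ha' := (h 0).ne ha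
      have hb' := (h 1).ne hb
      have hc' := (h 2).ne hc
      have hd' := (h 3).ne hd
      exact ⟨⟨ha'.1, hb'.1, hc'.1, hd'.1⟩, (ha'.2.rayEd_iff hG hb'.2 hc'.2 hd'.2).2 he⟩
  · change _ ↔ ∃ a b c : H, m 0 = ACT.gr a ∧ m 1 = ACT.gr b ∧ m 2 = ACT.gr c ∧ a * b = c
    constructor
    · rintro ⟨⟨h0, h1, h2⟩, he⟩
      obtain ⟨a, ha, ha'⟩ := (h 0).exists_gr h0
      obtain ⟨b, hb, hb'⟩ := (h 1).exists_gr h1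
      obtain ⟨c, hc, hc'⟩ := (h 2).exists_gr h2
      refine ⟨a, b, c, ha, hb, hc, Subtype.ext ?_⟩
      rw [Subgroup.coe_mul, ← ha', ← hb', ← hc', ← he, Subgroup.coe_mul]
    · rintro ⟨a, b, c, ha, hb, hc, rfl⟩
      have ha' := (h 0).eq ha
      have hb' := (h 1).eq hb
      have hc' := (h 2).eq hc
      refine ⟨⟨ha'.1, hb'.1, hc'.1⟩, Subtype.ext ?_⟩
      rw [Subgroup.coe_mul, ha'.2, hb'.2, hc'.2, Subgroup.coe_mul]
  · change _ ↔ ∃ (g : H) (a b : Ep G), m 0 = ACT.gr g ∧ m 1 = ACT.pt a ∧ m 2 = ACT.pt b ∧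
      (bar (g : AutED L)).1 (a : Cpl L) = b
    constructor
    · rintro ⟨⟨h0, h1, h2⟩, he⟩
      obtain ⟨g, hg, hg'⟩ := (h 0).exists_gr h0
      obtain ⟨b, hb, hb'⟩ := (h 1).exists_pt h1
      obtain ⟨c, hc, hc'⟩ := (h 2).exists_pt h2
      refine ⟨g, b, c, hg, hb, hc, ?_⟩
      rw [← hg']
      exact (hb'.rayMap_iff hc').1 he
    · rintro ⟨g, b, c, hg, hb, hc, he⟩
      have hg' := (h 0).eq hg
      have hb' := (h 1).ne hb
      have hc' := (h 2).ne hc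
      refine ⟨⟨hg'.1, hb'.1, hc'.1⟩, (hb'.2.rayMap_iff hc'.2).2 ?_⟩
      rw [← hg'.2] at he
      exact he

theorem exists_repEp_iff (hG : IsMN3 G) {t : Fin 3 → G} : (∃ m, RepEp G H t m) ↔
    (t 0 = t 1 ∧ (t 2 : AutED L) ∈ H) ∨ (t 0 ≠ t 1 ∧ Ray (t 0, t 1)) := by
  have := hG.locMove
  constructor
  · rintro ⟨m, h⟩
    rcases m.cases with ⟨x, rfl⟩ | ⟨g, rfl⟩
    · exact Or.inr ⟨h.1, ray_iff.2 ⟨_, h.2⟩⟩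
    · refine Or.inl ⟨h.1, ?_⟩
      rw [h.2]
      exact g.2
  · rintro (⟨h1, h2⟩ | ⟨h1, h2⟩)
    · exact ⟨ACT.gr ⟨_, h2⟩, h1, rfl⟩
    · obtain ⟨x, hx⟩ := (ray_iff (X := Cpl L)).1 h2
      exact ⟨ACT.pt ⟨x, (mem_ep_iff hG).2 ⟨_, hx⟩⟩, h1, hx⟩

theorem exists_repEp (hG : IsMN3 G) (hH : H ≤ G) (m : ACT (Ep G) H) : ∃ t, RepEp G H t m := by
  have := hG.locMove
  rcases m.cases with ⟨x, rfl⟩ | ⟨g, rfl⟩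
  · obtain ⟨p, hp⟩ := (mem_ep_iff hG).1 x.2
    exact ⟨![p.1, p.2, p.1], Ray.fst_ne_snd hG (ray_iff.2 ⟨_, hp⟩), hp⟩
  · exact ⟨fun _ => ⟨g, hH g.2⟩, rfl, rfl⟩

/-- Translation of formulas about `ACT(Ep(G), H)`, where `H` is defined by `δ` from two
parameters. -/
noncomputable def epOps (δ : LGR.Formula (Fin 3)) : TransOps.{0} LMNPG where
  F β := LGR.Formula (Fin 2 ⊕ β × Fin 3)
  bot := ⊥
  imp φ ψ := φ.imp ψ
  all φ := (φ.relabel (Sum.elim (fun d => Sum.inl (Sum.inl d)) (fun q => q.1.elim (Sum.inr q.2)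
    fun b => Sum.inl (Sum.inr (b, q.2)))) : LGR.Formula ((Fin 2 ⊕ _ × Fin 3) ⊕ Fin 3)).iAlls (Fin 3)
  map f φ := φ.relabel (Sum.map id (Prod.map f id))
  dom := (eqF (Term.var (Sum.inr ((), 0))) (Term.var (Sum.inr ((), 1))) ⊓
      δ.relabel ![Sum.inl 0, Sum.inl 1, Sum.inr ((), 2)]) ⊔
    (∼(eqF (Term.var (Sum.inr ((), 0))) (Term.var (Sum.inr ((), 1)))) ⊓
      fRay (Term.var (Sum.inr ((), 0)), Term.var (Sum.inr ((), 1))))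
  eq := fTrEq (fun k => Term.var (Sum.inr (0, k))) (fun k => Term.var (Sum.inr (1, k)))
  rel R := fTrRel R (fun j k => Term.var (Sum.inr (j, k)))

/-- Satisfaction of the translated formulas. -/
def epReal (δ : LGR.Formula (Fin 3)) (d : Fin 2 → G) {β : Type} (φ : (epOps δ).F β)
    (v : β → Fin 3 → G) : Prop :=
  Formula.Realize (L := LGR) (α := Fin 2 ⊕ β × Fin 3) φ (Sum.elim d fun q => v q.1 q.2)

/-- The two parameters `d` are needed for `Lft G` and `Rt G`, which become definable only after a
direction has been chosen. -/
theorem epModels (hG : IsMN3 G) (hH : H ≤ G) {δ : LGR.Formula (Fin 3)} {d : Fin 2 → G}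
    (hδ : ∀ g : G, δ.Realize ![d 0, d 1, g] ↔ (g : AutED L) ∈ H) :
    (epOps δ).Models (epReal δ d) (RepEp G H) where
  bot _ := id
  imp _ _ _ := Iff.rfl
  all φ v := by
    refine Formula.realize_iAlls.trans (forall_congr' fun t => ?_)
    refine Formula.realize_relabel.trans (iff_of_eq (congrArg _ (funext fun q => ?_)))
    rcases q with d | ⟨_ | b, k⟩ <;> rfl
  map f φ v := by
    refine Formula.realize_relabel.trans (iff_of_eq (congrArg _ (funext fun q => ?_)))
    rcases q with d | ⟨b, k⟩ <;> rfl
  dom v := by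
    rw [exists_repEp_iff hG, ← hδ]
    refine Formula.realize_sup.trans (or_congr (Formula.realize_inf.trans (and_congr
      (realize_eqF _ _ _) ?_)) (Formula.realize_inf.trans (and_congr (Formula.realize_not.trans
        (not_congr (realize_eqF _ _ _))) (realize_fRay _ _))))
    refine Formula.realize_relabel.trans (iff_of_eq (congrArg _ (funext fun q => ?_)))
    fin_cases q <;> rfl
  surj := exists_repEp hG hH
  eq v m h := (realize_fTrEq (fun k => Term.var (Sum.inr ((0 : Fin 2), k)))
    (fun k => Term.var (Sum.inr (1, k))) (Sum.elim d fun q => v q.1 q.2)).trans (repEp_eq_iff hG (h 0) (h 1))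
  rel R v m h := (realize_fTrRel R _ _).trans (repEp_rel_iff hG R h)

end Rep

end MonRec

namespace MonRec

open Set FirstOrder FirstOrder.Language

/-! ### First order interpretation of the action on endpoints -/

/-- The first order strong interpretation of `ACT(Ep(G), G)` in `G`. -/
noncomputable def epInterp : FOInterp LGR LMNPG where
  n := 3
  fU := eqF (Term.var 0) (Term.var 1) ⊔
    (∼(eqF (Term.var 0) (Term.var 1)) ⊓ fRay (Term.var 0, Term.var 1))
  fEq := fTrEq (fun k => Term.var (0, k)) (fun k => Term.var (1, k))
  fRel R := fTrRel R (fun j k => Term.var (j, k))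
  fImap := eqF (Term.var (Sum.inl 0)) (Term.var (Sum.inl 1)) ⊓
    eqF (Term.var (Sum.inl 2)) (Term.var (Sum.inr ()))

/-- The formula on `G` with the same meaning as the formula `φ` on `ACT(Ep(G), H)`, where `H` is
defined by `δ` from the two newest variables. -/
noncomputable def epTrans (δ : LGR.Formula (Fin 3)) {β : Type} (φ : LMNPG.Formula β) :
    LGR.Formula (Option (Option β)) :=
  Formula.relabel (α := Fin 2 ⊕ (β ⊕ Fin 0) × Fin 3)
    (Sum.elim ![some none, none] fun q => q.1.elim (fun b => some (some b)) Fin.elim0)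
    ((epOps δ).trans φ)

section Sem

variable {L : Type u} [LinearOrder L] [NoMinOrder L] [NoMaxOrder L] [Nonempty L] [DenselyOrdered L]
  {G H : Subgroup (AutED L)}

theorem epInterp_fU (hG : IsMN3 G) (t : Fin 3 → G) :
    epInterp.fU.Realize t ↔ ∃ m : ACT (Ep G) G, RepEp G G t m := by
  rw [exists_repEp_iff hG]
  refine Formula.realize_sup.trans (or_congr ?_ ?_)
  · exact (realize_eqF _ _ _).trans (and_iff_left (t 2).2).symm
  · exact Formula.realize_inf.trans (and_congr (Formula.realize_not.trans
      (not_congr (realize_eqF _ _ _))) (realize_fRay _ _))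

theorem exists_isStrongInterpretingMap (hG : IsMN3 G) :
    ∃ μ, epInterp.IsStrongInterpretingMap (M := G) (M' := ACT (Ep G) G) ACT.gr μ := by
  choose μ hμ using fun a : {a : Fin 3 → G // epInterp.fU.Realize a} => (epInterp_fU hG a.1).1 a.2
  refine ⟨μ, fun m => ?_, fun a b => ?_, fun m R a => ?_, fun a x => ?_⟩
  · obtain ⟨t, ht⟩ := exists_repEp hG le_rfl m
    have h := (epInterp_fU hG t).2 ⟨m, ht⟩
    refine ⟨⟨t, h⟩, (repEp_eq_iff hG (hμ ⟨t, h⟩) ht).1 ?_⟩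
    exact (repEp_eq_iff hG ht ht).2 rfl
  · exact (repEp_eq_iff hG (hμ a) (hμ b)).symm.trans (realize_fTrEq
      (fun k => Term.var ((0 : Fin 2), k)) (fun k => Term.var (1, k))
      (fun p => (![a.1, b.1] : Fin 2 → Fin 3 → G) p.1 p.2)).symm
  · exact (repEp_rel_iff hG R fun j => hμ (a j)).symm.trans (realize_fTrRel R
      (fun j k => Term.var (j, k)) (fun p => (a p.1).1 p.2)).symm
  · have h1 : epInterp.fImap.Realize (Sum.elim a fun _ => x) ↔ RepEp G G a (ACT.gr x) :=
      Formula.realize_inf.trans (and_congr (realize_eqF _ _ _)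
        ((realize_eqF _ _ _).trans Subtype.ext_iff))
    rw [h1]
    constructor
    · intro h
      have hU := (epInterp_fU hG a).2 ⟨_, h⟩
      exact ⟨hU, (repEp_eq_iff hG (hμ ⟨a, hU⟩) h).1 ((repEp_eq_iff hG h h).2 rfl)⟩
    · rintro ⟨hU, he⟩
      rw [← he]
      exact hμ ⟨a, hU⟩

theorem realize_epTrans (hG : IsMN3 G) (hH : H ≤ G) {δ : LGR.Formula (Fin 3)} {d : G × G}
    (hδ : ∀ g : G, δ.Realize ![d.1, d.2, g] ↔ (g : AutED L) ∈ H) {β : Type} (φ : LMNPG.Formula β)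
    (g : β → H) : (epTrans δ φ).Realize (push (push (fun b => (⟨g b, hH (g b).2⟩ : G)) d.1) d.2) ↔
      φ.Realize fun b => (ACT.gr (g b) : ACT (Ep G) H) := by
  have h := (epModels hG hH (d := ![d.1, d.2]) hδ).realize_trans φ
    (Sum.elim (fun b _ => ⟨g b, hH (g b).2⟩) Fin.elim0)
    (Sum.elim (fun b => (ACT.gr (g b) : ACT (Ep G) H)) Fin.elim0) (by
      rintro (b | j)
      · exact ⟨rfl, rfl⟩
      · exact j.elim0)
  refine Formula.realize_relabel.trans (Iff.trans (iff_of_eq (congrArg _ (funext fun q => ?_))) (h.trans ?_))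
  · rcases q with q | ⟨b | j, k⟩
    · fin_cases q <;> rfl
    · rfl
    · exact j.elim0
  · rw [Formula.Realize]
    refine iff_of_eq (congrArg₂ _ rfl (Subsingleton.elim _ _))

end Sem

/-- The formula on `G` with the same meaning as the formula `φ` on `ACT(Ep(G), H)`, where `H` is
defined by `δ` from any ray. -/
noncomputable def epTransRay (δ : LGR.Formula (Fin 3)) {β : Type} (φ : LMNPG.Formula β) :
    LGR.Formula β := ex2 (fRay np ⊓ epTrans δ φ)

/-- The sentence that holds in `G` if two sentences hold in the structures that are given by the
directions of the chain, in some order. -/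
noncomputable def pairSentence (φ ψ : LMNPG.Sentence) : LGR.Sentence :=
  ex2 (fRay np ⊓ (epTrans (fBddDir (Term.var 0, Term.var 1) (Term.var 2)) φ ⊓
    ex2 (fRay np ⊓ (∼(fSameDir (upp (upp np)) np) ⊓
      (epTrans (fBddDir (Term.var 0, Term.var 1) (Term.var 2)) ψ).relabel
        (Option.map (Option.map Empty.elim))))))

section Sem

variable {L : Type u} [LinearOrder L] [NoMinOrder L] [NoMaxOrder L] [Nonempty L] [DenselyOrdered L]
  {G H : Subgroup (AutED L)}

theorem IsMN3.exists_ray (hG : IsMN3 G) : ∃ d : G × G, Ray d := by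
  have := hG.locMove
  obtain ⟨d, z, hd⟩ := exists_isLRay (A := G) (Cpl L)
  exact ⟨d, hd.ray⟩

theorem realize_epTransRay (hG : IsMN3 G) (hH : H ≤ G) {δ : LGR.Formula (Fin 3)}
    (hδ : ∀ d : G × G, Ray d → ∀ g : G, δ.Realize ![d.1, d.2, g] ↔ (g : AutED L) ∈ H) {β : Type}
    (φ : LMNPG.Formula β) (g : β → H) :
    (epTransRay δ φ).Realize (fun b => (⟨g b, hH (g b).2⟩ : G)) ↔
      φ.Realize fun b => (ACT.gr (g b) : ACT (Ep G) H) := by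
  simp only [epTransRay, realize_ex2, Formula.realize_inf, realize_fRay, val2_np]
  constructor
  · rintro ⟨d, hd, h⟩
    exact (realize_epTrans hG hH (hδ d hd) φ g).1 h
  · intro h
    obtain ⟨d, hd⟩ := hG.exists_ray
    exact ⟨d, hd, (realize_epTrans hG hH (hδ d hd) φ g).2 h⟩

theorem sentence_epTransRay (hG : IsMN3 G) (hH : H ≤ G) {δ : LGR.Formula (Fin 3)}
    (hδ : ∀ d : G × G, Ray d → ∀ g : G, δ.Realize ![d.1, d.2, g] ↔ (g : AutED L) ∈ H)
    (φ : LMNPG.Sentence) : G ⊨ (epTransRay δ φ : LGR.Sentence) ↔ ACT (Ep G) H ⊨ φ := by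
  have := realize_epTransRay hG hH hδ φ Empty.elim
  rw [Sentence.Realize, Sentence.Realize]
  convert this using 2

theorem bddAbove_iff_mem_lft (g : G) : BddAbove (sp (Cpl L) g) ↔ (g : AutED L) ∈ Lft G :=
  (and_iff_right g.2).symm

theorem bddBelow_iff_mem_rt (g : G) : BddBelow (sp (Cpl L) g) ↔ (g : AutED L) ∈ Rt G :=
  (and_iff_right g.2).symm

theorem bddDir_iff_mem_lft (hG : IsMN3 G) {d : G × G} {z : Cpl L} (hd : IsLRay (Cpl L) d z) (g : G) :
    BddDir d g ↔ (g : AutED L) ∈ Lft G := by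
  have := hG.locMove
  rw [hd.bddDir_iff, bddAbove_iff_mem_lft]

theorem bddDir_iff_mem_rt (hG : IsMN3 G) {d : G × G} {z : Cpl L}
    (hd : IsLRay (Cpl L)ᵒᵈ d (OrderDual.toDual z)) (g : G) : BddDir d g ↔ (g : AutED L) ∈ Rt G := by
  have := hG.locMove
  rw [hd.bddDir_iff_dual, bddBelow_iff_mem_rt]

theorem bddBoth_iff_mem (hG : IsMN3 G) (g : G) : BddBoth g ↔ (g : AutED L) ∈ Bdd G := by
  have := hG.locMove
  rw [bddBoth_iff (X := Cpl L), bddAbove_iff_mem_lft, bddBelow_iff_mem_rt]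
  rfl

theorem keepsDir_iff_strictMono (hG : IsMN3 G) (g : G) : KeepsDir g ↔ StrictMono (g : AutED L).1 := by
  have := hG.locMove
  rw [keepsDir_iff (X := Cpl L), inc_cpl_iff]

/-- Two rays of opposite direction name the two sides of the chain, but which is which cannot be
expressed. Hence the disjunction over both orders. -/
theorem realize_pairSentence (hG : IsMN3 G) (φ ψ : LMNPG.Sentence) : G ⊨ pairSentence φ ψ ↔
    (ACT (Ep G) (Lft G) ⊨ φ ∧ ACT (Ep G) (Rt G) ⊨ ψ) ∨
      (ACT (Ep G) (Rt G) ⊨ φ ∧ ACT (Ep G) (Lft G) ⊨ ψ) := by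
  have := hG.locMove
  have hL : ∀ (d : G × G) (z : Cpl L), IsLRay (Cpl L) d z → ∀ (φ : LMNPG.Sentence) (e : Empty → G),
      ((epTrans (fBddDir (Term.var 0, Term.var 1) (Term.var 2)) φ).Realize (push (push e d.1) d.2) ↔
        ACT (Ep G) (Lft G) ⊨ φ) := by
    intro d z hd φ e
    rw [Sentence.Realize, Subsingleton.elim e fun b => ⟨_, lft_le (Empty.elim b : Lft G).2⟩,
      realize_epTrans hG lft_le (fun g => (realize_fBddDir (Term.var 0, Term.var 1) (Term.var 2)
        ![d.1, d.2, g]).trans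
        (bddDir_iff_mem_lft hG hd g)) φ]
    exact iff_of_eq (congrArg _ (Subsingleton.elim _ _))
  have hR : ∀ (d : G × G) (z : Cpl L), IsLRay (Cpl L)ᵒᵈ d (OrderDual.toDual z) →
      ∀ (φ : LMNPG.Sentence) (e : Empty → G),
      ((epTrans (fBddDir (Term.var 0, Term.var 1) (Term.var 2)) φ).Realize (push (push e d.1) d.2) ↔
        ACT (Ep G) (Rt G) ⊨ φ) := by
    intro d z hd φ e
    rw [Sentence.Realize, Subsingleton.elim e fun b => ⟨_, rt_le (Empty.elim b : Rt G).2⟩,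
      realize_epTrans hG rt_le (fun g => (realize_fBddDir (Term.var 0, Term.var 1) (Term.var 2)
        ![d.1, d.2, g]).trans
        (bddDir_iff_mem_rt hG hd g)) φ]
    exact iff_of_eq (congrArg _ (Subsingleton.elim _ _))
  have key : G ⊨ pairSentence φ ψ ↔ ∃ d : G × G, Ray d ∧
      (epTrans (fBddDir (Term.var 0, Term.var 1) (Term.var 2)) φ).Realize
        (push (push Empty.elim d.1) d.2) ∧ ∃ d' : G × G, Ray d' ∧ ¬ SameDir d d' ∧
      (epTrans (fBddDir (Term.var 0, Term.var 1) (Term.var 2)) ψ).Realize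
        (push (push Empty.elim d'.1) d'.2) := by
    rw [Sentence.Realize, Subsingleton.elim (default : Empty → G) Empty.elim]
    simp only [pairSentence, realize_ex2, Formula.realize_inf, realize_fRay, val2_np,
      Formula.realize_not, realize_fSameDir, val2_upp, Formula.realize_relabel]
    -- The translation of `ψ` refers to the newest pair only; the relabelling forgets the pair
    -- quantified before it.
    have : ∀ d d' : G × G, push (push (push (push Empty.elim d.1) d.2) d'.1) d'.2 ∘
        Option.map (Option.map Empty.elim) = push (push Empty.elim d'.1) d'.2 := by
      intro d d'
      funext o
      rcases o with _ | _ | e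
      · rfl
      · rfl
      · exact e.elim
    simp only [this]
  rw [key]
  constructor
  · rintro ⟨d, hd, h1, d', hd', hne, h2⟩
    obtain ⟨z, hz | hz⟩ := (ray_iff (X := Cpl L)).1 hd <;>
    obtain ⟨z', hz' | hz'⟩ := (ray_iff (X := Cpl L)).1 hd'
    · exact absurd (hz.sameDir hz') hne
    · exact Or.inl ⟨(hL d z hz _ _).1 h1, (hR d' z' hz' _ _).1 h2⟩
    · exact Or.inr ⟨(hR d z hz _ _).1 h1, (hL d' z' hz' _ _).1 h2⟩
    · exact absurd (IsLRay.sameDir hz hz') hne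
  · obtain ⟨d, z, hz⟩ := exists_isLRay (A := G) (Cpl L)
    obtain ⟨d', z', hz'⟩ := exists_isLRay_dual (A := G) (Cpl L)
    have hd' : Ray d' := ray_iff.2 ⟨z', Or.inr hz'⟩
    rintro (⟨h1, h2⟩ | ⟨h1, h2⟩)
    · exact ⟨d, hz.ray, (hL d z hz _ _).2 h1, d', hd', hz.not_sameDir hz', (hR d' z' hz' _ _).2 h2⟩
    · exact ⟨d', hd', (hR d' z' hz' _ _).2 h1, d, hz.ray,
        fun h => hz.not_sameDir hz' h.symm, (hL d z hz _ _).2 h2⟩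

end Sem

end MonRec

namespace MonRec

open Set FirstOrder FirstOrder.Language

/-! ### Elementary equivalence -/

section Two

variable {L₁ : Type u} [LinearOrder L₁] [DenselyOrdered L₁] [NoMinOrder L₁] [NoMaxOrder L₁]
  [Nonempty L₁] {L₂ : Type v} [LinearOrder L₂] [DenselyOrdered L₂] [NoMinOrder L₂] [NoMaxOrder L₂]
  [Nonempty L₂] {G₁ : Subgroup (AutED L₁)} {G₂ : Subgroup (AutED L₂)}

theorem elementarilyEquivalent_of_epTransRay (h₁ : IsMN3 G₁) (h₂ : IsMN3 G₂)
    (h : LGR.ElementarilyEquivalent G₁ G₂) {H₁ : Subgroup (AutED L₁)} {H₂ : Subgroup (AutED L₂)}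
    (hH₁ : H₁ ≤ G₁) (hH₂ : H₂ ≤ G₂) (δ : LGR.Formula (Fin 3))
    (hδ₁ : ∀ d : G₁ × G₁, Ray d → ∀ g : G₁, δ.Realize ![d.1, d.2, g] ↔ (g : AutED L₁) ∈ H₁)
    (hδ₂ : ∀ d : G₂ × G₂, Ray d → ∀ g : G₂, δ.Realize ![d.1, d.2, g] ↔ (g : AutED L₂) ∈ H₂) :
    LMNPG.ElementarilyEquivalent (ACT (Ep G₁) H₁) (ACT (Ep G₂) H₂) := by
  rw [elementarilyEquivalent_iff] at *
  intro φ
  rw [← sentence_epTransRay h₁ hH₁ hδ₁, h, sentence_epTransRay h₂ hH₂ hδ₂]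

/-- Suppose that the pairs match in neither order and take a witness against each order. Two
witnesses from the same left theory have a conjunction that fails in both right theories, so by `h`
the other left theory would contain no sentence at all. Two witnesses from different left theories
contradict `h` at once. -/
theorem theories_match {S₁ S₂ T₁ T₂ : LMNPG.Sentence → Prop}
    (inf : ∀ φ ψ, (S₁ (φ ⊓ ψ) ↔ S₁ φ ∧ S₁ ψ) ∧ (S₂ (φ ⊓ ψ) ↔ S₂ φ ∧ S₂ ψ) ∧
      (T₁ (φ ⊓ ψ) ↔ T₁ φ ∧ T₁ ψ) ∧ (T₂ (φ ⊓ ψ) ↔ T₂ φ ∧ T₂ ψ))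
    (neg : ∀ φ, (S₁ (∼φ) ↔ ¬ S₁ φ) ∧ (S₂ (∼φ) ↔ ¬ S₂ φ) ∧ (T₁ (∼φ) ↔ ¬ T₁ φ) ∧ (T₂ (∼φ) ↔ ¬ T₂ φ))
    (h : ∀ φ ψ, (S₁ φ ∧ T₁ ψ) ∨ (T₁ φ ∧ S₁ ψ) ↔ (S₂ φ ∧ T₂ ψ) ∨ (T₂ φ ∧ S₂ ψ)) :
    ((∀ φ, S₁ φ ↔ S₂ φ) ∧ ∀ φ, T₁ φ ↔ T₂ φ) ∨ ((∀ φ, S₁ φ ↔ T₂ φ) ∧ ∀ φ, T₁ φ ↔ S₂ φ) := by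
  have sep : ∀ {A B : LMNPG.Sentence → Prop}, (∀ φ, A (∼φ) ↔ ¬ A φ) → (∀ φ, B (∼φ) ↔ ¬ B φ) →
      (¬ ∀ φ, A φ ↔ B φ) → ∃ φ, A φ ∧ ¬ B φ := by
    intro A B hA hB hn
    push Not at hn
    obtain ⟨φ, ⟨h1, h2⟩ | ⟨h1, h2⟩⟩ := hn
    · exact ⟨φ, h1, h2⟩
    · exact ⟨∼φ, (hA φ).2 h1, fun h3 => (hB φ).1 h3 h2⟩
  by_contra! hn
  have c1 : (∃ φ, S₁ φ ∧ ¬ S₂ φ) ∨ ∃ φ, T₁ φ ∧ ¬ T₂ φ := by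
    by_cases hS : ∀ φ, S₁ φ ↔ S₂ φ
    · obtain ⟨φ, hφ⟩ := hn.1 hS
      exact Or.inr (sep (fun φ => (neg φ).2.2.1) (fun φ => (neg φ).2.2.2) fun h => by
        have := h φ; tauto)
    · exact Or.inl (sep (fun φ => (neg φ).1) (fun φ => (neg φ).2.1) hS)
  have c2 : (∃ φ, S₁ φ ∧ ¬ T₂ φ) ∨ ∃ φ, T₁ φ ∧ ¬ S₂ φ := by
    by_cases hS : ∀ φ, S₁ φ ↔ T₂ φ
    · obtain ⟨φ, hφ⟩ := hn.2 hS
      exact Or.inr (sep (fun φ => (neg φ).2.2.1) (fun φ => (neg φ).2.1) fun h => by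
        have := h φ; tauto)
    · exact Or.inl (sep (fun φ => (neg φ).1) (fun φ => (neg φ).2.2.2) hS)
  rcases c1 with ⟨φ, h1, h2⟩ | ⟨φ, h1, h2⟩ <;> rcases c2 with ⟨ψ, h3, h4⟩ | ⟨ψ, h3, h4⟩
  · have m1 := (inf φ ψ).1.2 ⟨h1, h3⟩
    have m2 : ¬ S₂ (φ ⊓ ψ) := fun h' => h2 ((inf φ ψ).2.1.1 h').1
    have m3 : ¬ T₂ (φ ⊓ ψ) := fun h' => h4 ((inf φ ψ).2.2.2.1 h').2
    have key : ∀ θ, ¬ T₁ θ := fun θ hθ =>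
      ((h (φ ⊓ ψ) θ).1 (Or.inl ⟨m1, hθ⟩)).elim (fun x => m2 x.1) fun x => m3 x.1
    exact key (∼φ) ((neg φ).2.2.1.2 (key φ))
  · exact ((h φ ψ).1 (Or.inl ⟨h1, h3⟩)).elim (fun x => h2 x.1) fun x => h4 x.2
  · exact ((h φ ψ).1 (Or.inr ⟨h1, h3⟩)).elim (fun x => h4 x.2) fun x => h2 x.1
  · have m1 := (inf φ ψ).2.2.1.2 ⟨h1, h3⟩
    have m2 : ¬ T₂ (φ ⊓ ψ) := fun h' => h2 ((inf φ ψ).2.2.2.1 h').1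
    have m3 : ¬ S₂ (φ ⊓ ψ) := fun h' => h4 ((inf φ ψ).2.1.1 h').2
    have key : ∀ θ, ¬ S₁ θ := fun θ hθ =>
      ((h (φ ⊓ ψ) θ).1 (Or.inr ⟨m1, hθ⟩)).elim (fun x => m3 x.1) fun x => m2 x.1
    exact key (∼φ) ((neg φ).1.2 (key φ))

/-- Elementarily equivalent groups have elementarily equivalent actions on endpoints. -/
theorem act_elementarilyEquivalent (h₁ : IsMN3 G₁) (h₂ : IsMN3 G₂)
    (h : LGR.ElementarilyEquivalent G₁ G₂) :
    LMNPG.ElementarilyEquivalent (ACT (Ep G₁) G₁) (ACT (Ep G₂) G₂) ∧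
    LMNPG.ElementarilyEquivalent (ACT (Ep G₁) (Bdd G₁)) (ACT (Ep G₂) (Bdd G₂)) ∧
    LMNPG.ElementarilyEquivalent (ACT (Ep G₁) (Opp G₁)) (ACT (Ep G₂) (Opp G₂)) ∧
    ((LMNPG.ElementarilyEquivalent (ACT (Ep G₁) (Lft G₁)) (ACT (Ep G₂) (Lft G₂)) ∧
        LMNPG.ElementarilyEquivalent (ACT (Ep G₁) (Rt G₁)) (ACT (Ep G₂) (Rt G₂))) ∨
      (LMNPG.ElementarilyEquivalent (ACT (Ep G₁) (Lft G₁)) (ACT (Ep G₂) (Rt G₂)) ∧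
        LMNPG.ElementarilyEquivalent (ACT (Ep G₁) (Rt G₁)) (ACT (Ep G₂) (Lft G₂)))) := by
  refine ⟨?_, ?_, ?_, ?_⟩
  · exact elementarilyEquivalent_of_epTransRay h₁ h₂ h le_rfl le_rfl ⊤
      (fun d _ g => iff_of_true (by simp) g.2) (fun d _ g => iff_of_true (by simp) g.2)
  · exact elementarilyEquivalent_of_epTransRay h₁ h₂ h bdd_le bdd_le (fBddBoth (Term.var 2))
      (fun d _ g => (realize_fBddBoth _ _).trans (bddBoth_iff_mem h₁ g))
      (fun d _ g => (realize_fBddBoth _ _).trans (bddBoth_iff_mem h₂ g))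
  · exact elementarilyEquivalent_of_epTransRay h₁ h₂ h opp_le opp_le (fKeepsDir (Term.var 2))
      (fun d _ g => (realize_fKeepsDir _ _).trans
        ((keepsDir_iff_strictMono h₁ g).trans (and_iff_right g.2).symm))
      (fun d _ g => (realize_fKeepsDir _ _).trans
        ((keepsDir_iff_strictMono h₂ g).trans (and_iff_right g.2).symm))
  · simp only [elementarilyEquivalent_iff]
    rw [elementarilyEquivalent_iff] at h
    refine theories_match (fun φ ψ => ?_) (fun φ => ?_) fun φ ψ => ?_
    · exact ⟨Formula.realize_inf, Formula.realize_inf, Formula.realize_inf, Formula.realize_inf⟩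
    · exact ⟨Formula.realize_not, Formula.realize_not, Formula.realize_not, Formula.realize_not⟩
    · rw [← realize_pairSentence h₁, ← realize_pairSentence h₂, h]

end Two

section One

variable {L : Type u} [LinearOrder L] [DenselyOrdered L] [NoMinOrder L] [NoMaxOrder L] [Nonempty L]
  {G : Subgroup (AutED L)}

theorem exists_bddDir_iff (hG : IsMN3 G) (g : G) : (∃ d : G × G, Ray d ∧ BddDir d g) ↔
    (g : AutED L) ∈ Lft G ∨ (g : AutED L) ∈ Rt G := by
  have := hG.locMove
  exact exists_ray_iff (X := Cpl L) (fun d z hd => bddDir_iff_mem_lft hG hd g)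
    fun d z hd => bddDir_iff_mem_rt hG hd g

theorem exists_bddDir₂_iff (hG : IsMN3 G) (f g : G) :
    (∃ d : G × G, Ray d ∧ BddDir d f ∧ BddDir d g) ↔
      ((f : AutED L) ∈ Lft G ∧ (g : AutED L) ∈ Lft G) ∨
        ((f : AutED L) ∈ Rt G ∧ (g : AutED L) ∈ Rt G) := by
  have := hG.locMove
  exact exists_ray_iff (X := Cpl L)
    (fun d z hd => and_congr (bddDir_iff_mem_lft hG hd f) (bddDir_iff_mem_lft hG hd g))
    fun d z hd => and_congr (bddDir_iff_mem_rt hG hd f) (bddDir_iff_mem_rt hG hd g)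

/-- A group is not elementarily equivalent to its proper distinguished subgroups. -/
theorem IsMN3.eq_of_elementarilyEquivalent (hG : IsMN3 G) {H : Subgroup (AutED L)}
    (hH : H = Bdd G ∨ H = Lft G ∨ H = Rt G ∨ H = Opp G) (h : LGR.ElementarilyEquivalent G H) :
    G = H := by
  rw [elementarilyEquivalent_iff] at h
  have hB : ∀ {H : Subgroup (AutED L)}, H = Bdd G → (∀ φ : LGR.Sentence, G ⊨ φ ↔ H ⊨ φ) → G = H := by
    rintro _ rfl h
    have h1 := h (allO (fBddBoth nv))
    simp only [Sentence.Realize, realize_allO, realize_fBddBoth, realize_nv,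
      bddBoth_iff_mem hG, bddBoth_iff_mem hG.bdd] at h1
    refine le_antisymm (fun g hg => h1.2 (fun k => ?_) ⟨g, hg⟩) bdd_le
    exact mem_bdd_iff.2 ⟨k.2, (mem_bdd_iff.1 k.2).2⟩
  -- The sentence says that any two elements are bounded on a common side. In `G` it fails for a
  -- pair consisting of an element outside `Lft G` and one outside `Rt G`.
  have hS : (∀ f g : H, (∃ d : H × H, Ray d ∧ BddDir d f ∧ BddDir d g)) →
      G = Lft G ∨ G = Rt G := by
    intro h0
    have h1 := h (allO (allO (ex2 (fRay np ⊓ (fBddDir np (up (up (up nv))) ⊓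
      fBddDir np (up (up nv)))))))
    simp only [Sentence.Realize, realize_allO, realize_fBddDir, realize_nv, realize_up,
      realize_ex2, Formula.realize_inf, realize_fRay, val2_np] at h1
    have h2 := h1.2 h0
    simp only [exists_bddDir₂_iff hG] at h2
    by_contra! hn
    have e1 : ∃ f ∈ G, f ∉ Lft G := by
      by_contra! h3
      exact hn.1 (le_antisymm h3 lft_le)
    have e2 : ∃ f ∈ G, f ∉ Rt G := by
      by_contra! h3
      exact hn.2 (le_antisymm h3 rt_le)
    obtain ⟨f, hf, hf'⟩ := e1
    obtain ⟨g, hg, hg'⟩ := e2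
    rcases h2 ⟨f, hf⟩ ⟨g, hg⟩ with h3 | h3
    · exact hf' h3.1
    · exact hg' h3.2
  rcases hH with hH | rfl | rfl | rfl
  · exact hB hH h
  · rcases hS (fun f g => (exists_bddDir₂_iff hG.lft f g).2
      (by rw [lft_lft]; exact Or.inl ⟨f.2, g.2⟩)) with h1 | h1
    · exact h1
    -- In this case `G` equals `Rt G`, so `Lft G` is `Bdd G` and the first case applies.
    · exact hB (by rw [Bdd, ← h1]; exact (inf_eq_left.2 lft_le).symm) h
  · rcases hS (fun f g => (exists_bddDir₂_iff hG.rt f g).2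
      (by rw [rt_rt]; exact Or.inr ⟨f.2, g.2⟩)) with h1 | h1
    · exact hB (by rw [Bdd, ← h1]; exact (inf_eq_right.2 rt_le).symm) h
    · exact h1
  · have h1 := h (allO (fKeepsDir nv))
    simp only [Sentence.Realize, realize_allO, realize_fKeepsDir, realize_nv,
      keepsDir_iff_strictMono hG, keepsDir_iff_strictMono hG.opp] at h1
    exact le_antisymm (fun g hg => ⟨hg, h1.2 (fun k => k.2.2) ⟨g, hg⟩⟩) opp_le

end One

/-! ### Properties expressed by first order formulas -/

theorem foExpressible_act (n : ℕ) (φ : LMNPG.Formula (Fin n)) :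
    FOExpressible.{u} n (fun _ _ _ _ _ _ G g =>
      φ.Realize (fun j => (ACT.gr (g j) : ACT (Ep G) G))) :=
  ⟨epTransRay ⊤ φ, fun _ _ _ _ _ _ _ hG g =>
    realize_epTransRay hG le_rfl (fun _ _ g => iff_of_true (by simp) g.2) φ g⟩

theorem foExpressible_mem_bdd :
    FOExpressible.{u} 1 (fun _ _ _ _ _ _ G g => (g 0).1 ∈ Bdd G) :=
  ⟨fBddBoth (Term.var 0), fun _ _ _ _ _ _ _ hG _ =>
    (realize_fBddBoth _ _).trans (bddBoth_iff_mem hG _)⟩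

theorem foExpressible_strictMono :
    FOExpressible.{u} 1 (fun _ _ _ _ _ _ _ g => StrictMono (g 0).1.1) :=
  ⟨fKeepsDir (Term.var 0), fun _ _ _ _ _ _ _ hG _ =>
    (realize_fKeepsDir _ _).trans (keepsDir_iff_strictMono hG _)⟩

theorem foExpressible_mem_lft_or_rt :
    FOExpressible.{u} 1 (fun _ _ _ _ _ _ G g => (g 0).1 ∈ Lft G ∨ (g 0).1 ∈ Rt G) := by
  refine ⟨ex2 (fRay np ⊓ fBddDir np (up (up (Term.var 0)))), fun L _ _ _ _ _ G hG g => ?_⟩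
  beta_reduce
  rw [← exists_bddDir_iff hG]
  simp only [realize_ex2, Formula.realize_inf, realize_fRay, val2_np, realize_fBddDir, realize_up]
  rfl

theorem foExpressible_same_side :
    FOExpressible.{u} 2 (fun _ _ _ _ _ _ G g =>
      ((g 0).1 ∈ Lft G ∧ (g 1).1 ∈ Lft G) ∨ ((g 0).1 ∈ Rt G ∧ (g 1).1 ∈ Rt G)) := by
  refine ⟨ex2 (fRay np ⊓ (fBddDir np (up (up (Term.var 0))) ⊓ fBddDir np (up (up (Term.var 1))))),
    fun L _ _ _ _ _ G hG g => ?_⟩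
  beta_reduce
  rw [← exists_bddDir₂_iff hG]
  simp only [realize_ex2, Formula.realize_inf, realize_fRay, val2_np, realize_fBddDir, realize_up]
  rfl

/-! ### Signed elements and equality of signs. -/

section Signed

variable {L : Type u} [LinearOrder L] [DenselyOrdered L] [NoMinOrder L] [NoMaxOrder L] [Nonempty L]
  {G : Subgroup (AutED L)}

theorem forall_le_smul_iff {g : G} : (∀ x : Cpl L, x ≤ g • x) ↔ ∀ x : L, x ≤ (g : AutED L).1 x := by
  have := pwLE_iff (f := 1) (g := g)
  simp only [one_smul] at this
  exact this.symm

theorem forall_smul_le_iff {g : G} : (∀ x : Cpl L, g • x ≤ x) ↔ ∀ x : L, (g : AutED L).1 x ≤ x := by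
  have := pwLE_iff (f := g) (g := 1)
  simp only [one_smul] at this
  exact this.symm

theorem exists_movesUp_iff (hG : IsMN3 G) (g : G) : (∃ d : G × G, Ray d ∧ MovesUp d g) ↔
    (∀ x : L, x ≤ (g : AutED L).1 x) ∨ ∀ x : L, (g : AutED L).1 x ≤ x := by
  have := hG.locMove
  exact exists_ray_iff (X := Cpl L) (fun d z hd => hd.movesUp_iff.trans forall_le_smul_iff)
    fun d z hd => hd.movesUp_iff_dual.trans forall_smul_le_iff

theorem exists_movesUp₂_iff (hG : IsMN3 G) (f g : G) :
    (∃ d : G × G, Ray d ∧ MovesUp d f ∧ MovesUp d g) ↔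
    ((∀ x : L, x ≤ (f : AutED L).1 x) ∧ ∀ x : L, x ≤ (g : AutED L).1 x) ∨
      ((∀ x : L, (f : AutED L).1 x ≤ x) ∧ ∀ x : L, (g : AutED L).1 x ≤ x) := by
  have := hG.locMove
  exact exists_ray_iff (X := Cpl L)
    (fun d z hd => and_congr (hd.movesUp_iff.trans forall_le_smul_iff)
      (hd.movesUp_iff.trans forall_le_smul_iff))
    fun d z hd => and_congr (hd.movesUp_iff_dual.trans forall_smul_le_iff)
      (hd.movesUp_iff_dual.trans forall_smul_le_iff)

theorem exists_moved {g : AutED L} (h : g ≠ 1) : ∃ x, g.1 x ≠ x := by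
  by_contra! hn
  exact h (Subtype.ext (Equiv.ext hn))

/-- Both elements move some point, and comparing these two moves excludes opposite signs. -/
theorem sameSign_iff {f g : AutED L} : SameSign f g ↔ f ≠ 1 ∧ g ≠ 1 ∧
    (((∀ x, x ≤ f.1 x) ∧ ∀ x, x ≤ g.1 x) ∨ ((∀ x, f.1 x ≤ x) ∧ ∀ x, g.1 x ≤ x)) := by
  constructor
  · rintro ⟨⟨hf, hf'⟩, ⟨hg, hg'⟩, h⟩
    refine ⟨hf, hg, ?_⟩
    obtain ⟨x, hx⟩ := exists_moved hf
    obtain ⟨y, hy⟩ := exists_moved hg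
    rcases hf' with hf' | hf' <;> rcases hg' with hg' | hg'
    · exact Or.inl ⟨hf', hg'⟩
    · rcases h x y hx hy with h1 | h1
      · exact absurd (hf' x) (not_le.2 h1.1)
      · exact absurd (hg' y) (not_le.2 h1.2)
    · rcases h x y hx hy with h1 | h1
      · exact absurd (hg' y) (not_le.2 h1.2)
      · exact absurd (hf' x) (not_le.2 h1.1)
    · exact Or.inr ⟨hf', hg'⟩
  · rintro ⟨hf, hg, h | h⟩
    · exact ⟨⟨hf, Or.inl h.1⟩, ⟨hg, Or.inl h.2⟩, fun x y hx hy =>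
        Or.inr ⟨(h.1 x).lt_of_ne' hx, (h.2 y).lt_of_ne' hy⟩⟩
    · exact ⟨⟨hf, Or.inr h.1⟩, ⟨hg, Or.inr h.2⟩, fun x y hx hy =>
        Or.inl ⟨(h.1 x).lt_of_ne hx, (h.2 y).lt_of_ne hy⟩⟩

/-- The language has no constant for the identity, but in a group it is the only idempotent. -/
theorem mul_self_eq_iff_eq_one {g : G} : ¬ g * g = g ↔ (g : AutED L) ≠ 1 := by
  rw [mul_eq_left, ← OneMemClass.coe_eq_one]

end Signed

theorem foExpressible_signed :
    FOExpressible.{u} 1 (fun _ _ _ _ _ _ _ g => Signed (g 0).1) := by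
  refine ⟨∼(eqF (Term.var 0 * Term.var 0) (Term.var 0)) ⊓
    ex2 (fRay np ⊓ fMovesUp np (up (up (Term.var 0)))), fun L _ _ _ _ _ G hG g => ?_⟩
  beta_reduce
  rw [Signed, ← exists_movesUp_iff hG, ← mul_self_eq_iff_eq_one]
  simp only [realize_ex2, Formula.realize_inf, realize_fRay, val2_np, realize_fMovesUp, realize_up,
    Formula.realize_not, realize_eqF]
  rfl

theorem foExpressible_sameSign :
    FOExpressible.{u} 2 (fun _ _ _ _ _ _ _ g => SameSign (g 0).1 (g 1).1) := by
  refine ⟨∼(eqF (Term.var 0 * Term.var 0) (Term.var 0)) ⊓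
    (∼(eqF (Term.var 1 * Term.var 1) (Term.var 1)) ⊓
    ex2 (fRay np ⊓ (fMovesUp np (up (up (Term.var 0))) ⊓ fMovesUp np (up (up (Term.var 1)))))),
    fun L _ _ _ _ _ G hG g => ?_⟩
  beta_reduce
  rw [sameSign_iff, ← exists_movesUp₂_iff hG, ← mul_self_eq_iff_eq_one, ← mul_self_eq_iff_eq_one]
  simp only [realize_ex2, Formula.realize_inf, realize_fRay, val2_np, realize_fMovesUp, realize_up,
    Formula.realize_not, realize_eqF]
  rfl

/-! ### Counting orbits of endpoints. -/

section Orbits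

variable {L : Type u} [LinearOrder L] [DenselyOrdered L] [NoMinOrder L] [NoMaxOrder L] [Nonempty L]
  {G : Subgroup (AutED L)}

theorem forall_ep_iff (hG : IsMN3 G) {P : Cpl L → Prop} {Q : G × G → Prop}
    (h : ∀ p x, IsRayAt (Cpl L) p x → (Q p ↔ P x)) :
    (∀ x ∈ Ep G, P x) ↔ ∀ p : G × G, Ray p → Q p := by
  have := hG.locMove
  constructor
  · intro H p hp
    obtain ⟨x, hx⟩ := (ray_iff (X := Cpl L)).1 hp
    exact (h p x hx).2 (H x ((mem_ep_iff hG).2 ⟨p, hx⟩))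
  · intro H x hx
    obtain ⟨p, hp⟩ := (mem_ep_iff hG).1 hx
    exact (h p x hp).1 (H p (ray_iff.2 ⟨x, hp⟩))

theorem mem_orbit_iff (hG : IsMN3 G) {p q : G × G} {x y : Cpl L} (hp : IsRayAt (Cpl L) p x)
    (hq : IsRayAt (Cpl L) q y) : (∃ g : G, RayMap g p q) ↔ y ∈ orbit G x := by
  have := hG.locMove
  rw [orbit_eq]
  exact exists_congr fun g => hp.rayMap_iff hq

theorem orbit_eq_iff {x y : Cpl L} : orbit G x = orbit G y ↔ y ∈ orbit G x := by
  rw [orbit_eq, orbit_eq]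
  exact eq_comm.trans MulAction.orbit_eq_iff

/-- A system of exactly `n` rays representing the orbits once each is a statement about the group,
since lying in one orbit is expressed by `RayMap`. -/
theorem encard_orbits_iff (hG : IsMN3 G) (n : ℕ) : (orbit G '' Ep G).encard = n ↔
    ∃ p : Fin n → G × G, (∀ i, Ray (p i)) ∧ (∀ i j, i ≠ j → ¬ ∃ g, RayMap g (p i) (p j)) ∧
      ∀ q : G × G, Ray q → ∃ i, ∃ g, RayMap g (p i) q := by
  have := hG.locMove
  constructor
  · intro h
    have hf : (orbit G '' Ep G).Finite := Set.finite_of_encard_eq_coe h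
    have : Nonempty (Fin n ≃ (orbit G '' Ep G)) := by
      have := hf.fintype
      have e := Fintype.equivFin (orbit G '' Ep G)
      have hc : Fintype.card (orbit G '' Ep G) = n := by
        rw [← Set.coe_fintypeCard] at h
        exact_mod_cast h
      rw [hc] at e
      exact ⟨e.symm⟩
    obtain ⟨e⟩ := this
    have h1 : ∀ i, ∃ p : G × G, ∃ x, IsRayAt (Cpl L) p x ∧ orbit G x = e i := by
      intro i
      obtain ⟨x, hx, hxi⟩ := (e i).2
      obtain ⟨p, hp⟩ := (mem_ep_iff hG).1 hx
      exact ⟨p, x, hp, hxi⟩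
    choose p x hp hx using h1
    refine ⟨p, fun i => ray_iff.2 ⟨_, hp i⟩, fun i j hij hg => ?_, fun q hq => ?_⟩
    · rw [mem_orbit_iff hG (hp i) (hp j), ← orbit_eq_iff, hx, hx] at hg
      exact hij (e.injective (Subtype.ext hg))
    · obtain ⟨y, hy⟩ := (ray_iff (X := Cpl L)).1 hq
      refine ⟨e.symm ⟨orbit G y, y, (mem_ep_iff hG).2 ⟨q, hy⟩, rfl⟩, ?_⟩
      rw [mem_orbit_iff hG (hp _) hy, ← orbit_eq_iff, hx, e.apply_symm_apply]
  · rintro ⟨p, hr, hne, hall⟩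
    choose x hx using fun i => (ray_iff (X := Cpl L)).1 (hr i)
    have hinj : Function.Injective fun i => orbit G (x i) := by
      intro i j hij
      by_contra h
      exact hne i j h ((mem_orbit_iff hG (hx i) (hx j)).2 (orbit_eq_iff.1 hij))
    have hrange : orbit G '' Ep G = range fun i => orbit G (x i) := by
      ext M
      constructor
      · rintro ⟨y, hy, rfl⟩
        obtain ⟨q, hq⟩ := (mem_ep_iff hG).1 hy
        obtain ⟨i, hi⟩ := hall q (ray_iff.2 ⟨_, hq⟩)
        exact ⟨i, orbit_eq_iff.2 ((mem_orbit_iff hG (hx i) hq).1 hi)⟩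
      · rintro ⟨i, rfl⟩
        exact ⟨x i, (mem_ep_iff hG).2 ⟨_, hx i⟩, rfl⟩
    rw [hrange, ← image_univ, hinj.encard_image, encard_univ]
    simp

end Orbits

theorem foExpressible_transitive :
    FOExpressible.{u} 0 (fun _ _ _ _ _ _ G _ => ∀ x ∈ Ep G, ∀ y ∈ Ep G, y ∈ orbit G x) := by
  refine ⟨all2 ((fRay np).imp (all2 ((fRay np).imp (exO (fRayMap nv (upp (upp (upp np)))
    (upp np)))))), fun L _ _ _ _ _ G hG g => ?_⟩
  simp only [realize_all2, Formula.realize_imp, realize_fRay, val2_np, realize_exO, realize_fRayMap,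
    realize_nv, val2_upp]
  exact (forall_ep_iff hG fun p x hp => (forall_ep_iff hG fun q y hq =>
    mem_orbit_iff hG hp hq).symm).symm

theorem foExpressible_orbits (n : ℕ) :
    FOExpressible.{u} 0 (fun _ _ _ _ _ _ G _ => (orbit G '' Ep G).encard = n) := by
  let t : Fin n → LGR.Term (Fin 0 ⊕ Fin n × Fin 2) × LGR.Term (Fin 0 ⊕ Fin n × Fin 2) := fun i =>
    (Term.var (Sum.inr (i, 0)), Term.var (Sum.inr (i, 1)))
  refine ⟨Formula.iExs (Fin n × Fin 2) ((Formula.iInf fun i => fRay (t i)) ⊓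
    ((Formula.iInf fun i => Formula.iInf fun j =>
      if i = j then ⊤ else ∼(exO (fRayMap nv (upp (t i)) (upp (t j))))) ⊓
    all2 ((fRay np).imp (Formula.iSup fun i => exO (fRayMap nv (upp (upp (upp (t i))))
      (upp np)))))), fun L _ _ _ _ _ G hG g => ?_⟩
  beta_reduce
  rw [encard_orbits_iff hG]
  have key : ∀ (i j : Fin n) (v : Fin 0 ⊕ Fin n × Fin 2 → G),
      (if i = j then ⊤ else ∼(exO (fRayMap nv (upp (t i)) (upp (t j)))) :
        LGR.Formula (Fin 0 ⊕ Fin n × Fin 2)).Realize v ↔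
      (i ≠ j → ¬ ∃ g, RayMap g (val2 (t i) v) (val2 (t j) v)) := by
    intro i j v
    split_ifs with h
    · simp [h]
    · simp [h, Formula.realize_not]
  simp only [Formula.realize_iExs, Formula.realize_inf, Formula.realize_iInf, key, realize_fRay,
    realize_all2, Formula.realize_imp, val2_np, Formula.realize_iSup, realize_exO, realize_fRayMap,
    val2_upp, realize_nv]
  constructor
  · rintro ⟨f, h⟩
    exact ⟨fun i => (f (i, 0), f (i, 1)), h⟩
  · rintro ⟨p, h⟩
    exact ⟨fun q => ![(p q.1).1, (p q.1).2] q.2, h⟩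

end MonRec

namespace MonRec

open Set FirstOrder FirstOrder.Language

/-! ### Second order formulas -/

section General

variable {L : FirstOrder.Language.{0, 0}} {M : Type u} [L.Structure M]

theorem elim_map_eq {β β' : Type} {ar : β → ℕ} {ar' : β' → ℕ} {ρ : β → β'}
    (h : ∀ X, ar' (ρ X) = ar X) (k : ℕ) :
    ∀ o : Option β, (Option.map ρ o).elim k ar' = o.elim k ar
  | none => rfl
  | some X => h X

/-- Change of variables in second order formulas. -/
def SOFormula.relabel : ∀ {α α' β β' : Type} {ar : β → ℕ} {ar' : β' → ℕ} (_ : α → α') (ρ : β → β')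
    (_ : ∀ X, ar' (ρ X) = ar X), SOFormula L α β ar → SOFormula L α' β' ar'
  | _, _, _, _, _, _, _, _, _, .falsum => .falsum
  | _, _, _, _, _, _, σ, _, _, .equal t s => .equal (t.relabel σ) (s.relabel σ)
  | _, _, _, _, _, _, σ, _, _, .rel R ts => .rel R fun j => (ts j).relabel σ
  | _, _, _, _, _, _, σ, ρ, h, .var X ts => .var (ρ X) fun j => (ts (Fin.cast (h X) j)).relabel σ
  | _, _, _, _, _, _, σ, ρ, h, .imp φ ψ => .imp (φ.relabel σ ρ h) (ψ.relabel σ ρ h)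
  | _, _, _, _, _, _, σ, ρ, h, .all φ => .all (φ.relabel (Option.map σ) ρ h)
  | _, _, _, _, _, _, σ, ρ, h, .allRel k φ =>
    .allRel k (φ.relabel σ (Option.map ρ) (elim_map_eq h k))

theorem SOFormula.realize_relabel : ∀ {α α' β β' : Type} {ar : β → ℕ} {ar' : β' → ℕ} (σ : α → α')
    (ρ : β → β') (h : ∀ X, ar' (ρ X) = ar X) (φ : SOFormula L α β ar) (a : α' → M)
    (V : (X : β') → (Fin (ar' X) → M) → Prop), (φ.relabel σ ρ h).Realize a V ↔
      φ.Realize (a ∘ σ) fun X w => V (ρ X) fun j => w (Fin.cast (h X) j)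
  | _, _, _, _, _, _, _, _, _, .falsum, _, _ => Iff.rfl
  | _, _, _, _, _, _, _, _, _, .equal t s, a, V => by
    simp only [relabel, Realize, Term.realize_relabel]
  | _, _, _, _, _, _, _, _, _, .rel R ts, a, V => by
    simp only [relabel, Realize, Term.realize_relabel]
  | _, _, _, _, _, _, _, _, _, .var X ts, a, V => by
    simp only [relabel, Realize, Term.realize_relabel]
  | _, _, _, _, _, _, σ, ρ, h, .imp φ ψ, a, V => by
    simp only [relabel, Realize, φ.realize_relabel σ ρ h, ψ.realize_relabel σ ρ h]
  | _, _, _, _, _, _, σ, ρ, h, .all φ, a, V => by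
    simp only [relabel, Realize, φ.realize_relabel (Option.map σ) ρ h]
    refine forall_congr' fun x => iff_of_eq (congrArg (fun a => φ.Realize a _) (funext fun o => ?_))
    cases o <;> rfl
  | _, _, _, _, _, _, σ, ρ, h, .allRel k φ, a, V => by
    simp only [relabel, Realize, φ.realize_relabel]
    refine forall_congr' fun x => iff_of_eq (congrArg (φ.Realize _) (funext fun o => ?_))
    cases o <;> rfl

/-- First order formulas as second order formulas. -/
def SOFormula.ofBounded {α β : Type} {ar : β → ℕ} : ∀ {γ : Type} {k : ℕ} (_ : α ⊕ Fin k → γ),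
    L.BoundedFormula α k → SOFormula L γ β ar
  | _, _, _, .falsum => .falsum
  | _, _, σ, .equal t s => .equal (t.relabel σ) (s.relabel σ)
  | _, _, σ, .rel R ts => .rel R fun j => (ts j).relabel σ
  | _, _, σ, .imp φ ψ => .imp (ofBounded σ φ) (ofBounded σ ψ)
  | _, _, σ, .all φ => .all (ofBounded (Option.map σ ∘ lastToNew) φ)

theorem SOFormula.realize_ofBounded {α β : Type} {ar : β → ℕ} :
    ∀ {γ : Type} {k : ℕ} (σ : α ⊕ Fin k → γ) (φ : L.BoundedFormula α k) (a : γ → M)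
    (V : (X : β) → (Fin (ar X) → M) → Prop), (ofBounded σ φ : SOFormula L γ β ar).Realize a V ↔
      φ.Realize (a ∘ σ ∘ Sum.inl) (a ∘ σ ∘ Sum.inr)
  | _, _, _, .falsum, _, _ => Iff.rfl
  | _, _, σ, .equal t s, a, V => by
    have h : Sum.elim (a ∘ σ ∘ Sum.inl) (a ∘ σ ∘ Sum.inr) = a ∘ σ := Sum.elim_comp_inl_inr (a ∘ σ)
    simp only [ofBounded, Realize, BoundedFormula.Realize, Term.realize_relabel, h]
  | _, _, σ, .rel R ts, a, V => by
    have h : Sum.elim (a ∘ σ ∘ Sum.inl) (a ∘ σ ∘ Sum.inr) = a ∘ σ := Sum.elim_comp_inl_inr (a ∘ σ)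
    simp only [ofBounded, Realize, BoundedFormula.Realize, Term.realize_relabel, h]
  | _, _, σ, .imp φ ψ, a, V => by
    simp only [ofBounded, Realize, BoundedFormula.Realize, realize_ofBounded σ]
  | _, _, σ, .all φ, a, V => by
    simp only [ofBounded, Realize, BoundedFormula.Realize, realize_ofBounded _ φ]
    refine forall_congr' fun x => iff_of_eq (congrArg (φ.Realize _) (funext fun j => ?_))
    refine Fin.lastCases ?_ (fun j => ?_) j
    · simp [lastToNew]
    · simp [lastToNew]

/-- First order formulas as second order formulas. -/
def SOFormula.ofFO {α β : Type} {ar : β → ℕ} (φ : L.Formula α) : SOFormula L α β ar :=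
  ofBounded (Sum.elim id Fin.elim0) φ

@[simp] theorem SOFormula.realize_ofFO {α β : Type} {ar : β → ℕ} (φ : L.Formula α) (a : α → M)
    (V : (X : β) → (Fin (ar X) → M) → Prop) :
    (ofFO φ : SOFormula L α β ar).Realize a V ↔ φ.Realize a :=
  (realize_ofBounded _ _ _ _).trans (iff_of_eq (congrArg (BoundedFormula.Realize φ _)
    (Subsingleton.elim _ _)))

variable {α β : Type} {ar : β → ℕ} {a : α → M} {V : (X : β) → (Fin (ar X) → M) → Prop}

/-- Negation. -/
def SOFormula.not (φ : SOFormula L α β ar) : SOFormula L α β ar := .imp φ .falsum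

/-- Conjunction. -/
def SOFormula.and (φ ψ : SOFormula L α β ar) : SOFormula L α β ar := (SOFormula.imp φ ψ.not).not

/-- Disjunction. -/
def SOFormula.or (φ ψ : SOFormula L α β ar) : SOFormula L α β ar := .imp φ.not ψ

@[simp] theorem SOFormula.realize_imp (φ ψ : SOFormula L α β ar) :
    (SOFormula.imp φ ψ).Realize a V ↔ (φ.Realize a V → ψ.Realize a V) := Iff.rfl

@[simp] theorem SOFormula.realize_not (φ : SOFormula L α β ar) :
    φ.not.Realize a V ↔ ¬ φ.Realize a V := Iff.rfl

@[simp] theorem SOFormula.realize_and (φ ψ : SOFormula L α β ar) :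
    (φ.and ψ).Realize a V ↔ φ.Realize a V ∧ ψ.Realize a V := by
  simp [SOFormula.and]

@[simp] theorem SOFormula.realize_or (φ ψ : SOFormula L α β ar) :
    (φ.or ψ).Realize a V ↔ φ.Realize a V ∨ ψ.Realize a V := by
  simp [SOFormula.or, or_iff_not_imp_left]

/-- Extension of an assignment of relations. -/
def pushRel {β : Type} {ar : β → ℕ} {k : ℕ} (V : (X : β) → (Fin (ar X) → M) → Prop)
    (S : (Fin k → M) → Prop) : (o : Option β) → (Fin (o.elim k ar) → M) → Prop
  | none => S
  | some X => V X

theorem SOFormula.realize_allRel {k : ℕ} (φ : SOFormula L α (Option β) (fun o => o.elim k ar)) :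
    (SOFormula.allRel k φ).Realize a V ↔ ∀ S, φ.Realize a (pushRel V S) :=
  forall_congr' fun S => iff_of_eq (congrArg (φ.Realize a) (funext fun o => by cases o <;> rfl))

/-- Universal quantification over pairs. -/
def SOFormula.all₂ (φ : SOFormula L (Option (Option α)) β ar) : SOFormula L α β ar := .all (.all φ)

/-- Existential quantification over pairs. -/
def SOFormula.ex₂ (φ : SOFormula L (Option (Option α)) β ar) : SOFormula L α β ar := φ.not.all₂.not

@[simp] theorem SOFormula.realize_all₂ (φ : SOFormula L (Option (Option α)) β ar) :
    φ.all₂.Realize a V ↔ ∀ p : M × M, φ.Realize (push (push a p.1) p.2) V :=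
  ⟨fun h p => h p.1 p.2, fun h x y => h (x, y)⟩

@[simp] theorem SOFormula.realize_ex₂ (φ : SOFormula L (Option (Option α)) β ar) :
    φ.ex₂.Realize a V ↔ ∃ p : M × M, φ.Realize (push (push a p.1) p.2) V := by
  simp [SOFormula.ex₂]

end General

/-! ### Cuts in the set of rays -/

section Defs

variable {A : Type*} [Mul A]

/-- The set `S` of rays is a cut without last element with respect to the direction of `R`. -/
def IsCut (R : A × A) (S : A × A → Prop) : Prop :=
  Ray R ∧ (∀ p, S p → Ray p) ∧ (∃ p, S p) ∧ (∃ q, Ray q ∧ ¬ S q) ∧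
    (∀ p, S p → ∀ q, Ray q → RayLE R q p → S q) ∧ ∀ p, S p → ∃ q, S q ∧ ¬ RayLE R q p

/-- The endpoint of `p` precedes, with respect to the direction of `D`, the point that is given by
the cut `S` with respect to the direction of `R`. -/
def LtCut (D p R : A × A) (S : A × A → Prop) : Prop :=
  (SameDir D R ∧ S p) ∨
    (¬ SameDir D R ∧ Ray p ∧ ∃ q, Ray q ∧ ¬ S q ∧ ¬ RayLE R p q)

/-- The order of the points that are given by two cuts. -/
def CutLT (D R : A × A) (S : A × A → Prop) (R' : A × A) (S' : A × A → Prop) : Prop :=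
  ∃ p, Ray p ∧ ¬ LtCut D p R S ∧ LtCut D p R' S'

/-- Two cuts give the same point. -/
def CutEq (R : A × A) (S : A × A → Prop) (R' : A × A) (S' : A × A → Prop) : Prop :=
  ∀ p, LtCut R p R S ↔ LtCut R p R' S'

/-- The element `g` maps the point given by one cut to the point given by another. -/
def CutMap (g : A) (R : A × A) (S : A × A → Prop) (R' : A × A) (S' : A × A → Prop) : Prop :=
  ∀ D : A × A, D.1 * g = g * R.1 → D.2 * g = g * R.2 → ∀ p, Ray p → ∀ r : A × A,
    r.1 * g = g * p.1 → r.2 * g = g * p.2 → (LtCut R p R S ↔ LtCut D r R' S')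

end Defs

section Formulas

variable {α β : Type} {A : Type u} [Mul A]

/-- Second order formulas with binary relation variables. -/
abbrev SOF (α β : Type) := SOFormula LGR α β (fun _ => 2)

/-- The set of pairs that is given by a binary relation. -/
def relSet (S : (Fin 2 → A) → Prop) (p : A × A) : Prop := S ![p.1, p.2]

/-- The pair `p` is in the relation `X`. -/
def sIn (X : β) (p : LGR.Term α × LGR.Term α) : SOF α β := .var X ![p.1, p.2]

@[simp] theorem realize_sIn (X : β) (p : LGR.Term α × LGR.Term α) (a : α → A)
    (V : β → (Fin 2 → A) → Prop) : (sIn X p).Realize a V ↔ relSet (V X) (val2 p a) := by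
  refine iff_of_eq (congrArg (V X) (funext fun j => ?_))
  fin_cases j <;> rfl

/-- The formula for `IsCut`. -/
noncomputable def sIsCut (R : LGR.Term α × LGR.Term α) (X : β) : SOF α β :=
  .and (.ofFO (fRay R)) (.and (.all₂ (.imp (sIn X np) (.ofFO (fRay np))))
    (.and (.ex₂ (sIn X np)) (.and (.ex₂ (.and (.ofFO (fRay np)) (.not (sIn X np))))
      (.and (.all₂ (.imp (sIn X np) (.all₂ (.imp (.ofFO (fRay np))
        (.imp (.ofFO (fRayLE (upp (upp (upp (upp R)))) np (upp (upp np)))) (sIn X np))))))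
        (.all₂ (.imp (sIn X np) (.ex₂ (.and (sIn X np)
          (.not (.ofFO (fRayLE (upp (upp (upp (upp R)))) np (upp (upp np)))))))))))))

@[simp] theorem realize_sIsCut (R : LGR.Term α × LGR.Term α) (X : β) (a : α → A)
    (V : β → (Fin 2 → A) → Prop) :
    (sIsCut R X).Realize a V ↔ IsCut (val2 R a) (relSet (V X)) := by
  simp only [sIsCut, IsCut, SOFormula.realize_and, SOFormula.realize_ofFO, SOFormula.realize_all₂,
    SOFormula.realize_ex₂, SOFormula.realize_imp, SOFormula.realize_not, realize_sIn, realize_fRay,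
    realize_fRayLE, val2_np, val2_upp]

/-- The formula for `LtCut`. -/
noncomputable def sLtCut (D p R : LGR.Term α × LGR.Term α) (X : β) : SOF α β :=
  .or (.and (.ofFO (fSameDir D R)) (sIn X p)) (.and (.not (.ofFO (fSameDir D R)))
    (.and (.ofFO (fRay p)) (.ex₂ (.and (.ofFO (fRay np)) (.and (.not (sIn X np))
      (.not (.ofFO (fRayLE (upp (upp R)) (upp (upp p)) np))))))))

@[simp] theorem realize_sLtCut (D p R : LGR.Term α × LGR.Term α) (X : β) (a : α → A)
    (V : β → (Fin 2 → A) → Prop) : (sLtCut D p R X).Realize a V ↔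
      LtCut (val2 D a) (val2 p a) (val2 R a) (relSet (V X)) := by
  simp only [sLtCut, LtCut, SOFormula.realize_and, SOFormula.realize_or, SOFormula.realize_ofFO,
    SOFormula.realize_ex₂, SOFormula.realize_not, realize_sIn, realize_fRay,
    realize_fRayLE, realize_fSameDir, val2_np, val2_upp]

/-- The formula for `CutLT`. -/
noncomputable def sCutLT (D R : LGR.Term α × LGR.Term α) (X : β) (R' : LGR.Term α × LGR.Term α)
    (X' : β) : SOF α β :=
  .ex₂ (.and (.ofFO (fRay np)) (.and (.not (sLtCut (upp (upp D)) np (upp (upp R)) X))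
    (sLtCut (upp (upp D)) np (upp (upp R')) X')))

@[simp] theorem realize_sCutLT (D R : LGR.Term α × LGR.Term α) (X : β)
    (R' : LGR.Term α × LGR.Term α) (X' : β) (a : α → A) (V : β → (Fin 2 → A) → Prop) :
    (sCutLT D R X R' X').Realize a V ↔
      CutLT (val2 D a) (val2 R a) (relSet (V X)) (val2 R' a) (relSet (V X')) := by
  simp only [sCutLT, CutLT, SOFormula.realize_and, SOFormula.realize_ofFO,
    SOFormula.realize_ex₂, SOFormula.realize_not, realize_sLtCut, realize_fRay, val2_np, val2_upp]

/-- The formula for `CutEq`. -/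
noncomputable def sCutEq (R : LGR.Term α × LGR.Term α) (X : β) (R' : LGR.Term α × LGR.Term α)
    (X' : β) : SOF α β :=
  .all₂ (.and (.imp (sLtCut (upp (upp R)) np (upp (upp R)) X)
      (sLtCut (upp (upp R)) np (upp (upp R')) X'))
    (.imp (sLtCut (upp (upp R)) np (upp (upp R')) X') (sLtCut (upp (upp R)) np (upp (upp R)) X)))

@[simp] theorem realize_sCutEq (R : LGR.Term α × LGR.Term α) (X : β)
    (R' : LGR.Term α × LGR.Term α) (X' : β) (a : α → A) (V : β → (Fin 2 → A) → Prop) :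
    (sCutEq R X R' X').Realize a V ↔
      CutEq (val2 R a) (relSet (V X)) (val2 R' a) (relSet (V X')) := by
  simp only [sCutEq, CutEq, SOFormula.realize_and, SOFormula.realize_imp,
    SOFormula.realize_all₂, realize_sLtCut, val2_np, val2_upp, ← iff_iff_implies_and_implies]

/-- The formula for `CutMap`. -/
noncomputable def sCutMap (g : LGR.Term α) (R : LGR.Term α × LGR.Term α) (X : β)
    (R' : LGR.Term α × LGR.Term α) (X' : β) : SOF α β :=
  .all₂ (.imp (.ofFO (eqF (np.1 * up (up g)) (up (up g) * up (up R.1))))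
    (.imp (.ofFO (eqF (np.2 * up (up g)) (up (up g) * up (up R.2))))
    (.all₂ (.imp (.ofFO (fRay np)) (.all₂
      (.imp (.ofFO (eqF (np.1 * up (up (up (up (up (up g))))))
        (up (up (up (up (up (up g))))) * up (up np.1))))
      (.imp (.ofFO (eqF (np.2 * up (up (up (up (up (up g))))))
        (up (up (up (up (up (up g))))) * up (up np.2))))
      (.and (.imp (sLtCut (upp (upp (upp (upp (upp (upp R)))))) (upp (upp np))
          (upp (upp (upp (upp (upp (upp R)))))) X)
        (sLtCut (upp (upp (upp (upp np)))) np (upp (upp (upp (upp (upp (upp R')))))) X'))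
      (.imp (sLtCut (upp (upp (upp (upp np)))) np (upp (upp (upp (upp (upp (upp R')))))) X')
        (sLtCut (upp (upp (upp (upp (upp (upp R)))))) (upp (upp np))
          (upp (upp (upp (upp (upp (upp R)))))) X))))))))))

@[simp] theorem realize_sCutMap (g : LGR.Term α) (R : LGR.Term α × LGR.Term α) (X : β)
    (R' : LGR.Term α × LGR.Term α) (X' : β) (a : α → A) (V : β → (Fin 2 → A) → Prop) :
    (sCutMap g R X R' X').Realize a V ↔
      CutMap (g.realize a) (val2 R a) (relSet (V X)) (val2 R' a) (relSet (V X')) := by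
  simp only [sCutMap, CutMap, SOFormula.realize_and, SOFormula.realize_imp, SOFormula.realize_ofFO,
    SOFormula.realize_all₂, realize_sLtCut, val2_np, val2_upp, ← iff_iff_implies_and_implies,
    realize_eqF, realize_mul, realize_up, realize_fRay, np_fst, np_snd, realize_nv, val2_fst,
    val2_snd]

end Formulas

end MonRec

namespace MonRec

open Set FirstOrder FirstOrder.Language

/-! ### The points given by cuts -/

section Cuts

variable {A : Type*} (X : Type*) [Group A] [LinearOrder X] [MulAction A X]

/-- The left ray `R` and the set `S` of rays determine the point `x`. -/
def CutAt (R : A × A) (S : A × A → Prop) (x : X) : Prop :=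
  (∃ z, IsLRay X R z) ∧ ∀ p, S p ↔ ∃ y, IsRayAt X p y ∧ y < x

/-- The ray `R` and the set `S` of rays determine the point `x`. -/
def CutRep (R : A × A) (S : A × A → Prop) (x : X) : Prop :=
  CutAt X R S x ∨ CutAt Xᵒᵈ R S (OrderDual.toDual x)

variable {X} [LocMove A X] [NoMinOrder X] [NoMaxOrder X] [DenselyOrdered X] [TopologicalSpace X]
  [OrderTopology X]

theorem CutRep.dual {R : A × A} {S : A × A → Prop} {x : X} (h : CutRep X R S x) :
    CutRep Xᵒᵈ R S (OrderDual.toDual x) := h.symm.imp_right fun h =>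
  ⟨h.1, fun p => (h.2 p).trans (exists_congr fun _ => and_congr_left fun _ => Iff.rfl)⟩

theorem exists_isRayAt_mem_Ioo {a b : X} (h : a < b) :
    ∃ (p : A × A) (y : X), y ∈ Ioo a b ∧ IsRayAt X p y := by
  obtain ⟨p, y, hy, hp⟩ := exists_isLRay_mem_Ioo A h
  exact ⟨p, y, hy, Or.inl hp⟩

/-- The point is the supremum of the endpoints of the rays in `S`. As `S` has no last element, it
consists of exactly the rays with endpoints strictly below, so a point has one cut for each
direction. -/
theorem IsLRay.isCut_iff {R : A × A} {z : X} (hR : IsLRay X R z) {S : A × A → Prop} :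
    IsCut R S ↔ ∃ x, CutAt X R S x := by
  constructor
  · rintro ⟨-, hr, ⟨p₀, hp₀⟩, ⟨q₀, hq₀, hq₀'⟩, down, nomax⟩
    obtain ⟨y₀, hy₀⟩ := (ray_iff (X := X)).1 (hr p₀ hp₀)
    obtain ⟨w₀, hw₀⟩ := (ray_iff (X := X)).1 hq₀
    obtain ⟨x, hx⟩ := LocMove.lub A {y : X | ∃ p, S p ∧ IsRayAt X p y} ⟨y₀, p₀, hp₀, hy₀⟩ ⟨w₀, by
      rintro y ⟨p, hp, hy⟩
      by_contra! h
      exact hq₀' (down p hp q₀ hq₀ ((hR.rayLE_iff hw₀ hy).2 h.le))⟩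
    refine ⟨x, ⟨z, hR⟩, fun p => ⟨fun hp => ?_, ?_⟩⟩
    · obtain ⟨y, hy⟩ := (ray_iff (X := X)).1 (hr p hp)
      obtain ⟨q, hq, hqp⟩ := nomax p hp
      obtain ⟨y', hy'⟩ := (ray_iff (X := X)).1 (hr q hq)
      rw [hR.rayLE_iff hy' hy, not_le] at hqp
      exact ⟨y, hy, hqp.trans_le (hx.1 ⟨q, hq, hy'⟩)⟩
    · rintro ⟨y, hy, hyx⟩
      obtain ⟨y', ⟨q, hq, hy'⟩, hlt, -⟩ := hx.exists_between hyx
      exact down q hq p (ray_iff.2 ⟨y, hy⟩) ((hR.rayLE_iff hy hy').2 hlt.le)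
  · rintro ⟨x, -, hx⟩
    refine ⟨hR.ray, fun p hp => ?_, ?_, ?_, fun p hp q hq hqp => ?_, fun p hp => ?_⟩
    · obtain ⟨y, hy, -⟩ := (hx p).1 hp
      exact ray_iff.2 ⟨y, hy⟩
    · obtain ⟨x', hx'⟩ := exists_lt x
      obtain ⟨p, y, hy, hp⟩ := exists_isRayAt_mem_Ioo (A := A) hx'
      exact ⟨p, (hx p).2 ⟨y, hp, hy.2⟩⟩
    · obtain ⟨x', hx'⟩ := exists_gt x
      obtain ⟨p, y, hy, hp⟩ := exists_isRayAt_mem_Ioo (A := A) hx'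
      refine ⟨p, ray_iff.2 ⟨y, hp⟩, fun h => ?_⟩
      obtain ⟨y', hp', hy'⟩ := (hx p).1 h
      rw [hp'.unique hp] at hy'
      exact lt_asymm hy.1 hy'
    · obtain ⟨y, hy, hyx⟩ := (hx p).1 hp
      obtain ⟨w, hw⟩ := (ray_iff (X := X)).1 hq
      exact (hx q).2 ⟨w, hw, ((hR.rayLE_iff hw hy).1 hqp).trans_lt hyx⟩
    · obtain ⟨y, hy, hyx⟩ := (hx p).1 hp
      obtain ⟨q, w, hw, hq⟩ := exists_isRayAt_mem_Ioo (A := A) hyx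
      exact ⟨q, (hx q).2 ⟨w, hq, hw.2⟩, fun h => absurd ((hR.rayLE_iff hq hy).1 h)
        (not_le.2 hw.1)⟩

theorem isCut_iff {R : A × A} {S : A × A → Prop} : IsCut R S ↔ ∃ x : X, CutRep X R S x := by
  constructor
  · intro h
    obtain ⟨z, hz | hz⟩ := (ray_iff (X := X)).1 h.1
    · exact (hz.isCut_iff.1 h).imp fun x hx => Or.inl hx
    · obtain ⟨x, hx⟩ := IsLRay.isCut_iff hz |>.1 h
      exact ⟨x, Or.inr hx⟩
  · rintro ⟨x, hx | hx⟩
    · obtain ⟨z, hz⟩ := hx.1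
      exact hz.isCut_iff.2 ⟨x, hx⟩
    · obtain ⟨z, hz⟩ := hx.1
      exact IsLRay.isCut_iff hz |>.2 ⟨_, hx⟩

theorem exists_cutRep [Nonempty X] (x : X) : ∃ (R : A × A) (S : A × A → Prop), CutRep X R S x := by
  obtain ⟨d, z, hd⟩ := exists_isLRay (A := A) X
  exact ⟨d, fun p => ∃ y, IsRayAt X p y ∧ y < x, Or.inl ⟨⟨z, hd⟩, fun _ => Iff.rfl⟩⟩

/-- If `R` is opposite to `D`, then `S` is the set of rays with endpoints beyond `x`. The endpoints
before `x` are recognized by having another endpoint outside `S` after them, which exists by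
density. -/
theorem IsLRay.ltCut_iff {D p R : A × A} {S : A × A → Prop} {x y z : X} (hD : IsLRay X D z)
    (hp : IsRayAt X p y) (h : CutRep X R S x) : LtCut D p R S ↔ y < x := by
  rcases h with ⟨⟨w, hR⟩, hS⟩ | ⟨⟨w, hR⟩, hS⟩
  · have h1 := hD.sameDir hR
    simp only [LtCut, h1, true_and, not_true, false_and, or_false, hS]
    exact ⟨fun ⟨y', hy', hlt⟩ => hp.unique hy' ▸ hlt, fun h => ⟨y, hp, h⟩⟩
  · have hR' : IsLRay Xᵒᵈ R (OrderDual.toDual (OrderDual.ofDual w)) := hR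
    have h1 := hD.not_sameDir hR'
    simp only [LtCut, h1, false_and, not_false_eq_true, true_and, false_or, hS]
    constructor
    · rintro ⟨-, q, hq, hqx, hqp⟩
      obtain ⟨v, hv⟩ := (ray_iff (X := X)).1 hq
      rw [hR'.rayLE_iff_dual hp hv, not_le] at hqp
      refine hqp.trans_le (not_lt.1 fun hlt => hqx ⟨OrderDual.toDual v, (isRayAt_dual X).2 hv, hlt⟩)
    · intro hyx
      obtain ⟨q, v, hv, hq⟩ := exists_isRayAt_mem_Ioo (A := A) hyx
      refine ⟨ray_iff.2 ⟨y, hp⟩, q, ray_iff.2 ⟨v, hq⟩, ?_, ?_⟩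
      · rintro ⟨v', hv', hlt⟩
        have := ((isRayAt_dual X).1 hv').unique hq
        exact lt_asymm hv.2 (this ▸ hlt)
      · rw [hR'.rayLE_iff_dual hp hq, not_le]
        exact hv.1

theorem IsLRay.ltCut_iff_dual {D p R : A × A} {S : A × A → Prop} {x y z : X}
    (hD : IsLRay Xᵒᵈ D (OrderDual.toDual z)) (hp : IsRayAt X p y) (h : CutRep X R S x) :
    LtCut D p R S ↔ x < y :=
  hD.ltCut_iff ((isRayAt_dual X).2 hp) h.dual

theorem LtCut.ray {D p R : A × A} {S : A × A → Prop} {x : X} (h : CutRep X R S x)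
    (hp : LtCut D p R S) : Ray p := by
  rcases hp with ⟨-, hp⟩ | ⟨-, hp, -⟩
  · exact ((isCut_iff (X := X)).2 ⟨x, h⟩).2.1 p hp
  · exact hp

theorem IsLRay.cutLT_iff {D R R' : A × A} {S S' : A × A → Prop} {x x' z : X} (hD : IsLRay X D z)
    (h : CutRep X R S x) (h' : CutRep X R' S' x') : CutLT D R S R' S' ↔ x < x' := by
  constructor
  · rintro ⟨p, hp, h1, h2⟩
    obtain ⟨y, hy⟩ := (ray_iff (X := X)).1 hp
    rw [hD.ltCut_iff hy h, not_lt] at h1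
    exact h1.trans_lt ((hD.ltCut_iff hy h').1 h2)
  · intro hlt
    obtain ⟨p, y, hy, hp⟩ := exists_isRayAt_mem_Ioo (A := A) hlt
    exact ⟨p, ray_iff.2 ⟨y, hp⟩, fun h1 => lt_asymm hy.1 ((hD.ltCut_iff hp h).1 h1),
      (hD.ltCut_iff hp h').2 hy.2⟩

theorem IsLRay.cutLT_iff_dual {D R R' : A × A} {S S' : A × A → Prop} {x x' z : X}
    (hD : IsLRay Xᵒᵈ D (OrderDual.toDual z)) (h : CutRep X R S x) (h' : CutRep X R' S' x') :
    CutLT D R S R' S' ↔ x' < x :=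
  hD.cutLT_iff h.dual h'.dual

theorem eq_of_forall_ray_lt_iff {x x' : X}
    (h : ∀ (p : A × A) (y : X), IsRayAt X p y → (y < x ↔ y < x')) : x = x' := by
  refine le_antisymm (not_lt.1 fun hlt => ?_) (not_lt.1 fun hlt => ?_)
  · obtain ⟨p, y, hy, hp⟩ := exists_isRayAt_mem_Ioo (A := A) hlt
    exact lt_asymm hy.1 ((h p y hp).1 hy.2)
  · obtain ⟨p, y, hy, hp⟩ := exists_isRayAt_mem_Ioo (A := A) hlt
    exact lt_asymm hy.1 ((h p y hp).2 hy.2)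

theorem IsLRay.cutEq_iff {R R' : A × A} {S S' : A × A → Prop} {x x' z : X} (hR : IsLRay X R z)
    (h : CutRep X R S x) (h' : CutRep X R' S' x') : CutEq R S R' S' ↔ x = x' := by
  constructor
  · intro he
    exact eq_of_forall_ray_lt_iff (A := A) fun p y hp => by
      rw [← hR.ltCut_iff hp h, ← hR.ltCut_iff hp h', he]
  · rintro rfl p
    by_cases hp : Ray p
    · obtain ⟨y, hy⟩ := (ray_iff (X := X)).1 hp
      rw [hR.ltCut_iff hy h, hR.ltCut_iff hy h']
    · exact iff_of_false (fun hlt => hp (hlt.ray h)) fun hlt => hp (hlt.ray h')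

theorem CutRep.cutEq_iff {R R' : A × A} {S S' : A × A → Prop} {x x' : X}
    (h : CutRep X R S x) (h' : CutRep X R' S' x') : CutEq R S R' S' ↔ x = x' := by
  obtain ⟨⟨z, hz⟩, -⟩ | ⟨⟨z, hz⟩, -⟩ := id h
  · exact hz.cutEq_iff h h'
  · exact IsLRay.cutEq_iff (X := Xᵒᵈ) hz h.dual h'.dual

theorem cutMap_conj_iff {g : A} {R R' : A × A} {S S' : A × A → Prop} :
    CutMap g R S R' S' ↔ ∀ p, Ray p → (LtCut R p R S ↔
      LtCut (g * R.1 * g⁻¹, g * R.2 * g⁻¹) (g * p.1 * g⁻¹, g * p.2 * g⁻¹) R' S') := by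
  constructor
  · exact fun h p hp => h _ (by group) (by group) p hp _ (by group) (by group)
  · rintro h ⟨D, D'⟩ hD hD' p hp ⟨r, r'⟩ hr hr'
    rw [← eq_mul_inv_iff_mul_eq] at hD hD' hr hr'
    dsimp only at hD hD' hr hr'
    rw [hD, hD', hr, hr']
    exact h p hp

/-- Points before `x` in the direction of `R` go to points before `g • x` in the direction of the
conjugate of `R`. Using this conjugate as reference lets one formula cover order-preserving and
order-reversing `g`. -/
theorem IsLRay.cutMap_iff {g : A} {R R' : A × A} {S S' : A × A → Prop} {x x' z : X}
    (hR : IsLRay X R z) (h : CutRep X R S x) (h' : CutRep X R' S' x') :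
    CutMap g R S R' S' ↔ g • x = x' := by
  rw [cutMap_conj_iff]
  rcases LocMove.monotonic (X := X) g with hg | hg
  · constructor
    · intro H
      refine eq_of_forall_ray_lt_iff (A := A) fun q w hq => ?_
      have h1 := hq.conj g⁻¹
      have h2 := H _ (ray_iff.2 ⟨_, h1⟩)
      have h3 := h1.conj g
      rw [hR.ltCut_iff h1 h, (hR.conj hg).ltCut_iff h3 h', ← hg.lt_iff_lt] at h2
      simpa using h2
    · rintro rfl p hp
      obtain ⟨y, hy⟩ := (ray_iff (X := X)).1 hp
      rw [hR.ltCut_iff hy h, (hR.conj hg).ltCut_iff (hy.conj g) h']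
      exact hg.lt_iff_lt.symm
  · constructor
    · intro H
      refine congrArg OrderDual.ofDual (eq_of_forall_ray_lt_iff (A := A) (x := OrderDual.toDual (g • x))
        (x' := OrderDual.toDual x') fun q w => ?_)
      obtain ⟨w, rfl⟩ := OrderDual.toDual.surjective w
      intro hq
      have h1 := (IsRayAt.conj (X := X) ((isRayAt_dual X).1 hq) g⁻¹ : IsRayAt X _ (g⁻¹ • w))
      have h2 := H _ (ray_iff.2 ⟨_, h1⟩)
      have h3 := h1.conj g
      rw [hR.ltCut_iff h1 h, (hR.conj_anti hg).ltCut_iff_dual h3 h', ← hg.lt_iff_gt] at h2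
      rw [smul_inv_smul] at h2
      exact h2
    · rintro rfl p hp
      obtain ⟨y, hy⟩ := (ray_iff (X := X)).1 hp
      rw [hR.ltCut_iff hy h, (hR.conj_anti hg).ltCut_iff_dual (hy.conj g) h']
      exact hg.lt_iff_gt.symm

theorem CutRep.cutMap_iff {g : A} {R R' : A × A} {S S' : A × A → Prop} {x x' : X}
    (h : CutRep X R S x) (h' : CutRep X R' S' x') : CutMap g R S R' S' ↔ g • x = x' := by
  obtain ⟨⟨z, hz⟩, -⟩ | ⟨⟨z, hz⟩, -⟩ := id h
  · exact hz.cutMap_iff h h'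
  · exact IsLRay.cutMap_iff (X := Xᵒᵈ) hz h.dual h'.dual

end Cuts

end MonRec

namespace MonRec

open Set FirstOrder FirstOrder.Language

/-! ### Second order interpretation of the action on the completion -/

section Formulas

/-- Equality of the elements given by triples and sets. -/
def CrEq {A : Type*} [Mul A] (a : Fin 3 → A) (S : A × A → Prop) (b : Fin 3 → A)
    (S' : A × A → Prop) : Prop :=
  (a 0 = a 1 ∧ b 0 = b 1 ∧ a 2 = b 2) ∨ (a 0 ≠ a 1 ∧ b 0 ≠ b 1 ∧ CutEq (a 0, a 1) S (b 0, b 1) S')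

/-- The relations between the elements given by triples and sets. -/
def CrRel {A : Type*} [Mul A] : ∀ {m : ℕ}, MNPGRel m → (Fin m → Fin 3 → A) →
    (Fin m → A × A → Prop) → Prop
  | _, .pt, a, _ => a 0 0 ≠ a 0 1
  | _, .gr, a, _ => a 0 0 = a 0 1
  | _, .ed, a, S => (a 0 0 ≠ a 0 1 ∧ a 1 0 ≠ a 1 1 ∧ a 2 0 ≠ a 2 1 ∧ a 3 0 ≠ a 3 1) ∧
      ((CutLT (a 0 0, a 0 1) (a 0 0, a 0 1) (S 0) (a 1 0, a 1 1) (S 1) ∧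
        CutLT (a 0 0, a 0 1) (a 2 0, a 2 1) (S 2) (a 3 0, a 3 1) (S 3)) ∨
      (CutLT (a 0 0, a 0 1) (a 1 0, a 1 1) (S 1) (a 0 0, a 0 1) (S 0) ∧
        CutLT (a 0 0, a 0 1) (a 3 0, a 3 1) (S 3) (a 2 0, a 2 1) (S 2)))
  | _, .comp, a, _ => (a 0 0 = a 0 1 ∧ a 1 0 = a 1 1 ∧ a 2 0 = a 2 1) ∧ a 0 2 * a 1 2 = a 2 2
  | _, .ap, a, S => (a 0 0 = a 0 1 ∧ a 1 0 ≠ a 1 1 ∧ a 2 0 ≠ a 2 1) ∧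
      CutMap (a 0 2) (a 1 0, a 1 1) (S 1) (a 2 0, a 2 1) (S 2)

variable {α β : Type} {A : Type u} [Mul A]

/-- The second order formula for equality of terms. -/
def sEqT (s t : LGR.Term α) : SOF α β := .ofFO (eqF s t)

@[simp] theorem realize_sEqT (s t : LGR.Term α) (v : α → A) (V : β → (Fin 2 → A) → Prop) :
    (sEqT s t : SOF α β).Realize v V ↔ s.realize v = t.realize v := by
  rw [sEqT, SOFormula.realize_ofFO, realize_eqF]

/-- The second order formula for being a representative. -/
noncomputable def sDom (a : Fin 3 → LGR.Term α) (X : β) : SOF α β :=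
  .or (sEqT (a 0) (a 1)) (.and (.not (sEqT (a 0) (a 1))) (sIsCut (a 0, a 1) X))

@[simp] theorem realize_sDom (a : Fin 3 → LGR.Term α) (X : β) (v : α → A)
    (V : β → (Fin 2 → A) → Prop) : (sDom a X).Realize v V ↔
      (a 0).realize v = (a 1).realize v ∨ ((a 0).realize v ≠ (a 1).realize v ∧
        IsCut ((a 0).realize v, (a 1).realize v) (relSet (V X))) := by
  simp [sDom]

/-- The second order formula for `CrEq`. -/
noncomputable def sCrEq (a : Fin 3 → LGR.Term α) (X : β) (b : Fin 3 → LGR.Term α) (Y : β) :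
    SOF α β :=
  .or (.and (sEqT (a 0) (a 1)) (.and (sEqT (b 0) (b 1)) (sEqT (a 2) (b 2))))
    (.and (.not (sEqT (a 0) (a 1))) (.and (.not (sEqT (b 0) (b 1)))
      (sCutEq (a 0, a 1) X (b 0, b 1) Y)))

@[simp] theorem realize_sCrEq (a : Fin 3 → LGR.Term α) (X : β) (b : Fin 3 → LGR.Term α) (Y : β)
    (v : α → A) (V : β → (Fin 2 → A) → Prop) : (sCrEq a X b Y).Realize v V ↔
      CrEq (fun k => (a k).realize v) (relSet (V X)) (fun k => (b k).realize v)
        (relSet (V Y)) := by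
  simp [sCrEq, CrEq]

/-- The second order formulas for `CrRel`. -/
noncomputable def sCrRel : ∀ {m : ℕ}, MNPGRel m → (Fin m → Fin 3 → LGR.Term α) →
    (Fin m → β) → SOF α β
  | _, .pt, a, _ => .not (sEqT (a 0 0) (a 0 1))
  | _, .gr, a, _ => sEqT (a 0 0) (a 0 1)
  | _, .ed, a, S => .and (.and (.not (sEqT (a 0 0) (a 0 1))) (.and (.not (sEqT (a 1 0) (a 1 1)))
      (.and (.not (sEqT (a 2 0) (a 2 1))) (.not (sEqT (a 3 0) (a 3 1))))))
      (.or (.and (sCutLT (a 0 0, a 0 1) (a 0 0, a 0 1) (S 0) (a 1 0, a 1 1) (S 1))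
        (sCutLT (a 0 0, a 0 1) (a 2 0, a 2 1) (S 2) (a 3 0, a 3 1) (S 3)))
      (.and (sCutLT (a 0 0, a 0 1) (a 1 0, a 1 1) (S 1) (a 0 0, a 0 1) (S 0))
        (sCutLT (a 0 0, a 0 1) (a 3 0, a 3 1) (S 3) (a 2 0, a 2 1) (S 2))))
  | _, .comp, a, _ => .and (.and (sEqT (a 0 0) (a 0 1)) (.and (sEqT (a 1 0) (a 1 1))
      (sEqT (a 2 0) (a 2 1)))) (sEqT (a 0 2 * a 1 2) (a 2 2))
  | _, .ap, a, S => .and (.and (sEqT (a 0 0) (a 0 1)) (.and (.not (sEqT (a 1 0) (a 1 1)))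
      (.not (sEqT (a 2 0) (a 2 1))))) (sCutMap (a 0 2) (a 1 0, a 1 1) (S 1) (a 2 0, a 2 1) (S 2))

@[simp] theorem realize_sCrRel {m : ℕ} (R : MNPGRel m) (a : Fin m → Fin 3 → LGR.Term α)
    (X : Fin m → β) (v : α → A) (V : β → (Fin 2 → A) → Prop) : (sCrRel R a X).Realize v V ↔
      CrRel R (fun j k => (a j k).realize v) (fun j => relSet (V (X j))) := by
  cases R <;> simp [sCrRel, CrRel]

end Formulas

section Rep

variable {L : Type u} [LinearOrder L] [NoMinOrder L] [NoMaxOrder L] [Nonempty L] [DenselyOrdered L]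
  {G : Subgroup (AutED L)}

/-- The representatives of the elements of `ACT(L̄, G)`. -/
abbrev CrTuple (G : Type u) := (Fin 3 → G) × (Fin 1 → (Fin 2 → G) → Prop)

/-- The triple and the relation in `t` represent the element `m` of `ACT(L̄, G)`. -/
def RepCr (G : Subgroup (AutED L)) (t : CrTuple G) (m : ACT (Set.univ : Set (Cpl L)) G) : Prop :=
  Sum.elim (fun x : (Set.univ : Set (Cpl L)) => t.1 0 ≠ t.1 1 ∧
      CutRep (Cpl L) (t.1 0, t.1 1) (relSet (t.2 0)) (x : Cpl L))
    (fun h : G => t.1 0 = t.1 1 ∧ t.1 2 = h) m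

variable {t t' : CrTuple G} {m m' : ACT (Set.univ : Set (Cpl L)) G}

theorem RepCr.exists_pt (h : RepCr G t m) (ht : t.1 0 ≠ t.1 1) :
    ∃ x, m = ACT.pt x ∧ CutRep (Cpl L) (t.1 0, t.1 1) (relSet (t.2 0)) (x : Cpl L) := by
  rcases m.cases with ⟨x, rfl⟩ | ⟨g, rfl⟩
  · exact ⟨x, rfl, h.2⟩
  · exact absurd h.1 ht

theorem RepCr.exists_gr (h : RepCr G t m) (ht : t.1 0 = t.1 1) :
    ∃ g, m = ACT.gr g ∧ t.1 2 = g := by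
  rcases m.cases with ⟨x, rfl⟩ | ⟨g, rfl⟩
  · exact absurd ht h.1
  · exact ⟨g, rfl, h.2⟩

theorem RepCr.ne (h : RepCr G t m) {x : (Set.univ : Set (Cpl L))} (hm : m = ACT.pt x) :
    t.1 0 ≠ t.1 1 ∧ CutRep (Cpl L) (t.1 0, t.1 1) (relSet (t.2 0)) (x : Cpl L) := by
  subst hm
  exact h

theorem RepCr.eq (h : RepCr G t m) {g : G} (hm : m = ACT.gr g) : t.1 0 = t.1 1 ∧ t.1 2 = g := by
  subst hm
  exact h

theorem repCr_eq_iff (hG : IsMN3 G) (h : RepCr G t m) (h' : RepCr G t' m') :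
    CrEq t.1 (relSet (t.2 0)) t'.1 (relSet (t'.2 0)) ↔ m = m' := by
  have := hG.locMove
  constructor
  · rintro (⟨h1, h2, h3⟩ | ⟨h1, h2, h3⟩)
    · obtain ⟨g, rfl, rfl⟩ := h.exists_gr h1
      obtain ⟨g', rfl, rfl⟩ := h'.exists_gr h2
      rw [h3]
    · obtain ⟨x, rfl, hx⟩ := h.exists_pt h1
      obtain ⟨x', rfl, hx'⟩ := h'.exists_pt h2
      rw [Subtype.ext ((hx.cutEq_iff hx').1 h3)]
  · rintro rfl
    rcases m.cases with ⟨x, rfl⟩ | ⟨g, rfl⟩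
    · exact Or.inr ⟨h.1, h'.1, (h.2.cutEq_iff h'.2).2 rfl⟩
    · exact Or.inl ⟨h.1, h'.1, h.2.trans h'.2.symm⟩

theorem CutRep.ed_iff (hG : IsMN3 G) {R R₁ R₂ R₃ : G × G} {S S₁ S₂ S₃ : G × G → Prop}
    {x x₁ x₂ x₃ : Cpl L} (h : CutRep (Cpl L) R S x) (h₁ : CutRep (Cpl L) R₁ S₁ x₁)
    (h₂ : CutRep (Cpl L) R₂ S₂ x₂) (h₃ : CutRep (Cpl L) R₃ S₃ x₃) :
    (CutLT R R S R₁ S₁ ∧ CutLT R R₂ S₂ R₃ S₃) ∨ (CutLT R R₁ S₁ R S ∧ CutLT R R₃ S₃ R₂ S₂) ↔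
      Ed x x₁ x₂ x₃ := by
  have := hG.locMove
  obtain ⟨⟨z, hz⟩, -⟩ | ⟨⟨z, hz⟩, -⟩ := id h
  · rw [hz.cutLT_iff h h₁, hz.cutLT_iff h₂ h₃, hz.cutLT_iff h₁ h, hz.cutLT_iff h₃ h₂, Ed]
  · have hz' : IsLRay (Cpl L)ᵒᵈ R (OrderDual.toDual (OrderDual.ofDual z)) := hz
    rw [hz'.cutLT_iff_dual h h₁, hz'.cutLT_iff_dual h₂ h₃, hz'.cutLT_iff_dual h₁ h,
      hz'.cutLT_iff_dual h₃ h₂, Ed, or_comm]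

theorem repCr_rel_iff (hG : IsMN3 G) {k : ℕ} (R : MNPGRel k) {t : Fin k → CrTuple G}
    {m : Fin k → ACT (Set.univ : Set (Cpl L)) G} (h : ∀ j, RepCr G (t j) (m j)) :
    CrRel R (fun j => (t j).1) (fun j => relSet ((t j).2 0)) ↔
      Structure.RelMap (L := LMNPG) R m := by
  have := hG.locMove
  cases R
  · change _ ↔ ∃ x : (Set.univ : Set (Cpl L)), m 0 = ACT.pt x
    exact ⟨fun h0 => ((h 0).exists_pt h0).imp fun _ hx => hx.1, fun ⟨x, hx⟩ => ((h 0).ne hx).1⟩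
  · change _ ↔ ∃ x : G, m 0 = ACT.gr x
    exact ⟨fun h0 => ((h 0).exists_gr h0).imp fun _ hx => hx.1, fun ⟨x, hx⟩ => ((h 0).eq hx).1⟩
  · change _ ↔ ∃ a b c d : (Set.univ : Set (Cpl L)), m 0 = ACT.pt a ∧ m 1 = ACT.pt b ∧
      m 2 = ACT.pt c ∧ m 3 = ACT.pt d ∧ Ed (a : Cpl L) b c d
    constructor
    · rintro ⟨⟨h0, h1, h2, h3⟩, he⟩
      obtain ⟨a, ha, ha'⟩ := (h 0).exists_pt h0
      obtain ⟨b, hb, hb'⟩ := (h 1).exists_pt h1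
      obtain ⟨c, hc, hc'⟩ := (h 2).exists_pt h2
      obtain ⟨d, hd, hd'⟩ := (h 3).exists_pt h3
      exact ⟨a, b, c, d, ha, hb, hc, hd, (ha'.ed_iff hG hb' hc' hd').1 he⟩
    · rintro ⟨a, b, c, d, ha, hb, hc, hd, he⟩
      have ha' := (h 0).ne ha
      have hb' := (h 1).ne hb
      have hc' := (h 2).ne hc
      have hd' := (h 3).ne hd
      exact ⟨⟨ha'.1, hb'.1, hc'.1, hd'.1⟩, (ha'.2.ed_iff hG hb'.2 hc'.2 hd'.2).2 he⟩
  · change _ ↔ ∃ a b c : G, m 0 = ACT.gr a ∧ m 1 = ACT.gr b ∧ m 2 = ACT.gr c ∧ a * b = c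
    constructor
    · rintro ⟨⟨h0, h1, h2⟩, he⟩
      obtain ⟨a, ha, rfl⟩ := (h 0).exists_gr h0
      obtain ⟨b, hb, rfl⟩ := (h 1).exists_gr h1
      obtain ⟨c, hc, rfl⟩ := (h 2).exists_gr h2
      exact ⟨_, _, _, ha, hb, hc, he⟩
    · rintro ⟨a, b, c, ha, hb, hc, rfl⟩
      have ha' := (h 0).eq ha
      have hb' := (h 1).eq hb
      have hc' := (h 2).eq hc
      refine ⟨⟨ha'.1, hb'.1, hc'.1⟩, ?_⟩
      dsimp only
      rw [ha'.2, hb'.2, hc'.2]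
  · change _ ↔ ∃ (g : G) (a b : (Set.univ : Set (Cpl L))), m 0 = ACT.gr g ∧ m 1 = ACT.pt a ∧
      m 2 = ACT.pt b ∧ (bar (g : AutED L)).1 (a : Cpl L) = b
    constructor
    · rintro ⟨⟨h0, h1, h2⟩, he⟩
      obtain ⟨g, hg, rfl⟩ := (h 0).exists_gr h0
      obtain ⟨b, hb, hb'⟩ := (h 1).exists_pt h1
      obtain ⟨c, hc, hc'⟩ := (h 2).exists_pt h2
      exact ⟨_, b, c, hg, hb, hc, (hb'.cutMap_iff hc').1 he⟩
    · rintro ⟨g, b, c, hg, hb, hc, he⟩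
      have hg' := (h 0).eq hg
      have hb' := (h 1).ne hb
      have hc' := (h 2).ne hc
      refine ⟨⟨hg'.1, hb'.1, hc'.1⟩, (hb'.2.cutMap_iff hc'.2).2 ?_⟩
      dsimp only
      rw [hg'.2]
      exact he

theorem exists_repCr_iff (hG : IsMN3 G) : (∃ m, RepCr G t m) ↔
    t.1 0 = t.1 1 ∨ (t.1 0 ≠ t.1 1 ∧ IsCut (t.1 0, t.1 1) (relSet (t.2 0))) := by
  have := hG.locMove
  rw [isCut_iff (X := Cpl L)]
  constructor
  · rintro ⟨m, h⟩
    rcases m.cases with ⟨x, rfl⟩ | ⟨g, rfl⟩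
    · exact Or.inr ⟨h.1, x, h.2⟩
    · exact Or.inl h.1
  · rintro (h1 | ⟨h1, x, hx⟩)
    · exact ⟨ACT.gr (t.1 2), h1, rfl⟩
    · exact ⟨ACT.pt ⟨x, trivial⟩, h1, hx⟩

theorem repCr_self (g : G) : RepCr G (fun _ => g, fun _ _ => True) (ACT.gr g) := ⟨rfl, rfl⟩

theorem exists_repCr (hG : IsMN3 G) (m : ACT (Set.univ : Set (Cpl L)) G) : ∃ t, RepCr G t m := by
  have := hG.locMove
  rcases m.cases with ⟨x, rfl⟩ | ⟨g, rfl⟩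
  · obtain ⟨R, S, h⟩ := exists_cutRep (A := G) (x : Cpl L)
    refine ⟨(![R.1, R.2, R.1], fun _ w => S (w 0, w 1)), Ray.fst_ne_snd hG ?_, h⟩
    exact ((isCut_iff (X := Cpl L)).2 ⟨_, h⟩).1
  · exact ⟨_, repCr_self g⟩

/-- The second order strong interpretation of `ACT(L̄, G)` in `G`. -/
noncomputable def crInterp : SOInterp LGR LMNPG where
  n := 3
  p := 1
  ar _ := 2
  fU := sDom (fun k => Term.var k) 0
  fEq := sCrEq (fun k => Term.var (0, k)) (0, 0) (fun k => Term.var (1, k)) (1, 0)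
  fRel R := sCrRel R (fun j k => Term.var (j, k)) (fun j => (j, 0))
  fImap := .and (sEqT (Term.var (Sum.inl 0)) (Term.var (Sum.inl 1)))
    (sEqT (Term.var (Sum.inl 2)) (Term.var (Sum.inr ())))

theorem crInterp_fU (hG : IsMN3 G) (t : CrTuple G) :
    crInterp.fU.Realize t.1 t.2 ↔ ∃ m, RepCr G t m := by
  rw [exists_repCr_iff hG]
  exact realize_sDom (fun k => Term.var k) 0 t.1 t.2

theorem exists_isStrongInterpretingMap_cpl (hG : IsMN3 G) :
    ∃ μ, crInterp.IsStrongInterpretingMap (M := G) (M' := ACT (Set.univ : Set (Cpl L)) G)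
      ACT.gr μ := by
  choose μ hμ using fun a : crInterp.Arg G => (crInterp_fU hG (a.fo, a.so)).1 a.sat
  refine ⟨μ, fun m => ?_, fun a b => ?_, fun m R a => ?_, fun a S x => ?_⟩
  · obtain ⟨t, ht⟩ := exists_repCr hG m
    have h := (crInterp_fU hG t).2 ⟨m, ht⟩
    refine ⟨⟨t.1, t.2, h⟩, (repCr_eq_iff hG (hμ ⟨t.1, t.2, h⟩) ht).1 ?_⟩
    exact (repCr_eq_iff hG ht ht).2 rfl
  · exact (repCr_eq_iff hG (hμ a) (hμ b)).symm.trans (realize_sCrEq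
      (fun k => Term.var ((0 : Fin 2), k)) ((0 : Fin 2), (0 : Fin 1)) (fun k => Term.var (1, k)) (1, 0)
      (fun q => ((![a, b] : Fin 2 → crInterp.Arg G) q.1).fo q.2)
      (fun q => ((![a, b] : Fin 2 → crInterp.Arg G) q.1).so q.2)).symm
  · exact (repCr_rel_iff hG R fun j => hμ (a j)).symm.trans (realize_sCrRel R
      (fun j k => Term.var (j, k)) (fun j => (j, (0 : Fin 1))) (fun q => (a q.1).fo q.2)
      (fun q => (a q.1).so q.2)).symm
  · have h1 : crInterp.fImap.Realize (Sum.elim a fun _ => x) S ↔ RepCr G (a, S) (ACT.gr x) :=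
      (SOFormula.realize_and _ _).trans (and_congr
        (realize_sEqT (Term.var (Sum.inl (0 : Fin 3))) (Term.var (Sum.inl 1))
          (Sum.elim a fun _ => x) S)
        (realize_sEqT (Term.var (Sum.inl (2 : Fin 3))) (Term.var (Sum.inr ()))
          (Sum.elim a fun _ => x) S))
    rw [h1]
    constructor
    · intro h
      have hU := (crInterp_fU hG (a, S)).2 ⟨_, h⟩
      exact ⟨hU, (repCr_eq_iff hG (hμ ⟨a, S, hU⟩) h).1 ((repCr_eq_iff hG h h).2 rfl)⟩
    · rintro ⟨hU, he⟩
      rw [← he]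
      exact hμ ⟨a, S, hU⟩

/-! ### Second order expressibility -/

/-- Translation of formulas about `ACT(L̄, G)`. -/
noncomputable def crOps : TransOps.{1} LMNPG where
  F β := SOF (β × Fin 3) (β × Fin 1)
  bot := .falsum
  imp φ ψ := .imp φ ψ
  all {β} φ := .all (.all (.all (.allRel 2 (SOFormula.relabel
    (fun q : Option β × Fin 3 => (q.1.elim (![none, some none, some (some none)] q.2)
      fun b => some (some (some (b, q.2))) : Option (Option (Option (β × Fin 3)))))
    (fun q : Option β × Fin 1 => q.1.map fun b => (b, q.2))
    (by rintro ⟨_ | b, j⟩ <;> rfl) φ))))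
  map f φ := φ.relabel (Prod.map f id) (Prod.map f id) fun _ => rfl
  dom := sDom (fun k => Term.var ((), k)) ((), 0)
  eq := sCrEq (fun k => Term.var (0, k)) (0, 0) (fun k => Term.var (1, k)) (1, 0)
  rel R := sCrRel R (fun j k => Term.var (j, k)) (fun j => (j, 0))

/-- Satisfaction of the translated formulas. -/
def crReal {β : Type} (φ : crOps.F β) (v : β → CrTuple G) : Prop :=
  SOFormula.Realize (L := LGR) (α := β × Fin 3) (β := β × Fin 1) (ar := fun _ => 2) φ
    (fun q => (v q.1).1 q.2) (fun q => (v q.1).2 q.2)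

theorem crModels (hG : IsMN3 G) : crOps.Models (crReal (G := G)) (RepCr G) where
  bot _ := id
  imp _ _ _ := Iff.rfl
  all {β} φ v := by
    -- The innermost of the three quantified variables is the newest and is read as entry `0`,
    -- whence the order `z`, `y`, `x`.
    have key : ∀ (x y z : G) (S : (Fin 2 → G) → Prop), crReal φ (push v (![z, y, x], fun _ => S)) ↔
        SOFormula.Realize (L := LGR) (α := Option β × Fin 3) (β := Option β × Fin 1)
          (ar := fun _ => 2) φ
          (push (push (push (fun q : β × Fin 3 => (v q.1).1 q.2) x) y) z ∘
            fun q : Option β × Fin 3 => (q.1.elim (![none, some none, some (some none)] q.2)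
              fun b => some (some (some (b, q.2))) : Option (Option (Option (β × Fin 3)))))
          (fun q => (push v (![z, y, x], fun _ => S) q.1).2 q.2) := by
      intro x y z S
      refine iff_of_eq (congrArg (fun a => SOFormula.Realize (L := LGR) (α := Option β × Fin 3)
        (β := Option β × Fin 1) (ar := fun _ => 2) φ a _) (funext fun q => ?_))
      rcases q with ⟨_ | b, k⟩
      · fin_cases k <;> rfl
      · rfl
    have key' : ∀ (x y z : G) (S : (Fin 2 → G) → Prop), crReal φ (push v (![z, y, x], fun _ => S)) ↔
        (SOFormula.relabel (ar' := fun o : Option (β × Fin 1) => o.elim 2 fun _ => 2)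
          (fun q : Option β × Fin 3 => (q.1.elim (![none, some none, some (some none)] q.2)
            fun b => some (some (some (b, q.2))) : Option (Option (Option (β × Fin 3)))))
          (fun q : Option β × Fin 1 => q.1.map fun b => (b, q.2))
          (by rintro ⟨_ | b, j⟩ <;> rfl) φ).Realize
          (push (push (push (fun q : β × Fin 3 => (v q.1).1 q.2) x) y) z)
          (pushRel (fun q => (v q.1).2 q.2) S) := by
      intro x y z S
      refine (key x y z S).trans (Iff.trans (iff_of_eq (congrArg _ (funext fun q => ?_)))
        (SOFormula.realize_relabel _ _ _ _ _ _).symm)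
      rcases q with ⟨_ | b, k⟩ <;> rfl
    have key'' : crReal (crOps.all φ) v ↔ ∀ (x y z : G) (S : (Fin 2 → G) → Prop),
        crReal φ (push v (![z, y, x], fun _ => S)) := by
      simp only [key']
      exact forall_congr' fun x => forall_congr' fun y => forall_congr' fun z =>
        SOFormula.realize_allRel _
    rw [key'']
    constructor
    · rintro h ⟨a, S⟩
      have h1 := h (a 2) (a 1) (a 0) (S 0)
      have h2 : ![a 0, a 1, a 2] = a := by
        funext k
        fin_cases k <;> rfl
      have h3 : (fun _ => S 0) = S := by
        funext j
        rw [Subsingleton.elim j 0]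
      rwa [h2, h3] at h1
    · exact fun h x y z S => h _
  map f φ v := SOFormula.realize_relabel _ _ _ _ _ _
  dom v := (realize_sDom (fun k => Term.var ((), k)) ((), (0 : Fin 1)) (fun q => (v q.1).1 q.2)
    (fun q => (v q.1).2 q.2)).trans (exists_repCr_iff hG).symm
  surj := exists_repCr hG
  eq v m h := (realize_sCrEq (fun k => Term.var ((0 : Fin 2), k)) ((0 : Fin 2), (0 : Fin 1))
    (fun k => Term.var (1, k)) (1, 0) (fun q => (v q.1).1 q.2)
    (fun q => (v q.1).2 q.2)).trans (repCr_eq_iff hG (h 0) (h 1))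
  rel R v m h := (realize_sCrRel R (fun j k => Term.var (j, k)) (fun j => (j, (0 : Fin 1)))
    (fun q => (v q.1).1 q.2) (fun q => (v q.1).2 q.2)).trans (repCr_rel_iff hG R h)

end Rep

theorem soExpressible_act (n : ℕ) (φ : LMNPG.Formula (Fin n)) :
    SOExpressible.{u} n (fun L _ _ _ _ _ G g =>
      φ.Realize (fun j => (ACT.gr (g j) : ACT (Set.univ : Set (Cpl L)) G))) := by
  -- The translation has a free relation variable for every free variable of `φ`. Group elements
  -- ignore their relation entries, so all of these variables can be identified and bound by one
  -- dummy quantifier.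
  refine ⟨.allRel 2 (SOFormula.relabel (α := (Fin n ⊕ Fin 0) × Fin 3) (β := (Fin n ⊕ Fin 0) × Fin 1)
    (ar := fun _ => 2) (fun q => q.1.elim id Fin.elim0) (fun _ => none) (fun _ => rfl)
    (crOps.trans φ)), fun L _ _ _ _ _ G hG g => ?_⟩
  have h := fun S : (Fin 2 → G) → Prop => (crModels hG).realize_trans φ
    (Sum.elim (fun j => (fun _ => g j, fun _ => S)) Fin.elim0)
    (Sum.elim (fun j => ACT.gr (g j)) Fin.elim0) (by
      rintro (j | j)
      · exact ⟨rfl, rfl⟩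
      · exact j.elim0)
  have h' : ∀ S : (Fin 2 → G) → Prop, _ ↔ φ.Realize
      (fun j => (ACT.gr (g j) : ACT (Set.univ : Set (Cpl L)) G)) := fun S =>
    (h S).trans (iff_of_eq (congrArg (BoundedFormula.Realize φ _) (Subsingleton.elim _ _)))
  beta_reduce
  rw [← h' fun _ => True, SOFormula.realize_allRel]
  have key : ∀ S : (Fin 2 → G) → Prop, (SOFormula.relabel (α := (Fin n ⊕ Fin 0) × Fin 3)
      (β := (Fin n ⊕ Fin 0) × Fin 1) (ar := fun _ => 2) (ar' := fun o => o.elim 2 Empty.elim)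
      (fun q => q.1.elim id Fin.elim0) (fun _ => none) (fun _ => rfl) (crOps.trans φ)).Realize g
      (pushRel (fun X => X.elim) S) ↔
      crReal (crOps.trans φ) (Sum.elim (fun j => (fun _ => g j, fun _ => S)) Fin.elim0) := by
    intro S
    refine (SOFormula.realize_relabel _ _ _ _ _ _).trans (iff_of_eq (congrArg₂ _ (funext fun q => ?_)
      (funext fun q => ?_)))
    · rcases q with ⟨j | j, k⟩
      · rfl
      · exact j.elim0
    · rcases q with ⟨j | j, k⟩
      · rfl
      · exact j.elim0
  constructor
  · intro H
    exact (key _).1 (H _)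
  · intro H S
    exact (key S).2 ((h' S).2 ((h' _).1 H))

end MonRec

namespace MonRec

open Set FirstOrder FirstOrder.Language

/-! ### Dedekind completeness -/

section Completeness

variable {L : Type u} [LinearOrder L] [NoMinOrder L] [NoMaxOrder L] [Nonempty L] [DenselyOrdered L]
  {G : Subgroup (AutED L)}

theorem Cpl.of_surjective_iff : Function.Surjective (Cpl.of : L → Cpl L) ↔
    ∀ s : Set L, s.Nonempty → BddAbove s → ∃ a, IsLUB s a := by
  have hof : ∀ {a b : L}, Cpl.of a ≤ Cpl.of b ↔ a ≤ b := fun {a b} => by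
    rw [← not_lt, Cpl.of_lt_of, not_lt]
  constructor
  · rintro h s hs ⟨b, hb⟩
    obtain ⟨x, hx⟩ := Cpl.exists_isLUB (Cpl.of '' s) (hs.image _)
      ⟨Cpl.of b, forall_mem_image.2 fun a ha => hof.2 (hb ha)⟩
    obtain ⟨a, rfl⟩ := h x
    exact ⟨a, fun c hc => hof.1 (hx.1 ⟨c, hc, rfl⟩), fun c hc => hof.1 (hx.2
      (forall_mem_image.2 fun d hd => hof.2 (hc hd)))⟩
  · intro h x
    obtain ⟨y, hy⟩ := exists_lt x
    obtain ⟨b, hb⟩ := Cpl.exists_of_mem_Ioo hy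
    obtain ⟨z, hz⟩ := exists_gt x
    obtain ⟨c, hc⟩ := Cpl.exists_of_mem_Ioo hz
    obtain ⟨a, ha⟩ := h {a | Cpl.of a < x} ⟨b, hb.2⟩
      ⟨c, fun d hd => (Cpl.of_lt_of.1 (lt_trans hd hc.1)).le⟩
    refine ⟨a, le_antisymm (le_of_not_gt fun hlt => ?_) (le_of_not_gt fun hlt => ?_)⟩
    · obtain ⟨d, hd⟩ := Cpl.exists_of_mem_Ioo hlt
      exact not_le_of_gt (Cpl.of_lt_of.1 hd.2)
        (ha.2 fun e he => (Cpl.of_lt_of.1 (lt_trans he hd.1)).le)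
    · obtain ⟨d, hd⟩ := Cpl.exists_of_mem_Ioo hlt
      exact not_le_of_gt (Cpl.of_lt_of.1 hd.1) (ha.1 hd.2)

/-- As `L` is an orbit, it is the whole completion exactly when the action on the completion is
transitive. This turns completeness into a first order sentence about the action, which then has a
second order translation in the group. -/
theorem of_surjective_iff_of_transitive (ht : ∀ x y : L, ∃ g ∈ G, g.1 x = y) :
    Function.Surjective (Cpl.of : L → Cpl L) ↔ ∀ x y : Cpl L, y ∈ orbit G x := by
  constructor
  · intro h x y
    obtain ⟨a, rfl⟩ := h x
    rw [orbit_of_transitive ht a]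
    exact h y
  · intro h y
    obtain ⟨a⟩ := ‹Nonempty L›
    have := h (Cpl.of a) y
    rwa [orbit_of_transitive ht a] at this

/-- The sentence of monotonic permutation groups for transitivity. -/
noncomputable def transitiveFormula : LMNPG.Formula (Fin 0) :=
  allO (allO ((Relations.formula (L := LMNPG) MNPGRel.pt fun _ => up nv).imp
    ((Relations.formula (L := LMNPG) MNPGRel.pt fun _ => nv).imp
      (exO (Relations.formula (L := LMNPG) MNPGRel.ap ![nv, up (up nv), up nv])))))

theorem realize_transitiveFormula (v : Fin 0 → ACT (univ : Set (Cpl L)) G) :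
    transitiveFormula.Realize v ↔ ∀ x y : Cpl L, y ∈ orbit G x := by
  simp only [transitiveFormula, realize_allO, Formula.realize_imp, realize_exO]
  constructor
  · intro h x y
    obtain ⟨g, f, a, b, hf, ha, hb, he⟩ := h (ACT.pt ⟨x, trivial⟩) (ACT.pt ⟨y, trivial⟩)
      ⟨_, rfl⟩ ⟨_, rfl⟩
    cases (Sum.inl_injective ha : (⟨x, trivial⟩ : (univ : Set (Cpl L))) = a)
    cases (Sum.inl_injective hb : (⟨y, trivial⟩ : (univ : Set (Cpl L))) = b)
    exact ⟨f, f.2, he⟩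
  · rintro h _ _ ⟨x, rfl⟩ ⟨y, rfl⟩
    obtain ⟨g, hg, he⟩ := h x y
    exact ⟨ACT.gr ⟨g, hg⟩, ⟨g, hg⟩, x, y, rfl, rfl, rfl, he⟩

theorem exists_sentence_dedekindComplete :
    ∃ ψ : SOFormula LGR (Fin 0) Empty Empty.elim, ∀ (L : Type u) [LinearOrder L]
        [DenselyOrdered L] [NoMinOrder L] [NoMaxOrder L] [Nonempty L] (G : Subgroup (AutED L)),
      IsMN3 G → (∀ x y : L, ∃ g ∈ G, g.1 x = y) →
        (ψ.Realize (M := G) Fin.elim0 (fun X => X.elim) ↔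
          ∀ s : Set L, s.Nonempty → BddAbove s → ∃ a, IsLUB s a) := by
  obtain ⟨ψ, hψ⟩ := soExpressible_act.{u} 0 transitiveFormula
  refine ⟨ψ, fun L _ _ _ _ _ G hG ht => (hψ L G hG _).trans ?_⟩
  beta_reduce
  rw [realize_transitiveFormula, ← of_surjective_iff_of_transitive ht, Cpl.of_surjective_iff]

end Completeness

end MonRec

/-! ### Assembly of the reconstruction package. -/

theorem mainTheorem3 :
    -- two groups
    (∀ (L₁ : Type u) [LinearOrder L₁] [DenselyOrdered L₁] [NoMinOrder L₁] [NoMaxOrder L₁]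
        [Nonempty L₁] (L₂ : Type v) [LinearOrder L₂] [DenselyOrdered L₂] [NoMinOrder L₂]
        [NoMaxOrder L₂] [Nonempty L₂] (G₁ : Subgroup (AutED L₁)) (G₂ : Subgroup (AutED L₂)),
      IsMN3 G₁ → IsMN3 G₂ →
      -- elementarily equivalent groups have elementarily equivalent actions on endpoints
      (LGR.ElementarilyEquivalent G₁ G₂ →
        LMNPG.ElementarilyEquivalent (ACT (Ep G₁) G₁) (ACT (Ep G₂) G₂) ∧
        LMNPG.ElementarilyEquivalent (ACT (Ep G₁) (Bdd G₁)) (ACT (Ep G₂) (Bdd G₂)) ∧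
        LMNPG.ElementarilyEquivalent (ACT (Ep G₁) (Opp G₁)) (ACT (Ep G₂) (Opp G₂)) ∧
        ((LMNPG.ElementarilyEquivalent (ACT (Ep G₁) (Lft G₁)) (ACT (Ep G₂) (Lft G₂)) ∧
            LMNPG.ElementarilyEquivalent (ACT (Ep G₁) (Rt G₁)) (ACT (Ep G₂) (Rt G₂))) ∨
          (LMNPG.ElementarilyEquivalent (ACT (Ep G₁) (Lft G₁)) (ACT (Ep G₂) (Rt G₂)) ∧
            LMNPG.ElementarilyEquivalent (ACT (Ep G₁) (Rt G₁)) (ACT (Ep G₂) (Lft G₂))))) ∧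
      -- every group isomorphism is induced by a unique bijection of the completions
      (∀ α : G₁ ≃* G₂, ∃ τ : Cpl L₁ ≃ Cpl L₂,
        Monotonic τ ∧ IsEDIso τ ∧ IsHomeo τ ∧ Induces τ α ∧
        (∀ τ' : Cpl L₁ ≃ Cpl L₂, Monotonic τ' ∨ IsEDIso τ' ∨ IsHomeo τ' → Induces τ' α → τ' = τ) ∧
        IsActIso Set.univ Set.univ τ α ∧ IsActIso (Ep G₁) (Ep G₂) τ α ∧
        RespectsOrbitsAndOrder τ α)) ∧
    -- one group
    (∀ (L : Type u) [LinearOrder L] [DenselyOrdered L] [NoMinOrder L] [NoMaxOrder L] [Nonempty L]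
        (G : Subgroup (AutED L)), IsMN3 G →
      -- automorphisms are conjugations by elements of the normalizer, for `G` and for the
      -- distinguished subgroups
      (AutIsNormalizer G ∧ AutIsNormalizer (Opp G) ∧ AutIsNormalizer (Bdd G) ∧
        AutIsNormalizer (BddDer G) ∧
        normHomeo G ≤ normHomeo (Opp G) ∧ normHomeo (Opp G) ≤ normHomeo (Bdd G) ∧
        normHomeo (Bdd G) ≤ normHomeo (BddDer G)) ∧
      (∀ (α : MulAut G) (τ : Equiv.Perm (Cpl L)), τ ∈ AutED (Cpl L) → Induces τ α →
        IsActIso (Ep G) (Ep G) τ α ∧ RespectsOrbitsAndOrder τ α) ∧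
      -- the automorphisms that preserve the pointwise order
      ((oAut G).index ≠ 0 ∧ (oAut G).index ≤ 2) ∧
      (HasNontrivialOrder G → ∀ α ∈ oAut G, ∀ τ : Equiv.Perm (Cpl L), τ ∈ AutED (Cpl L) →
        Induces τ α → StrictMono τ) ∧
      -- characteristic subgroups
      (((Opp G).subgroupOf G).Characteristic ∧ ((Bdd G).subgroupOf G).Characteristic ∧
        ((BddDer G).subgroupOf G).Characteristic) ∧
      (∀ α : MulAut G,
        (((Lft G).subgroupOf G).map α.toMonoidHom = (Lft G).subgroupOf G ∧
          ((Rt G).subgroupOf G).map α.toMonoidHom = (Rt G).subgroupOf G) ∨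
        (((Lft G).subgroupOf G).map α.toMonoidHom = (Rt G).subgroupOf G ∧
          ((Rt G).subgroupOf G).map α.toMonoidHom = (Lft G).subgroupOf G)) ∧
      (∀ α β : MulAut G, (∀ g ∈ (BddDer G).subgroupOf G, α g = β g) → α = β) ∧
      -- the subgroups of elements with support bounded on one side
      (∀ H : Subgroup (AutED L), H = Lft G ∨ H = Rt G →
        (HasNontrivialOrder G →
          (∀ α ∈ oAut G, (H.subgroupOf G).map α.toMonoidHom = H.subgroupOf G) ∧
          ∀ α ∈ oAut G, ∀ β ∈ oAut G, (∀ g ∈ H.subgroupOf G, α g = β g) → α = β) ∧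
        (H ≠ Bdd G → ∀ α : MulAut H, ∃ τ : Equiv.Perm (Cpl L), StrictMono τ ∧ Induces τ α ∧
          ∀ τ' ∈ AutED (Cpl L), Induces τ' α → τ' = τ)) ∧
      -- when all automorphisms of `G` are conjugations by elements of `Aut(ED(L))`
      ((∀ x y : L, ∃ g ∈ G, g.1 x = y) →
        ((∃ Φ : Subgroup.normalizer (G : Set (AutED L)) ≃* MulAut G,
            ∀ (σ : Subgroup.normalizer (G : Set (AutED L))) (g : G),
              (Φ σ g : AutED L) = σ * g * (σ : AutED L)⁻¹) ↔
          ¬ ∃ M ∈ orbits G, M ≠ Set.range Cpl.of ∧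
            Nonempty (ACT (Set.range Cpl.of) G ≃[LMNPG] ACT M G))) ∧
      -- elementary equivalence with subgroups
      (∀ H : Subgroup (AutED L), H = Bdd G ∨ H = Lft G ∨ H = Rt G ∨ H = Opp G →
        LGR.ElementarilyEquivalent G H → G = H)) ∧
    -- first order and second order strong interpretations of the actions in the groups
    (∃ I : FOInterp LGR LMNPG, ∀ (L : Type u) [LinearOrder L] [DenselyOrdered L] [NoMinOrder L]
        [NoMaxOrder L] [Nonempty L] (G : Subgroup (AutED L)), IsMN3 G →
      ∃ μ, I.IsStrongInterpretingMap (M := G) (M' := ACT (Ep G) G) ACT.gr μ) ∧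
    (∃ I : SOInterp LGR LMNPG, ∀ (L : Type u) [LinearOrder L] [DenselyOrdered L] [NoMinOrder L]
        [NoMaxOrder L] [Nonempty L] (G : Subgroup (AutED L)), IsMN3 G →
      ∃ μ, I.IsStrongInterpretingMap (M := G) (M' := ACT (Set.univ : Set (Cpl L)) G) ACT.gr μ) ∧
    -- expressibility in the language of groups
    (∀ (n : ℕ) (φ : LMNPG.Formula (Fin n)),
      FOExpressible.{u} n (fun _ _ _ _ _ _ G g =>
        φ.Realize (fun j => (ACT.gr (g j) : ACT (Ep G) G)))) ∧
    FOExpressible.{u} 1 (fun _ _ _ _ _ _ _ g => Signed (g 0).1) ∧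
    FOExpressible.{u} 2 (fun _ _ _ _ _ _ _ g => SameSign (g 0).1 (g 1).1) ∧
    FOExpressible.{u} 1 (fun _ _ _ _ _ _ G g => (g 0).1 ∈ Bdd G) ∧
    FOExpressible.{u} 1 (fun _ _ _ _ _ _ G g => (g 0).1 ∈ Lft G ∨ (g 0).1 ∈ Rt G) ∧
    FOExpressible.{u} 2 (fun _ _ _ _ _ _ G g =>
      ((g 0).1 ∈ Lft G ∧ (g 1).1 ∈ Lft G) ∨ ((g 0).1 ∈ Rt G ∧ (g 1).1 ∈ Rt G)) ∧
    FOExpressible.{u} 0 (fun _ _ _ _ _ _ G _ => ∀ x ∈ Ep G, ∀ y ∈ Ep G, y ∈ orbit G x) ∧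
    (∀ n : ℕ, FOExpressible.{u} 0 (fun _ _ _ _ _ _ G _ => (orbit G '' Ep G).encard = n)) ∧
    FOExpressible.{u} 1 (fun _ _ _ _ _ _ _ g => StrictMono (g 0).1.1) ∧
    (∀ (n : ℕ) (φ : LMNPG.Formula (Fin n)),
      SOExpressible.{u} n (fun L _ _ _ _ _ G g =>
        φ.Realize (fun j => (ACT.gr (g j) : ACT (Set.univ : Set (Cpl L)) G)))) ∧
    (∃ ψ : SOFormula LGR (Fin 0) Empty Empty.elim, ∀ (L : Type u) [LinearOrder L]
        [DenselyOrdered L] [NoMinOrder L] [NoMaxOrder L] [Nonempty L] (G : Subgroup (AutED L)),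
      IsMN3 G → (∀ x y : L, ∃ g ∈ G, g.1 x = y) →
        (ψ.Realize (M := G) Fin.elim0 (fun X => X.elim) ↔
          ∀ s : Set L, s.Nonempty → BddAbove s → ∃ a, IsLUB s a)) := by
  refine ⟨fun L₁ _ _ _ _ _ L₂ _ _ _ _ _ G₁ G₂ h₁ h₂ =>
    ⟨act_elementarilyEquivalent h₁ h₂, group_iso_induced h₁ h₂⟩, fun L _ _ _ _ _ G hG => ?_,
    ⟨epInterp, fun L _ _ _ _ _ G hG => exists_isStrongInterpretingMap hG⟩,
    ⟨crInterp, fun L _ _ _ _ _ G hG => exists_isStrongInterpretingMap_cpl hG⟩,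
    foExpressible_act, foExpressible_signed, foExpressible_sameSign, foExpressible_mem_bdd,
    foExpressible_mem_lft_or_rt, foExpressible_same_side, foExpressible_transitive,
    foExpressible_orbits, foExpressible_strictMono, soExpressible_act,
    exists_sentence_dedekindComplete⟩
  refine ⟨⟨hG.autIsNormalizer, hG.opp.autIsNormalizer, hG.bdd.autIsNormalizer,
      hG.bddDer.autIsNormalizer, normHomeo_chain⟩, fun α τ hτ h => ?_, hG.index_oAut,
    fun ho α hα τ hτ h => strictMono_of_mem_oAut ho hα (IsEDIso.monotonic hτ) h,
    hG.characteristic, fun α => ?_,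
    fun α β h => eq_of_agree hG hG.bddDer (bddDer_le_bdd.trans bdd_le) fun g hg => h g hg,
    fun H => hG.one_sided, hG.normalizer_iff, fun H => hG.eq_of_elementarilyEquivalent⟩
  · have hm : Monotonic τ := IsEDIso.monotonic hτ
    exact ⟨isActIso_of_induces hm h (mem_ep_map_iff hG hG hm h), respectsOrbitsAndOrder hm h⟩
  · obtain ⟨τ, hm | hm, hτ⟩ := exists_monotonic_induces hG hG α
    · exact Or.inl (map_lft_rt_of_strictMono hm hτ)
    · exact Or.inr (map_lft_rt_of_strictAnti hm hτ)
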